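/- **Setting.** Let $4\le q\le 5$ and $2\le p\le 2^{q-2}$ (this includes the 8-bit formats E5M2, $(p,q)=(2,5)$, and E4M3, $(p,q)=(3,4)$). Put $\mathfrak e_{\min}=-2^{q-1}+2$, $\mathfrak e_{\max}=2^{q-1}-1$, and let $\mathbb F$ be the set of all reals $s(1+i/2^p)2^{e}$ and $s(i/2^p)2^{\mathfrak e_{\min}}$ with $s\in\{-1,1\}$, $i\in\{0,\dots,2^p-1\}$, $e\in\{\mathfrak e_{\min},\dots,\mathfrak e_{\max}\}$; $\Omega=(2-2^{-p})2^{\mathfrak e_{\max}}$ is its largest element, and $\overline{\mathbb F}=\mathbb F\cup\{\pm\infty,\mathrm{NaN}\}$. Rounding sends $x\in\mathbb R$ to the nearest element of $\mathbb F$ (ties to the one with even $i$) if $|x|<\Omega+2^{\mathfrak e_{\max}-p-1}$, and to $\pm\infty$ otherwise. The operations $x\oplus y$, $x\otimes y$ are the rounded sum and product, extended to $\overline{\mathbb F}$ by the usual IEEE rules. Sums $\bigoplus$ and matrix products are evaluated from left to right. For $\hat\sigma\in\{\mathrm{ReLU},\mathrm{ELU},\mathrm{GELU},\mathrm{Swish},\mathrm{Sigmoid},\tanh\}$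 (with $\mathrm{Swish}(x)=x/(1+e^{-x})$), let $\sigma,\sigma':\overline{\mathbb F}\to\overline{\mathbb F}$ be the rounded versions of $\hat\sigma$ and of $\hat\sigma'$ (with $\mathrm{ReLU}'(0)=0$); at $\pm\infty$ they are the rounded limits, and at NaN they are NaN. An $L$-layer $\sigma$ network is $f=\rho_L\circ\sigma\circ\rho_{L-1}\circ\cdots\circ\sigma\circ\rho_1$ with $\rho_l(x)=A_l\otimes x\oplus b_l$, where $A_l,b_l$ have entries in $\mathbb F$, the hidden dimensions are arbitrary positive integers, and $\sigma$ acts coordinatewise. With $y_l=\rho_l\circ\sigma\circ\cdots\circ\sigma\circ\rho_1(x)$, the gradient computed by reverse-mode automatic differentiation from the input gradient $g$ is $$\mathcal D_{f,x}(g)=g\otimes A_L\otimes\sigma'(y_{L-1})\otimes A_{L-1}\otimes\cdots\otimes\sigma'(y_1)\otimes A_1,$$ evaluated from left to right, where $\sigma'(y)$ is the diagonal matrix with entries $\sigma'(y_i)$. Define - $M_\sigma=2^{\mathfrak e_{\max}-2}$ and $H_\sigma=\Omega$ for ReLU, ELU, GELU, Swish; - $M_\sigma=2^{\mathfrak e_{\max}-1}$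 and $H_\sigma=2^{p-1}$ for Sigmoid; - $M_\sigma=2^{\mathfrak e_{\max}-1}$ and $H_\sigma=2^{p-2}$ for $\tanh$. Let $d\ge1$, $\mathcal X=([-M_\sigma,M_\sigma]\cap\mathbb F)^d$, and $$\tau=\begin{cases}13&\text{if }q=4\text{ and }\hat\sigma=\mathrm{Sigmoid},\\ 9&\text{if }q=5\text{ and }\hat\sigma=\tanh,\\ 10&\text{otherwise.}\end{cases}$$ **Theorem.** 1. Let $f^*:\mathcal X\to\mathbb F$, $h^*:\mathcal X\to[-H_\sigma,H_\sigma]\cap\mathbb F$ and $g^*:\mathbb F^d\to\mathbb F^{1\times d}$ be such that $g^*(x)=0$ for every $x\in\mathcal X$ with $h^*(x)=0$. Then for every $L\ge\tau$ there is an $L$-layer $\sigma$ network $f$ such that for all $x\in\mathcal X$, $$f(x)=f^*(x)\quad\text{and}\quad \mathcal D_{f,x}(h^*(x))=g^*(x).$$ 2. Let $f^*:\mathcal X\to\mathbb F$ and $g^*:\mathbb F^d\times\mathbb F\to\mathbb F^{1\times d}$ be such that $g^*(x,-y)=-g^*(x,y)$ for all $x,y$. Then for every $L\ge 2^{q+1}+2p+2+\tau$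 there is an $L$-layer $\sigma$ network $f$ such that for all $x\in\mathcal X$ and all $y\in[-H_\sigma,H_\sigma]\cap\mathbb F$, $$f(x)=f^*(x)\quad\text{and}\quad \mathcal D_{f,x}(y)=g^*(x,y).$$ -/

import Mathlib

open Filter Topology

namespace FPNet

/-! ### Floating-point numbers with `p` mantissa bits and `q` exponent bits -/

/-- Smallest exponent `-2^(q-1) + 2`. -/
def emin (q : ℕ) : ℤ := -2 ^ (q - 1) + 2

/-- Largest exponent `2^(q-1) - 1`. -/
def emax (q : ℕ) : ℤ := 2 ^ (q - 1) - 1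

/-- `x` is written with sign `±1` and mantissa digits `i`, either in normal form
`s (1 + i/2^p) 2^e` with `emin ≤ e ≤ emax`, or in subnormal form `s (i/2^p) 2^emin`. -/
def HasRep (p q : ℕ) (x : ℝ) (i : ℕ) : Prop :=
  i < 2 ^ p ∧ ∃ s ∈ ({-1, 1} : Set ℝ),
    (∃ e ∈ Set.Icc (emin q) (emax q), x = s * (1 + (i : ℝ) / 2 ^ p) * (2 : ℝ) ^ e) ∨
      x = s * ((i : ℝ) / 2 ^ p) * (2 : ℝ) ^ (emin q)

/-- The set `𝔽` of finite floating-point numbers. -/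
def floatSet (p q : ℕ) : Set ℝ := {x | ∃ i, HasRep p q x i}

/-- The type of finite floating-point numbers. -/
abbrev Flt (p q : ℕ) : Type := floatSet p q

/-- The mantissa digits `i` of `x` form an even integer. -/
def IsEvenFlt {p q : ℕ} (x : Flt p q) : Prop := ∃ i, Even i ∧ HasRep p q (x : ℝ) i

/-- The largest finite float `Ω = (2 - 2^(-p)) 2^emax`. -/
noncomputable def Omega (p q : ℕ) : ℝ := (2 - (2 : ℝ) ^ (-(p : ℤ))) * (2 : ℝ) ^ (emax q)

theorem zero_mem_floatSet (p q : ℕ) : (0 : ℝ) ∈ floatSet p q :=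
  ⟨0, by positivity, 1, by simp, Or.inr (by simp)⟩

theorem neg_mem_floatSet {p q : ℕ} {x : ℝ} (hx : x ∈ floatSet p q) : -x ∈ floatSet p q := by
  obtain ⟨i, hi, s, hs, h⟩ := hx
  refine ⟨i, hi, -s, ?_, ?_⟩
  · rcases hs with rfl | hs
    · simp
    · rw [Set.mem_singleton_iff] at hs
      simp [hs]
  · rcases h with ⟨e, he, rfl⟩ | rfl
    · exact Or.inl ⟨e, he, by ring⟩
    · exact Or.inr (by ring)

instance (p q : ℕ) : Zero (Flt p q) := ⟨⟨0, zero_mem_floatSet p q⟩⟩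

instance (p q : ℕ) : Neg (Flt p q) := ⟨fun x => ⟨-(x : ℝ), neg_mem_floatSet x.2⟩⟩

theorem floatSet_finite (p q : ℕ) : (floatSet p q).Finite := by
  have h2 : ({-1, 1} : Set ℝ).Finite := by simp
  refine Set.Finite.subset
    ((Set.finite_Iio (2 ^ p)).biUnion (t := fun i : ℕ =>
      ⋃ s ∈ ({-1, 1} : Set ℝ),
        ((fun e : ℤ => s * (1 + (i : ℝ) / 2 ^ p) * (2 : ℝ) ^ e) '' Set.Icc (emin q) (emax q)) ∪
          {s * ((i : ℝ) / 2 ^ p) * (2 : ℝ) ^ (emin q)})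
      (fun i _ => h2.biUnion fun s _ =>
        ((Set.finite_Icc _ _).image _).union (Set.finite_singleton _))) ?_
  rintro x ⟨i, hi, s, hs, h⟩
  refine Set.mem_biUnion (show i ∈ Set.Iio (2 ^ p) from hi) (Set.mem_biUnion hs ?_)
  rcases h with ⟨e, he, rfl⟩ | rfl
  · exact Or.inl ⟨e, he, rfl⟩
  · exact Or.inr rfl

/-- `y` minimizes `|x - y|` over the finite floats. -/
def IsNearest {p q : ℕ} (x : ℝ) (y : Flt p q) : Prop :=
  ∀ z : Flt p q, |x - (y : ℝ)| ≤ |x - (z : ℝ)|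

theorem exists_isNearest (p q : ℕ) (x : ℝ) : ∃ y : Flt p q, IsNearest x y := by
  have : Finite (Flt p q) := (floatSet_finite p q).to_subtype
  exact Finite.exists_min fun y : Flt p q => |x - (y : ℝ)|

open Classical in
/-- A nearest finite float; when two are equally near, the even one. -/
noncomputable def nearest (p q : ℕ) (x : ℝ) : Flt p q :=
  if h : ∃ y : Flt p q, IsNearest x y ∧ IsEvenFlt y then h.choose
  else (exists_isNearest p q x).choose

/-- All floating-point numbers: finite ones, `±∞` and NaN. -/
inductive XFlt (p q : ℕ) : Type
  | fin (x : Flt p q) : XFlt p q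
  | posInf : XFlt p q
  | negInf : XFlt p q
  | nan : XFlt p q

open Classical in
/-- Rounding of a real number to a floating-point number. -/
noncomputable def round (p q : ℕ) (x : ℝ) : XFlt p q :=
  if Omega p q + (2 : ℝ) ^ (emax q - p - 1) ≤ x then .posInf
  else if x ≤ -Omega p q - (2 : ℝ) ^ (emax q - p - 1) then .negInf
  else .fin (nearest p q x)

/-- Rounding of an extended real number. -/
noncomputable def roundEReal (p q : ℕ) (x : EReal) : XFlt p q :=
  if x = ⊤ then .posInf else if x = ⊥ then .negInf else round p q x.toReal

namespace XFlt

variable {p q : ℕ}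

/-- Floating-point addition `x ⊕ y`. -/
noncomputable def add : XFlt p q → XFlt p q → XFlt p q
  | nan, _ => nan
  | _, nan => nan
  | fin x, fin y => round p q ((x : ℝ) + (y : ℝ))
  | fin _, posInf => posInf
  | posInf, fin _ => posInf
  | posInf, posInf => posInf
  | fin _, negInf => negInf
  | negInf, fin _ => negInf
  | negInf, negInf => negInf
  | posInf, negInf => nan
  | negInf, posInf => nan

open Classical in
/-- The product of the infinity of sign `s` (`true` is `+`) and the finite float `y`. -/
noncomputable def infMul (s : Bool) (y : Flt p q) : XFlt p q :=
  if (y : ℝ) = 0 then nan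
  else if (0 < (y : ℝ) ↔ s = true) then posInf
  else negInf

/-- Floating-point multiplication `x ⊗ y`. -/
noncomputable def mul : XFlt p q → XFlt p q → XFlt p q
  | nan, _ => nan
  | _, nan => nan
  | fin x, fin y => round p q ((x : ℝ) * (y : ℝ))
  | fin x, posInf => infMul true x
  | posInf, fin y => infMul true y
  | fin x, negInf => infMul false x
  | negInf, fin y => infMul false y
  | posInf, posInf => posInf
  | negInf, negInf => posInf
  | posInf, negInf => negInf
  | negInf, posInf => negInf

/-- Left-associative floating-point sum `((v₁ ⊕ v₂) ⊕ v₃) ⊕ ⋯`, with empty sum `0`. -/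
noncomputable def sum : (n : ℕ) → (Fin n → XFlt p q) → XFlt p q
  | 0, _ => fin 0
  | n + 1, v => add (sum n fun i => v i.castSucc) (v (Fin.last n))

/-- Matrix times column vector. -/
noncomputable def mulVec {m n : ℕ} (A : Fin m → Fin n → XFlt p q) (x : Fin n → XFlt p q) :
    Fin m → XFlt p q :=
  fun i => sum n fun j => mul (A i j) (x j)

/-- Row vector times matrix. -/
noncomputable def vecMul {m n : ℕ} (g : Fin m → XFlt p q) (A : Fin m → Fin n → XFlt p q) :
    Fin n → XFlt p q :=
  fun j => sum m fun i => mul (g i) (A i j)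

/-- The diagonal matrix with diagonal `v`. -/
def diag {n : ℕ} (v : Fin n → XFlt p q) : Fin n → Fin n → XFlt p q :=
  fun i j => if i = j then v i else fin 0

end XFlt

open Classical in
/-- The rounded value of the limit of `φ` along `l` in `[-∞, ∞]`, or NaN if there is none. -/
noncomputable def roundLim (p q : ℕ) (φ : ℝ → ℝ) (l : Filter ℝ) : XFlt p q :=
  if h : ∃ a : EReal, Tendsto (fun x => (φ x : EReal)) l (𝓝 a) then roundEReal p q h.choose
  else .nan

/-- The rounded version of a real function, as a function on all floats. -/
noncomputable def roundFun (p q : ℕ) (φ : ℝ → ℝ) : XFlt p q → XFlt p q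
  | .fin x => round p q (φ (x : ℝ))
  | .posInf => roundLim p q φ atTop
  | .negInf => roundLim p q φ atBot
  | .nan => .nan

/-! ### Floating-point networks and automatic differentiation -/

/-- Parameters of a network with `L` layers (affine maps), input dimension `m` and output
dimension `n`; all hidden dimensions are positive. The first layer is the outermost
constructor. -/
inductive Net (p q : ℕ) : (L m n : ℕ) → Type
  | last {m n : ℕ} (A : Fin n → Fin m → Flt p q) (b : Fin n → Flt p q) : Net p q 1 m n
  | cons {L m k n : ℕ} (hk : 0 < k) (A : Fin k → Fin m → Flt p q) (b : Fin k → Flt p q)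
      (N : Net p q L k n) : Net p q (L + 1) m n

/-- The affine transformation `A ⊗ x ⊕ b`. -/
noncomputable def affine {p q m n : ℕ} (A : Fin n → Fin m → Flt p q) (b : Fin n → Flt p q)
    (x : Fin m → XFlt p q) : Fin n → XFlt p q :=
  fun i => (XFlt.mulVec (fun i j => .fin (A i j)) x i).add (.fin (b i))

/-- The network function `ρ_L ∘ σ ∘ ⋯ ∘ σ ∘ ρ_1`. -/
noncomputable def Net.eval {p q : ℕ} (σ : XFlt p q → XFlt p q) :
    {L m n : ℕ} → Net p q L m n → (Fin m → XFlt p q) → Fin n → XFlt p q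
  | _, _, _, .last A b, x => affine A b x
  | _, _, _, .cons _ A b N, x => N.eval σ fun i => σ (affine A b x i)

/-- Derivative of an affine transformation with matrix `A`: `g ↦ g ⊗ A`. -/
noncomputable def gradAffine {p q m n : ℕ} (A : Fin n → Fin m → Flt p q)
    (g : Fin n → XFlt p q) : Fin m → XFlt p q :=
  XFlt.vecMul g fun i j => .fin (A i j)

/-- Derivative of a coordinatewise activation at `y`: `g ↦ g ⊗ diag (σ'(y))`. -/
noncomputable def gradAct {p q n : ℕ} (σ' : XFlt p q → XFlt p q) (y : Fin n → XFlt p q)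
    (g : Fin n → XFlt p q) : Fin n → XFlt p q :=
  XFlt.vecMul g (XFlt.diag fun i => σ' (y i))

/-- Reverse-mode automatic differentiation: the output gradient at the input `x` for the
input gradient `g`, namely `D_{ρ₁} (D_{σ,y₁} (⋯ (D_{ρ_L} g)))`. -/
noncomputable def Net.grad {p q : ℕ} (σ σ' : XFlt p q → XFlt p q) :
    {L m n : ℕ} → Net p q L m n → (Fin m → XFlt p q) → (Fin n → XFlt p q) → Fin m → XFlt p q
  | _, _, _, .last A _, _, g => gradAffine A g
  | _, _, _, .cons _ A b N, x, g =>
      gradAffine A (gradAct σ' (affine A b x)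
        (N.grad σ σ' (fun i => σ (affine A b x i)) g))

/-! ### The activation functions -/

/-- Names of the six activation functions. -/
inductive Act : Type
  | relu | elu | gelu | swish | sigmoid | tanh

open Classical in
/-- The real activation functions. -/
noncomputable def Act.fn : Act → ℝ → ℝ
  | relu => fun x => max 0 x
  | elu => fun x => if 0 ≤ x then x else Real.exp x - 1
  | gelu => fun x => x / 2 *
      (1 + 2 / Real.sqrt Real.pi * ∫ t in (0 : ℝ)..(x / Real.sqrt 2), Real.exp (-t ^ 2))
  | swish => fun x => x / (1 + Real.exp (-x))
  | sigmoid => fun x => 1 / (1 + Real.exp (-x))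
  | tanh => Real.tanh

open Classical in
/-- Their derivatives; at the kink of ReLU the value is `0`, as usual in automatic
differentiation. The five other functions are differentiable everywhere. -/
noncomputable def Act.dfn : Act → ℝ → ℝ
  | relu => fun x => if 0 < x then 1 else 0
  | a => deriv a.fn

/-- The floating-point activation function `σ`. -/
noncomputable def Act.sigma (a : Act) (p q : ℕ) : XFlt p q → XFlt p q := roundFun p q a.fn

/-- The floating-point derivative `σ'`. -/
noncomputable def Act.sigma' (a : Act) (p q : ℕ) : XFlt p q → XFlt p q := roundFun p q a.dfn

/-- The bound `M_σ` on the inputs. -/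
noncomputable def Act.M (q : ℕ) : Act → ℝ
  | sigmoid => (2 : ℝ) ^ (emax q - 1)
  | tanh => (2 : ℝ) ^ (emax q - 1)
  | _ => (2 : ℝ) ^ (emax q - 2)

/-- The bound `H_σ` on the input gradients. -/
noncomputable def Act.H (p q : ℕ) : Act → ℝ
  | sigmoid => (2 : ℝ) ^ ((p : ℤ) - 1)
  | tanh => (2 : ℝ) ^ ((p : ℤ) - 2)
  | _ => Omega p q

/-- The depth threshold `τ` for `q = 4` and `q = 5`. -/
def Act.tau (q : ℕ) : Act → ℕ
  | sigmoid => if q = 4 then 13 else 10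
  | tanh => if q = 4 then 10 else 9
  | _ => 10

/-- The input domain `[-M_σ, M_σ]_𝔽^d`. -/
def Act.domain (a : Act) (p q d : ℕ) : Set (Fin d → Flt p q) :=
  {x | ∀ i, (x i : ℝ) ∈ Set.Icc (-a.M q) (a.M q)}

/-- A vector of finite floats as a vector of floats. -/
def toX {p q n : ℕ} (x : Fin n → Flt p q) : Fin n → XFlt p q := fun i => .fin (x i)

end FPNet

/-!
Both assertions are proved by networks that are sums of independent units, one for every input
point and every unit of a value or of a gradient that has to be delivered there. The domain is
finite, so finitely many units suffice, and the width of a network is unrestricted. All sums are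
arranged so that the operations on the relevant floats are exact, or so that their rounding is
known.

*Values.* For a point `x0`, comparisons of the coordinates of the input with thresholds
(`Kit.exists_tests`) tell whether the input is `x0`, and their conjunction (`Kit.link_cell_test`)
is a bit. This bit is carried upwards by cells (`Kit.link_cell_cell`), which are pairs of neurons
that are read with opposite weights and have the same derivative at the activation, so that no
gradient flows down through them. At the top a bit is turned into a float `u`
(`Kit.exists_value_unit`). Every float is a sum of at most `2 ^ (p + 1)` equal powers of two, with
all partial sums exact (`exists_unary`), so finitely many such units produce the prescribed value
at `x0` and contribute zero elsewhere.

*Gradients.* Two neurons with the same value and opposite outgoing weights contribute nothing to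
the values above them, but the first of them can transport a gradient to the layers below, if the
weights below the second one vanish (`link_pair`). A path of such pairs delivers a float `u` to one
coordinate of the gradient. It passes a gate (`Kit.link_gate`), a pair whose pre-activations are
shifted by the bit of `x0`, so that its derivative is zero unless the input is `x0`. Above the
gate, the gradient of the output has to be converted to zero or plus or minus the least positive
float; below the gate, this is scaled up to a power of two (`Kit.chain_path`, `Kit.exists_block`).
As with values, a prescribed gradient is a sum of such contributions.

For the first assertion, the gradient of the output at `x0` is a known float, and scaling it by
powers of two, with the rounding that this entails, leads to plus or minus the least positive float
(`Kit.exists_normalize`).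

For the second assertion, the gradient `y` of the output is arbitrary, and there is one gradient
path for every positive value that has to be recognized. Consider the rounding errors of repeated
halvings of `y`, down to zero. Each of them is a multiple of the least positive float by `-1`, `0`
or `1`, they depend on `y` in an odd way, and together they determine `y` (`eq_of_digits`). To
compare `y` with `y0`, a nonzero error of `y0` is selected. The corresponding error of `y` is the
candidate result, and it is compared with all the others: differences from the pattern of `y0` are
scaled up and added and subtracted again, which by absorption wipes out the candidate unless all
differences are zero (`lsum_wipe`). What remains is plus or minus the least positive float if `y =
±y0`, and zero otherwise (`Kit.exists_recognize`). This also explains the number of layers: the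
halvings have to run through the whole range of exponents.

*Composition.* A network is described from the output to the input by layers whose values and
gradients are specified for all inputs under consideration (`Layer`, `Link`, `Chain`), and such
descriptions can be added in parallel (`Layer.sum`, `Layer.fam`). `NetAbove.exists_net` turns a
description into a network, and `Kit.exists_net` assembles the units.

*Activation functions.* The facts about an activation function that are used are collected in the
structure `Kit`. It is instantiated by `Rectifier.kit` for ReLU, ELU, GELU and Swish, which
resemble the positive part, by `SigmoidKit.kit` for the sigmoid function and by `TanhKit.kit` for
the hyperbolic tangent.
-/

namespace FPNet

/-! ### Canonical form of floats, and nearest floats -/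

/-- The numerical relations between precision and exponent range that the construction uses. -/
class Ok (p q : ℕ) : Prop where
  two_le : 2 ≤ p
  p_le : p ≤ 8
  emin_eq : emin q = 1 - emax q
  add_le : (p : ℤ) + 3 ≤ emax q
  seven_le : 7 ≤ emax q
  le_fifteen : emax q ≤ 15

theorem Ok.of_bounds {p q : ℕ} (hp : 2 ≤ p) (hpq : p ≤ 2 ^ (q - 2)) (hq4 : 4 ≤ q) (hq5 : q ≤ 5) :
    Ok p q := by
  interval_cases q <;> refine ⟨hp, ?_, ?_, ?_, ?_, ?_⟩ <;> norm_num [emin, emax] at * <;> omega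

/-- Integer multiples `m 2^k` of powers of two are floats if `m` fits into the mantissa. This is the
form in which membership in the set of floats is established throughout. -/
theorem mem_floatSet_of_int {p q : ℕ} (hE : emin q ≤ emax q) {m k : ℤ} (hm : |m| < 2 ^ (p + 1))
    (hk : emin q - p ≤ k) (hk' : k ≤ emax q - p) : (m : ℝ) * 2 ^ k ∈ floatSet p q := by
  wlog h0 : 0 ≤ m generalizing m
  · have := neg_mem_floatSet (this (m := -m) (by simpa using hm) (by omega))
    simpa using this
  obtain ⟨j, hj⟩ := Int.le.dest hk
  induction j generalizing m k with
  | zero =>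
    obtain ⟨n, rfl⟩ := Int.eq_ofNat_of_zero_le h0
    have hn : n < 2 ^ (p + 1) := by
      have := hm; rw [abs_of_nonneg h0] at this; exact_mod_cast this
    have hk0 : k = emin q - p := by simpa using hj.symm
    by_cases h : n < 2 ^ p
    · refine ⟨n, h, 1, by simp, Or.inr ?_⟩
      rw [hk0, zpow_sub₀ (by norm_num)]
      simp; ring
    · push Not at h
      refine ⟨n - 2 ^ p, ?_, 1, by simp, Or.inl ⟨emin q, ⟨le_rfl, hE⟩, ?_⟩⟩
      · rw [pow_succ] at hn; omega
      · rw [hk0, zpow_sub₀ (by norm_num), Nat.cast_sub h]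
        simp; field_simp; ring
  | succ j ih =>
    by_cases h : m < 2 ^ p
    · have := @ih (k - 1) (by push_cast at hj; omega) (by omega) (2 * m)
        (by rw [abs_of_nonneg (by omega)] at hm ⊢; rw [pow_succ]; omega) (by omega)
        (by push_cast at hj; omega)
      convert this using 1
      rw [zpow_sub₀ (by norm_num)]; push_cast; ring
    · obtain ⟨n, rfl⟩ := Int.eq_ofNat_of_zero_le h0
      push Not at h
      have h' : 2 ^ p ≤ n := by exact_mod_cast h
      have hn : n < 2 ^ (p + 1) := by
        have := hm; rw [abs_of_nonneg h0] at this; exact_mod_cast this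
      refine ⟨n - 2 ^ p, ?_, 1, by simp, Or.inl ⟨k + p, ⟨by omega, by omega⟩, ?_⟩⟩
      · rw [pow_succ] at hn; omega
      · rw [zpow_add₀ (by norm_num), Nat.cast_sub h']
        simp; field_simp; ring

/-- Canonical form `n 2^k` of a nonnegative float, `n` being the integer significand. The last
condition makes it unique: the significand has full length unless the exponent is the least one. -/
def Canon (p q : ℕ) (x : ℝ) (n : ℕ) (k : ℤ) : Prop :=
  x = n * 2 ^ k ∧ n < 2 ^ (p + 1) ∧ emin q - p ≤ k ∧ k ≤ emax q - p ∧
    (2 ^ p ≤ n ∨ k = emin q - p)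

theorem HasRep.exists_canon {p q : ℕ} (hE : emin q ≤ emax q) {x : ℝ} {i : ℕ} (h : HasRep p q x i) :
    ∃ n k, Canon p q |x| n k ∧ (1 ≤ p → Even i → Even n) := by
  obtain ⟨hi, s, hs, h⟩ := h
  have hs' : |s| = 1 := by rcases hs with rfl | hs; · simp
                           · rw [Set.mem_singleton_iff.1 hs]; simp
  rcases h with ⟨e, ⟨he, he'⟩, rfl⟩ | rfl
  · refine ⟨2 ^ p + i, e - p, ⟨?_, ?_, by omega, by omega, Or.inl (by omega)⟩, ?_⟩
    · rw [abs_mul, abs_mul, hs', abs_of_nonneg (by positivity : (0:ℝ) ≤ 1 + i / 2 ^ p),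
        abs_of_pos (by positivity), zpow_sub₀ (by norm_num)]
      push_cast; simp; field_simp
    · rw [pow_succ]; omega
    · intro hp h
      exact ((Nat.even_pow.2 ⟨even_two, by omega⟩)).add h
  · refine ⟨i, emin q - p, ⟨?_, ?_, by omega, by omega, Or.inr rfl⟩, fun _ h => h⟩
    · rw [abs_mul, abs_mul, hs', abs_of_nonneg (by positivity : (0:ℝ) ≤ i / 2 ^ p),
        abs_of_pos (by positivity), zpow_sub₀ (by norm_num)]
      simp; ring
    · rw [pow_succ]; omega

theorem Canon.hasRep {p q : ℕ} {x : ℝ} {n : ℕ} {k : ℤ} (h : Canon p q x n k)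
    (hp : 1 ≤ p) (hn : Even n) : ∃ i, Even i ∧ HasRep p q x i := by
  obtain ⟨rfl, h1, h2, h3, h4⟩ := h
  by_cases h : 2 ^ p ≤ n
  · refine ⟨n - 2 ^ p, ?_, ?_, 1, by simp, Or.inl ⟨k + p, ⟨by omega, by omega⟩, ?_⟩⟩
    · rw [Nat.even_sub h]; simp [hn, Nat.even_pow]; omega
    · rw [pow_succ] at h1; omega
    · rw [zpow_add₀ (by norm_num), Nat.cast_sub h]
      simp; field_simp; ring
  · have hk : k = emin q - p := by tauto
    refine ⟨n, hn, by omega, 1, by simp, Or.inr ?_⟩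
    rw [hk, zpow_sub₀ (by norm_num)]
    simp; ring

theorem Canon.mem {p q : ℕ} (hE : emin q ≤ emax q) {x : ℝ} {n : ℕ} {k : ℤ} (h : Canon p q x n k) :
    x ∈ floatSet p q := by
  obtain ⟨rfl, h1, h2, h3, h4⟩ := h
  have := mem_floatSet_of_int (p := p) (q := q) hE (m := n) (k := k)
    (by simpa using by exact_mod_cast h1) h2 h3
  simpa using this

theorem mem_floatSet.exists_canon {p q : ℕ} (hE : emin q ≤ emax q) {x : ℝ} (h : x ∈ floatSet p q) :
    ∃ n k, Canon p q |x| n k := by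
  obtain ⟨i, hi⟩ := h
  obtain ⟨n, k, h, -⟩ := hi.exists_canon hE
  exact ⟨n, k, h⟩

/-- The gap above a canonical float is at least one unit in the last place. -/
theorem Canon.add_le {p q : ℕ} {x y : ℝ} {n n' : ℕ} {k k' : ℤ} (hx : Canon p q x n k)
    (hy : Canon p q y n' k') (h : x < y) : k ≤ k' ∧ x + 2 ^ k ≤ y := by
  obtain ⟨rfl, h1, h2, h3, h4⟩ := hx
  obtain ⟨rfl, h1', h2', h3', h4'⟩ := hy
  have hk : k ≤ k' := by
    by_contra hlt
    push Not at hlt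
    have h5 : 2 ^ p ≤ n := by omega
    have h6 : (n' : ℝ) * 2 ^ k' < (2 : ℝ) ^ (p + 1) * 2 ^ k' := by
      have : (n' : ℝ) < 2 ^ (p + 1) := by exact_mod_cast h1'
      gcongr
    have h7 : (2 : ℝ) ^ (p + 1) * 2 ^ k' ≤ 2 ^ p * 2 ^ k := by
      have : (2 : ℝ) ^ (k' + 1) ≤ 2 ^ k := zpow_le_zpow_right₀ (by norm_num) (by omega)
      rw [zpow_add₀ (by norm_num)] at this
      rw [pow_succ]
      calc (2 : ℝ) ^ p * 2 * 2 ^ k' = 2 ^ p * (2 ^ k' * 2 ^ (1:ℤ)) := by simp; ring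
        _ ≤ _ := by gcongr
    have h8 : (2 : ℝ) ^ p * 2 ^ k ≤ n * 2 ^ k := by
      have : (2 : ℝ) ^ p ≤ n := by exact_mod_cast h5
      gcongr
    linarith
  refine ⟨hk, ?_⟩
  obtain ⟨j, rfl⟩ := Int.le.dest hk
  have h5 : (n : ℝ) < n' * 2 ^ j := by
    have h6 : (n : ℝ) * 2 ^ k < (n' * 2 ^ j) * 2 ^ k := by
      calc _ < _ := h
        _ = _ := by rw [zpow_add₀ (by norm_num)]; simp; ring
    exact lt_of_mul_lt_mul_right h6 (by positivity)
  have h7 : n + 1 ≤ n' * 2 ^ j := by exact_mod_cast h5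
  have h8 : (n : ℝ) + 1 ≤ n' * 2 ^ j := by exact_mod_cast h7
  calc _ = ((n : ℝ) + 1) * 2 ^ k := by ring
    _ ≤ (n' * 2 ^ j) * 2 ^ k := by gcongr
    _ = _ := by rw [zpow_add₀ (by norm_num)]; simp; ring

variable {p q : ℕ}

theorem IsNearest.neg {x : ℝ} {y : Flt p q} (h : IsNearest x y) : IsNearest (-x) (-y) := by
  intro z
  have := h (-z)
  have e1 : ((-y : Flt p q) : ℝ) = -(y : ℝ) := rfl
  have e2 : ((-z : Flt p q) : ℝ) = -(z : ℝ) := rfl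
  rw [e1]; rw [e2] at this
  rw [← abs_neg, ← abs_neg (-x - (z:ℝ))]
  convert this using 2 <;> ring

theorem IsEvenFlt.neg {y : Flt p q} (h : IsEvenFlt y) : IsEvenFlt (-y) := by
  obtain ⟨i, hi, h1, s, hs, h⟩ := h
  refine ⟨i, hi, h1, -s, ?_, ?_⟩
  · rcases hs with rfl | hs
    · simp
    · rw [Set.mem_singleton_iff] at hs; simp [hs]
  · have e1 : ((-y : Flt p q) : ℝ) = -(y : ℝ) := rfl
    rw [e1]
    rcases h with ⟨e, he, h⟩ | h
    · exact Or.inl ⟨e, he, by rw [h]; ring⟩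
    · exact Or.inr (by rw [h]; ring)

theorem neg_neg_flt (y : Flt p q) : - -y = y := Subtype.ext (neg_neg (y : ℝ))

/-- No float lies between two floats that are both nearest to `x`. -/
theorem IsNearest.not_between {x : ℝ} {y z : Flt p q} (hy : IsNearest x y) (hz : IsNearest x z)
    (w : Flt p q) (h1 : (y : ℝ) < w) (h2 : (w : ℝ) < z) : False := by
  have h3 := hy z; have h4 := hz y
  have h5 := hy w
  have h6 : |x - y| = |x - z| := le_antisymm h3 h4
  rcases abs_eq_abs.1 h6 with h7 | h7
  · linarith
  · have : x = (y + z) / 2 := by linarith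
    rw [this] at h5
    have h8 : |((y:ℝ) + z) / 2 - y| = (z - y) / 2 := by
      rw [show ((y:ℝ) + z) / 2 - y = (z - y) / 2 by ring]; exact abs_of_pos (by linarith)
    rw [h8] at h5
    have : |((y:ℝ) + z) / 2 - w| < (z - y) / 2 := abs_lt.2 ⟨by linarith, by linarith⟩
    linarith

/-- Two different nearest floats are adjacent, so exactly one of them is even. -/
theorem IsNearest.tie (hE : emin q ≤ emax q) (hp : 1 ≤ p) {x : ℝ} {y z : Flt p q}
    (hy : IsNearest x y)
    (hz : IsNearest x z) (h : (y : ℝ) < z) :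
    (IsEvenFlt y ∨ IsEvenFlt z) ∧ ¬ (IsEvenFlt y ∧ IsEvenFlt z) := by
  -- if `y < 0`, then `z ≤ 0` since `0` does not lie between, and `-z`, `-y` take the parts of `y`, `z`
  wlog h0 : 0 ≤ (y : ℝ) generalizing x y z
  · have e : ∀ w : Flt p q, ((-w : Flt p q) : ℝ) = -(w : ℝ) := fun _ => rfl
    have hb := fun w => hy.not_between hz w
    have hz0 : (z : ℝ) ≤ 0 := by
      by_contra hc
      exact hb 0 (by push Not at h0; exact h0) (by push Not at hc; exact hc)
    have := this hz.neg hy.neg (by rw [e, e]; linarith) (by rw [e]; linarith)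
    have h1 : ∀ w : Flt p q, IsEvenFlt (-w) ↔ IsEvenFlt w :=
      fun w => ⟨fun h => by simpa [neg_neg_flt] using h.neg, fun h => h.neg⟩
    rw [h1, h1] at this
    tauto
  have hb := fun w => hy.not_between hz w
  -- unless the significand `n` of `y` is the largest one, the next float has the significand `n + 1`
  have key : ∀ n k, Canon p q y n k → n + 1 < 2 ^ (p + 1) → (z : ℝ) = (n + 1 : ℕ) * 2 ^ k := by
    intro n k hc hn
    obtain ⟨n', k', hc'⟩ := mem_floatSet.exists_canon hE z.2
    rw [abs_of_pos (by linarith)] at hc'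
    have h1 := (hc.add_le hc' h).2
    obtain ⟨r1, r2, r3, r4, r5⟩ := hc
    have h2 : ((n + 1 : ℕ) : ℝ) * 2 ^ k ∈ floatSet p q :=
      Canon.mem hE (n := n + 1) (k := k) ⟨rfl, hn, r3, r4, by omega⟩
    have h3 : ((n + 1 : ℕ) : ℝ) * 2 ^ k = y + 2 ^ k := by rw [r1]; push_cast; ring
    have h4 : (0:ℝ) < 2 ^ k := by positivity
    by_contra hne
    exact hb ⟨_, h2⟩ (by simp only; linarith)
      (by simp only; rw [h3]; exact lt_of_le_of_ne h1 (by rw [← h3]; exact fun h => hne h.symm))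
  constructor
  · obtain ⟨n, k, hc⟩ := mem_floatSet.exists_canon hE y.2
    rw [abs_of_nonneg h0] at hc
    rcases Nat.even_or_odd n with hn | hn
    · exact Or.inl (hc.hasRep hp hn)
    · right
      have hn1 : Even (n + 1) := hn.add_one
      obtain ⟨r1, r2, r3, r4, r5⟩ := id hc
      by_cases hlt : n + 1 < 2 ^ (p + 1)
      · have := key n k hc hlt
        refine Canon.hasRep (n := n + 1) (k := k) ⟨this, hlt, r3, r4, by omega⟩ hp hn1
      -- the largest significand is odd, and the next one is `2 ^ p` with the next exponent
      · have hn2 : n + 1 = 2 ^ (p + 1) := by omega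
        obtain ⟨n', k', hc'⟩ := mem_floatSet.exists_canon hE z.2
        rw [abs_of_pos (by linarith)] at hc'
        obtain ⟨h1, h2⟩ := hc.add_le hc' h
        obtain ⟨s1, s2, s3, s4, s5⟩ := id hc'
        have h3 : (y:ℝ) + 2 ^ k = (2 ^ p : ℕ) * 2 ^ (k + 1) := by
          rw [r1, zpow_add₀ (by norm_num)]
          have : (n : ℝ) = 2 ^ (p + 1) - 1 := by rw [eq_sub_iff_add_eq]; exact_mod_cast hn2
          rw [this]; push_cast; rw [pow_succ]; simp; ring
        have hk : k < k' := by
          by_contra hk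
          have : k' = k := by omega
          subst this
          have : (n' : ℝ) ≤ n := by exact_mod_cast (by omega : n' ≤ n)
          have h9 : (n' : ℝ) * 2 ^ k' ≤ n * 2 ^ k' := by gcongr
          linarith
        have hcc : Canon p q ((2 ^ p : ℕ) * 2 ^ (k + 1)) (2 ^ p) (k + 1) :=
          ⟨rfl, Nat.pow_lt_pow_right (by norm_num) (by omega), by omega, by omega, Or.inl le_rfl⟩
        have h4 : (0:ℝ) < 2 ^ k := by positivity
        have : (z : ℝ) = (2 ^ p : ℕ) * 2 ^ (k + 1) := by
          by_contra hne
          refine hb ⟨_, hcc.mem hE⟩ (by simp only; linarith) (by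
            simp only; rw [← h3]; exact lt_of_le_of_ne h2 (by rw [h3]; exact fun h => hne h.symm))
        rw [← this] at hcc
        exact hcc.hasRep hp (Nat.even_pow.2 ⟨even_two, by omega⟩)
  · rintro ⟨⟨i, hi, hyi⟩, j, hj, hzj⟩
    obtain ⟨n, k, hc, hn⟩ := hyi.exists_canon hE
    obtain ⟨n', k', hc', hn'⟩ := hzj.exists_canon hE
    specialize hn hp hi
    specialize hn' hp hj
    rw [abs_of_nonneg h0] at hc
    rw [abs_of_pos (by linarith)] at hc'
    -- `n` is even, hence not the largest one, and `n + 1 = n' 2 ^ b` would be even as well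
    have hlt : n + 1 < 2 ^ (p + 1) := by
      have := hc.2.1
      obtain ⟨a, ha⟩ := hn
      rw [pow_succ] at *; omega
    have h1 := key n k hc hlt
    have hk := (hc.add_le hc' h).1
    obtain ⟨b, rfl⟩ := Int.le.dest hk
    have h2 := hc'.1
    rw [h1, zpow_add₀ (by norm_num)] at h2
    have h3 : ((n + 1 : ℕ) : ℝ) = n' * 2 ^ b := by
      have h4 : (0:ℝ) < 2 ^ k := by positivity
      have : ((n + 1 : ℕ) : ℝ) * 2 ^ k = (n' * 2 ^ b) * 2 ^ k := by rw [h2]; simp; ring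
      exact mul_right_cancel₀ h4.ne' this
    have h5 : n + 1 = n' * 2 ^ b := by exact_mod_cast h3
    have : Even (n + 1) := by rw [h5]; exact hn'.mul_right _
    rw [Nat.even_add_one] at this
    exact this hn

theorem nearest_isNearest (x : ℝ) : IsNearest x (nearest p q x) := by
  unfold nearest
  split_ifs with h
  · exact h.choose_spec.1
  · exact (exists_isNearest p q x).choose_spec

theorem nearest_eq_of_unique {x : ℝ} {y : Flt p q} (h : ∀ z, IsNearest x z → z = y) :
    nearest p q x = y := h _ (nearest_isNearest x)

theorem nearest_eq_of_even (hE : emin q ≤ emax q) (hp : 1 ≤ p) {x : ℝ} {y : Flt p q}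
    (hy : IsNearest x y)
    (he : IsEvenFlt y) : nearest p q x = y := by
  have hex : ∃ y : Flt p q, IsNearest x y ∧ IsEvenFlt y := ⟨y, hy, he⟩
  have h1 : nearest p q x = hex.choose := by unfold nearest; rw [dif_pos hex]
  obtain ⟨h2, h3⟩ := hex.choose_spec
  rw [← h1] at h2 h3
  rcases lt_trichotomy (y : ℝ) (nearest p q x : Flt p q) with h | h | h
  · exact absurd ⟨he, h3⟩ (hy.tie hE hp h2 h).2
  · exact (Subtype.ext h).symm
  · exact absurd ⟨h3, he⟩ (h2.tie hE hp hy h).2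

theorem nearest_neg (hE : emin q ≤ emax q) (hp : 1 ≤ p) (x : ℝ) :
    nearest p q (-x) = -nearest p q x := by
  by_cases h : ∃ y : Flt p q, IsNearest x y ∧ IsEvenFlt y
  · obtain ⟨y, hy, he⟩ := h
    rw [nearest_eq_of_even hE hp hy he, nearest_eq_of_even hE hp hy.neg he.neg]
  · have h2 : ∀ y z : Flt p q, IsNearest x y → IsNearest x z → y = z := by
      intro y z hy hz
      rcases lt_trichotomy (y : ℝ) z with h' | h' | h'
      · rcases (hy.tie hE hp hz h').1 with h3 | h3
        · exact absurd ⟨y, hy, h3⟩ h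
        · exact absurd ⟨z, hz, h3⟩ h
      · exact Subtype.ext h'
      · rcases (hz.tie hE hp hy h').1 with h3 | h3
        · exact absurd ⟨z, hz, h3⟩ h
        · exact absurd ⟨y, hy, h3⟩ h
    refine nearest_eq_of_unique fun z hz => ?_
    have h3 := hz.neg
    rw [neg_neg] at h3
    rw [← h2 _ _ h3 (nearest_isNearest x), neg_neg_flt]

theorem nearest_mono {x y : ℝ} (h : x ≤ y) : (nearest p q x : ℝ) ≤ nearest p q y := by
  rcases h.eq_or_lt with rfl | h
  · exact le_rfl
  by_contra hc
  push Not at hc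
  have h1 := nearest_isNearest (p := p) (q := q) x (nearest p q y)
  have h2 := nearest_isNearest (p := p) (q := q) y (nearest p q x)
  set a : ℝ := (nearest p q x : ℝ)
  set b : ℝ := (nearest p q y : ℝ)
  rw [← sq_le_sq] at h1 h2
  nlinarith

theorem nearest_of_mem {x : ℝ} (h : x ∈ floatSet p q) : nearest p q x = ⟨x, h⟩ := by
  refine nearest_eq_of_unique fun z hz => ?_
  have := hz ⟨x, h⟩
  simp only [sub_self, abs_zero] at this
  exact Subtype.ext (by have := abs_nonpos_iff.1 this; simp only; linarith)

/-! ### Rounding to finite floats -/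

/-- The finite float nearest to `r`; for a float `r` it is `r` itself. -/
noncomputable def F (r : ℝ) : XFlt p q := .fin (nearest p q r)

/-- The real value of the finite float nearest to `r`. -/
noncomputable def rd (p q : ℕ) (r : ℝ) : ℝ := (nearest p q r : ℝ)

/-- The unit `2^(emax - 2)` in which the levels of the neurons are measured. -/
noncomputable def T (q : ℕ) : ℝ := 2 ^ (emax q - 2)

/-- The least positive float. -/
noncomputable def eta (p q : ℕ) : ℝ := 2 ^ (emin q - p)

theorem T_pos : 0 < T q := by unfold T; positivity
theorem eta_pos : 0 < eta p q := by unfold eta; positivity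

theorem okE (p q : ℕ) [h : Ok p q] : emin q ≤ emax q := by
    have := h.emin_eq; have := h.seven_le; omega
theorem Ok.one_le [h : Ok p q] : 1 ≤ p := by have := h.two_le; omega

theorem rd_mem (r : ℝ) : rd p q r ∈ floatSet p q := (nearest p q r).2

theorem rd_of_mem {r : ℝ} (h : r ∈ floatSet p q) : rd p q r = r := by
  unfold rd; rw [nearest_of_mem h]

theorem F_of_mem {r : ℝ} (h : r ∈ floatSet p q) : (F r : XFlt p q) = .fin ⟨r, h⟩ := by
  unfold F; rw [nearest_of_mem h]

theorem F_coe (x : Flt p q) : (F (x : ℝ) : XFlt p q) = .fin x := F_of_mem x.2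

theorem F_rd (r : ℝ) : (F (rd p q r) : XFlt p q) = F r := by
  rw [F_of_mem (rd_mem r)]; rfl

theorem F_eq_iff {r s : ℝ} : (F r : XFlt p q) = F s ↔ rd p q r = rd p q s := by
  constructor
  · intro h; injection h with h; exact congrArg Subtype.val h
  · intro h; exact congrArg XFlt.fin (Subtype.ext h)

theorem F_zero : (F 0 : XFlt p q) = .fin 0 := F_of_mem (zero_mem_floatSet p q)

theorem rd_mono {r s : ℝ} (h : r ≤ s) : rd p q r ≤ rd p q s := nearest_mono h

theorem rd_le {r s : ℝ} (h : r ≤ s) (hs : s ∈ floatSet p q) : rd p q r ≤ s :=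
  (rd_mono h).trans_eq (rd_of_mem hs)

theorem le_rd {r s : ℝ} (h : r ≤ s) (hr : r ∈ floatSet p q) : r ≤ rd p q s :=
  (rd_of_mem hr).symm.trans_le (rd_mono h)

theorem rd_neg [h : Ok p q] (r : ℝ) : rd p q (-r) = -rd p q r := by
  unfold rd; rw [nearest_neg (okE p q) h.one_le]; rfl

theorem abs_rd_le {r s : ℝ} (h : |r| ≤ s) (hs : s ∈ floatSet p q) : |rd p q r| ≤ s := by
  rw [abs_le] at *
  refine ⟨?_, rd_le h.2 hs⟩
  exact le_rd h.1 (neg_mem_floatSet hs)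

theorem abs_rd_sub_le (r : ℝ) {s : ℝ} (hs : s ∈ floatSet p q) : |r - rd p q r| ≤ |r - s| :=
  nearest_isNearest r ⟨s, hs⟩

theorem zero_mem : (0 : ℝ) ∈ floatSet p q := zero_mem_floatSet p q

/-! ### Membership in the set of floats -/

theorem mem_int [Ok p q] (m k : ℤ) (hm : |m| < 2 ^ (p + 1)) (hk : emin q - p ≤ k)
    (hk' : k ≤ emax q - p) : (m : ℝ) * 2 ^ k ∈ floatSet p q := mem_floatSet_of_int (okE p q) hm hk
      hk'

theorem mem_small [h : Ok p q] (m : ℤ) (k : ℤ) (hm : |m| ≤ 7) (hk : emin q - p ≤ k)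
    (hk' : k ≤ emax q - 2) : (m : ℝ) * 2 ^ k ∈ floatSet p q := by
  have h2 := h.two_le
  have h8 : (8 : ℤ) ≤ 2 ^ (p + 1) := by
    calc (8 : ℤ) = 2 ^ 3 := by norm_num
      _ ≤ _ := pow_le_pow_right₀ (by norm_num) (by omega)
  by_cases hc : k ≤ emax q - p
  · exact mem_int m k (by omega) hk hc
  · obtain ⟨j, hj⟩ := Int.le.dest (show emax q - p ≤ k by omega)
    have : (m : ℝ) * 2 ^ k = ((m * 2 ^ j : ℤ) : ℝ) * 2 ^ (emax q - p) := by
      rw [← hj, zpow_add₀ (by norm_num)]; push_cast; simp; ring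
    rw [this]
    refine mem_int _ _ ?_ (by have := okE p q; omega) le_rfl
    rw [abs_mul, abs_of_pos (by positivity : (0:ℤ) < 2 ^ j)]
    calc |m| * 2 ^ j ≤ 7 * 2 ^ j := by gcongr
      _ < 8 * 2 ^ j := by gcongr; norm_num
      _ = 2 ^ (j + 3) := by ring
      _ ≤ 2 ^ (p + 1) := pow_le_pow_right₀ (by norm_num) (by omega)

theorem mem_zpow [h : Ok p q] (k : ℤ) (hk : emin q - p ≤ k) (hk' : k ≤ emax q) :
    (2 : ℝ) ^ k ∈ floatSet p q := by
  by_cases hc : k ≤ emax q - 2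
  · simpa using mem_small (p := p) (q := q) 1 k (by norm_num) hk hc
  · have := h.two_le; have := h.seven_le; have := h.emin_eq
    by_cases hc' : k = emax q
    · have := mem_small (p := p) (q := q) 4 (emax q - 2) (by norm_num) (by omega) le_rfl
      rw [hc']; convert this using 1; rw [zpow_sub₀ (by norm_num)]; norm_num; ring
    · have := mem_small (p := p) (q := q) 2 (emax q - 2) (by norm_num) (by omega) le_rfl
      rw [show k = (emax q - 2) + 1 by omega]; convert this using 1
      rw [zpow_add₀ (by norm_num)]; norm_num; ring

/-- Multiples of `T` by integers up to `7`. -/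
theorem mem_T [h : Ok p q] (m : ℤ) (hm : |m| ≤ 7) : (m : ℝ) * T q ∈ floatSet p q := by
  have := h.two_le; have := h.seven_le; have := h.emin_eq
  exact mem_small m _ hm (by omega) le_rfl

theorem four_T : 4 * T q = 2 ^ emax q := by
  unfold T; rw [zpow_sub₀ (by norm_num)]; norm_num; ring

theorem T_ge (p : ℕ) [h : Ok p q] : 32 ≤ T q := by
  have := h.seven_le
  calc (32 : ℝ) = 2 ^ (5 : ℤ) := by norm_num
    _ ≤ _ := zpow_le_zpow_right₀ (by norm_num) (by omega)

theorem Omega_eq : Omega p q = (2 ^ (p + 1) - 1) * 2 ^ (emax q - p) := by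
  unfold Omega
  rw [zpow_sub₀ (by norm_num), zpow_neg, pow_succ]; simp; field_simp

theorem Omega_mem [Ok p q] : Omega p q ∈ floatSet p q := by
  have := mem_int (p := p) (q := q) (2 ^ (p + 1) - 1) (emax q - p)
    (by have : (1 : ℤ) ≤ 2 ^ (p + 1) := one_le_pow₀ (by norm_num)
        rw [abs_of_nonneg (by omega)]; omega) (by have := okE p q; omega) le_rfl
  rw [Omega_eq]; exact_mod_cast this

theorem abs_le_Omega [Ok p q] {x : ℝ} (hx : x ∈ floatSet p q) : |x| ≤ Omega p q := by
  obtain ⟨n, k, h1, h2, h3, h4, h5⟩ := mem_floatSet.exists_canon (okE p q) hx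
  rw [h1, Omega_eq]
  have : (n : ℝ) ≤ 2 ^ (p + 1) - 1 := by
    rw [le_sub_iff_add_le]; exact_mod_cast h2
  have h1 : (1 : ℝ) ≤ 2 ^ (p + 1) := one_le_pow₀ (by norm_num)
  gcongr
  linarith

theorem seven_T_le [h : Ok p q] : 7 * T q ≤ Omega p q := by
  have := abs_le_Omega (mem_T (p := p) (q := q) 7 (by norm_num))
  rw [abs_of_pos (by have := T_pos (q := q); positivity)] at this
  exact_mod_cast this

theorem Omega_le : Omega p q ≤ 8 * T q := by
  have := four_T (q := q)
  unfold Omega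
  rw [← this]
  have : (0:ℝ) < 2 ^ (-(p:ℤ)) := by positivity
  have := T_pos (q := q)
  nlinarith

theorem round_eq {r : ℝ} (h : |r| ≤ Omega p q) : round p q r = F r := by
  have h0 : (0:ℝ) < 2 ^ (emax q - p - 1) := by positivity
  rw [abs_le] at h
  unfold round
  rw [if_neg (by linarith), if_neg (by linarith)]; rfl

theorem round_of_mem [Ok p q] {r : ℝ} (h : r ∈ floatSet p q) : round p q r = F r :=
  round_eq (abs_le_Omega h)

theorem add_fin (x y : Flt p q) : XFlt.add (.fin x) (.fin y) = round p q ((x : ℝ) + y) := rfl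
theorem mul_fin (x y : Flt p q) : XFlt.mul (.fin x) (.fin y) = round p q ((x : ℝ) * y) := rfl

theorem add_F' {r s : ℝ} (hr : r ∈ floatSet p q) (hs : s ∈ floatSet p q) :
    XFlt.add (F r) (F s) = round p q (r + s) := by
  rw [F_of_mem hr, F_of_mem hs, add_fin]

theorem mul_F' {r s : ℝ} (hr : r ∈ floatSet p q) (hs : s ∈ floatSet p q) :
    XFlt.mul (F r) (F s) = round p q (r * s) := by
  rw [F_of_mem hr, F_of_mem hs, mul_fin]

theorem add_F {r s : ℝ} (hr : r ∈ floatSet p q) (hs : s ∈ floatSet p q)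
    (h : |r + s| ≤ Omega p q) : XFlt.add (F r : XFlt p q) (F s) = F (r + s) := by
  rw [add_F' hr hs, round_eq h]

theorem mul_F {r s : ℝ} (hr : r ∈ floatSet p q) (hs : s ∈ floatSet p q)
    (h : |r * s| ≤ Omega p q) : XFlt.mul (F r : XFlt p q) (F s) = F (r * s) := by
  rw [mul_F' hr hs, round_eq h]

/-- A sum that is itself a float is exact. -/
theorem add_F_mem [Ok p q] {r s t : ℝ} (hr : r ∈ floatSet p q) (hs : s ∈ floatSet p q)
    (h : r + s = t) (ht : t ∈ floatSet p q) : XFlt.add (F r : XFlt p q) (F s) = F t := by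
  subst h; exact add_F hr hs (abs_le_Omega ht)

/-- A product that is itself a float is exact. -/
theorem mul_F_mem [Ok p q] {r s t : ℝ} (hr : r ∈ floatSet p q) (hs : s ∈ floatSet p q)
    (h : r * s = t) (ht : t ∈ floatSet p q) : XFlt.mul (F r : XFlt p q) (F s) = F t := by
  subst h; exact mul_F hr hs (abs_le_Omega ht)

theorem zero_add_F [Ok p q] (r : ℝ) : XFlt.add (F 0 : XFlt p q) (F r) = F r := by
  rw [← F_rd r]; exact add_F_mem zero_mem (rd_mem r) (zero_add _) (rd_mem r)

theorem add_zero_F [Ok p q] (r : ℝ) : XFlt.add (F r : XFlt p q) (F 0) = F r := by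
  rw [← F_rd r]; exact add_F_mem (rd_mem r) zero_mem (add_zero _) (rd_mem r)

theorem mul_zero_F [Ok p q] (r : ℝ) : XFlt.mul (F r : XFlt p q) (F 0) = F 0 := by
  rw [← F_rd r]; exact mul_F_mem (rd_mem r) zero_mem (mul_zero _) zero_mem

theorem zero_mul_F [Ok p q] (r : ℝ) : XFlt.mul (F 0 : XFlt p q) (F r) = F 0 := by
  rw [← F_rd r]; exact mul_F_mem zero_mem (rd_mem r) (zero_mul _) zero_mem

theorem mul_one_F [h : Ok p q] (r : ℝ) : XFlt.mul (F r : XFlt p q) (F 1) = F r := by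
  have h1 : (1 : ℝ) ∈ floatSet p q := by
    simpa using mem_zpow (p := p) (q := q) 0 (by have := h.emin_eq; have := h.seven_le; omega)
      (by have := h.seven_le; omega)
  rw [← F_rd r]; exact mul_F_mem (rd_mem r) h1 (mul_one _) (rd_mem r)

theorem add_neg_F [Ok p q] (r : ℝ) : XFlt.add (F r : XFlt p q) (F (-r)) = F 0 := by
  rw [← F_rd r, ← F_rd (-r), rd_neg]
  exact add_F_mem (rd_mem r) (neg_mem_floatSet (rd_mem r)) (add_neg_cancel _) zero_mem

/-- Sign reversal of a float. -/
def nx : XFlt p q → XFlt p q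
  | .fin x => .fin (-x)
  | .posInf => .negInf
  | .negInf => .posInf
  | .nan => .nan

theorem nx_F [Ok p q] (r : ℝ) : nx (F r : XFlt p q) = F (-r) := by
  rw [← F_rd (-r), rd_neg, F_of_mem (neg_mem_floatSet (rd_mem r))]; rfl

theorem round_neg [Ok p q] (r : ℝ) : round p q (-r) = nx (round p q r) := by
  have h0 : (0:ℝ) < 2 ^ (emax q - p - 1) := by positivity
  have h1 : 0 ≤ Omega p q := le_trans (by have := T_pos (q := q); positivity) (seven_T_le (p := p))
  unfold round
  split_ifs <;> first | linarith | rfl | skip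
  rw [nearest_neg (okE p q) (Ok.one_le (p := p) (q := q))]; rfl

theorem nx_add [Ok p q] (a b : XFlt p q) : (nx a).add (nx b) = nx (a.add b) := by
  cases a <;> cases b <;> try rfl
  rename_i x y
  change round p q (-(x:ℝ) + -(y:ℝ)) = nx (round p q ((x:ℝ) + y))
  rw [← round_neg]; congr 1; ring

theorem mul_nx_F [Ok p q] (r s : ℝ) :
    XFlt.mul (F r : XFlt p q) (F (-s)) = nx (XFlt.mul (F r) (F s)) := by
  rw [← F_rd r, ← F_rd s, ← F_rd (-s), rd_neg, mul_F' (rd_mem r) (neg_mem_floatSet (rd_mem s)),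
    mul_F' (rd_mem r) (rd_mem s), ← round_neg]
  congr 1; ring

theorem nx_mul_F [Ok p q] (r s : ℝ) :
    XFlt.mul (F (-r) : XFlt p q) (F s) = nx (XFlt.mul (F r) (F s)) := by
  rw [← F_rd r, ← F_rd s, ← F_rd (-r), rd_neg, mul_F' (neg_mem_floatSet (rd_mem r)) (rd_mem s),
    mul_F' (rd_mem r) (rd_mem s), ← round_neg]
  congr 1; ring

theorem mem_canon {x : ℝ} [Ok p q] (hx : x ∈ floatSet p q) :
    ∃ m k : ℤ, x = m * 2 ^ k ∧ |m| < 2 ^ (p + 1) ∧ emin q - p ≤ k ∧ k ≤ emax q - p ∧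
      (2 ^ p ≤ |m| ∨ k = emin q - p) := by
  obtain ⟨n, k, h1, h2, h3, h4, h5⟩ := mem_floatSet.exists_canon (okE p q) hx
  have e : |((n : ℤ))| = n := by simp
  have h2' : ((n : ℤ)) < 2 ^ (p + 1) := by exact_mod_cast h2
  have h5' : (2 ^ p : ℤ) ≤ n ∨ k = emin q - p := by
    rcases h5 with h | h
    · left; exact_mod_cast h
    · exact Or.inr h
  rcases abs_cases x with ⟨h, _⟩ | ⟨h, _⟩
  · exact ⟨n, k, by rw [← h, h1]; simp, by rwa [e], h3, h4, by rwa [e]⟩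
  · refine ⟨-n, k, ?_, by rwa [abs_neg, e], h3, h4, by rwa [abs_neg, e]⟩
    have : x = -|x| := by rw [h]; ring
    rw [this, h1]; push_cast; ring

/-- Scaling by a power of two is exact unless the result is too large or subnormal. -/
theorem mem_scale [Ok p q] {x : ℝ} (hx : x ∈ floatSet p q) (j : ℤ)
    (h : |x * 2 ^ j| ≤ Omega p q) (h' : 0 ≤ j ∨ 2 ^ emin q ≤ |x * 2 ^ j|) :
    x * 2 ^ j ∈ floatSet p q := by
  obtain ⟨m, k, rfl, h2, h3, h4, h5⟩ := mem_canon hx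
  have hm : |(m : ℝ)| < 2 ^ (p + 1) := by exact_mod_cast h2
  have e : (m : ℝ) * 2 ^ k * 2 ^ j = m * 2 ^ (k + j) := by rw [zpow_add₀ (by norm_num)]; ring
  rw [e] at h h' ⊢
  rw [abs_mul, abs_of_pos (by positivity : (0:ℝ) < 2 ^ (k + j))] at h h'
  have hlow : emin q - p ≤ k + j := by
    rcases h' with h' | h'
    · omega
    · by_contra hc
      have h6 : (2:ℝ) ^ (k + j) ≤ 2 ^ (emin q - p - 1) := zpow_le_zpow_right₀ (by norm_num)
        (by omega)
      have h7 : (2:ℝ) ^ emin q = 2 ^ (p + 1) * 2 ^ (emin q - p - 1) := by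
        rw [← zpow_natCast, ← zpow_add₀ (by norm_num)]; congr 1; push_cast; ring
      have h8 : |(m:ℝ)| * 2 ^ (k + j) < 2 ^ (p + 1) * 2 ^ (emin q - p - 1) := by
        calc _ < (2:ℝ) ^ (p + 1) * 2 ^ (k + j) := by gcongr
          _ ≤ _ := by gcongr
      linarith
  by_cases hup : k + j ≤ emax q - p
  · exact mem_int _ _ h2 hlow hup
  · -- the significand absorbs the excess of the exponent
    obtain ⟨i, hi⟩ := Int.le.dest (show emax q - p ≤ k + j by omega)
    have e2 : (m : ℝ) * 2 ^ (k + j) = ((m * 2 ^ i : ℤ) : ℝ) * 2 ^ (emax q - p) := by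
      rw [← hi, zpow_add₀ (by norm_num)]; push_cast; simp; ring
    rw [e2]
    refine mem_int _ _ ?_ (by have := okE p q; omega) le_rfl
    have h6 : |((m * 2 ^ i : ℤ) : ℝ)| * 2 ^ (emax q - p) ≤ (2 ^ (p + 1) - 1) * 2 ^
      (emax q - p) := by
      rw [← Omega_eq]
      refine le_trans (le_of_eq ?_) h
      rw [← abs_of_pos (by positivity : (0:ℝ) < 2 ^ (emax q - p)), ← abs_mul, ← e2, abs_mul,
        abs_of_pos (by positivity : (0:ℝ) < 2 ^ (k + j))]
    have h7 := le_of_mul_le_mul_right h6 (by positivity)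
    have h8 : |m * 2 ^ i| ≤ (2 ^ (p + 1) - 1 : ℤ) := by exact_mod_cast h7
    omega

/-- Every float is an integer multiple of the least positive float. -/
theorem exists_int_eta [Ok p q] {x : ℝ} (hx : x ∈ floatSet p q) : ∃ m : ℤ, x = m * eta p q := by
  obtain ⟨m, k, rfl, h2, h3, h4, h5⟩ := mem_canon hx
  obtain ⟨i, hi⟩ := Int.le.dest h3
  refine ⟨m * 2 ^ i, ?_⟩
  unfold eta
  rw [← hi, zpow_add₀ (by norm_num)]; push_cast; simp; ring

theorem mem_eta [Ok p q] (m : ℤ) (hm : |m| < 2 ^ (p + 1)) : (m : ℝ) * eta p q ∈ floatSet p q :=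
  mem_int m _ hm le_rfl (by have := okE p q; omega)

theorem eta_mem [Ok p q] : eta p q ∈ floatSet p q :=
  mem_zpow _ le_rfl (by have := okE p q; omega)

theorem eta_le_abs [Ok p q] {x : ℝ} (hx : x ∈ floatSet p q) (h0 : x ≠ 0) : eta p q ≤ |x| := by
  obtain ⟨m, rfl⟩ := exists_int_eta hx
  have : m ≠ 0 := by rintro rfl; simp at h0
  have : (1:ℝ) ≤ |(m:ℝ)| := by exact_mod_cast Int.one_le_abs this
  rw [abs_mul, abs_of_pos eta_pos]
  have := eta_pos (p := p) (q := q)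
  nlinarith

theorem rd_eq_of_close [Ok p q] {r y : ℝ} (hy : y ∈ floatSet p q) (h : |r - y| < eta p q / 2) :
    rd p q r = y := by
  have h1 := abs_rd_sub_le (p := p) (q := q) r hy
  obtain ⟨m, hm⟩ := exists_int_eta (rd_mem (p := p) (q := q) r)
  obtain ⟨n, rfl⟩ := exists_int_eta hy
  rw [hm] at h1 ⊢
  have h2 : |(m:ℝ) * eta p q - n * eta p q| < eta p q := by
    have : (m:ℝ) * eta p q - n * eta p q = (r - n * eta p q) - (r - m * eta p q) := by ring
    rw [this]
    have := abs_sub (r - n * eta p q) (r - m * eta p q)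
    linarith
  rw [← sub_mul, abs_mul, abs_of_pos eta_pos] at h2
  have h3 : |((m:ℝ) - n)| < 1 := by
    have := eta_pos (p := p) (q := q)
    by_contra hc; push Not at hc; nlinarith
  have h4 : |m - n| < 1 := by exact_mod_cast h3
  rw [Int.abs_lt_one_iff] at h4
  rw [show m = n by omega]

/-- In the subnormal range the floats are equally spaced. -/
theorem abs_rd_sub_le_half [h : Ok p q] {r : ℝ} (hr : |r| ≤ 2 ^ emin q) :
    |rd p q r - r| ≤ eta p q / 2 := by
  have he := eta_pos (p := p) (q := q)
  set m := _root_.round (r / eta p q)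
  have h1 : |r / eta p q - m| ≤ 1 / 2 := abs_sub_round _
  have h2 : |r - m * eta p q| ≤ eta p q / 2 := by
    have : r - m * eta p q = (r / eta p q - m) * eta p q := by field_simp
    rw [this, abs_mul, abs_of_pos he]; nlinarith
  have h3 : (2:ℝ) ^ emin q = 2 ^ p * eta p q := by
    unfold eta; rw [zpow_sub₀ (by norm_num)]; simp; field_simp
  have hm : (m : ℝ) * eta p q ∈ floatSet p q := by
    apply mem_eta
    have h4 : |(m:ℝ)| * eta p q ≤ (2 ^ p + 1 / 2) * eta p q := by
      have : (m:ℝ) * eta p q = r - (r - m * eta p q) := by ring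
      rw [← abs_of_pos he, ← abs_mul, this, abs_of_pos he]
      have := abs_sub r (r - m * eta p q)
      linarith
    have h5 := le_of_mul_le_mul_right h4 he
    have h6 : (2:ℝ) ^ p + 1 / 2 < 2 ^ (p + 1) := by
      have : (1:ℝ) ≤ 2 ^ p := one_le_pow₀ (by norm_num)
      rw [pow_succ]; linarith
    have h7 := lt_of_le_of_lt h5 h6
    exact_mod_cast h7
  rw [abs_sub_comm]
  exact (abs_rd_sub_le r hm).trans h2

/-- Scaling a float by a power of two changes it by at most half the least float. -/
theorem abs_rd_scale_sub_le [Ok p q] {x : ℝ} (hx : x ∈ floatSet p q) (j : ℤ)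
    (h : |x * 2 ^ j| ≤ Omega p q) : |rd p q (x * 2 ^ j) - x * 2 ^ j| ≤ eta p q / 2 := by
  by_cases hc : 2 ^ emin q ≤ |x * 2 ^ j|
  · rw [rd_of_mem (mem_scale hx j h (Or.inr hc))]
    rw [sub_self, abs_zero]; exact (half_pos eta_pos).le
  · exact abs_rd_sub_le_half (by linarith)

/-- A power of two absorbs every term of size at most half of the gap below it. -/
theorem rd_absorb [h : Ok p q] {e : ℤ} (he : emin q ≤ e) (he' : e ≤ emax q) {t : ℝ}
    (ht : |t| ≤ 2 ^ (e - p - 2)) : rd p q (2 ^ e + t) = 2 ^ e := by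
  have hmem := mem_zpow (p := p) (q := q) e (by omega) he'
  have hc : Canon p q (2 ^ e) (2 ^ p) (e - p) := by
    refine ⟨?_, Nat.pow_lt_pow_right (by norm_num) (by omega), by omega, by omega, Or.inl le_rfl⟩
    rw [zpow_sub₀ (by norm_num)]; simp; field_simp
  have e1 : (2:ℝ) ^ (e - p - 1) = 2 * 2 ^ (e - p - 2) := by
    rw [show e - p - 1 = (e - p - 2) + 1 by ring, zpow_add₀ (by norm_num)]; simp; ring
  have e0 : (2:ℝ) ^ (e - p) = 4 * 2 ^ (e - p - 2) := by
    rw [show e - p = (e - p - 2) + 2 by ring, zpow_add₀ (by norm_num)]; simp; ring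
  have gap : ∀ z ∈ floatSet p q, z ≠ 2 ^ e → 2 ^ (e - p - 1) ≤ |z - 2 ^ e| := by
    intro z hz hne
    rcases lt_or_gt_of_ne hne with hlt | hgt
    · rw [abs_of_neg (by linarith)]
      by_cases h0 : z ≤ 0
      · have : (2:ℝ) ^ (e - p - 1) ≤ 2 ^ e := zpow_le_zpow_right₀ (by norm_num) (by omega)
        linarith
      · push Not at h0
        obtain ⟨n', k', hc'⟩ := mem_floatSet.exists_canon (okE p q) hz
        rw [abs_of_pos h0] at hc'
        have h1 := (hc'.add_le hc hlt).2
        by_cases hk : e - p - 1 ≤ k'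
        · have : (2:ℝ) ^ (e - p - 1) ≤ 2 ^ k' := zpow_le_zpow_right₀ (by norm_num) hk
          linarith
        · have h2 : z ≤ 2 ^ (e - 1) := by
            rw [hc'.1]
            have : (n' : ℝ) ≤ 2 ^ (p + 1) := by exact_mod_cast hc'.2.1.le
            calc (n' : ℝ) * 2 ^ k' ≤ 2 ^ (p + 1) * 2 ^ (e - p - 2) := by
                  gcongr
                  · norm_num
                  · omega
              _ = 2 ^ (e - 1) := by
                  rw [← zpow_natCast, ← zpow_add₀ (by norm_num)]; congr 1; push_cast; ring
          have h3 : (2:ℝ) ^ (e - p - 1) ≤ 2 ^ (e - 1) := zpow_le_zpow_right₀ (by norm_num)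
            (by omega)
          have h4 : (2:ℝ) ^ e = 2 * 2 ^ (e - 1) := by
            rw [show e = (e - 1) + 1 by ring, zpow_add₀ (by norm_num)]; simp; ring
          linarith
    · rw [abs_of_pos (by linarith)]
      obtain ⟨n', k', hc'⟩ := mem_floatSet.exists_canon (okE p q) hz
      rw [abs_of_pos (lt_trans (by positivity) hgt)] at hc'
      have h1 := (hc.add_le hc' hgt).2
      linarith
  have hn : IsNearest (2 ^ e + t) (⟨2 ^ e, hmem⟩ : Flt p q) := by
    intro z
    simp only [add_sub_cancel_left]
    by_cases hz : (z : ℝ) = 2 ^ e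
    · rw [hz]; simp
    · have h1 := gap z z.2 hz
      have h2 : |(z:ℝ) - 2 ^ e| ≤ |2 ^ e + t - z| + |t| := by
        have : (z:ℝ) - 2 ^ e = -(2 ^ e + t - z) + t := by ring
        rw [this]
        exact (abs_add_le _ _).trans (by rw [abs_neg])
      linarith
  unfold rd
  rw [nearest_eq_of_even (okE p q) h.one_le hn
    (hc.hasRep h.one_le (Nat.even_pow.2 ⟨even_two, by have := h.two_le; omega⟩))]

theorem rd_absorb_neg [h : Ok p q] {e : ℤ} (he : emin q ≤ e) (he' : e ≤ emax q) {t : ℝ}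
    (ht : |t| ≤ 2 ^ (e - p - 2)) : rd p q (-2 ^ e + t) = -2 ^ e := by
  have := rd_absorb (p := p) he he' (t := -t) (by rwa [abs_neg])
  rw [show -(2:ℝ) ^ e + t = -(2 ^ e + -t) by ring, rd_neg, this]

/-! ### One-sided bounds that allow an infinite value -/

/-- `z` is `-∞` or a finite float that is at most `r`. -/
def LeX (z : XFlt p q) (r : ℝ) : Prop := z = .negInf ∨ ∃ x ∈ floatSet p q, z = F x ∧ x ≤ r

/-- `z` is `+∞` or a finite float that is at least `r`. -/
def GeX (z : XFlt p q) (r : ℝ) : Prop := z = .posInf ∨ ∃ x ∈ floatSet p q, z = F x ∧ r ≤ x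

theorem LeX.mono {z : XFlt p q} {r s : ℝ} (h : LeX z r) (hrs : r ≤ s) : LeX z s := by
  rcases h with h | ⟨x, hx, h, h'⟩
  · exact Or.inl h
  · exact Or.inr ⟨x, hx, h, h'.trans hrs⟩

theorem leX_F {r s : ℝ} (hr : r ∈ floatSet p q) (h : r ≤ s) : LeX (F r : XFlt p q) s :=
  Or.inr ⟨r, hr, rfl, h⟩

theorem geX_F {r s : ℝ} (hr : r ∈ floatSet p q) (h : s ≤ r) : GeX (F r : XFlt p q) s :=
  Or.inr ⟨r, hr, rfl, h⟩

theorem round_leX [Ok p q] {r s : ℝ} (h : r ≤ s) (hs : s ∈ floatSet p q) : LeX (round p q r) s := by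
  have h0 : (0:ℝ) < 2 ^ (emax q - p - 1) := by positivity
  have := (abs_le.1 (abs_le_Omega hs)).2
  unfold round
  rw [if_neg (by linarith)]
  split_ifs
  · exact Or.inl rfl
  · exact Or.inr ⟨rd p q r, rd_mem r, (F_rd r).symm, rd_le h hs⟩

theorem round_geX [Ok p q] {r s : ℝ} (h : s ≤ r) (hs : s ∈ floatSet p q) : GeX (round p q r) s := by
  have h0 : (0:ℝ) < 2 ^ (emax q - p - 1) := by positivity
  have := (abs_le.1 (abs_le_Omega hs)).1
  unfold round
  split_ifs
  · exact Or.inl rfl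
  · linarith
  · exact Or.inr ⟨rd p q r, rd_mem r, (F_rd r).symm, le_rd h hs⟩

theorem LeX.add [Ok p q] {z : XFlt p q} {r t s : ℝ} (h : LeX z r) (ht : t ∈ floatSet p q)
    (hs : s ∈ floatSet p q) (hle : r + t ≤ s) : LeX (z.add (F t)) s := by
  rcases h with rfl | ⟨x, hx, rfl, h'⟩
  · rw [F_of_mem ht]; exact Or.inl rfl
  · rw [add_F' hx ht]; exact round_leX (by linarith) hs

theorem GeX.add [Ok p q] {z : XFlt p q} {r t s : ℝ} (h : GeX z r) (ht : t ∈ floatSet p q)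
    (hs : s ∈ floatSet p q) (hle : s ≤ r + t) : GeX (z.add (F t)) s := by
  rcases h with rfl | ⟨x, hx, rfl, h'⟩
  · rw [F_of_mem ht]; exact Or.inl rfl
  · rw [add_F' hx ht]; exact round_geX (by linarith) hs

/-- Adding `t` does not lift a bound `r` if `r ⊕ t` rounds to at most `s`. -/
theorem LeX.add_rd [Ok p q] {z : XFlt p q} {r t s : ℝ} (h : LeX z r) (ht : t ∈ floatSet p q)
    (hr : r + t ≤ Omega p q) (hle : rd p q (r + t) ≤ s) : LeX (z.add (F t)) s := by
  rcases h with rfl | ⟨x, hx, rfl, h'⟩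
  · rw [F_of_mem ht]; exact Or.inl rfl
  · rw [add_F' hx ht]
    rcases round_leX (p := p) (q := q) (r := x + t) (s := Omega p q) (by linarith) Omega_mem with
      h | ⟨y, hy, h, _⟩
    · exact Or.inl h
    · refine Or.inr ⟨y, hy, h, ?_⟩
      have h0 : (0:ℝ) < 2 ^ (emax q - p - 1) := by positivity
      unfold round at h
      rw [if_neg (by linarith)] at h
      split_ifs at h
      · rw [F_of_mem hy] at h; cases h
      · have h3 : rd p q (x + t) = y := by
          rw [F_of_mem hy] at h; injection h with h; exact congrArg Subtype.val h
        rw [← h3]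
        exact (rd_mono (by linarith)).trans hle

/-! ### Left-to-right sums over lists -/

/-- Left-to-right sum of the floats `f a`, `a ∈ l`, starting from `z`. -/
noncomputable def lsum {α : Type*} (z : XFlt p q) (l : List α) (f : α → XFlt p q) : XFlt p q :=
  l.foldl (fun s a => s.add (f a)) z

section
variable {α β : Type*}

@[simp] theorem lsum_nil (z : XFlt p q) (f : α → XFlt p q) : lsum z [] f = z := rfl
@[simp] theorem lsum_cons (z : XFlt p q) (a : α) (l : List α) (f : α → XFlt p q) :
    lsum z (a :: l) f = lsum (z.add (f a)) l f := rfl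
theorem lsum_append (z : XFlt p q) (l l' : List α) (f : α → XFlt p q) :
    lsum z (l ++ l') f = lsum (lsum z l f) l' f := List.foldl_append

theorem lsum_map (z : XFlt p q) (l : List α) (g : α → β) (f : β → XFlt p q) :
    lsum z (l.map g) f = lsum z l fun a => f (g a) := by
  simp [lsum, List.foldl_map]

theorem lsum_congr {z : XFlt p q} {l : List α} {f g : α → XFlt p q} (h : ∀ a ∈ l, f a = g a) :
    lsum z l f = lsum z l g := by
  induction l generalizing z with
  | nil => rfl
  | cons a l ih =>
    rw [lsum_cons, lsum_cons, h a (by simp)]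
    exact ih fun b hb => h b (by simp [hb])

/-- Blocks that do not change the partial sum may be skipped. -/
theorem lsum_flatMap_id {z : XFlt p q} {l : List α} {g : α → List β} {f : β → XFlt p q}
    (h : ∀ a ∈ l, lsum z (g a) f = z) : lsum z (l.flatMap g) f = z := by
  induction l with
  | nil => rfl
  | cons a l ih =>
    rw [List.flatMap_cons, lsum_append, h a (by simp)]
    exact ih fun b hb => h b (by simp [hb])

theorem lsum_id {z : XFlt p q} {l : List α} {f : α → XFlt p q}
    (h : ∀ a ∈ l, z.add (f a) = z) : lsum z l f = z := by
  induction l with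
  | nil => rfl
  | cons a l ih => rw [lsum_cons, h a (by simp)]; exact ih fun b hb => h b (by simp [hb])

theorem lsum_zero [Ok p q] {z : ℝ} {l : List α} {f : α → XFlt p q}
    (h : ∀ a ∈ l, f a = F 0) : lsum (F z) l f = F z :=
  lsum_id fun a ha => by rw [h a ha, add_zero_F]

/-- If each block contributes like the single term `g a`, the sum is a sum over the `g a`. -/
theorem lsum_flatMap_eq {P : XFlt p q → Prop} {z : XFlt p q} {l : List α} {g : α → List β}
    {f : β → XFlt p q} {t : α → XFlt p q} (hz : P z)
    (hP : ∀ a ∈ l, ∀ z, P z → P (z.add (t a)))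
    (h : ∀ a ∈ l, ∀ z, P z → lsum z (g a) f = z.add (t a)) :
    lsum z (l.flatMap g) f = lsum z l t := by
  induction l generalizing z with
  | nil => rfl
  | cons a l ih =>
    rw [List.flatMap_cons, lsum_append, h a (by simp) z hz, lsum_cons]
    exact ih (hP a (by simp) z hz) (fun b hb => hP b (by simp [hb])) fun b hb => h b (by simp [hb])

/-- A sum with at most one nonzero term. -/
theorem lsum_single [Ok p q] {l : List α} (hl : l.Nodup) {a : α} (ha : a ∈ l) {f : α → XFlt p q}
    {z r : ℝ} (h : (F z).add (f a) = F r)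
    (h0 : ∀ b ∈ l, b ≠ a → f b = F 0) : lsum (F z) l f = F r := by
  induction l with
  | nil => simp at ha
  | cons b l ih =>
    rw [List.nodup_cons] at hl
    rw [lsum_cons]
    by_cases hb : b = a
    · subst hb
      rw [h]
      exact lsum_zero fun c hc => h0 c (by simp [hc]) (by rintro rfl; exact hl.1 hc)
    · rw [h0 b (by simp) hb, add_zero_F]
      refine ih hl.2 (by simpa [Ne.symm hb] using ha) fun c hc => h0 c (by simp [hc])

theorem lsum_nx [Ok p q] (z : XFlt p q) (l : List α) (f : α → XFlt p q) :
    lsum (nx z) l (fun a => nx (f a)) = nx (lsum z l f) := by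
  induction l generalizing z with
  | nil => rfl
  | cons a l ih => rw [lsum_cons, lsum_cons, nx_add, ih]

theorem xsum_eq_lsum (n : ℕ) (v : Fin n → XFlt p q) :
    XFlt.sum n v = lsum (F 0) (List.ofFn v) id := by
  induction n with
  | zero => simp [XFlt.sum, F_zero]
  | succ n ih =>
    rw [XFlt.sum, ih, List.ofFn_succ', List.concat_eq_append, lsum_append]
    rfl

theorem xsum_comp {n : ℕ} (e : Fin n → α) (f : α → XFlt p q) :
    XFlt.sum n (fun i => f (e i)) = lsum (F 0) (List.ofFn e) f := by
  rw [xsum_eq_lsum, show (fun i => f (e i)) = f ∘ e from rfl, ← List.map_ofFn, lsum_map]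
  rfl

end

/-! ### Networks assembled layer by layer, from the output to the input -/

section
variable {ι α α' : Type*} {σ σ' : XFlt p q → XFlt p q} {fs y : ι → ℝ} {n m : ℕ}

/-- There is a network with `n` affine maps which, when its input vector is `v (e k) i`, has the
output `fs i`, and which turns the output gradient `y i` into the gradient `γ (e k) i`. The index
`i : ι` runs over all situations that the network has to handle, and `e` names the neurons of the
layer below the network. -/
def Tail (σ σ' : XFlt p q → XFlt p q) (fs y : ι → ℝ) (n : ℕ) (e : Fin m → α) (v γ : α → ι → ℝ) :
    Prop :=
  ∃ N : Net p q n m 1, ∀ i,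
    N.eval σ (fun k => F (v (e k) i)) = (fun _ => F (fs i)) ∧
    N.grad σ σ' (fun k => F (v (e k) i)) (fun _ => F (y i)) = fun k => F (γ (e k) i)

/-- `Tail` for a layer whose neurons are given by a list. -/
def LTail (σ σ' : XFlt p q → XFlt p q) (fs y : ι → ℝ) (n : ℕ) (l : List α) (v γ : α → ι → ℝ) :
    Prop := Tail σ σ' fs y n l.get v γ

/-- The product with the diagonal matrix of the derivatives is coordinatewise, because `0 ⊗ g` and
`0 ⊕ g` are exact for finite floats. -/
theorem gradAct_eq [Ok p q] {y : Fin n → XFlt p q} {g d δ : Fin n → ℝ}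
    (hd : ∀ k, σ' (y k) = F (d k)) (hδ : ∀ k, XFlt.mul (F (g k) : XFlt p q) (F (d k)) = F (δ k)) :
    gradAct σ' y (fun k => F (g k)) = fun k => F (δ k) := by
  funext j
  unfold gradAct XFlt.vecMul
  have := xsum_comp (id : Fin n → Fin n)
    (fun i => XFlt.mul (F (g i)) (XFlt.diag (fun i => σ' (y i)) i j))
  rw [List.ofFn_id] at this
  refine this.trans (lsum_single (List.nodup_finRange n) (List.mem_finRange j) ?_ ?_)
  · simp only [XFlt.diag, if_true, hd, hδ]
    rw [zero_add_F]
  · intro b _ hb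
    simp only [XFlt.diag, if_neg hb]
    rw [← F_zero, mul_zero_F]

/-- A layer is put below a network. The new layer `l` has pre-activations `z`, values `v` and
derivatives `d`, and the gradient `γ` at its output becomes `δ` behind the activation; below it are
the neurons `e` with values `v'`, which receive the gradients `γ'`. -/
theorem Tail.step [Ok p q] {l : List α} (hl : l ≠ []) {e : Fin m → α'} {v γ : α → ι → ℝ}
    {v' γ' : α' → ι → ℝ} (h : LTail σ σ' fs y n l v γ) (A : α → α' → ℝ) (b : α → ℝ)
    (z : α → ι → XFlt p q) (d δ : α → ι → ℝ)
    (hz : ∀ i, ∀ a ∈ l,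
      (lsum (F 0) (List.ofFn e) fun a' => XFlt.mul (F (A a a')) (F (v' a' i))).add (F (b a)) = z a
        i)
    (hv : ∀ i, ∀ a ∈ l, σ (z a i) = F (v a i)) (hd : ∀ i, ∀ a ∈ l, σ' (z a i) = F (d a i))
    (hδ : ∀ i, ∀ a ∈ l, XFlt.mul (F (γ a i) : XFlt p q) (F (d a i)) = F (δ a i))
    (hγ : ∀ i, ∀ a' ∈ List.ofFn e,
      (lsum (F 0) l fun a => XFlt.mul (F (δ a i) : XFlt p q) (F (A a a'))) = F (γ' a' i)) :
    Tail σ σ' fs y (n + 1) e v' γ' := by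
  obtain ⟨N, hN⟩ := h
  refine ⟨.cons (List.length_pos_iff.2 hl) (fun i j => nearest p q (A (l.get i) (e j)))
    (fun i => nearest p q (b (l.get i))) N, fun i => ?_⟩
  have haff : affine (fun i j => nearest p q (A (l.get i) (e j)))
    (fun i => nearest p q (b (l.get i)))
      (fun k => F (v' (e k) i)) = fun k => z (l.get k) i := by
    funext k
    rw [← hz i _ (List.get_mem l k), ← xsum_comp e
      (fun a' => XFlt.mul (F (A (l.get k) a')) (F (v' a' i)))]
    rfl
  have hσ : (fun k => σ (z (l.get k) i)) = fun k => F (v (l.get k) i) :=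
    funext fun k => hv i _ (List.get_mem l k)
  constructor
  · rw [Net.eval, haff, hσ]; exact (hN i).1
  · rw [Net.grad, haff, hσ, (hN i).2,
      gradAct_eq (d := fun k => d (l.get k) i) (δ := fun k => δ (l.get k) i)
        (fun k => hd i _ (List.get_mem l k)) (fun k => hδ i _ (List.get_mem l k))]
    funext j
    rw [← hγ i (e j) (List.mem_ofFn.2 ⟨j, rfl⟩)]
    unfold gradAffine XFlt.vecMul
    have := xsum_comp (p := p) (q := q) l.get (fun a => XFlt.mul (F (δ a i)) (F (A a (e j))))
    rw [List.ofFn_get] at this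
    rw [← this]; rfl

theorem LTail.step [Ok p q] {l : List α} (hl : l ≠ []) {l' : List α'} {v γ : α → ι → ℝ}
    {v' γ' : α' → ι → ℝ} (h : LTail σ σ' fs y n l v γ) (A : α → α' → ℝ) (b : α → ℝ)
    (z : α → ι → XFlt p q) (d δ : α → ι → ℝ)
    (hz : ∀ i, ∀ a ∈ l,
      (lsum (F 0) l' fun a' => XFlt.mul (F (A a a')) (F (v' a' i))).add (F (b a)) = z a i)
    (hv : ∀ i, ∀ a ∈ l, σ (z a i) = F (v a i)) (hd : ∀ i, ∀ a ∈ l, σ' (z a i) = F (d a i))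
    (hδ : ∀ i, ∀ a ∈ l, XFlt.mul (F (γ a i) : XFlt p q) (F (d a i)) = F (δ a i))
    (hγ : ∀ i, ∀ a' ∈ l',
      (lsum (F 0) l fun a => XFlt.mul (F (δ a i) : XFlt p q) (F (A a a'))) = F (γ' a' i)) :
    LTail σ σ' fs y (n + 1) l' v' γ' :=
  Tail.step hl h A b z d δ (by rwa [List.ofFn_get]) hv hd hδ (by rwa [List.ofFn_get])

/-- A network that consists of the output layer only. -/
theorem LTail.last {l : List α} {v γ : α → ι → ℝ} (A : α → ℝ)
    (hf : ∀ i, (lsum (F 0) l fun a => XFlt.mul (F (A a)) (F (v a i))).add (F 0 : XFlt p q) = F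
      (fs i))
    (hγ : ∀ i, ∀ a ∈ l, (F 0 : XFlt p q).add (XFlt.mul (F (y i)) (F (A a))) = F (γ a i)) :
    LTail σ σ' fs y 1 l v γ := by
  refine ⟨.last (fun _ j => nearest p q (A (l.get j))) (fun _ => nearest p q 0), fun i => ⟨?_, ?_⟩⟩
  · funext k
    rw [← hf i]
    have := xsum_comp (p := p) (q := q) l.get (fun a => XFlt.mul (F (A a)) (F (v a i)))
    rw [List.ofFn_get] at this
    rw [← this]; rfl
  · funext k
    rw [← hγ i _ (List.get_mem l k), F_zero]; rfl

end

/-! ### Layers with specified values and gradients, and their parallel composition -/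

theorem add_zero_X [Ok p q] (z : XFlt p q) : z.add (F 0) = z := by
  rw [F_zero]
  cases z with
  | fin x => rw [← F_coe x, ← F_zero, add_zero_F]
  | posInf => rfl
  | negInf => rfl
  | nan => rfl

theorem zero_add_X [Ok p q] (z : XFlt p q) : (F 0 : XFlt p q).add z = z := by
  rw [F_zero]
  cases z with
  | fin x => rw [← F_coe x, ← F_zero, zero_add_F]
  | posInf => rfl
  | negInf => rfl
  | nan => rfl

section
variable {α β : Type*}

theorem lsum_zero_X [Ok p q] {z : XFlt p q} {l : List α} {f : α → XFlt p q}
    (h : ∀ a ∈ l, f a = F 0) : lsum z l f = z :=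
  lsum_id fun a ha => by rw [h a ha, add_zero_X]

/-- Terms outside a sublist may be dropped if they vanish. -/
theorem lsum_sublist [Ok p q] {z : XFlt p q} {s l : List α} (hs : s.Sublist l) (hl : l.Nodup)
    {f : α → XFlt p q} (h : ∀ a ∈ l, a ∉ s → f a = F 0) : lsum z l f = lsum z s f := by
  induction hs generalizing z with
  | slnil => rfl
  | @cons s l a hs ih =>
    rw [List.nodup_cons] at hl
    rw [lsum_cons, h a (by simp) (fun ha => hl.1 (hs.subset ha)), add_zero_X]
    exact ih hl.2 fun b hb => h b (by simp [hb])
  | @cons_cons s l a hs ih =>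
    rw [List.nodup_cons] at hl
    rw [lsum_cons, lsum_cons]
    refine ih hl.2 fun b hb hbs => h b (by simp [hb]) ?_
    simp only [List.mem_cons, not_or]
    exact ⟨by rintro rfl; exact hl.1 hb, hbs⟩

/-- In a sum over disjoint blocks, only the block `k` counts if the other ones vanish. -/
theorem lsum_block [Ok p q] {z : XFlt p q} {K : List α} (hK : K.Nodup) {k : α} (hk : k ∈ K)
    {g : α → List β} {f : β → XFlt p q} (h : ∀ k' ∈ K, k' ≠ k → ∀ b ∈ g k', f b = F 0) :
    lsum z (K.flatMap g) f = lsum z (g k) f := by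
  induction K with
  | nil => simp at hk
  | cons c K ih =>
    rw [List.nodup_cons] at hK
    rw [List.flatMap_cons, lsum_append]
    by_cases hc : c = k
    · subst hc
      exact lsum_flatMap_id fun a ha => lsum_zero_X
        (h a (by simp [ha]) (by rintro rfl; exact hK.1 ha))
    · rw [lsum_zero_X (h c (by simp) hc)]
      exact ih hK.2 (by simpa [Ne.symm hc] using hk) fun a ha => h a (by simp [ha])

end

section
variable {ι : Type} {σ σ' : XFlt p q → XFlt p q} {fs y : ι → ℝ}

/-- The specification of an activation layer: its neurons in their order, a condition on their
values after the activation, and their gradients, in each situation `i : ι`. -/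
structure Layer (ι : Type) where
  /-- names of neurons -/
  N : Type
  /-- the neurons of the layer -/
  l : List N
  /-- what the layers above rely on, when a neuron has a given value -/
  ok : ι → N → ℝ → Prop
  /-- the gradient that arrives at a neuron from above -/
  γ : ι → N → ℝ

/-- A neuron with pre-activation `z` has a value that satisfies `ok`, and turns the gradient `γ`
into `δ`. -/
def Fires (σ σ' : XFlt p q → XFlt p q) (z : XFlt p q) (ok : ℝ → Prop) (γ δ : ℝ) : Prop :=
  ∃ v d, ok v ∧ σ z = F v ∧ σ' z = F d ∧ XFlt.mul (F γ) (F d) = (F δ : XFlt p q)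

/-- Some affine map leads from the layer `D` to the layer `U` above it. -/
def Link (σ σ' : XFlt p q → XFlt p q) (U D : Layer ι) : Prop :=
  ∃ (A : U.N → D.N → ℝ) (b : U.N → ℝ) (δ : ι → U.N → ℝ),
    (∀ i (v : D.N → ℝ), (∀ a ∈ D.l, D.ok i a (v a)) → ∀ a ∈ U.l,
      Fires σ σ' ((lsum (F 0) D.l fun a' => XFlt.mul (F (A a a')) (F (v a'))).add (F (b a)))
        (U.ok i a) (U.γ i a) (δ i a)) ∧
    ∀ i, ∀ a' ∈ D.l, lsum (F 0) U.l (fun a => XFlt.mul (F (δ i a)) (F (A a a'))) =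
      (F (D.γ i a') : XFlt p q)

/-- `n` affine maps lead from the layer `D` up to the layer `U`. -/
def Chain (σ σ' : XFlt p q → XFlt p q) : ℕ → Layer ι → Layer ι → Prop
  | 0, U, D => U = D
  | n + 1, U, D => ∃ M, Chain σ σ' n U M ∧ Link σ σ' M D

theorem Link.chain {U D : Layer ι} (h : Link σ σ' U D) : Chain σ σ' 1 U D := ⟨U, rfl, h⟩

theorem Chain.trans {m n : ℕ} {U M D : Layer ι} (h : Chain σ σ' m U M) (h' : Chain σ σ' n M D) :
    Chain σ σ' (m + n) U D := by
  induction n generalizing D with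
  | zero => cases h'; exact h
  | succ n ih =>
    obtain ⟨M', h1, h2⟩ := h'
    exact ⟨M', ih h1, h2⟩

/-- Two layers side by side. -/
abbrev Layer.sum (U V : Layer ι) : Layer ι where
  N := U.N ⊕ V.N
  l := U.l.map Sum.inl ++ V.l.map Sum.inr
  ok i := Sum.elim (U.ok i) (V.ok i)
  γ i := Sum.elim (U.γ i) (V.γ i)

/-- A family of layers side by side. -/
abbrev Layer.fam {κ : Type} (K : List κ) (U : κ → Layer ι) : Layer ι where
  N := Σ k, (U k).N
  l := K.flatMap fun k => (U k).l.map (Sigma.mk k)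
  ok i a := (U a.1).ok i a.2
  γ i a := (U a.1).γ i a.2

theorem Layer.mem_sum_inl {U V : Layer ι} {a : U.N} : Sum.inl a ∈ (U.sum V).l ↔ a ∈ U.l := by
  change Sum.inl a ∈ U.l.map Sum.inl ++ V.l.map Sum.inr ↔ _
  simp

theorem Layer.mem_sum_inr {U V : Layer ι} {a : V.N} : Sum.inr a ∈ (U.sum V).l ↔ a ∈ V.l := by
  change Sum.inr a ∈ U.l.map Sum.inl ++ V.l.map Sum.inr ↔ _
  simp

theorem Layer.lsum_sum (U V : Layer ι) (z : XFlt p q) (f : U.N ⊕ V.N → XFlt p q) :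
    lsum z (U.sum V).l f = lsum (lsum z U.l fun a => f (.inl a)) V.l fun a => f (.inr a) := by
  change lsum z (U.l.map Sum.inl ++ V.l.map Sum.inr) f = _
  rw [lsum_append, lsum_map, lsum_map]

theorem Layer.mem_fam {κ : Type} {K : List κ} {U : κ → Layer ι} {k : κ} {a : (U k).N} :
    (⟨k, a⟩ : Σ k, (U k).N) ∈ (Layer.fam K U).l ↔ k ∈ K ∧ a ∈ (U k).l := by
  change (⟨k, a⟩ : Σ k, (U k).N) ∈ K.flatMap (fun k => (U k).l.map (Sigma.mk k)) ↔ _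
  simp only [List.mem_flatMap, List.mem_map]
  constructor
  · rintro ⟨k', hk', a', ha', e⟩
    cases e
    exact ⟨hk', ha'⟩
  · rintro ⟨hk, ha⟩; exact ⟨k, hk, a, ha, rfl⟩

theorem Layer.lsum_fam {κ : Type} {K : List κ} {U : κ → Layer ι} {P : XFlt p q → Prop}
    {z : XFlt p q} {f : (Σ k, (U k).N) → XFlt p q} {t : κ → XFlt p q} (hz : P z)
    (hP : ∀ k ∈ K, ∀ z, P z → P (z.add (t k)))
    (h : ∀ k ∈ K, ∀ z, P z → lsum z (U k).l (fun a => f ⟨k, a⟩) = z.add (t k)) :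
    lsum z (Layer.fam K U).l f = lsum z K t := by
  change lsum z (K.flatMap fun k => (U k).l.map (Sigma.mk k)) f = _
  exact lsum_flatMap_eq hz hP fun k hk z hz => (lsum_map _ _ _ _).trans (h k hk z hz)

theorem Layer.lsum_fam_block [Ok p q] {κ : Type} {K : List κ} (hK : K.Nodup) {U : κ → Layer ι}
    {k : κ} (hk : k ∈ K) {z : XFlt p q} {f : (Σ k, (U k).N) → XFlt p q}
    (h : ∀ k', k' ≠ k → ∀ a, f ⟨k', a⟩ = F 0) :
    lsum z (Layer.fam K U).l f = lsum z (U k).l fun a => f ⟨k, a⟩ := by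
  change lsum z (K.flatMap fun k => (U k).l.map (Sigma.mk k)) f = _
  rw [lsum_block hK hk, lsum_map]
  intro k' _ hne b hb
  obtain ⟨c, _, rfl⟩ := List.mem_map.1 hb
  exact h k' hne c

/-- Parallel composition: the matrix is block diagonal, and exact additions of zero do not disturb
the sums. -/
theorem Link.sum [Ok p q] {U V U' V' : Layer ι} (h : Link σ σ' U U') (h' : Link σ σ' V V') :
    Link σ σ' (U.sum V) (U'.sum V') := by
  obtain ⟨A, b, δ, h1, h2⟩ := h
  obtain ⟨A', b', δ', h1', h2'⟩ := h'
  refine ⟨Sum.elim (fun a => Sum.elim (A a) fun _ => 0) (fun a => Sum.elim (fun _ => 0) (A' a)),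
    Sum.elim b b', fun i => Sum.elim (δ i) (δ' i), ?_, ?_⟩
  · rintro i v hv (a | a) ha
    · rw [Layer.lsum_sum]
      simp only [Sum.elim_inl, Sum.elim_inr]
      rw [lsum_zero_X (l := V'.l) (fun a _ => zero_mul_F _)]
      exact h1 i (fun a => v (.inl a)) (fun a ha => hv (.inl a) (Layer.mem_sum_inl.2 ha)) a
        (Layer.mem_sum_inl.1 ha)
    · rw [Layer.lsum_sum]
      simp only [Sum.elim_inl, Sum.elim_inr]
      rw [lsum_zero_X (l := U'.l) (fun a _ => zero_mul_F _)]
      exact h1' i (fun a => v (.inr a)) (fun a ha => hv (.inr a) (Layer.mem_sum_inr.2 ha)) a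
        (Layer.mem_sum_inr.1 ha)
  · rintro i (a | a) ha
    · rw [Layer.lsum_sum]
      simp only [Sum.elim_inl, Sum.elim_inr]
      rw [lsum_zero_X (l := V.l) (fun a _ => mul_zero_F _)]
      exact h2 i a (Layer.mem_sum_inl.1 ha)
    · rw [Layer.lsum_sum]
      simp only [Sum.elim_inl, Sum.elim_inr]
      rw [lsum_zero_X (l := U.l) (fun a _ => mul_zero_F _)]
      exact h2' i a (Layer.mem_sum_inr.1 ha)

theorem Chain.sum [Ok p q] {n : ℕ} {U V U' V' : Layer ι} (h : Chain σ σ' n U U')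
    (h' : Chain σ σ' n V V') : Chain σ σ' n (U.sum V) (U'.sum V') := by
  induction n generalizing U' V' with
  | zero => cases h; cases h'; rfl
  | succ n ih =>
    obtain ⟨M, h1, h2⟩ := h
    obtain ⟨M', h1', h2'⟩ := h'
    exact ⟨M.sum M', ih h1 h1', h2.sum h2'⟩

open Classical in
theorem Link.fam [Ok p q] {κ : Type} {K : List κ} (hK : K.Nodup) {U D : κ → Layer ι}
    (h : ∀ k, Link σ σ' (U k) (D k)) : Link σ σ' (Layer.fam K U) (Layer.fam K D) := by
  choose A b δ h1 h2 using h
  -- the matrix is block diagonal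
  let A' : (Σ k, (U k).N) → (Σ k, (D k).N) → ℝ := fun a a' =>
    if e : a'.1 = a.1 then A a.1 a.2 (e ▸ a'.2) else 0
  have hA : ∀ k a a', A' ⟨k, a⟩ ⟨k, a'⟩ = A k a a' := fun k a a' => by simp [A']
  have hA0 : ∀ k a k' a', k' ≠ k → A' ⟨k, a⟩ ⟨k', a'⟩ = 0 := fun k a k' a' e => by simp [A', e]
  refine ⟨A', fun a => b a.1 a.2, fun i a => δ a.1 i a.2, ?_, ?_⟩
  · rintro i v hv ⟨k, a⟩ ha
    obtain ⟨hk, ha⟩ := Layer.mem_fam.1 ha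
    rw [Layer.lsum_fam_block hK hk fun k' hne b => by rw [hA0 _ _ _ _ hne, zero_mul_F]]
    simp only [hA]
    exact h1 k i (fun a => v ⟨k, a⟩) (fun a ha => hv ⟨k, a⟩ (Layer.mem_fam.2 ⟨hk, ha⟩)) a ha
  · rintro i ⟨k, a⟩ ha
    obtain ⟨hk, ha⟩ := Layer.mem_fam.1 ha
    rw [Layer.lsum_fam_block hK hk fun k' hne b => by rw [hA0 _ _ _ _ hne.symm, mul_zero_F]]
    simp only [hA]
    exact h2 k i a ha

theorem Chain.fam [Ok p q] {κ : Type} {K : List κ} (hK : K.Nodup) {n : ℕ} {U D : κ → Layer ι}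
    (h : ∀ k, Chain σ σ' n (U k) (D k)) : Chain σ σ' n (Layer.fam K U) (Layer.fam K D) := by
  induction n generalizing D with
  | zero => obtain rfl : U = D := funext h; rfl
  | succ n ih =>
    choose M h1 h2 using h
    exact ⟨Layer.fam K M, ih h1, Link.fam hK h2⟩

/-- A neuron of the constant value `k`, to which no gradient arrives. -/
abbrev Layer.const (ι : Type) (k : ℝ) : Layer ι where
  N := Unit
  l := [()]
  ok _ _ v := v = k
  γ _ _ := 0

theorem Link.const [Ok p q] {U : Layer ι} {z0 k d : ℝ} (h : σ (F z0) = F k) (h' : σ' (F z0) = F d)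
    (hU : ∀ i, ∀ a ∈ U.l, U.γ i a = 0) : Link σ σ' (Layer.const ι k) U := by
  refine ⟨fun _ _ => 0, fun _ => z0, fun _ _ => 0, ?_, ?_⟩
  · intro i v _ a _
    rw [lsum_zero_X (fun a _ => zero_mul_F _), zero_add_F]
    exact ⟨k, d, rfl, h, h', zero_mul_F _⟩
  · intro i a ha
    rw [lsum_zero_X (fun a _ => mul_zero_F _), hU i a ha]

/-- A network with `n` affine maps on top of the layer `U`, which is accompanied by a neuron of
constant value so that it is not empty. -/
def NetAbove (σ σ' : XFlt p q → XFlt p q) (fs y : ι → ℝ) (k : ℝ) (n : ℕ) (U : Layer ι) : Prop :=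
  ∀ v : Unit ⊕ U.N → ι → ℝ, (∀ i, ∀ a ∈ ((Layer.const ι k).sum U).l,
      ((Layer.const ι k).sum U).ok i a (v a i)) →
    LTail σ σ' fs y n ((Layer.const ι k).sum U).l v fun a i => ((Layer.const ι k).sum U).γ i a

/-- A network is extended downwards by a layer. -/
theorem NetAbove.link [Ok p q] {k z0 d : ℝ} (hz : σ (F z0) = F k) (hz' : σ' (F z0) = F d) {n : ℕ}
    {U D : Layer ι} (h : NetAbove σ σ' fs y k n U) (h' : Link σ σ' U D) :
    NetAbove σ σ' fs y k (n + 1) D := by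
  intro v' hv'
  obtain ⟨A, b, δ, h1, h2⟩ := (Link.const (U := Layer.const ι k) hz hz' (fun _ _ _ => rfl)).sum h'
  have h3 := fun i => h1 i (fun a => v' a i) (hv' i)
  choose! v d hv hvv hd hδ using h3
  exact LTail.step (by simp [Layer.sum, Layer.const]) (h (fun a i => v i a) hv) A b _
    (fun a i => d i a) (fun a i => δ i a) (fun i a _ => rfl) hvv hd hδ h2

theorem NetAbove.chain [Ok p q] {k z0 d : ℝ} (hz : σ (F z0) = F k) (hz' : σ' (F z0) = F d)
    {n m : ℕ} {U D : Layer ι} (h : NetAbove σ σ' fs y k n U) (h' : Chain σ σ' m U D) :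
    NetAbove σ σ' fs y k (n + m) D := by
  induction m generalizing D with
  | zero => cases h'; exact h
  | succ m ih =>
    obtain ⟨M, h1, h2⟩ := h'
    exact (ih h1).link hz hz' h2

/-! ### The two ends of a network -/

/-- The output layer on top of `U`: the gradients are those of `U`, and the sum of the outputs,
continued from an initial value that satisfies `I`, increases by the float `s`. -/
def Top (y : ι → ℝ) (I : XFlt p q → Prop) (U : Layer ι) (s : ι → ℝ) : Prop :=
  ∃ A : U.N → ℝ, (∀ i (v : U.N → ℝ), (∀ a ∈ U.l, U.ok i a (v a)) → ∀ z, I z →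
      lsum z U.l (fun a => XFlt.mul (F (A a)) (F (v a))) = z.add (F (s i))) ∧
    ∀ i, ∀ a ∈ U.l, XFlt.mul (F (y i)) (F (A a)) = (F (U.γ i a) : XFlt p q)

theorem Top.sum [Ok p q] {U V : Layer ι} {s : ι → ℝ}
    (h : Top (p := p) (q := q) y (· = F 0) U fun _ => 0)
    (h' : Top (p := p) (q := q) y (· = F 0) V s) :
    Top (p := p) (q := q) y (· = F 0) (U.sum V) s := by
  obtain ⟨A, h1, h2⟩ := h
  obtain ⟨A', h1', h2'⟩ := h'
  refine ⟨Sum.elim A A', ?_, ?_⟩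
  · rintro i v hv z rfl
    rw [Layer.lsum_sum]
    simp only [Sum.elim_inl, Sum.elim_inr]
    rw [h1 i (fun a => v (.inl a)) (fun a ha => hv (.inl a) (Layer.mem_sum_inl.2 ha)) _ rfl,
      add_zero_X,
      h1' i (fun a => v (.inr a)) (fun a ha => hv (.inr a) (Layer.mem_sum_inr.2 ha)) _ rfl]
  · rintro i (a | a) ha
    · exact h2 i a (Layer.mem_sum_inl.1 ha)
    · exact h2' i a (Layer.mem_sum_inr.1 ha)

theorem Top.fam {κ : Type} {K : List κ} {I I' : XFlt p q → Prop} {U : κ → Layer ι}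
    {s : κ → ι → ℝ} {S : ι → ℝ} (h : ∀ k, Top (p := p) (q := q) y I' (U k) (s k))
    (hI' : ∀ k i z, I' z → I' (z.add (F (s k i)))) (hI : ∀ z, I z → I' z)
    (hS : ∀ i z, I z → lsum z K (fun k => F (s k i)) = z.add (F (S i))) :
    Top (p := p) (q := q) y I (Layer.fam K U) S := by
  choose A h1 h2 using h
  refine ⟨fun a => A a.1 a.2, ?_, ?_⟩
  · intro i v hv z hz
    rw [← hS i z hz]
    exact Layer.lsum_fam (hI z hz) (fun k _ z hz => hI' k i z hz) fun k hk z hz =>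
      h1 k i (fun a => v ⟨k, a⟩) (fun a ha => hv ⟨k, a⟩ (Layer.mem_fam.2 ⟨hk, ha⟩)) z hz
  · rintro i ⟨k, a⟩ ha
    exact h2 k i a (Layer.mem_fam.1 ha).2

/-- The output layer is a network with one affine map. -/
theorem Top.netAbove [Ok p q] {k : ℝ} {U : Layer ι}
    (h : Top (p := p) (q := q) y (· = F 0) U fs) : NetAbove σ σ' fs y k 1 U := by
  have h0 : Top (p := p) (q := q) y (· = F 0) (Layer.const ι k) fun _ => 0 := by
    refine ⟨fun _ => 0, ?_, ?_⟩
    · rintro i v _ z rfl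
      rw [lsum_zero_X (fun a _ => zero_mul_F _), add_zero_X]
    · intro i a _; exact mul_zero_F _
  obtain ⟨A, h1, h2⟩ := h0.sum h
  intro v hv
  refine LTail.last A (fun i => ?_) (fun i a ha => ?_)
  · rw [h1 i (fun a => v a i) (hv i) _ rfl, add_zero_X, zero_add_F]
  · rw [h2 i a ha, zero_add_F]

variable {d : ℕ} {x : ι → Fin d → Flt p q}

/-- Some affine map leads from the inputs `x i` to the layer `U`, and the gradient of the input `j`,
continued by the contributions of `U` from a partial sum that satisfies `I`, increases by the float
`t i j`. -/
def Feed (σ σ' : XFlt p q → XFlt p q) (x : ι → Fin d → Flt p q) (I : XFlt p q → Prop) (U : Layer ι)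
    (t : ι → Fin d → ℝ) : Prop :=
  ∃ (A : U.N → Fin d → ℝ) (b : U.N → ℝ) (δ : ι → U.N → ℝ),
    (∀ i, ∀ a ∈ U.l,
      Fires σ σ' ((lsum (F 0) (List.finRange d) fun j => XFlt.mul (F (A a j)) (F (x i j : ℝ))).add
        (F (b a))) (U.ok i a) (U.γ i a) (δ i a)) ∧
    ∀ i j z, I z → lsum z U.l (fun a => XFlt.mul (F (δ i a)) (F (A a j))) =
      (z.add (F (t i j)) : XFlt p q)

theorem Feed.sum {I I' : XFlt p q → Prop} {U V : Layer ι} {t t' T : ι → Fin d → ℝ}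
    (h : Feed σ σ' x I U t) (h' : Feed σ σ' x I' V t')
    (hI : ∀ i j (z : XFlt p q), I z → I' (z.add (F (t i j))))
    (hT : ∀ i j (z : XFlt p q), I z → (z.add (F (t i j))).add (F (t' i j)) = z.add (F (T i j))) :
    Feed σ σ' x I (U.sum V) T := by
  obtain ⟨A, b, δ, h1, h2⟩ := h
  obtain ⟨A', b', δ', h1', h2'⟩ := h'
  refine ⟨Sum.elim A A', Sum.elim b b', fun i => Sum.elim (δ i) (δ' i), ?_, ?_⟩
  · rintro i (a | a) ha
    · exact h1 i a (Layer.mem_sum_inl.1 ha)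
    · exact h1' i a (Layer.mem_sum_inr.1 ha)
  · intro i j z hz
    rw [Layer.lsum_sum]
    simp only [Sum.elim_inl, Sum.elim_inr]
    rw [h2 _ _ _ hz, h2' _ _ _ (hI i j z hz), hT _ _ _ hz]

theorem Feed.fam {I : XFlt p q → Prop} {κ : Type} {K : List κ} {U : κ → Layer ι}
    {t : κ → ι → Fin d → ℝ} {T : ι → Fin d → ℝ}
    (h : ∀ k, Feed σ σ' x (fun _ => True) (U k) (t k))
    (hT : ∀ i j (z : XFlt p q), I z → lsum z K (fun k => F (t k i j)) = z.add (F (T i j))) :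
    Feed σ σ' x I (Layer.fam K U) T := by
  choose A b δ h1 h2 using h
  refine ⟨fun a => A a.1 a.2, fun a => b a.1 a.2, fun i a => δ a.1 i a.2, ?_, ?_⟩
  · rintro i ⟨k, a⟩ ha
    exact h1 k i a (Layer.mem_fam.1 ha).2
  · intro i j z hz
    rw [← hT i j z hz]
    exact Layer.lsum_fam (P := fun _ => True) trivial (fun _ _ _ _ => trivial)
      fun k hk z hz => h2 k i j z hz

/-- A network that has the right output and the right gradient in every situation. -/
theorem NetAbove.exists_net [Ok p q] {k z0 e : ℝ} (hz : σ (F z0) = F k) (hz' : σ' (F z0) = F e)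
    {n : ℕ} {U : Layer ι} {t : ι → Fin d → ℝ} (h : NetAbove σ σ' fs y k n U)
    (h' : Feed σ σ' x (· = F 0) U t) :
    ∃ N : Net p q (n + 1) d 1, ∀ i,
      N.eval σ (toX (x i)) = (fun _ => F (fs i)) ∧
      N.grad σ σ' (toX (x i)) (fun _ => F (y i)) = fun j => F (t i j) := by
  have h0 : Feed σ σ' x (· = F 0) (Layer.const ι k) fun _ _ => 0 := by
    refine ⟨fun _ _ => 0, fun _ => z0, fun _ _ => 0, ?_, ?_⟩
    · intro i a _
      rw [lsum_zero_X (fun a _ => zero_mul_F _), zero_add_F]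
      exact ⟨k, e, rfl, hz, hz', zero_mul_F _⟩
    · intro i j z _
      rw [lsum_zero_X (fun a _ => mul_zero_F _), add_zero_X]
  obtain ⟨A, b, δ, h1, h2⟩ := h0.sum h' (T := t) (fun i j z hz => by rwa [add_zero_X])
    (fun i j z _ => by rw [add_zero_X])
  choose! v d hv hvv hd hδ using h1
  have := Tail.step (e := (id : Fin _ → Fin _)) (v' := fun j i => (x i j : ℝ))
    (γ' := fun j i => t i j)
    (by simp [Layer.sum, Layer.const]) (h (fun a i => v i a) hv) A b _
    (fun a i => d i a) (fun a i => δ i a) (fun i a _ => rfl)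
    (by rw [List.ofFn_id]; exact hvv) (by rw [List.ofFn_id]; exact hd) hδ
    (fun i j _ => by rw [h2 _ _ _ rfl, zero_add_F])
  obtain ⟨N, hN⟩ := this
  refine ⟨N, fun i => ?_⟩
  have : toX (x i) = fun j => (F (x i j : ℝ) : XFlt p q) := funext fun j => (F_coe _).symm
  rw [this]
  exact hN i

end

/-! ### The properties of an activation function on which the construction rests -/

theorem exists_mul_F [Ok p q] {r s a b : ℝ} (hr : |r| ≤ a) (hs : |s| ≤ b) (ha : a ∈ floatSet p q)
    (hb : b ∈ floatSet p q) (h : a * b ≤ Omega p q) :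
    ∃ t, XFlt.mul (F r : XFlt p q) (F s) = F t ∧ |t| ≤ a * b := by
  have h1 := abs_rd_le hr ha
  have h2 := abs_rd_le hs hb
  have h3 : |rd p q r * rd p q s| ≤ a * b := by
    rw [abs_mul]; exact mul_le_mul h1 h2 (abs_nonneg _) ((abs_nonneg _).trans h1)
  refine ⟨rd p q r * rd p q s, ?_, h3⟩
  rw [← F_rd r, ← F_rd s, mul_F (rd_mem r) (rd_mem s) (h3.trans h)]

/-- The sign that belongs to a Boolean. -/
def sgn (b : Bool) : ℝ := if b then -1 else 1

@[simp] theorem sgn_false : sgn false = 1 := rfl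
@[simp] theorem sgn_true : sgn true = -1 := rfl

/-- The names of eight neurons that carry a bit: four pairs. The two neurons of a pair are read with
opposite weights, so that they cancel when the bit is off; four pairs together provide a sum that is
large enough when the bit is on. -/
def cellList : List (Fin 4 × Bool) := (List.finRange 4).flatMap fun c => [(c, false), (c, true)]

/-- Value and derivative of the activation are finite at `z`, and the value satisfies `P`. -/
def Out (σ σ' : XFlt p q → XFlt p q) (z : XFlt p q) (P : ℝ → Prop) : Prop :=
  ∃ v d, P v ∧ σ z = F v ∧ σ' z = F d

theorem Out.fires [Ok p q] {σ σ' : XFlt p q → XFlt p q} {z : XFlt p q} {P Q : ℝ → Prop}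
    (h : Out σ σ' z P) (hPQ : ∀ v, P v → Q v) : Fires σ σ' z Q 0 0 := by
  obtain ⟨v, d, h1, h2, h3⟩ := h
  exact ⟨v, d, hPQ v h1, h2, h3, zero_mul_F d⟩

/-- What the construction needs to know about an activation function: the constants of the
different kinds of neurons, and how these neurons respond. The inputs are bounded by `M` and the
gradients of the output by `H`. The upper part of a network lies above the gates that let gradients
pass at a single input point only, the lower part below them. -/
structure Kit (p q : ℕ) (σ σ' : XFlt p q → XFlt p q) (M H : ℝ) where
  /-- the value of a neuron that is switched off -/
  kap : ℝ
  abs_kap : |kap| ≤ 1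
  /-- far to the left, value and derivative are constant after rounding -/
  low : ∀ z, LeX z (-T q) → σ z = F kap ∧ σ' z = F 0
  /-- the pre-activation of a neuron of the upper part that transports gradients -/
  onH : ℝ
  /-- the value of such a neuron -/
  vH : ℝ
  /-- the derivative at such a neuron -/
  cH : ℝ
  onH_eq : onH = 0 ∨ onH = 2 * T q
  sig_onH : σ (F onH) = F vH
  dsig_onH : σ' (F onH) = F cH
  vH_nonneg : 0 ≤ vH
  vH_le : 2 * vH ≤ 4 * T q * cH
  cH_eq : (cH = 1 ∧ H ≤ Omega p q) ∨ (cH = 1 / 4 ∧ H ≤ T q / 4)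
  /-- the pre-activation of a neuron of the lower part that transports gradients -/
  onL : ℝ
  /-- the value of such a neuron -/
  vL : ℝ
  /-- minus the binary logarithm of the derivative at such a neuron -/
  lc : ℕ
  lc_le : lc ≤ 2
  sig_onL : σ (F onL) = F vL
  dsig_onL : σ' (F onL) = F (2 ^ (-(lc : ℤ)))
  vL_nonneg : 0 ≤ vL
  vL_le : vL ≤ 1
  vL_le' : 2 ^ lc * vL ≤ 2
  /-- whether the gradient neurons of the lower part may deviate from their value when the input is
  not the one that they watch -/
  soft : Prop
  soft_spec : soft → onL = 0 ∧ onH = 0 ∧ vL ≤ 1 / 2 ∧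
    ∀ r, Out σ σ' (F r) fun v => |v| ≤ 1
  /-- the weight with which bits are read -/
  w : ℝ
  /-- the bias of the second neuron of a bit -/
  b' : ℝ
  /-- the value of the first neuron of a bit that is on -/
  vOn : ℝ
  /-- the value of the second neuron of a bit that is on -/
  vOn' : ℝ
  /-- the derivative at both neurons of a bit that is on -/
  dOn : ℝ
  w_bd : 0 ≤ w ∧ w ≤ T q
  b'_eq : b' = -3 * T q ∨ b' = -6 * T q
  on1 : σ (F (2 * T q)) = F vOn ∧ σ' (F (2 * T q)) = F dOn
  on2 : σ (F (4 * T q + b')) = F vOn' ∧ σ' (F (4 * T q + b')) = F dOn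
  dOn_eq : dOn = 0 ∨ (dOn = 1 ∧ w = 1)
  /-- a bit that is on is read as `4 T` -/
  row_on : lsum (F 0) cellList (fun c => XFlt.mul (F (sgn c.2 * w)) (F (if c.2 then vOn' else vOn)))
    = (F (4 * T q) : XFlt p q)
  /-- the number of layers that a comparison of an input with a threshold takes -/
  nt : ℕ
  nt_ge : 2 ≤ nt
  /-- weights of the comparison -/
  tw : ℕ → ℝ
  /-- biases of the comparison -/
  tb : ℕ → ℝ
  /-- values on the way to the outcome that the comparison is satisfied -/
  good : ℕ → ℝ → Prop
  /-- values on the way to the outcome that the comparison is violated -/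
  viol : ℕ → ℝ → Prop
  /-- input weights of the comparison -/
  ta : ℝ → ℝ
  good_start : ∀ x ∈ floatSet p q, ∀ t ∈ floatSet p q, |x| ≤ M → |t| ≤ M → ∀ s, s * x < s * t →
    (s = 1 ∨ s = -1) → Out σ σ' ((XFlt.mul (F (-s * ta t)) (F x)).add (F (s * ta t * t))) (good 0)
  viol_start : ∀ x ∈ floatSet p q, ∀ t ∈ floatSet p q, |x| ≤ M → |t| ≤ M → ∀ s, s * t ≤ s * x →
    (s = 1 ∨ s = -1) → Out σ σ' ((XFlt.mul (F (-s * ta t)) (F x)).add (F (s * ta t * t))) (viol 0)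
  good_step : ∀ l, l + 1 < nt → ∀ v, good l v →
    Out σ σ' ((XFlt.mul (F (tw l)) (F v)).add (F (tb l))) (good (l + 1))
  viol_step : ∀ l, l + 1 < nt → ∀ v, viol l v →
    Out σ σ' ((XFlt.mul (F (tw l)) (F v)).add (F (tb l))) (viol (l + 1))
  /-- a satisfied comparison ends in the value of a neuron that is switched off -/
  good_end : ∀ v, good (nt - 1) v → v = kap
  /-- the weight with which the outcomes of comparisons are read -/
  wA : ℝ
  wA_bd : 0 ≤ wA ∧ wA ≤ 4 * T q
  /-- a satisfied comparison does not lift a sum that is already low -/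
  and_good : ∀ z : XFlt p q, LeX z (-4 * T q) →
    LeX ((z.add (XFlt.mul (F (-wA)) (F kap))).add (XFlt.mul (F wA) (F kap))) (-4 * T q)
  /-- a violated comparison makes the sum low -/
  and_viol : ∀ (z : XFlt p q) v, LeX z 0 → viol (nt - 1) v →
    LeX ((z.add (XFlt.mul (F (-wA)) (F v))).add (XFlt.mul (F wA) (F kap))) (-4 * T q)
  /-- minus the binary logarithm of the factor which a gradient gains in the first layer -/
  m2 : ℕ
  m2_le : m2 + lc ≤ p
  m2_lt : m2 < p
  /-- the lower part is deep enough to turn the least positive float into any power of two -/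
  reach : 2 * emax q - 1 + m2 ≤ (nt - 1) * (emax q - lc)
  /-- input bias of a gradient neuron -/
  b1 : ℝ → ℝ
  /-- the pre-activation of the constants that accompany it -/
  zc : ℝ
  /-- the value of these constants -/
  vc : ℝ
  /-- the derivative at these constants -/
  dc : ℝ
  /-- the derivative at the gradient neuron of the first layer -/
  d1 : ℝ
  /-- the weights of the first layer and of its constants -/
  (A2 A2' C2 : ℝ)
  sig_zc : σ (F zc) = F vc ∧ σ' (F zc) = F dc
  dc_bd : |dc| ≤ 1
  d1_bd : ∃ k : ℕ, k ≤ 2 ∧ d1 = 2 ^ (-(k : ℤ))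
  A2_eq : A2 * d1 = 2 ^ (-(m2 : ℤ))
  A2'_bd : |A2'| ≤ A2
  C2_bd : 0 ≤ C2 ∧ C2 ≤ 2
  /-- the gradient neuron of the first layer: its derivative is `d1` at the input `x0` that it
  watches, and the next layer receives nothing from it and its constants there, and a bounded value
  elsewhere -/
  first : ∀ x ∈ floatSet p q, ∀ x0 ∈ floatSet p q, |x| ≤ M → |x0| ≤ M → ∃ v e,
    σ ((F x).add (F (b1 x0))) = F v ∧ σ' ((F x).add (F (b1 x0))) = F e ∧ (x = x0 → e = d1) ∧
    ∃ r, ((((F 0).add (XFlt.mul (F A2) (F v))).add (XFlt.mul (F A2') (F vc))).add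
      (XFlt.mul (F C2) (F vc))).add (XFlt.mul (F (-C2)) (F vc)) = (F r : XFlt p q) ∧
      |r| ≤ T q ∧ (x = x0 ∨ ¬ soft → r = 0)
  /-- a neuron, with input weight `wv`, bias `bv` and output weight `W`, that contributes `2 ^ k` to
  the output if the bit is on and `0` otherwise, and at which every gradient stays finite -/
  value : ∀ k : ℤ, emin q - p ≤ k → k ≤ emax q - p → ∃ wv bv W r v0 v1 d0 d1 z : ℝ,
    0 ≤ wv ∧ wv ≤ T q ∧
    lsum (F 0) cellList (fun c => XFlt.mul (F (sgn c.2 * wv)) (F (if c.2 then vOn' else vOn)))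
      = (F r : XFlt p q) ∧ (F r).add (F bv) = (F z : XFlt p q) ∧
    σ (F z) = F v1 ∧ σ' (F z) = F d1 ∧ σ (F bv) = F v0 ∧ σ' (F bv) = F d0 ∧
    XFlt.mul (F W) (F v1) = (F (2 ^ k) : XFlt p q) ∧ XFlt.mul (F W) (F v0) = (F 0 : XFlt p q) ∧
    ∀ y ∈ floatSet p q, |y| ≤ H → ∃ γ, XFlt.mul (F y) (F W) = (F γ : XFlt p q) ∧
      ∀ d, d = d0 ∨ d = d1 → ∃ δ g, XFlt.mul (F γ) (F d) = (F δ : XFlt p q) ∧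
        XFlt.mul (F δ) (F wv) = (F g : XFlt p q)

/-! ### Neurons that carry the bit whether the input is a given point -/

section
variable {ι : Type} {σ σ' : XFlt p q → XFlt p q} {M H : ℝ}

/-- Opposite weights cancel exactly as long as nothing overflows. -/
theorem pair_cancel_left [Ok p q] {g s : ℝ} (h : ∃ t, XFlt.mul (F g : XFlt p q) (F s) = F t) :
    ((F 0).add (XFlt.mul (F g) (F s))).add (XFlt.mul (F (-g)) (F s)) = (F 0 : XFlt p q) := by
  obtain ⟨t, ht⟩ := h
  rw [nx_mul_F, ht, nx_F, zero_add_F, add_neg_F]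

theorem exists_mul_one [Ok p q] (g : ℝ) (b : Bool) :
    ∃ t, XFlt.mul (F g : XFlt p q) (F (sgn b * 1)) = F t := by
  cases b
  · exact ⟨g, by rw [sgn_false, one_mul, mul_one_F]⟩
  · exact ⟨-g, by rw [sgn_true, neg_one_mul, mul_nx_F, mul_one_F, nx_F]⟩

theorem exists_mul_sgn [Ok p q] {g s : ℝ} (b : Bool)
    (h : ∃ t, XFlt.mul (F g : XFlt p q) (F s) = F t) :
    ∃ t, XFlt.mul (F g : XFlt p q) (F (sgn b * s)) = F t := by
  obtain ⟨t, ht⟩ := h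
  cases b
  · exact ⟨t, by rw [sgn_false, one_mul, ht]⟩
  · exact ⟨-t, by rw [sgn_true, neg_one_mul, mul_nx_F, ht, nx_F]⟩

theorem one_mem [h : Ok p q] : (1 : ℝ) ∈ floatSet p q := by
  have := h.emin_eq; have := h.seven_le
  simpa using mem_zpow (p := p) (q := q) 0 (by omega) (by omega)

/-- A bit that is off contributes nothing. -/
theorem row_off [Ok p q] {w k : ℝ} (h : ∃ t, XFlt.mul (F w : XFlt p q) (F k) = F t) :
    lsum (F 0) cellList (fun c => XFlt.mul (F (sgn c.2 * w)) (F k)) = (F 0 : XFlt p q) := by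
  refine lsum_flatMap_id fun c _ => ?_
  obtain ⟨t, ht⟩ := h
  simp only [lsum_cons, lsum_nil, sgn_false, sgn_true, one_mul, neg_one_mul]
  rw [nx_mul_F, ht, nx_F, zero_add_F, add_neg_F]

open Classical in
/-- Eight neurons that carry the bit `on`; the gradients that arrive are `g` and `-g`. -/
abbrev cellLayer (K : Kit p q σ σ' M H) (on : ι → Prop) (g : ι → ℝ) : Layer ι where
  N := Fin 4 × Bool
  l := cellList
  ok i a v := v = if on i then (if a.2 then K.vOn' else K.vOn) else K.kap
  γ i a := sgn a.2 * g i

namespace Kit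
variable (K : Kit p q σ σ' M H)

theorem exists_mul_kap [Ok p q] {w : ℝ} (hw : |w| ≤ 4 * T q) :
    ∃ t, XFlt.mul (F w : XFlt p q) (F K.kap) = F t := by
  have h7 := seven_T_le (p := p) (q := q)
  have hT := T_pos (q := q)
  obtain ⟨t, h, _⟩ := exists_mul_F (p := p) (q := q) hw K.abs_kap
    (by exact_mod_cast mem_T (p := p) (q := q) 4 (by norm_num)) one_mem (by linarith)
  exact ⟨t, h⟩

theorem low_mono {z : XFlt p q} {m : ℝ} (h : LeX z m) (hm : m ≤ -T q) :
    σ z = F K.kap ∧ σ' z = F 0 := K.low z (h.mono hm)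

theorem low_F [Ok p q] (m : ℤ) (hm : -7 ≤ m) (hm' : m ≤ -1) :
    σ (F (m * T q)) = F K.kap ∧ σ' (F (m * T q)) = F 0 := by
  have hT := T_pos (q := q)
  refine K.low_mono (leX_F (mem_T m (by rw [abs_le]; omega)) le_rfl) ?_
  have : (m : ℝ) ≤ -1 := by exact_mod_cast hm'
  nlinarith

open Classical in
/-- The gradient behind a neuron that carries a bit. -/
noncomputable def cellGrad (on : ι → Prop) (g : ι → ℝ) (i : ι) (a : Fin 4 × Bool) : ℝ :=
  if on i ∧ K.dOn = 1 then sgn a.2 * g i else 0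

/-- A neuron of a bit responds correctly if its pre-activation is the prescribed one when the bit is
on, and low when it is off. -/
theorem cell_fires [Ok p q] (on : ι → Prop) (g : ι → ℝ) (i : ι) (c : Fin 4) (b : Bool)
    {z : XFlt p q} (h1 : on i → z = F (if b then 4 * T q + K.b' else 2 * T q))
    (h0 : ¬ on i → LeX z (-T q)) :
    Fires σ σ' z ((cellLayer K on g).ok i (c, b)) ((cellLayer K on g).γ i (c, b))
      (K.cellGrad on g i (c, b)) := by
  by_cases hi : on i
  · have hs : σ z = F (if b then K.vOn' else K.vOn) ∧ σ' z = F K.dOn := by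
      rw [h1 hi]
      cases b
      · exact K.on1
      · exact K.on2
    refine ⟨if b then K.vOn' else K.vOn, K.dOn, (if_pos hi).symm, hs.1, hs.2, ?_⟩
    rcases K.dOn_eq with h | ⟨h, _⟩
    · have e : K.cellGrad on g i (c, b) = 0 := by simp [cellGrad, h]
      rw [h, e]; exact mul_zero_F _
    · have e : K.cellGrad on g i (c, b) = sgn b * g i := by simp [cellGrad, h, hi]
      rw [h, e]; exact mul_one_F _
  · obtain ⟨h1, h2⟩ := K.low z (h0 hi)
    refine ⟨K.kap, 0, (if_neg hi).symm, h1, h2, ?_⟩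
    have e : K.cellGrad on g i (c, b) = 0 := by simp [cellGrad, hi]
    rw [e]; exact mul_zero_F _

open Classical in
/-- How the neurons of the next layer read a bit. -/
theorem cell_row [Ok p q] (on : ι → Prop) (g : ι → ℝ) (i : ι) {v : Fin 4 × Bool → ℝ}
    (hv : ∀ a ∈ (cellLayer K on g).l, (cellLayer K on g).ok i a (v a)) :
    lsum (F 0) cellList (fun c => XFlt.mul (F (sgn c.2 * K.w)) (F (v c))) =
      (F (if on i then 4 * T q else 0) : XFlt p q) := by
  have hT := T_pos (q := q)
  by_cases hi : on i
  · rw [if_pos hi, ← K.row_on]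
    refine lsum_congr fun a ha => ?_
    rw [hv a ha, if_pos hi]
  · rw [if_neg hi]
    refine Eq.trans (lsum_congr fun a ha => ?_) (row_off (K.exists_mul_kap (w := K.w) (by
      rw [abs_of_nonneg K.w_bd.1]; linarith [K.w_bd.2])))
    rw [hv a ha, if_neg hi]

theorem b'_add_mem [Ok p q] : 4 * T q + K.b' ∈ floatSet p q := by
  rcases K.b'_eq with h | h
  · rw [h]; convert mem_T (p := p) (q := q) 1 (by norm_num) using 1; push_cast; ring
  · rw [h]; convert mem_T (p := p) (q := q) (-2) (by norm_num) using 1; push_cast; ring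

theorem b'_mem [Ok p q] : K.b' ∈ floatSet p q := by
  rcases K.b'_eq with h | h
  · rw [h]; convert mem_T (p := p) (q := q) (-3) (by norm_num) using 1; push_cast; ring
  · rw [h]; convert mem_T (p := p) (q := q) (-6) (by norm_num) using 1; push_cast; ring

theorem b'_le : K.b' ≤ -3 * T q := by
  have hT := T_pos (q := q)
  rcases K.b'_eq with h | h <;> rw [h] ; linarith

theorem mT [Ok p q] (m : ℤ) (hm : |m| ≤ 7) {x : ℝ} (h : x = m * T q) : x ∈ floatSet p q :=
  h ▸ mem_T m hm

/-- A bit is handed on from layer to layer, and no gradient passes. -/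
theorem link_cell_cell [Ok p q] (on : ι → Prop) (g : ι → ℝ) :
    Link σ σ' (cellLayer K on g) (cellLayer K on fun _ => 0) := by
  have hT := T_pos (q := q)
  have hb := K.b'_le
  refine ⟨fun _ c => sgn c.2 * K.w, fun a => if a.2 then K.b' else -2 * T q, K.cellGrad on g,
    ?_, ?_⟩
  · rintro i v hv ⟨c, b⟩ _
    rw [K.cell_row on _ i hv]
    refine K.cell_fires on g i c b (fun hi => ?_) (fun hi => ?_)
    · rw [if_pos hi]
      cases b
      · exact add_F_mem (mT 4 (by norm_num) (by norm_num)) (mT (-2) (by norm_num) (by norm_num))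
          (by simp; ring) (mT 2 (by norm_num) (by norm_num))
      · exact add_F_mem (mT 4 (by norm_num) (by norm_num)) K.b'_mem rfl K.b'_add_mem
    · rw [if_neg hi, zero_add_F]
      cases b
      · exact leX_F (mT (-2) (by norm_num) (by simp)) (by simp; linarith)
      · exact leX_F K.b'_mem (by simp; linarith)
  · intro i a' _
    simp only [mul_zero]
    refine lsum_flatMap_id fun c _ => ?_
    simp only [lsum_cons, lsum_nil, cellGrad, sgn_false, sgn_true, one_mul, neg_one_mul]
    by_cases h : on i ∧ K.dOn = 1
    · rw [if_pos h, if_pos h]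
      have hw : K.w = 1 := by
        rcases K.dOn_eq with h' | ⟨_, h'⟩
        · rw [h'] at h; norm_num at h
        · exact h'
      rw [hw]
      exact pair_cancel_left (exists_mul_one _ _)
    · rw [if_neg h, if_neg h, zero_mul_F, zero_add_F, zero_add_F]

/-! ### Comparisons of inputs with thresholds -/

/-- The neuron of the layer `n` of a comparison that is violated in the situations `bad`, with a
neuron of the constant value `kap`. -/
abbrev test (bad : ι → Prop) (n : ℕ) : Layer ι where
  N := Bool
  l := [false, true]
  ok i b v := if b then v = K.kap else (bad i → K.viol n v) ∧ (¬ bad i → K.good n v)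
  γ _ _ := 0

/-- The layer `n` of the comparisons in the list `l`. -/
abbrev testLayer {τ : Type} (l : List τ) (bad : τ → ι → Prop) (n : ℕ) : Layer ι :=
  Layer.fam l fun t => K.test (bad t) n

variable {τ : Type}

theorem const_fires [Ok p q] {P : ℝ → Prop} (h : P K.kap) :
    Fires σ σ' (F (-2 * T q)) P 0 0 := by
  have := K.low_F (-2) (by norm_num) (by norm_num)
  push_cast at this
  exact ⟨K.kap, 0, h, this.1, this.2, zero_mul_F _⟩

/-- One step of a comparison. -/
theorem link_test [Ok p q] (bad : ι → Prop) (n : ℕ) (hn : n + 1 < K.nt) :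
    Link σ σ' (K.test bad (n + 1)) (K.test bad n) := by
  refine ⟨fun a a' => if a || a' then 0 else K.tw n,
    fun a => if a then -2 * T q else K.tb n, fun _ _ => 0, ?_, ?_⟩
  · rintro i v hv (_ | _) _
    · have hok := hv false (by simp)
      simp only [lsum_cons, lsum_nil, Bool.or_true, Bool.or_false, if_true, Bool.false_eq_true,
        if_false, zero_mul_F, add_zero_X, zero_add_X] at hok ⊢
      by_cases hb : bad i
      · exact (K.viol_step n hn _ (hok.1 hb)).fires fun v hv => ⟨fun _ => hv, fun h => absurd hb h⟩
      · exact (K.good_step n hn _ (hok.2 hb)).fires fun v hv => ⟨fun h => absurd h hb, fun _ => hv⟩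
    · simp only [Bool.true_or, if_true]
      rw [lsum_zero_X (fun a _ => zero_mul_F _), zero_add_F]
      exact K.const_fires rfl
  · intro i a' _
    exact lsum_zero_X (fun a _ => zero_mul_F _)

theorem chain_test [Ok p q] (l : List τ) (hl : l.Nodup) (bad : τ → ι → Prop) (n : ℕ)
    (hn : n < K.nt) : Chain σ σ' n (K.testLayer l bad n) (K.testLayer l bad 0) := by
  induction n with
  | zero => rfl
  | succ n ih =>
    have := (Link.fam hl fun t => K.link_test (bad t) n hn).chain.trans (ih (by omega))
    rwa [add_comm] at this

/-- The bit is on if none of the comparisons is violated. The conjunction of arbitrarily many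
comparisons is computed by a single sum, since violations only push the sum down and it stays low
even if it overflows to `-∞`. -/
theorem link_cell_test [Ok p q] (on : ι → Prop) (l : List τ) (bad : τ → ι → Prop)
    (h : ∀ i, on i ↔ ∀ t ∈ l, ¬ bad t i) :
    Link σ σ' (cellLayer K on fun _ => 0) (K.testLayer l bad (K.nt - 1)) := by
  have hT := T_pos (q := q)
  have hb := K.b'_le
  refine ⟨fun _ t => if t.2 then K.wA else -K.wA, fun a => if a.2 then 4 * T q + K.b' else 2 * T q,
    K.cellGrad on fun _ => 0, ?_, ?_⟩
  · rintro i v hv ⟨c, b⟩ _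
    have hk : ∃ t, XFlt.mul (F K.wA : XFlt p q) (F K.kap) = F t :=
      K.exists_mul_kap (by rw [abs_of_nonneg K.wA_bd.1]; exact K.wA_bd.2)
    have hgood : ((F 0 : XFlt p q).add (XFlt.mul (F (-K.wA)) (F K.kap))).add
        (XFlt.mul (F K.wA) (F K.kap)) = F 0 := by
      obtain ⟨t, ht⟩ := hk
      rw [nx_mul_F, ht, nx_F, zero_add_F]
      have := add_neg_F (p := p) (q := q) (-t)
      rwa [neg_neg] at this
    have hv1 : ∀ t ∈ l, v ⟨t, true⟩ = K.kap := fun t ht => by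
      simpa using hv ⟨t, true⟩ (Layer.mem_fam.2 ⟨ht, by simp⟩)
    have hv0 : ∀ t ∈ l, (bad t i → K.viol (K.nt - 1) (v ⟨t, false⟩)) ∧
        (¬ bad t i → v ⟨t, false⟩ = K.kap) := fun t ht => by
      have := hv ⟨t, false⟩ (Layer.mem_fam.2 ⟨ht, by simp⟩)
      simp only [Bool.false_eq_true, if_false] at this
      exact ⟨this.1, fun h => K.good_end _ (this.2 h)⟩
    -- each comparison keeps the sum at zero or brings it below `-4 T`, where it stays
    have hrow : ∀ l' : List τ, (∀ t ∈ l', t ∈ l) → ∀ z : XFlt p q,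
        (z = F 0 → ((∀ t ∈ l', ¬ bad t i) →
          lsum z (K.testLayer l' bad (K.nt - 1)).l
            (fun t => XFlt.mul (F (if t.2 then K.wA else -K.wA)) (F (v t))) = F 0) ∧
          ((¬ ∀ t ∈ l', ¬ bad t i) → LeX (lsum z (K.testLayer l' bad (K.nt - 1)).l
            (fun t => XFlt.mul (F (if t.2 then K.wA else -K.wA)) (F (v t)))) (-4 * T q))) ∧
        (LeX z (-4 * T q) → LeX (lsum z (K.testLayer l' bad (K.nt - 1)).l
            (fun t => XFlt.mul (F (if t.2 then K.wA else -K.wA)) (F (v t)))) (-4 * T q)) := by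
      intro l'
      induction l' with
      | nil =>
        intro _ z
        exact ⟨fun hz => ⟨fun _ => hz, fun h => absurd (by simp) h⟩, fun hz => hz⟩
      | cons t l' ih =>
        intro hl z
        have ht := hl t (by simp)
        have e : lsum z (K.testLayer (t :: l') bad (K.nt - 1)).l
            (fun t => XFlt.mul (F (if t.2 then K.wA else -K.wA)) (F (v t))) =
            lsum ((z.add (XFlt.mul (F (-K.wA)) (F (v ⟨t, false⟩)))).add
              (XFlt.mul (F K.wA) (F K.kap))) (K.testLayer l' bad (K.nt - 1)).l
              (fun t => XFlt.mul (F (if t.2 then K.wA else -K.wA)) (F (v t))) := by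
          rw [← hv1 t ht]
          simp [List.flatMap_cons]
        rw [e]
        have ih := ih (fun t h => hl t (by simp [h]))
        by_cases hbad : bad t i
        · have hviol := fun hz => K.and_viol z _ hz ((hv0 t ht).1 hbad)
          refine ⟨fun hz => ⟨fun h => absurd hbad (h t (by simp)), fun _ => ?_⟩, fun hz => ?_⟩
          · subst hz
            exact (ih _).2 (hviol (leX_F zero_mem le_rfl))
          · exact (ih _).2 (hviol (hz.mono (by linarith)))
        · rw [(hv0 t ht).2 hbad]
          refine ⟨fun hz => ?_, fun hz => (ih _).2 (K.and_good z hz)⟩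
          subst hz
          rw [hgood]
          have := (ih (F 0)).1 rfl
          refine ⟨fun h => this.1 fun t h' => h t (by simp [h']), fun h => this.2 fun h' => h ?_⟩
          simpa [hbad] using h'
    have hr := (hrow l (fun _ h => h) (F 0)).1 rfl
    refine K.cell_fires on (fun _ => 0) i c b (fun hi => ?_) (fun hi => ?_)
    · rw [hr.1 ((h i).1 hi), zero_add_F]
    · have := hr.2 (fun h' => hi ((h i).2 h'))
      cases b
      · exact (this.add (mT 2 (by norm_num) (by simp)) (mT (-2) (by norm_num) rfl)
          (by simp; linarith)).mono (by push_cast; linarith)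
      · refine (this.add (s := K.b') K.b'_add_mem K.b'_mem (by linarith)).mono (by linarith)
  · intro i a' _
    refine lsum_zero_X (fun a _ => ?_)
    have : K.cellGrad on (fun _ => 0) i a = 0 := by simp [cellGrad]
    rw [this, zero_mul_F]

variable {d : ℕ} {x : ι → Fin d → Flt p q}

/-- The first layer of the comparison `s x < s t` of the input `j`. -/
theorem feed_test [Ok p q] (j : Fin d) {t : ℝ} (ht : t ∈ floatSet p q) (htM : |t| ≤ M)
    (hx : ∀ i, |(x i j : ℝ)| ≤ M) {s : ℝ} (hs : s = 1 ∨ s = -1) :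
    Feed σ σ' x (fun _ => True) (K.test (fun i => s * t ≤ s * (x i j : ℝ)) 0) fun _ _ => 0 := by
  refine ⟨fun a j' => if a = false ∧ j' = j then -s * K.ta t else 0,
    fun a => if a then -2 * T q else s * K.ta t * t, fun _ _ => 0, ?_, ?_⟩
  · rintro i (_ | _) _
    · simp only [true_and, Bool.false_eq_true, if_false]
      have e : lsum (F 0) (List.finRange d)
        (fun j' => XFlt.mul (F (if j' = j then -s * K.ta t else 0))
          (F (x i j' : ℝ))) = (XFlt.mul (F (-s * K.ta t)) (F (x i j : ℝ)) : XFlt p q) := by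
        rw [lsum_sublist (s := [j]) (by simp) (List.nodup_finRange d)
          (fun a _ ha => by rw [if_neg (by simpa using ha), zero_mul_F])]
        simp [zero_add_X]
      rw [e]
      by_cases hb : s * t ≤ s * (x i j : ℝ)
      · exact (K.viol_start _ (x i j).2 t ht (hx i) htM s hb hs).fires
          fun v hv => ⟨fun _ => hv, fun h => absurd hb h⟩
      · exact (K.good_start _ (x i j).2 t ht (hx i) htM s (not_le.1 hb) hs).fires
          fun v hv => ⟨fun h => absurd h hb, fun _ => hv⟩
    · simp only [Bool.true_eq_false, false_and, if_false, if_true]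
      rw [lsum_zero_X (fun a _ => zero_mul_F _), zero_add_F]
      exact K.const_fires rfl
  · intro i a' z _
    rw [lsum_zero_X (fun a _ => zero_mul_F _), add_zero_X]

/-! ### Neurons that produce the output -/

open Classical in
/-- The neuron of the last layer that contributes to the output where `on` holds. -/
abbrev valueLayer (on : ι → Prop) (v1 v0 : ℝ) (γ : ι → ℝ) : Layer ι where
  N := Unit
  l := [()]
  ok i _ v := v = if on i then v1 else v0
  γ i _ := γ i

open Classical in
/-- A neuron which contributes `s u`, for a power of two `u`, to the output where `on` holds. -/
theorem exists_value [Ok p q] {y : ι → ℝ} (hy : ∀ i, y i ∈ floatSet p q) (hyH : ∀ i, |y i| ≤ H)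
    {k : ℤ} (hk : emin q - p ≤ k) (hk' : k ≤ emax q - p) {s : ℝ} (hs : s = 1 ∨ s = -1)
    (on : ι → Prop) :
    ∃ U g, Top (p := p) (q := q) y (fun _ => True) U (fun i => if on i then s * 2 ^ k else 0) ∧
      Link σ σ' U (cellLayer K on g) := by
  obtain ⟨wv, bv, W, r, v0, v1, d0, d1, z, hw, hw', hrow, hz, hv1, hd1, hv0, hd0, hW1, hW0, hfin⟩ :=
    K.value k hk hk'
  choose γ hγ hfin using fun i => hfin (y i) (hy i) (hyH i)
  choose δ g hδ hg using fun i => hfin i (if on i then d1 else d0) (by split_ifs <;> simp)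
  have hsm : ∀ a b t : ℝ, XFlt.mul (F a : XFlt p q) (F b) = F t →
      XFlt.mul (F (s * a) : XFlt p q) (F b) = F (s * t) := by
    intro a b t h
    rcases hs with rfl | rfl
    · rw [one_mul, one_mul, h]
    · rw [neg_one_mul, neg_one_mul, nx_mul_F, h, nx_F]
  refine ⟨valueLayer on v1 v0 (fun i => s * γ i), fun i => s * g i,
    ⟨fun _ => s * W, ?_, ?_⟩, ⟨fun _ c => sgn c.2 * wv, fun _ => bv, fun i _ => s * δ i, ?_, ?_⟩⟩
  · intro i v hv z _
    have := hv () (by simp)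
    simp only [lsum_cons, lsum_nil]
    rw [this]
    split_ifs
    · rw [hsm _ _ _ hW1]
    · rw [hsm _ _ _ hW0, mul_zero]
  · intro i a _
    have := hγ i
    rcases hs with rfl | rfl
    · simp only [one_mul, this]
    · simp only [neg_one_mul]
      rw [mul_nx_F, this, nx_F]
  · intro i v hv a _
    have hδ' := hsm _ _ _ (hδ i)
    by_cases hi : on i
    · have e : lsum (F 0) cellList (fun c => XFlt.mul (F (sgn c.2 * wv)) (F (v c))) =
        (F r : XFlt p q) := by
        rw [← hrow]
        refine lsum_congr fun c hc => ?_
        have := hv c hc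
        simp only [if_pos hi] at this
        rw [this]
      rw [e, hz]
      rw [if_pos hi] at hδ'
      exact ⟨v1, d1, (if_pos hi).symm, hv1, hd1, hδ'⟩
    · have e : lsum (F 0) cellList (fun c => XFlt.mul (F (sgn c.2 * wv)) (F (v c))) =
        (F 0 : XFlt p q) := by
        refine Eq.trans (lsum_congr fun c hc => ?_)
          (row_off (K.exists_mul_kap (w := wv) (by rw [abs_of_nonneg hw]; linarith)))
        have := hv c hc
        simp only [if_neg hi] at this
        rw [this]
      rw [e, zero_add_F]
      rw [if_neg hi] at hδ'
      exact ⟨v0, d0, (if_neg hi).symm, hv0, hd0, hδ'⟩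
  · intro i c _
    have hg' := hsm _ _ _ (hg i)
    simp only [lsum_cons, lsum_nil, zero_add_X]
    cases c.2
    · rw [sgn_false, one_mul, one_mul, hg']
    · rw [sgn_true, neg_one_mul, neg_one_mul, mul_nx_F, hg', nx_F]

end Kit
end

/-! ### Pairs of neurons that transport gradients -/

section
variable {ι : Type} {σ σ' : XFlt p q → XFlt p q} {M H : ℝ}

/-- Only the first neuron of each pair is read from above. -/
theorem pair_grad [Ok p q] {α : Type*} {l : List α} {f : α × Bool → XFlt p q}
    (h : ∀ a ∈ l, f (a, true) = F 0) (z : XFlt p q) :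
    lsum z (l.flatMap fun a => [(a, false), (a, true)]) f = lsum z l fun a => f (a, false) :=
  lsum_flatMap_eq (P := fun _ => True) trivial (fun _ _ _ _ => trivial) fun a ha z _ => by
    simp only [lsum_cons, lsum_nil]
    rw [h a ha, add_zero_X]

theorem mul_sgn_left [Ok p q] {r s t : ℝ} (b : Bool) (h : XFlt.mul (F r : XFlt p q) (F s) = F t) :
    XFlt.mul (F (sgn b * r) : XFlt p q) (F s) = F (sgn b * t) := by
  cases b
  · simpa using h
  · rw [sgn_true, neg_one_mul, neg_one_mul, nx_mul_F, h, nx_F]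

theorem mul_sgn_right [Ok p q] {r s t : ℝ} (b : Bool) (h : XFlt.mul (F r : XFlt p q) (F s) = F t) :
    XFlt.mul (F r : XFlt p q) (F (sgn b * s)) = F (sgn b * t) := by
  cases b
  · simpa using h
  · rw [sgn_true, neg_one_mul, neg_one_mul, mul_nx_F, h, nx_F]

/-- Pairs of neurons with the same value and opposite gradients. Since the outgoing weights of the
two neurons of a pair are opposite, a pair has no influence on the values of later layers. -/
abbrev pairLayer {I : Type} (l : List I) (val β : ι → I → ℝ) : Layer ι where
  N := I × Bool
  l := l.flatMap fun j => [(j, false), (j, true)]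
  ok i a v := v = val i a.1
  γ i a := sgn a.2 * β i a.1

theorem mem_pairs {α : Type*} {l : List α} {a : α} {b : Bool} :
    ((a, b) ∈ l.flatMap fun t => [(t, false), (t, true)]) ↔ a ∈ l := by
  cases b <;> simp

/-- Gradients are multiplied by an arbitrary matrix, provided that it does not cause an overflow. -/
theorem link_pair [Ok p q] {on v c : ℝ} (hσ : σ (F on) = F v) (hσ' : σ' (F on) = F c)
    {I J : Type} {lI : List I} {lJ : List J} {β X : ι → I → ℝ} {val' β' : ι → J → ℝ}
    (A : I → J → ℝ)
    (hX : ∀ s, ∀ i ∈ lI, XFlt.mul (F (β s i) : XFlt p q) (F c) = F (X s i))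
    (hA : ∀ s, ∀ i ∈ lI, ∀ j ∈ lJ, ∃ r, XFlt.mul (F (A i j) : XFlt p q) (F (val' s j)) = F r)
    (hβ : ∀ s, ∀ j ∈ lJ, lsum (F 0) lI (fun i => XFlt.mul (F (X s i) : XFlt p q) (F (A i j))) =
      F (β' s j)) :
    Link σ σ' (pairLayer lI (fun _ _ => v) β) (pairLayer lJ val' β') := by
  refine ⟨fun a c => if a.2 then 0 else sgn c.2 * A a.1 c.1, fun _ => on,
    fun s a => sgn a.2 * X s a.1, ?_, ?_⟩
  · rintro s u hu ⟨i, b⟩ hi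
    have hi' := mem_pairs.1 hi
    have hz : lsum (F 0) (pairLayer lJ val' β').l (fun c =>
        XFlt.mul (F (if b then 0 else sgn c.2 * A i c.1)) (F (u c))) = (F 0 : XFlt p q) := by
      cases b
      · refine lsum_flatMap_id fun j hj => ?_
        obtain ⟨r, hr⟩ := hA s i hi' j hj
        have h1 : u (j, false) = val' s j := hu (j, false) (mem_pairs.2 hj)
        have h2 : u (j, true) = val' s j := hu (j, true) (mem_pairs.2 hj)
        simp only [lsum_cons, lsum_nil, Bool.false_eq_true, if_false, sgn_false, sgn_true,
          one_mul, neg_one_mul]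
        rw [h1, h2]
        exact pair_cancel_left ⟨r, hr⟩
      · exact lsum_zero_X fun c _ => by simp [zero_mul_F]
    simp only [hz, zero_add_F]
    exact ⟨v, c, rfl, hσ, hσ', mul_sgn_left b (hX s i hi')⟩
  · rintro s ⟨j, b⟩ hj
    have hj' := mem_pairs.1 hj
    rw [pair_grad (fun i _ => by simp [mul_zero_F])]
    simp only [Bool.false_eq_true, if_false, sgn_false, one_mul]
    cases b
    · simpa using hβ s j hj'
    · simp only [sgn_true, neg_one_mul, mul_nx_F]
      have := lsum_nx (F 0) lI (fun i => XFlt.mul (F (X s i) : XFlt p q) (F (A i j)))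
      rw [nx_F, neg_zero] at this
      rw [this, hβ s j hj', nx_F]

/-- The neurons `false` and `true` of a pair in the lower part. The first one has the value `vL`,
except that it may deviate from it where `on` does not hold. -/
abbrev pathLayer (K : Kit p q σ σ' M H) (on : ι → Prop) (β : ι → ℝ) : Layer ι where
  N := Bool
  l := [false, true]
  ok i b v := v = K.vL ∨ (b = false ∧ K.soft ∧ |v| ≤ 1 ∧ ¬ on i)
  γ i b := sgn b * β i

/-- The first neuron transports the gradient to an input, the other ones are constants. -/
abbrev blockLayer (K : Kit p q σ σ' M H) (on : ι → Prop) (γ : ι → Fin 4 → ℝ) : Layer ι where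
  N := Fin 4
  l := [0, 1, 2, 3]
  ok i a v := if a = 0 then
      ∃ r, ((((F 0).add (XFlt.mul (F K.A2) (F v))).add (XFlt.mul (F K.A2') (F K.vc))).add
        (XFlt.mul (F K.C2) (F K.vc))).add (XFlt.mul (F (-K.C2)) (F K.vc)) = (F r : XFlt p q) ∧
        |r| ≤ T q ∧ (on i ∨ ¬ K.soft → r = 0)
    else v = K.vc
  γ i a := γ i a

namespace Kit
variable (K : Kit p q σ σ' M H)

theorem leX_F' {r s : ℝ} (hs : s ∈ floatSet p q) (h : r ≤ s) : LeX (F r : XFlt p q) s := by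
  rw [← F_rd]; exact leX_F (rd_mem r) (rd_le h hs)

theorem two_pow_mem [h : Ok p q] (n : ℕ) (hn : n ≤ 7) : (2 : ℝ) ^ n ∈ floatSet p q := by
  have := h.emin_eq; have := h.seven_le
  have := mem_zpow (p := p) (q := q) n (by omega) (by omega)
  simpa using this

theorem two_pow_le {a b : ℤ} (hab : a ≤ b) : (2 : ℝ) ^ a ≤ 2 ^ b :=
  zpow_le_zpow_right₀ (by norm_num) hab

open Classical in
/-- The gate lets the gradient pass where `on` holds: its two neurons read the bit, and where the bit
is off their pre-activation is low, so that their derivative is rounded to zero. The weights that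
lead to the pair below are so small, compared with the bit, that its values are absorbed. -/
theorem link_gate [h : Ok p q] (on : ι → Prop) {β X β1 : ι → ℝ}
    (hX : ∀ i, on i → XFlt.mul (F (β i) : XFlt p q) (F K.cH) = F (X i))
    (hX0 : ∀ i, ¬ on i → X i = 0) (hX1 : ∀ i, |X i| ≤ 1)
    (hβ : ∀ i, XFlt.mul (F (X i) : XFlt p q) (F (2 ^ K.lc)) = F (β1 i)) :
    Link σ σ' (pairLayer [()] (fun i _ => if on i then K.vH else K.kap) fun i _ => β i)
      ((cellLayer K on fun _ => 0).sum (pathLayer K on β1)) := by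
  have hT := T_pos (q := q)
  have hT32 := T_ge (q := q) p
  have h7 := seven_T_le (p := p) (q := q)
  have hlc := K.lc_le
  have h4 : (2 : ℝ) ^ K.lc ≤ 2 ^ 2 := pow_le_pow_right₀ (by norm_num) hlc
  have hpos : (0 : ℝ) < 2 ^ K.lc := by positivity
  have habs : |(2 : ℝ) ^ K.lc| ≤ 4 := by rw [abs_of_pos hpos]; linarith
  have hm4 : (4 : ℝ) ∈ floatSet p q := by
    have := two_pow_mem (p := p) (q := q) 2 (by norm_num); norm_num at this; exact this
  have hm8 : (8 : ℝ) ∈ floatSet p q := by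
    have := two_pow_mem (p := p) (q := q) 3 (by norm_num); norm_num at this; exact this
  have hmT : 4 * T q ∈ floatSet p q := mT 4 (by norm_num) (by norm_num)
  have hbias : K.onH - 4 * T q ∈ floatSet p q := by
    rcases K.onH_eq with h | h <;> rw [h]
    · exact mT (-4) (by norm_num) (by push_cast; ring)
    · exact mT (-2) (by norm_num) (by push_cast; ring)
  have honH : K.onH ∈ floatSet p q ∧ K.onH ≤ 2 * T q := by
    rcases K.onH_eq with h | h <;> rw [h]
    · exact ⟨zero_mem, by linarith⟩
    · exact ⟨mT 2 (by norm_num) (by push_cast; ring), le_rfl⟩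
  have hvL1 : |K.vL| ≤ 1 := by rw [abs_of_nonneg K.vL_nonneg]; exact K.vL_le
  refine ⟨fun a c => Sum.elim (fun c => sgn c.2 * K.w)
    (fun b => if a.2 then 0 else sgn b * 2 ^ K.lc) c, fun _ => K.onH - 4 * T q,
    fun i a => sgn a.2 * X i, ?_, ?_⟩
  · rintro i v hv ⟨⟨⟩, b⟩ _
    rw [Layer.lsum_sum]
    simp only [Sum.elim_inl, Sum.elim_inr]
    have hcell := K.cell_row on (fun _ => 0) i (v := fun c => v (.inl c))
      (fun a ha => hv (.inl a) (Layer.mem_sum_inl.2 ha))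
    rw [hcell]
    simp only [lsum_cons, lsum_nil, sgn_false, sgn_true, one_mul, neg_one_mul]
    have hvt : v (.inr true) = K.vL := by
      have := hv (.inr true) (Layer.mem_sum_inr.2 (by simp))
      simpa using this
    have hvf := hv (.inr false) (Layer.mem_sum_inr.2 (by simp))
    simp only [Sum.elim_inr, true_and] at hvf
    by_cases hi : on i
    · have hvf : v (.inr false) = K.vL := by
        rcases hvf with h | h
        · exact h
        · exact absurd hi h.2.2
      rw [if_pos hi, hvt, hvf]
      have hz : ((F (4 * T q)).add (XFlt.mul (F (if b then 0 else 2 ^ K.lc)) (F K.vL))).add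
          (XFlt.mul (F (if b then 0 else -2 ^ K.lc)) (F K.vL)) = (F (4 * T q) : XFlt p q) := by
        cases b
        · simp only [Bool.false_eq_true, if_false]
          obtain ⟨t, ht, _⟩ := exists_mul_F (p := p) (q := q) habs hvL1 hm4 one_mem (by linarith)
          -- the product is at most 2, thus absorbed by `4 T`
          have ht2 : |rd p q t| ≤ 2 := by
            have h2 : (2 : ℝ) ∈ floatSet p q := by
              have := two_pow_mem (p := p) (q := q) 1 (by norm_num); norm_num at this; exact this
            have e := mul_F (p := p) (q := q) (two_pow_mem K.lc (by omega)) (rd_mem K.vL) (by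
              have := abs_rd_le (p := p) (q := q) hvL1 one_mem
              rw [abs_mul]
              have := mul_le_mul habs this (abs_nonneg _) (by norm_num)
              linarith)
            rw [F_rd, ht] at e
            rw [F_eq_iff] at e
            rw [e]
            refine abs_rd_le ?_ h2
            have h1 : K.vL ≤ 2 / 2 ^ K.lc := by
              rw [le_div_iff₀ hpos]; linarith [K.vL_le']
            have h3 : (2 / 2 ^ K.lc : ℝ) ∈ floatSet p q := by
              have := h.emin_eq; have := h.seven_le
              have := mem_zpow (p := p) (q := q) (1 - K.lc) (by omega) (by omega)
              rw [zpow_sub₀ (by norm_num)] at this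
              simpa using this
            have h4 := rd_le h1 h3
            have h5 := le_rd K.vL_nonneg (zero_mem (p := p) (q := q))
            rw [abs_of_nonneg (by positivity)]
            rw [le_div_iff₀ hpos] at h4
            linarith
          have habsorb : ∀ s : ℝ, |s| ≤ 2 → s ∈ floatSet p q →
              (F (4 * T q)).add (F s) = (F (4 * T q) : XFlt p q) := by
            intro s hs hsm
            rw [add_F hmT hsm (by
              refine (abs_add_le _ _).trans ?_
              rw [abs_of_pos (by linarith : 0 < 4 * T q)]; linarith)]
            refine F_eq_iff.2 (Eq.trans ?_ (rd_of_mem hmT).symm)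
            rw [four_T]
            refine rd_absorb (okE p q) le_rfl (hs.trans ?_)
            have := h.add_le
            calc (2 : ℝ) = 2 ^ (1 : ℤ) := by norm_num
              _ ≤ _ := two_pow_le (by omega)
          rw [nx_mul_F, ht, nx_F, ← F_rd t, ← F_rd (-t), rd_neg,
            habsorb _ ht2 (rd_mem t), habsorb _ (by rwa [abs_neg]) (neg_mem_floatSet (rd_mem t))]
        · simp [zero_mul_F, add_zero_X]
      rw [hz, add_F_mem hmT hbias (by ring) honH.1]
      exact ⟨K.vH, K.cH, (if_pos hi).symm, K.sig_onH, K.dsig_onH, mul_sgn_left b (hX i hi)⟩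
    · have hvf1 : |v (.inr false)| ≤ 1 := by
        rcases hvf with h | h
        · rw [h]; exact hvL1
        · exact h.2.1
      rw [if_neg hi, hvt]
      have hle : LeX (((F 0).add
        (XFlt.mul (F (if b then 0 else 2 ^ K.lc)) (F (v (.inr false))))).add
          (XFlt.mul (F (if b then 0 else -2 ^ K.lc)) (F K.vL)) : XFlt p q) 8 := by
        cases b
        · simp only [Bool.false_eq_true, if_false]
          obtain ⟨t, ht, ht'⟩ := exists_mul_F (p := p) (q := q) habs hvf1 hm4 one_mem (by linarith)
          obtain ⟨t2, ht2, ht2'⟩ := exists_mul_F (p := p) (q := q) (r := -2 ^ K.lc)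
            (by rwa [abs_neg]) hvL1 hm4 one_mem (by linarith)
          rw [ht, ht2, zero_add_F, ← F_rd t2]
          refine (leX_F' (p := p) (q := q) hm4 ((le_abs_self t).trans (by linarith))).add
            (rd_mem t2) hm8 ?_
          have := rd_le (p := p) (q := q) ((le_abs_self t2).trans (by linarith : |t2| ≤ 4)) hm4
          linarith
        · simp only [if_true, zero_mul_F, add_zero_X]
          exact leX_F zero_mem (by norm_num)
      obtain ⟨h1, h2⟩ := K.low _ (hle.add hbias (mT (-1) (by norm_num) (by push_cast; ring))
        (by linarith [honH.2]))
      refine ⟨K.kap, 0, (if_neg hi).symm, h1, h2, ?_⟩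
      rw [mul_zero_F, hX0 i hi, mul_zero]
  · rintro i (c | b') _
    · simp only [Sum.elim_inl, mul_zero, List.flatMap_cons, List.flatMap_nil, List.append_nil,
        lsum_cons, lsum_nil, sgn_false, sgn_true, one_mul, neg_one_mul]
      refine pair_cancel_left (exists_mul_sgn _ ?_)
      obtain ⟨t, ht, _⟩ := exists_mul_F (p := p) (q := q) (hX1 i)
        (by rw [abs_of_nonneg K.w_bd.1]; exact K.w_bd.2 : |K.w| ≤ T q) one_mem
        (mT 1 (by norm_num) (by norm_num)) (by linarith)
      exact ⟨t, ht⟩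
    · simp only [Sum.elim_inr, List.flatMap_cons, List.flatMap_nil, List.append_nil,
        lsum_cons, lsum_nil, sgn_false, sgn_true, one_mul, neg_one_mul, if_true,
        Bool.false_eq_true, if_false, mul_zero_F, add_zero_X, zero_add_X]
      exact mul_sgn_right b' (hβ i)

theorem mem_sign_zpow [h : Ok p q] {e : ℤ} (he : |e| ≤ 1) {n : ℤ} (hn : emin q - p ≤ n)
    (hn' : n ≤ emax q) : (e : ℝ) * 2 ^ n ∈ floatSet p q := by
  have := mem_zpow (p := p) (q := q) n hn hn'
  rcases Int.abs_le_one_iff.1 he with rfl | rfl | rfl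
  · simpa using zero_mem
  · simpa using this
  · simpa using neg_mem_floatSet this

/-- Below the gate, a gradient is multiplied by `2 ^ s`. Only gradients `e 2 ^ n` with
`e ∈ {0, 1, -1}` occur there, and these are transported exactly. -/
theorem link_path [h : Ok p q] (on : ι → Prop) {e : ι → ℤ} (he : ∀ i, |e i| ≤ 1)
    (he0 : ∀ i, ¬ on i → e i = 0) {n : ℤ} {s : ℕ} (hn : emin q - p ≤ n)
    (hs : s + K.lc ≤ emax q) (hns : n + s + K.lc ≤ emax q) :
    Link σ σ' (pathLayer K on fun i => e i * 2 ^ (n + K.lc))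
      (pathLayer K on fun i => e i * 2 ^ (n + s + K.lc)) := by
  have hT := T_pos (q := q)
  have h7 := seven_T_le (p := p) (q := q)
  have hE := h.seven_le
  have hm := h.emin_eq
  have hp := h.add_le
  have hA : (2 : ℝ) ^ (s + K.lc) ≤ 4 * T q := by
    rw [four_T, ← zpow_natCast]; exact two_pow_le (by push_cast; omega)
  have hApos : (0 : ℝ) < 2 ^ (s + K.lc) := by positivity
  have hAabs : |(2 : ℝ) ^ (s + K.lc)| ≤ 4 * T q := by rwa [abs_of_pos hApos]
  have hAmem : (2 : ℝ) ^ (s + K.lc) ∈ floatSet p q := by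
    have := mem_zpow (p := p) (q := q) ((s + K.lc : ℕ) : ℤ) (by omega) (by push_cast; omega)
    rwa [zpow_natCast] at this
  have hmT : 4 * T q ∈ floatSet p q := mT 4 (by norm_num) (by norm_num)
  have hvL1 : |K.vL| ≤ 1 := by rw [abs_of_nonneg K.vL_nonneg]; exact K.vL_le
  have hlcmem : (2 : ℝ) ^ (-(K.lc : ℤ)) ∈ floatSet p q :=
    mem_zpow _ (by have := K.lc_le; omega) (by omega)
  have hδ : ∀ i, XFlt.mul (F (e i * 2 ^ (n + K.lc)) : XFlt p q) (F (2 ^ (-(K.lc : ℤ)))) =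
      F (e i * 2 ^ n) := fun i => by
    refine mul_F_mem (mem_sign_zpow (he i) (by omega) (by omega)) hlcmem ?_
      (mem_sign_zpow (he i) hn (by omega))
    rw [mul_assoc, ← zpow_add₀ (by norm_num)]; congr 2; ring
  refine ⟨fun b c => if b then 0 else sgn c * 2 ^ (s + K.lc), fun _ => K.onL,
    fun i b => sgn b * (e i * 2 ^ n), ?_, ?_⟩
  · rintro i v hv b _
    have hvt : v true = K.vL := by
      have := hv true (by simp)
      simpa using this
    have hvf : v false = K.vL ∨ (K.soft ∧ |v false| ≤ 1 ∧ ¬ on i) := by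
      have := hv false (by simp)
      simpa using this
    simp only [lsum_cons, lsum_nil, sgn_false, sgn_true, one_mul, neg_one_mul]
    rw [hvt]
    have hex : ((F 0).add (XFlt.mul (F (if b then 0 else 2 ^ (s + K.lc))) (F (v false)))).add
          (XFlt.mul (F (if b then 0 else -2 ^ (s + K.lc))) (F K.vL)) = (F 0 : XFlt p q) →
        Fires σ σ' ((((F 0).add (XFlt.mul (F (if b then 0 else 2 ^ (s + K.lc))) (F (v false)))).add
          (XFlt.mul (F (if b then 0 else -2 ^ (s + K.lc))) (F K.vL))).add (F K.onL))
          (fun v => v = K.vL ∨ (b = false ∧ K.soft ∧ |v| ≤ 1 ∧ ¬ on i))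
          (sgn b * (e i * 2 ^ (n + K.lc))) (sgn b * (e i * 2 ^ n)) := by
      intro hz
      rw [hz, zero_add_F]
      exact ⟨K.vL, _, Or.inl rfl, K.sig_onL, K.dsig_onL, mul_sgn_left b (hδ i)⟩
    cases b
    · simp only [Bool.false_eq_true, if_false] at hex ⊢
      obtain ⟨t2, ht2, ht2'⟩ := exists_mul_F (p := p) (q := q) hAabs hvL1 hmT one_mem (by linarith)
      rcases hvf with hvf | ⟨hsoft, hvf, hon⟩
      · refine hex ?_
        rw [hvf]; exact pair_cancel_left ⟨t2, ht2⟩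
      · obtain ⟨h1, _, h3, h4⟩ := K.soft_spec hsoft
        have h2mem : (1 / 2 : ℝ) ∈ floatSet p q := by
          have := mem_zpow (p := p) (q := q) (-1) (by omega) (by omega)
          simpa using this
        obtain ⟨t2, ht2, ht2'⟩ := exists_mul_F (p := p) (q := q) hAabs
          (by rw [abs_of_nonneg K.vL_nonneg]; exact h3) hmT h2mem (by linarith)
        obtain ⟨t, ht, ht'⟩ := exists_mul_F (p := p) (q := q) hAabs hvf hmT one_mem (by linarith)
        have hm2 : 2 * T q ∈ floatSet p q := mT 2 (by norm_num) (by norm_num)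
        have b1 := abs_rd_le (p := p) (q := q) (ht'.trans_eq (mul_one _)) hmT
        have b2 := abs_rd_le (p := p) (q := q)
          (ht2'.trans (by linarith : 4 * T q * (1 / 2) ≤ 2 * T q)) hm2
        have hz : ((F 0).add (XFlt.mul (F (2 ^ (s + K.lc))) (F (v false)))).add
            (XFlt.mul (F (-2 ^ (s + K.lc))) (F K.vL)) = (F (rd p q t + -rd p q t2) : XFlt p q) := by
          rw [nx_mul_F, ht, ht2, nx_F, zero_add_F, ← F_rd t, ← F_rd (-t2), rd_neg]
          refine add_F (rd_mem t) (neg_mem_floatSet (rd_mem t2)) ?_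
          refine (abs_add_le _ _).trans ?_
          rw [abs_neg]; linarith
        rw [hz, h1, add_zero_F]
        obtain ⟨v', d, hv', hs1, hs2⟩ := h4 (rd p q t + -rd p q t2)
        refine ⟨v', d, Or.inr ⟨trivial, hsoft, hv', hon⟩, hs1, hs2, ?_⟩
        simp [he0 i hon, zero_mul_F]
    · simp only [if_true] at hex ⊢
      exact hex (by simp [zero_mul_F, add_zero_X])
  · rintro i b _
    simp only [lsum_cons, lsum_nil, if_true, Bool.false_eq_true, if_false, mul_zero_F, add_zero_X,
      zero_add_X, sgn_false, one_mul]
    refine mul_sgn_right b (mul_F_mem (mem_sign_zpow (he i) hn (by omega)) hAmem ?_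
      (mem_sign_zpow (he i) (by omega) hns))
    rw [mul_assoc, ← zpow_natCast, ← zpow_add₀ (by norm_num)]; congr 2; push_cast; ring

/-- `N` layers can multiply a gradient by every power of two up to a certain size. -/
theorem chain_path [h : Ok p q] (on : ι → Prop) {e : ι → ℤ} (he : ∀ i, |e i| ≤ 1)
    (he0 : ∀ i, ¬ on i → e i = 0) (N : ℕ) {n : ℤ} (hn : emin q - p ≤ n) (S : ℕ)
    (hS : (S : ℤ) ≤ N * (emax q - K.lc)) (hnS : n + S + K.lc ≤ emax q) :
    Chain σ σ' N (pathLayer K on fun i => e i * 2 ^ (n + K.lc))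
      (pathLayer K on fun i => e i * 2 ^ (n + S + K.lc)) := by
  have hE := h.seven_le
  have hlc := K.lc_le
  induction N generalizing S with
  | zero =>
    obtain rfl : S = 0 := by push_cast at hS; omega
    simp [Chain]
  | succ N ih =>
    obtain ⟨w, hw⟩ := Int.eq_ofNat_of_zero_le (show 0 ≤ emax q - K.lc by omega)
    rw [hw] at hS ih
    set s := min S w with hs
    have h1 : ((S - s : ℕ) : ℤ) ≤ N * w := by
      have : S ≤ (N + 1) * w := by exact_mod_cast hS
      have h2 : S - s ≤ N * w := by
        rw [hs]
        rcases le_total S w with h | h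
        · rw [min_eq_left h]; simp
        · rw [min_eq_right h]; rw [Nat.sub_le_iff_le_add]; linarith
      exact_mod_cast h2
    have hsS : s ≤ S := min_le_left _ _
    have hsw : s ≤ w := min_le_right _ _
    refine ⟨_, ih (S - s) h1 (by omega), ?_⟩
    have := K.link_path on he he0 (n := n + (S - s : ℕ)) (s := s) (by omega) (by omega) (by omega)
    have e : n + ((S - s : ℕ) : ℤ) + s = n + S := by omega
    rwa [e] at this

/-- The step from a pair to the neurons of the first layer. -/
theorem link_block [h : Ok p q] (on : ι → Prop) {e : ι → ℤ} (he : ∀ i, |e i| ≤ 1)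
    (he0 : ∀ i, ¬ on i → e i = 0) {n : ℤ} (hn : emin q - p ≤ n) (hn' : n + K.lc ≤ emax q)
    {γ : ι → Fin 4 → ℝ}
    (hγ : ∀ i a, XFlt.mul (F (e i * 2 ^ n) : XFlt p q) (F (![K.A2, K.A2', K.C2, -K.C2] a)) =
      F (γ i a)) :
    Link σ σ' (pathLayer K on fun i => e i * 2 ^ (n + K.lc)) (blockLayer K on γ) := by
  have hE := h.seven_le
  have hm := h.emin_eq
  have hlc := K.lc_le
  have hδ : ∀ i, XFlt.mul (F (e i * 2 ^ (n + K.lc)) : XFlt p q) (F (2 ^ (-(K.lc : ℤ)))) =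
      F (e i * 2 ^ n) := fun i => by
    refine mul_F_mem (mem_sign_zpow (he i) (by omega) (by omega))
      (mem_zpow _ (by have := K.lc_le; omega) (by omega)) ?_
      (mem_sign_zpow (he i) hn (by omega))
    rw [mul_assoc, ← zpow_add₀ (by norm_num)]; congr 2; ring
  refine ⟨fun b c => if b then 0 else ![K.A2, K.A2', K.C2, -K.C2] c, fun _ => K.onL,
    fun i b => sgn b * (e i * 2 ^ n), ?_, ?_⟩
  · rintro i v hv b _
    cases b
    · have h0 := hv 0 (by simp)
      have h1 := hv 1 (by simp)
      have h2 := hv 2 (by simp)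
      have h3 := hv 3 (by simp)
      simp only [if_true, one_ne_zero, if_false, Fin.reduceEq] at h0 h1 h2 h3
      obtain ⟨r, hr, hrT, hr0⟩ := h0
      have hz : lsum (F 0) [(0 : Fin 4), 1, 2, 3] (fun c =>
          XFlt.mul (F (if false then 0 else ![K.A2, K.A2', K.C2, -K.C2] c)) (F (v c))) =
          (F r : XFlt p q) := by
        rw [← hr]
        simp [h1, h2, h3]
      rw [hz]
      by_cases hc : on i ∨ ¬ K.soft
      · rw [hr0 hc, zero_add_F]
        exact ⟨K.vL, _, Or.inl rfl, K.sig_onL, K.dsig_onL, mul_sgn_left false (hδ i)⟩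
      · push Not at hc
        obtain ⟨g1, _, g3, g4⟩ := K.soft_spec hc.2
        obtain ⟨v', d, hv', hs1, hs2⟩ := g4 r
        rw [g1, add_zero_F]
        refine ⟨v', d, Or.inr ⟨rfl, hc.2, hv', hc.1⟩, hs1, hs2, ?_⟩
        simp [he0 i hc.1, zero_mul_F]
    · simp only [if_true]
      rw [lsum_zero_X (fun c _ => zero_mul_F _), zero_add_F]
      exact ⟨K.vL, _, Or.inl rfl, K.sig_onL, K.dsig_onL, mul_sgn_left true (hδ i)⟩
  · rintro i c _
    simp only [lsum_cons, lsum_nil, if_true, Bool.false_eq_true, if_false, mul_zero_F, add_zero_X,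
      zero_add_X, sgn_false, one_mul]
    exact hγ i c

variable {d : ℕ} {x : ι → Fin d → Flt p q}

/-- The gradient `e i * 2 ^ k` is delivered to the input `j`. In the first layer a gradient neuron
depends on the input and cannot be paired with a copy whose gradient is opposite; constant neurons,
which do not pass any gradient to the input, cancel its value instead. -/
theorem exists_block [h : Ok p q] (on : ι → Prop) {e : ι → ℤ} (he : ∀ i, |e i| ≤ 1)
    (he0 : ∀ i, ¬ on i → e i = 0) {k : ℤ} (hk : emin q - p ≤ k) (hk' : k ≤ emax q - p)
    (j : Fin d) {x0 : ℝ} (hx0 : x0 ∈ floatSet p q) (hx0M : |x0| ≤ M)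
    (hx : ∀ i, |(x i j : ℝ)| ≤ M) (hon : ∀ i, on i → (x i j : ℝ) = x0) :
    ∃ γ, Link σ σ' (pathLayer K on fun i => e i * 2 ^ (k + K.m2 + K.lc)) (blockLayer K on γ) ∧
      Feed σ σ' x (fun _ => True) (blockLayer K on γ) fun i j' => if j' = j then e i * 2 ^ k else
        0 := by
  have hE := h.seven_le
  have hm := h.emin_eq
  have hp2 := h.two_le
  have hp8 := h.p_le
  have hpE := h.add_le
  have hm2 := K.m2_le
  have hT := T_pos (q := q)
  have h7 := seven_T_le (p := p) (q := q)
  obtain ⟨k1, hk1, hd1⟩ := K.d1_bd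
  have hA2 : K.A2 = 2 ^ ((k1 : ℤ) - K.m2) := by
    have := K.A2_eq
    rw [hd1] at this
    rw [zpow_sub₀ (by norm_num), div_eq_mul_inv, ← zpow_neg, ← this, mul_comm K.A2, ← mul_assoc,
      ← zpow_add₀ (by norm_num)]
    simp
  have hA2mem : K.A2 ∈ floatSet p q := hA2 ▸ mem_zpow _ (by omega) (by omega)
  have hA2pos : 0 < K.A2 := by rw [hA2]; positivity
  have hXabs : ∀ i, |(e i : ℝ) * 2 ^ (k + K.m2)| ≤ 2 ^ (k + K.m2) := fun i => by
    rw [abs_mul, abs_of_pos (by positivity : (0:ℝ) < 2 ^ (k + K.m2))]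
    have : |(e i : ℝ)| ≤ 1 := by exact_mod_cast he i
    exact mul_le_of_le_one_left (by positivity) this
  have hXmem : (2 : ℝ) ^ (k + K.m2) ∈ floatSet p q := mem_zpow _ (by omega) (by omega)
  have hb1 : (2 : ℝ) ^ (k + K.m2) * K.A2 ≤ 4 * T q := by
    rw [hA2, ← zpow_add₀ (by norm_num), four_T]; exact two_pow_le (by omega)
  have hb2 : (2 : ℝ) ^ (k + K.m2) * 2 ≤ 4 * T q := by
    have := K.m2_lt
    rw [← zpow_add_one₀ (by norm_num), four_T]; exact two_pow_le (by omega)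
  have h2mem : (2 : ℝ) ∈ floatSet p q := by
    simpa using two_pow_mem (p := p) (q := q) 1 (by norm_num)
  have hC : |K.C2| ≤ 2 := by rw [abs_of_nonneg K.C2_bd.1]; exact K.C2_bd.2
  have hfin : ∀ i a, ∃ t, XFlt.mul (F (e i * 2 ^ (k + K.m2)) : XFlt p q)
      (F (![K.A2, K.A2', K.C2, -K.C2] a)) = F t ∧ |t| ≤ 4 * T q := by
    intro i a
    have r1 := fun s (hs : |s| ≤ K.A2) => exists_mul_F (p := p) (q := q) (hXabs i) hs hXmem hA2mem
      (by linarith)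
    have r2 := fun s (hs : |s| ≤ 2) => exists_mul_F (p := p) (q := q) (hXabs i) hs hXmem h2mem
      (by linarith)
    fin_cases a
    · obtain ⟨t, ht, ht'⟩ := r1 K.A2 (by rw [abs_of_pos hA2pos])
      exact ⟨t, ht, ht'.trans hb1⟩
    · obtain ⟨t, ht, ht'⟩ := r1 K.A2' K.A2'_bd
      exact ⟨t, ht, ht'.trans hb1⟩
    · obtain ⟨t, ht, ht'⟩ := r2 K.C2 hC
      exact ⟨t, ht, ht'.trans hb2⟩
    · obtain ⟨t, ht, ht'⟩ := r2 (-K.C2) (by rwa [abs_neg])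
      exact ⟨t, ht, ht'.trans hb2⟩
  choose γ hγ hγ' using hfin
  refine ⟨γ, K.link_block on he he0 (by omega) (by omega) hγ, ?_⟩
  have hmT : 4 * T q ∈ floatSet p q := mT 4 (by norm_num) (by norm_num)
  have hfin2 : ∀ i a, ∃ t, XFlt.mul (F (γ i a) : XFlt p q) (F K.dc) = F t := fun i a => by
    obtain ⟨t, ht, _⟩ := exists_mul_F (p := p) (q := q) (hγ' i a) K.dc_bd hmT one_mem (by linarith)
    exact ⟨t, ht⟩
  choose δ hδ using hfin2
  have hγ0 : ∀ i, (F (γ i 0) : XFlt p q) = F (e i * 2 ^ (k + k1)) := fun i => by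
    rw [← hγ i 0]
    refine mul_F_mem (mem_sign_zpow (he i) (by omega) (by omega)) hA2mem ?_
      (mem_sign_zpow (he i) (by omega) (by omega))
    simp only [Matrix.cons_val_zero]
    rw [hA2, mul_assoc, ← zpow_add₀ (by norm_num)]; congr 2; ring
  refine ⟨fun a j' => if a = 0 ∧ j' = j then 1 else 0, fun a => if a = 0 then K.b1 x0 else K.zc,
    fun i a => if a = 0 then e i * 2 ^ k else δ i a, ?_, ?_⟩
  · intro i a _
    by_cases ha : a = 0
    · subst ha
      have hz : lsum (F 0) (List.finRange d) (fun j' =>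
          XFlt.mul (F (if (0 : Fin 4) = 0 ∧ j' = j then 1 else 0)) (F (x i j' : ℝ))) =
          (F (x i j : ℝ) : XFlt p q) := by
        rw [lsum_sublist (s := [j]) (by simp) (List.nodup_finRange d)
          (fun a _ ha => by rw [if_neg (by simpa using ha), zero_mul_F])]
        simp only [true_and, lsum_cons, lsum_nil, if_true, zero_add_X]
        exact mul_F_mem one_mem (x i j).2 (one_mul _) (x i j).2
      rw [hz]
      obtain ⟨v, ε, hv, hε, hε1, r, hr, hr1, hr0⟩ := K.first _ (x i j).2 x0 hx0 (hx i) hx0M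
      refine ⟨v, ε, ?_, hv, hε, ?_⟩
      · simp only [if_true]
        exact ⟨r, hr, hr1, fun hc => hr0 (hc.imp_left (hon i))⟩
      · simp only [if_true]
        rw [hγ0]
        by_cases hi : on i
        · rw [hε1 (hon i hi)]
          refine mul_F_mem (mem_sign_zpow (he i) (by omega) (by omega))
            (hd1 ▸ mem_zpow _ (by omega) (by omega)) ?_ (mem_sign_zpow (he i) (by omega) (by omega))
          rw [hd1, mul_assoc, ← zpow_add₀ (by norm_num)]; congr 2; ring
        · simp [he0 i hi, zero_mul_F]
    · simp only [ha, false_and, if_false]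
      rw [lsum_zero_X (fun c _ => zero_mul_F _), zero_add_F]
      exact ⟨K.vc, K.dc, rfl, K.sig_zc.1, K.sig_zc.2, hδ i a⟩
  · intro i j' z _
    by_cases hj : j' = j
    · subst hj
      simp [mul_one_F, mul_zero_F, add_zero_X]
    · simp [hj, mul_zero_F, add_zero_X]

end Kit
end

/-! ### The network as a sum of units, one for each point and each unit of a value or a gradient -/

section
variable {ι : Type} {σ σ' : XFlt p q → XFlt p q} {M H : ℝ}

/-- Sums of multiples of a power of two are exact if no overflow of the mantissa is possible. -/
theorem lsum_int [h : Ok p q] {α : Type*} {k : ℤ} (hk : emin q - p ≤ k) (hk' : k ≤ emax q - p)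
    (l : List α) (f : α → ℤ) (m : ℤ) (hm : |m| + (l.map fun a => |f a|).sum < 2 ^ (p + 1)) :
    lsum (F (m * 2 ^ k)) l (fun a => F (f a * 2 ^ k)) =
      (F ((m + (l.map f).sum : ℤ) * 2 ^ k) : XFlt p q) := by
  induction l generalizing m with
  | nil => simp
  | cons a l ih =>
    simp only [List.map_cons, List.sum_cons] at hm ⊢
    have h1 := abs_add_le m (f a)
    have h2 := abs_nonneg m
    have h3 : 0 ≤ (l.map fun a => |f a|).sum := List.sum_nonneg (by simp)
    have h4 := abs_nonneg (f a)
    rw [lsum_cons, add_F_mem (mem_int m k (by omega) hk hk') (mem_int (f a) k (by omega) hk hk')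
      (by push_cast; ring) (mem_int (m + f a) k (by omega) hk hk'), ih _ (by omega), add_assoc]

/-- Every float is a multiple of a power of two, and the multiples up to it are floats as well. -/
theorem exists_unary [Ok p q] {r : ℝ} (hr : r ∈ floatSet p q) :
    ∃ (c : ℤ) (n : ℕ) (k : ℤ), (c = 1 ∨ c = -1) ∧ r = n * (c * 2 ^ k) ∧ n < 2 ^ (p + 1) ∧
      emin q - p ≤ k ∧ k ≤ emax q - p := by
  obtain ⟨m, k, rfl, h1, h2, h3, _⟩ := mem_canon hr
  obtain ⟨n, rfl | rfl⟩ := Int.eq_nat_or_neg m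
  · exact ⟨1, n, k, Or.inl rfl, by push_cast; ring, by simpa using (by exact_mod_cast h1), h2, h3⟩
  · rw [abs_neg] at h1
    exact ⟨-1, n, k, Or.inr rfl, by push_cast; ring, by simpa using (by exact_mod_cast h1), h2, h3⟩

/-- The list of all elements with a property, used to index families of neurons. -/
theorem exists_list {τ : Type} [Finite τ] (P : τ → Prop) :
    ∃ l : List τ, l.Nodup ∧ ∀ t, t ∈ l ↔ P t :=
  ⟨(Set.toFinite {t | P t}).toFinset.toList, Finset.nodup_toList _, fun t => by simp⟩

namespace Kit
variable (K : Kit p q σ σ' M H) {d : ℕ} {x : ι → Fin d → Flt p q}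

/-- The comparisons that together decide whether the input is `x0`: with every float on either side
of a coordinate of `x0`. -/
theorem exists_tests [Ok p q] (hx : ∀ i j, |(x i j : ℝ)| ≤ M) (x0 : Fin d → Flt p q) :
    ∃ (τ : Type) (l : List τ) (bad : τ → ι → Prop), l.Nodup ∧
      (∀ i, x i = x0 ↔ ∀ t ∈ l, ¬ bad t i) ∧
      Feed σ σ' x (fun _ => True) (K.testLayer l bad 0) fun _ _ => 0 := by
  have : Finite (Flt p q) := (floatSet_finite p q).to_subtype
  obtain ⟨l, hl, hl'⟩ := exists_list fun t : Fin d × {t : Flt p q // |(t : ℝ)| ≤ M} × Bool =>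
    sgn t.2.2 * (x0 t.1 : ℝ) < sgn t.2.2 * (t.2.1.1 : ℝ)
  refine ⟨_, l, fun t i => sgn t.2.2 * (t.2.1.1 : ℝ) ≤ sgn t.2.2 * (x i t.1 : ℝ), hl, ?_, ?_⟩
  · intro i
    constructor
    · intro hi t ht
      simp only [hi]
      exact not_le.2 ((hl' t).1 ht)
    · intro h
      funext j
      by_contra hne
      have hne : (x i j : ℝ) ≠ x0 j := fun e => hne (Subtype.ext e)
      rcases hne.lt_or_gt with h1 | h1
      · exact h ⟨j, ⟨x i j, hx i j⟩, true⟩ ((hl' _).2 (by simpa using h1)) le_rfl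
      · exact h ⟨j, ⟨x i j, hx i j⟩, false⟩ ((hl' _).2 (by simpa using h1)) le_rfl
  · refine Feed.fam (t := fun _ _ _ => 0) (fun t => ?_) (fun i j z _ => ?_)
    · refine K.feed_test t.1 t.2.1.1.2 t.2.1.2 (fun i => hx i _) ?_
      cases t.2.2 <;> simp
    · rw [lsum_zero_X (fun _ _ => rfl), add_zero_X]

/-- A bit is carried through any number of layers. -/
theorem chain_cell [Ok p q] (on : ι → Prop) (m : ℕ) :
    Chain σ σ' m (cellLayer K on fun _ => 0) (cellLayer K on fun _ => 0) := by
  induction m with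
  | zero => rfl
  | succ m ih => exact ⟨_, ih, K.link_cell_cell on _⟩

theorem chain_cell_test [h : Ok p q] (on : ι → Prop) {τ : Type} {l : List τ} {bad : τ → ι → Prop}
    (hl : l.Nodup) (hon : ∀ i, on i ↔ ∀ t ∈ l, ¬ bad t i) :
    Chain σ σ' K.nt (cellLayer K on fun _ => 0) (K.testLayer l bad 0) := by
  have hnt := K.nt_ge
  have := (K.link_cell_test on l bad hon).chain.trans (K.chain_test l hl bad (K.nt - 1) (by omega))
  rwa [show 1 + (K.nt - 1) = K.nt by omega] at this

open Classical in
/-- A unit that contributes `s 2 ^ k` to the output at the input `x0`. -/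
theorem exists_value_unit [Ok p q] (hx : ∀ i j, |(x i j : ℝ)| ≤ M) {y : ι → ℝ}
    (hy : ∀ i, y i ∈ floatSet p q) (hyH : ∀ i, |y i| ≤ H) {x0 : Fin d → Flt p q} {on : ι → Prop}
    (hon : ∀ i, on i ↔ x i = x0)
    {k : ℤ} (hk : emin q - p ≤ k) (hk' : k ≤ emax q - p) {s : ℝ} (hs : s = 1 ∨ s = -1) {m : ℕ}
    (hm : 1 ≤ m) :
    ∃ U D, Top (p := p) (q := q) y (fun _ => True) U (fun i => if on i then s * 2 ^ k else 0) ∧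
      Chain σ σ' (m + 1 + K.nt) U D ∧ Feed σ σ' x (fun _ => True) D fun _ _ => 0 := by
  obtain ⟨τ, l, bad, hl, hl', hfeed⟩ := K.exists_tests hx x0
  obtain ⟨U, g, htop, hlink⟩ := K.exists_value hy hyH hk hk' hs on
  refine ⟨U, _, htop, ?_, hfeed⟩
  obtain ⟨m, rfl⟩ := Nat.exists_eq_add_of_le hm
  have := ((hlink.chain.trans (K.link_cell_cell on g).chain).trans (K.chain_cell on m)).trans
    (K.chain_cell_test on hl fun i => (hon i).trans (hl' i))
  rwa [show 1 + m + 1 = 1 + 1 + m by omega]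

open Classical in
/-- A unit that delivers the gradient `e i * 2 ^ k` to the input `j` at the input `x0`, given neurons
that turn the gradient of the output into `e i` times the least positive float. -/
theorem exists_path_unit [h : Ok p q] (hx : ∀ i j, |(x i j : ℝ)| ≤ M) {x0 : Fin d → Flt p q}
    (hx0 : ∀ j, |(x0 j : ℝ)| ≤ M) {on : ι → Prop} (hon : ∀ i, on i ↔ x i = x0)
    {e : ι → ℤ} (he : ∀ i, |e i| ≤ 1) (he0 : ∀ i, ¬ on i → e i = 0)
    {k : ℤ} (hk : emin q - p ≤ k) (hk' : k ≤ emax q - p) (j : Fin d) {m : ℕ}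
    {U : Layer ι} {β : ι → ℝ} (hU : Chain σ σ' m U
      (pairLayer [()] (fun i _ => if on i then K.vH else K.kap) fun i _ => β i))
    (hβ : ∀ i, on i → XFlt.mul (F (β i) : XFlt p q) (F K.cH) = F (e i * eta p q)) :
    ∃ D, Chain σ σ' (m + 1 + K.nt) U D ∧
      Feed σ σ' x (fun _ => True) D fun i j' => if j' = j then e i * 2 ^ k else 0 := by
  have hE := h.seven_le
  have hmin := h.emin_eq
  have hlc := K.lc_le
  have hp2 := h.two_le
  have hp8 := h.p_le
  have hm2 := K.m2_le
  have hnt := K.nt_ge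
  obtain ⟨τ, l, bad, hl, hl', hfeed⟩ := K.exists_tests hx x0
  obtain ⟨γ, hblock, hfeed'⟩ := K.exists_block on he he0 hk hk' j (x0 j).2 (hx0 j) (fun i => hx i j)
    (fun i hi => by rw [(hon i).1 hi])
  refine ⟨(K.testLayer l bad 0).sum (blockLayer K on γ), ?_, ?_⟩
  · have hgate := K.link_gate on (X := fun i => e i * eta p q) hβ
      (fun i hi => by simp [he0 i hi]) (fun i => by
        have h1 : |(e i : ℝ)| ≤ 1 := by exact_mod_cast he i
        have h2 : eta p q ≤ 1 := by
          unfold eta; exact zpow_le_one_of_nonpos₀ (by norm_num) (by omega)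
        rw [abs_mul, abs_of_pos eta_pos]
        nlinarith [eta_pos (p := p) (q := q), abs_nonneg (e i : ℝ)])
      (β1 := fun i => e i * 2 ^ (emin q - p + K.lc)) (fun i => by
        refine mul_F_mem (mem_sign_zpow (he i) le_rfl (by omega)) (two_pow_mem _ (by omega)) ?_
          (mem_sign_zpow (he i) (by omega) (by omega))
        rw [eta, mul_assoc, ← zpow_natCast, ← zpow_add₀ (by norm_num)])
    obtain ⟨S, hS⟩ := Int.eq_ofNat_of_zero_le (show 0 ≤ k + K.m2 - (emin q - p) by omega)
    have hreach := K.reach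
    have hpath := K.chain_path on he he0 (K.nt - 1) (n := emin q - p) le_rfl S (by
      push_cast [show 1 ≤ K.nt by omega]
      refine le_trans ?_ hreach
      omega) (by omega)
    rw [show emin q - p + (S : ℤ) + K.lc = k + K.m2 + K.lc by omega] at hpath
    have hp' := hpath.trans hblock.chain
    rw [show K.nt - 1 + 1 = K.nt by omega] at hp'
    exact (hU.trans hgate.chain).trans
      ((K.chain_cell_test on hl fun i => (hon i).trans (hl' i)).sum hp')
  · exact hfeed.sum hfeed' (fun _ _ _ _ => trivial) fun i j z _ => by rw [add_zero_X]

/-- In a sum over groups of equal terms, only the group `a` counts. -/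
theorem lsum_groups [h : Ok p q] {α : Type} {l : List α} (hl : l.Nodup) (n : α → ℕ) {f : α → ℝ}
    {a : α} (ha : a ∈ l) (h0 : ∀ b, b ≠ a → f b = 0) {k : ℤ} (hk : emin q - p ≤ k)
    (hk' : k ≤ emax q - p) {c : ℤ} (hc : |c| ≤ 1) (hf : f a = c * 2 ^ k) (hn : n a < 2 ^ (p + 1)) :
    lsum (F 0) (l.sigma fun a => List.range (n a)) (fun b => F (f b.1)) =
      (F (n a * (c * 2 ^ k)) : XFlt p q) := by
  unfold List.sigma
  rw [lsum_block hl ha (fun b _ hb t ht => by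
    obtain ⟨r, _, rfl⟩ := List.mem_map.1 ht
    show (F (f b) : XFlt p q) = F 0
    rw [h0 b hb]), lsum_map]
  show lsum (F 0) (List.range (n a)) (fun _ => F (f a)) = (_ : XFlt p q)
  rw [hf]
  have := lsum_int (p := p) (q := q) hk hk' (List.range (n a)) (fun _ => c) 0 (by
    have : (n a : ℤ) < 2 ^ (p + 1) := by exact_mod_cast hn
    simp only [List.map_const', List.length_range, List.sum_replicate, nsmul_eq_mul, abs_zero,
      zero_add]
    nlinarith)
  simpa [mul_assoc] using this

open Classical in
/-- A network with prescribed values and gradients. In the situation `i`, the input is `X (loc i)`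
and the gradient of the output is `y i`. The gradients that are to be computed are multiples of
vectors `r w`, with factors in `{0, 1, -1}` of which at most one is different from zero. -/
theorem exists_net [h : Ok p q] {P W : Type} [Finite P] [Finite W] {X : P → Fin d → Flt p q}
    (hX : X.Injective) (hXM : ∀ a j, |(X a j : ℝ)| ≤ M) (loc : ι → P) {y : ι → ℝ}
    (hy : ∀ i, y i ∈ floatSet p q) (hyH : ∀ i, |y i| ≤ H) (f : P → Flt p q) (wl : W → P)
    (e : W → ι → ℤ) (he : ∀ w i, |e w i| ≤ 1) (he0 : ∀ w i, loc i ≠ wl w → e w i = 0)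
    (r : W → Fin d → Flt p q) (G : ι → Fin d → ℝ)
    (hG : ∀ i j, (∀ w, e w i = 0) ∧ G i j = 0 ∨
      ∃ w, (∀ w', w' ≠ w → e w' i = 0) ∧ G i j = e w i * r w j)
    {m : ℕ} (hm : 1 ≤ m)
    (hpath : ∀ w (s : ℤ), s = 1 ∨ s = -1 → ∃ (U : Layer ι) (β : ι → ℝ),
      Top (p := p) (q := q) y (· = F 0) U (fun _ => 0) ∧
      Chain σ σ' m U
        (pairLayer [()] (fun i _ => if loc i = wl w then K.vH else K.kap) fun i _ => β i) ∧
      ∀ i, loc i = wl w →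
        XFlt.mul (F (β i) : XFlt p q) (F K.cH) = F ((s * e w i : ℤ) * eta p q)) :
    ∃ N : Net p q (m + K.nt + 3) d 1, ∀ i,
      N.eval σ (toX (X (loc i))) = (fun _ => F (f (loc i) : ℝ)) ∧
      N.grad σ σ' (toX (X (loc i))) (fun _ => F (y i)) = fun j => F (G i j) := by
  have hx : ∀ i j, |(X (loc i) j : ℝ)| ≤ M := fun i j => hXM _ j
  have hon : ∀ a i, loc i = a ↔ X (loc i) = X a := fun a i => hX.eq_iff.symm
  -- values and gradients in unary representation
  choose cv nv kv hcv hfv hnv hkv hkv' using fun a => exists_unary (f a).2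
  choose cg ng kg hcg hrg hng hkg hkg' using fun a : W × Fin d => exists_unary (r a.1 a.2).2
  have hse : ∀ a i, |cg a * e a.1 i| ≤ 1 := fun a i => by
    rcases hcg a with h | h <;> rw [h] <;> simpa using he a.1 i
  choose Uv Dv htv hcv' hfeedv using fun a => K.exists_value_unit hx hy hyH (hon a) (hkv a) (hkv' a)
    (s := cv a) (by rcases hcv a with h | h <;> rw [h] <;> simp) hm
  choose Ug β htg hcg' hβ using fun a : W × Fin d => hpath a.1 (cg a) (hcg a)
  choose Dg hcg'' hfeedg using fun a : W × Fin d => K.exists_path_unit hx (hXM (wl a.1))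
    (hon (wl a.1)) (hse a) (fun i hi => by rw [he0 a.1 i hi, mul_zero]) (hkg a) (hkg' a) a.2
    (hcg' a) (hβ a)
  obtain ⟨lv, hlv, hlv'⟩ := exists_list fun _ : P => True
  obtain ⟨lg, hlg, hlg'⟩ := exists_list fun _ : W × Fin d => True
  have ndv := hlv.sigma fun a => List.nodup_range (n := nv a)
  have ndg := hlg.sigma fun a => List.nodup_range (n := ng a)
  have top1 := Top.fam (K := lg.sigma fun a => List.range (ng a)) (S := fun _ => 0)
    (fun k => htg k.1) (fun k i z hz => by rw [hz, add_zero_X]) (fun _ hz => hz)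
    (fun i z _ => by rw [lsum_zero_X (fun _ _ => rfl), add_zero_X])
  have top2 := Top.fam (I := (· = F 0)) (K := lv.sigma fun a => List.range (nv a))
    (S := fun i => (f (loc i) : ℝ)) (fun k => htv k.1) (fun _ _ _ _ => trivial)
    (fun _ _ => trivial) (fun i z hz => by
      rw [hz, zero_add_X, hfv (loc i)]
      exact lsum_groups hlv nv (f := fun a => if loc i = a then (cv a : ℝ) * 2 ^ kv a else 0)
        ((hlv' (loc i)).2 trivial) (fun b hb => if_neg (Ne.symm hb)) (hkv _) (hkv' _)
        (by rcases hcv (loc i) with h | h <;> rw [h] <;> simp) (if_pos rfl) (hnv _))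
  have chain := (Chain.fam ndg fun k : Σ _ : W × Fin d, ℕ => hcg'' k.1).sum
    (Chain.fam ndv fun k : Σ _ : P, ℕ => hcv' k.1)
  have feed1 := Feed.fam (I := (· = F 0)) (K := lg.sigma fun a => List.range (ng a)) (T := G)
    (fun k => hfeedg k.1) (fun i j z hz => by
      rw [hz, zero_add_X]
      rcases hG i j with ⟨hw, hGij⟩ | ⟨w, hw, hGij⟩
      · rw [hGij]
        exact lsum_zero_X fun k _ => by simp [hw]
      · have hmul : G i j = ng (w, j) * ((cg (w, j) * e w i : ℤ) * 2 ^ kg (w, j)) := by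
          rw [hGij, hrg (w, j)]; push_cast; ring
        rw [hmul]
        exact lsum_groups hlg ng
          (f := fun a => if j = a.2 then ((cg a * e a.1 i : ℤ) : ℝ) * 2 ^ kg a else 0)
          ((hlg' (w, j)).2 trivial) (fun b hb => by
            by_cases hj : j = b.2
            · have : b.1 ≠ w := fun h => hb (Prod.ext h hj.symm)
              simp [hw _ this]
            · simp [hj]) (hkg _) (hkg' _)
          (hse _ _) (if_pos rfl) (hng _))
  have feed2 := Feed.fam (I := fun _ => True) (K := lv.sigma fun a => List.range (nv a))
    (T := fun _ _ => 0) (fun k => hfeedv k.1)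
    (fun i j z _ => by rw [lsum_zero_X (fun _ _ => rfl), add_zero_X])
  have feed := feed1.sum feed2 (T := G) (fun _ _ _ _ => trivial) (fun i j z _ => by rw [add_zero_X])
  have hlow := K.low_F (-2) (by norm_num) (by norm_num)
  have hnet := ((top1.sum top2).netAbove (σ := σ) (σ' := σ') (k := K.kap)).chain hlow.1 hlow.2 chain
  rw [show 1 + (m + 1 + K.nt) = m + K.nt + 2 by omega] at hnet
  exact hnet.exists_net hlow.1 hlow.2 feed

end Kit
end

/-! ### Conversion of the gradient of the output into the least positive float -/

section
variable {ι : Type} {σ σ' : XFlt p q → XFlt p q} {M H : ℝ}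

namespace Kit
variable (K : Kit p q σ σ' M H)

open Classical in
/-- A bound for gradients in the upper part, in terms of the derivative there. A derivative `1 / 4`
is compensated by weights with a factor `4`, which requires some room below the largest float. -/
noncomputable def bd : ℝ := if K.cH = 1 then Omega p q else T q / 4

theorem bd_eq : (K.cH = 1 ∧ K.bd = Omega p q) ∨ (K.cH = 1 / 4 ∧ K.bd = T q / 4) := by
  rcases K.cH_eq with h | h
  · exact Or.inl ⟨h.1, if_pos h.1⟩
  · exact Or.inr ⟨h.1, if_neg (by rw [h.1]; norm_num)⟩

theorem le_bd : H ≤ K.bd := by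
  rcases K.cH_eq with h | h
  · rw [bd, if_pos h.1]; exact h.2
  · rw [bd, if_neg (by rw [h.1]; norm_num)]; exact h.2

theorem quarter_mem [h : Ok p q] : (1 / 4 : ℝ) ∈ floatSet p q := by
  have := h.emin_eq; have := h.seven_le
  have := mem_zpow (p := p) (q := q) (-2) (by omega) (by omega)
  norm_num at this ⊢; exact this

theorem cH_mem [Ok p q] : K.cH ∈ floatSet p q := by
  rcases K.cH_eq with h | h <;> rw [h.1]
  · exact one_mem
  · exact quarter_mem

theorem cH_pos : 0 < K.cH := by
  rcases K.cH_eq with h | h <;> rw [h.1] <;> norm_num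

theorem quarter_T_mem [h : Ok p q] : T q / 4 ∈ floatSet p q := by
  have := h.emin_eq; have := h.seven_le; have := h.two_le
  have := mem_zpow (p := p) (q := q) (emax q - 2 - 2) (by omega) (by omega)
  rw [zpow_sub₀ (by norm_num)] at this
  unfold T; norm_num at this ⊢; exact this

/-- The gradient behind a neuron of the upper part, if the weight below the gradient `X` is `A`. -/
noncomputable def stp (A X : ℝ) : ℝ := rd p q (rd p q (X * A) * K.cH)

/-- In the upper part no gradient exceeds the bound if the weights compensate at most the factor
`cH` of the derivative. -/
theorem step [Ok p q] {X A : ℝ} (hX : X ∈ floatSet p q) (hXb : |X| ≤ K.bd) (hA : A ∈ floatSet p q)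
    (hA1 : |A| ≤ 1 / K.cH) :
    XFlt.mul (F X : XFlt p q) (F A) = F (X * A) ∧
    XFlt.mul (F (X * A) : XFlt p q) (F K.cH) = F (K.stp A X) ∧ |K.stp A X| ≤ K.bd := by
  have hT := T_pos (q := q)
  have h7 := seven_T_le (p := p) (q := q)
  have key : ∃ B ∈ floatSet p q, K.bd * (1 / K.cH) = B ∧ B ≤ Omega p q ∧ K.bd ∈ floatSet p q ∧
      B * K.cH = K.bd ∧ K.bd ≤ Omega p q := by
    rcases K.bd_eq with ⟨h1, h2⟩ | ⟨h1, h2⟩ <;> rw [h1, h2]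
    · exact ⟨_, Omega_mem, by ring, le_rfl, Omega_mem, by ring, le_rfl⟩
    · exact ⟨T q, mT 1 (by norm_num) (by norm_num), by ring, by linarith, quarter_T_mem, by ring,
        by linarith⟩
  obtain ⟨B, hB, hB1, hB2, hbm, hB3, hb⟩ := key
  have h1 : |X * A| ≤ B := by
    rw [abs_mul, ← hB1]
    exact mul_le_mul hXb hA1 (abs_nonneg _) ((abs_nonneg _).trans hXb)
  have h2 := abs_rd_le h1 hB
  have h3 : |rd p q (X * A) * K.cH| ≤ K.bd := by
    rw [abs_mul, abs_of_pos K.cH_pos, ← hB3]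
    exact mul_le_mul_of_nonneg_right h2 K.cH_pos.le
  refine ⟨mul_F hX hA (h1.trans hB2), ?_, abs_rd_le h3 hbm⟩
  rw [← F_rd (X * A), mul_F (rd_mem _) K.cH_mem (h3.trans hb), stp, F_rd]

theorem div_cH_mem [Ok p q] {X : ℝ} (hX : X ∈ floatSet p q) (hXb : |X| ≤ K.bd) :
    X * (1 / K.cH) ∈ floatSet p q := by
  rcases K.bd_eq with ⟨h1, h2⟩ | ⟨h1, h2⟩ <;> rw [h1]
  · simpa using hX
  · rw [h2] at hXb
    have hT := T_pos (q := q)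
    have h7 := seven_T_le (p := p) (q := q)
    have := mem_scale hX 2 (by
      rw [abs_mul, abs_of_pos (by positivity : (0:ℝ) < 2 ^ (2 : ℤ))]
      norm_num; linarith) (Or.inl (by norm_num))
    norm_num at this ⊢; exact this

/-- Multiplication by `a` is possible if it is exact. -/
theorem stp_exact [Ok p q] {X a : ℝ} (hX : a * X ∈ floatSet p q) (hXb : |a * X| ≤ K.bd) :
    K.stp (a * (1 / K.cH)) X = a * X := by
  have := K.cH_pos
  rw [stp, show X * (a * (1 / K.cH)) = (a * X) * (1 / K.cH) by ring,
    rd_of_mem (K.div_cH_mem hX hXb), mul_assoc, one_div_mul_cancel this.ne', mul_one, rd_of_mem hX]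

theorem pow_div_cH_mem [h : Ok p q] (n : ℤ) (hn : emin q - p ≤ n) (hn' : n ≤ 0) :
    (2 : ℝ) ^ n * (1 / K.cH) ∈ floatSet p q ∧ |(2 : ℝ) ^ n * (1 / K.cH)| ≤ 1 / K.cH := by
  have hE := h.seven_le
  have hc := K.cH_pos
  have h1 : (2 : ℝ) ^ n ≤ 1 := zpow_le_one_of_nonpos₀ (by norm_num) hn'
  have hpos : (0 : ℝ) < 2 ^ n := by positivity
  constructor
  · rcases K.cH_eq with ⟨h, _⟩ | ⟨h, _⟩ <;> rw [h]
    · simpa using mem_zpow n hn (by omega)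
    · have := mem_zpow (p := p) (q := q) (n + 2) (by omega) (by omega)
      rw [zpow_add₀ (by norm_num)] at this
      norm_num at this ⊢; exact this
  · rw [abs_of_pos (by positivity)]
    exact mul_le_of_le_one_left (by positivity) h1

/-- The weights of the upper part do not cause an overflow of the values. -/
theorem exists_mul_vH [Ok p q] {A : ℝ} (hA : |A| ≤ 2 / K.cH) :
    ∃ t, XFlt.mul (F A : XFlt p q) (F K.vH) = F t := by
  have hT := T_pos (q := q)
  have h7 := seven_T_le (p := p) (q := q)
  have hv := K.vH_le
  have hv0 := K.vH_nonneg
  have h2 : (2 : ℝ) ∈ floatSet p q := by simpa using two_pow_mem (p := p) (q := q) 1 (by norm_num)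
  have h8 : (8 : ℝ) ∈ floatSet p q := by
    have := two_pow_mem (p := p) (q := q) 3 (by norm_num); norm_num at this; exact this
  rcases K.cH_eq with ⟨h, _⟩ | ⟨h, _⟩ <;> rw [h] at hA hv
  · obtain ⟨t, ht, _⟩ := exists_mul_F (p := p) (q := q) (r := A) (a := 2) (by simpa using hA)
      (by rw [abs_of_nonneg hv0]; linarith : |K.vH| ≤ 2 * T q) h2
      (mT 2 (by norm_num) (by norm_num)) (by linarith)
    exact ⟨t, ht⟩
  · have hm : T q / 2 ∈ floatSet p q := by
      have := mem_scale (p := p) (q := q) quarter_T_mem 1 (by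
        rw [abs_of_pos (by positivity)]; norm_num; linarith) (Or.inl (by norm_num))
      norm_num at this; convert this using 1; ring
    obtain ⟨t, ht, _⟩ := exists_mul_F (p := p) (q := q) (r := A) (a := 8)
      (by norm_num at hA ⊢; exact hA)
      (by rw [abs_of_nonneg hv0]; linarith : |K.vH| ≤ T q / 2) h8 hm (by linarith)
    exact ⟨t, ht⟩

/-- Likewise above the gate. -/
theorem exists_mul_gate [Ok p q] {A : ℝ} (hA : |A| ≤ 2 / K.cH) (P : Prop) [Decidable P] :
    ∃ t, XFlt.mul (F A : XFlt p q) (F (if P then K.vH else K.kap)) = F t := by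
  split_ifs
  · exact K.exists_mul_vH hA
  · refine K.exists_mul_kap (hA.trans ?_)
    have := T_ge (q := q) p
    rcases K.cH_eq with ⟨h, _⟩ | ⟨h, _⟩ <;> rw [h] <;> norm_num <;> linarith

theorem lsum_diag [Ok p q] {I : Type} {l : List I} (hl : l.Nodup) {j : I} (hj : j ∈ l)
    {f : I → XFlt p q} (h0 : ∀ k ∈ l, k ≠ j → f k = F 0) : lsum (F 0) l f = f j := by
  rw [lsum_sublist (s := [j]) (by simpa using hj) hl
    (fun k hk hkj => h0 k hk (by simpa using hkj))]
  simp [zero_add_X]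

/-- The gradients after `n` layers in which the gradient `j` is multiplied by the weight `A n j`. -/
noncomputable def iter {I : Type} (A : ℕ → I → ℝ) (y : ℝ) : ℕ → I → ℝ
  | 0, _ => y
  | n + 1, j => K.stp (A n j) (iter A y n j)

theorem iter_bd [Ok p q] {I : Type} {A : ℕ → I → ℝ} (hA : ∀ n j, A n j ∈ floatSet p q)
    (hA1 : ∀ n j, |A n j| ≤ 1 / K.cH) {y : ℝ} (hy : y ∈ floatSet p q) (hyb : |y| ≤ K.bd) (n : ℕ)
    (j : I) : K.iter A y n j ∈ floatSet p q ∧ |K.iter A y n j| ≤ K.bd := by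
  induction n with
  | zero => exact ⟨hy, hyb⟩
  | succ n ih => exact ⟨rd_mem _, (K.step ih.1 ih.2 (hA n j) (hA1 n j)).2.2⟩

open Classical in
/-- The upper part of the network turns the gradient of the output into several gradients, each of
which is repeatedly multiplied by weights. -/
theorem exists_iter [Ok p q] {I : Type} {l : List I} (hl : l.Nodup) {A : ℕ → I → ℝ}
    (hA : ∀ n j, A n j ∈ floatSet p q) (hA1 : ∀ n j, |A n j| ≤ 1 / K.cH) {y : ι → ℝ}
    (hy : ∀ i, y i ∈ floatSet p q) (hyH : ∀ i, |y i| ≤ H) (N : ℕ) :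
    ∃ (U : Layer ι) (β : ι → I → ℝ), Top (p := p) (q := q) y (· = F 0) U (fun _ => 0) ∧
      Chain σ σ' N U (pairLayer l (fun _ _ => K.vH) β) ∧
      ∀ i, ∀ j ∈ l, XFlt.mul (F (β i j) : XFlt p q) (F K.cH) = F (K.iter A (y i) N j) := by
  have hyb := fun i => (hyH i).trans K.le_bd
  have hc := K.cH_pos
  have hc1 : |1 / K.cH| ≤ 2 / K.cH := by
    rw [abs_of_pos (by positivity)]; gcongr; norm_num
  induction N with
  | zero =>
    refine ⟨_, fun i _ => y i * (1 / K.cH), ?_, rfl, ?_⟩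
    · refine ⟨fun a => sgn a.2 * (1 / K.cH), ?_, ?_⟩
      · rintro i v hv z rfl
        rw [add_zero_X]
        refine lsum_flatMap_id fun j hj => ?_
        have h1 : v (j, false) = K.vH := hv (j, false) (mem_pairs.2 hj)
        have h2 : v (j, true) = K.vH := hv (j, true) (mem_pairs.2 hj)
        simp only [lsum_cons, lsum_nil, sgn_false, sgn_true, one_mul, neg_one_mul]
        rw [h1, h2]
        exact pair_cancel_left (K.exists_mul_vH hc1)
      · rintro i ⟨j, b⟩ _
        have h1 : XFlt.mul (F (y i) : XFlt p q) (F (1 / K.cH)) = F (y i * (1 / K.cH)) := by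
          have := K.pow_div_cH_mem (p := p) 0 (by
            have := okE p q; have := (‹Ok p q›).seven_le; have := (‹Ok p q›).emin_eq; omega) le_rfl
          simp only [zpow_zero, one_mul] at this
          exact (K.step (hy i) (hyb i) this.1 this.2).1
        exact mul_sgn_right b h1
    · intro i j _
      exact mul_F_mem (K.div_cH_mem (hy i) (hyb i)) K.cH_mem (by
        rw [mul_assoc, one_div_mul_cancel hc.ne', mul_one]; rfl) (hy i)
  | succ N ih =>
    obtain ⟨U, β, h1, h2, h3⟩ := ih
    have hst := fun i j => K.step (K.iter_bd hA hA1 (hy i) (hyb i) N j).1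
      (K.iter_bd hA hA1 (hy i) (hyb i) N j).2 (hA N j) (hA1 N j)
    refine ⟨U, fun i j => K.iter A (y i) N j * A N j, h1, ⟨_, h2, ?_⟩, fun i j _ => (hst i j).2.1⟩
    refine link_pair K.sig_onH K.dsig_onH (fun j k => if j = k then A N j else 0) h3
      (fun s j _ k _ => K.exists_mul_vH ?_) (fun s k hk => ?_)
    · have : (0 : ℝ) ≤ 2 / K.cH := by positivity
      split_ifs
      · exact (hA1 N j).trans (by gcongr; norm_num)
      · simpa using this
    · rw [lsum_diag hl hk (fun j _ hj => by rw [if_neg hj, mul_zero_F]), if_pos rfl]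
      exact (hst s k).1

end Kit
end

/-! ### Normalization of a known gradient -/

section
variable {ι : Type} {σ σ' : XFlt p q → XFlt p q} {M H : ℝ}

namespace Kit
variable (K : Kit p q σ σ' M H)

/-- An integer can be scaled by a power of two into an interval around `1` whose elements are, after
multiplication by the least positive float, rounded to the least positive float. The ratio of the
end points has to be `2`; the bounds `11 / 16` and `11 / 8` leave room for a second rounding. -/
theorem exists_two_pow_scale {m : ℤ} (hm : m ≠ 0) {n : ℕ} (hmn : |m| < (2 : ℤ) ^ n) :
    ∃ t : ℕ, t ≤ n ∧ 11 / 16 ≤ |(m : ℝ)| * 2 ^ (-(t : ℤ)) ∧ |(m : ℝ)| * 2 ^ (-(t : ℤ)) < 11 /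
      8 := by
  classical
  have hm' : |(m : ℝ)| < 2 ^ n := by exact_mod_cast hmn
  have hm1 : (1 : ℝ) ≤ |(m : ℝ)| := by exact_mod_cast Int.one_le_abs hm
  have hex : ∃ t : ℕ, |(m : ℝ)| * 2 ^ (-(t : ℤ)) < 11 / 8 := by
    refine ⟨n, ?_⟩
    rw [zpow_neg, zpow_natCast, ← div_eq_mul_inv, div_lt_iff₀ (by positivity)]
    nlinarith [pow_pos (zero_lt_two' ℝ) n]
  refine ⟨Nat.find hex, Nat.find_min' hex ?_, ?_, Nat.find_spec hex⟩
  · rw [zpow_neg, zpow_natCast, ← div_eq_mul_inv, div_lt_iff₀ (by positivity)]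
    nlinarith [pow_pos (zero_lt_two' ℝ) n]
  · rcases Nat.eq_zero_or_pos (Nat.find hex) with h | h
    · rw [h]; norm_num; linarith
    · have := Nat.find_min hex (Nat.sub_lt h one_pos)
      rw [not_lt, Nat.cast_sub (Nat.one_le_iff_ne_zero.2 h.ne'), neg_sub, sub_eq_add_neg, zpow_add₀
        (by norm_num)] at this
      norm_num at this ⊢; linarith

/-- Multiples of the least positive float by a factor close to `1` become the least positive float,
even if they are rounded twice. -/
theorem stp_eta [h : Ok p q] {x : ℝ} (h1 : 11 / 16 ≤ x) (h2 : x < 11 / 8) {s : ℤ}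
    (hs : s = 1 ∨ s = -1) :
    rd p q (rd p q (s * x * eta p q * (1 / K.cH)) * K.cH) = s * eta p q := by
  have he := eta_pos (p := p) (q := q)
  wlog h0 : s = 1
  · have hs1 : s = -1 := hs.resolve_left h0
    have := this K h1 h2 (Or.inl rfl) he rfl
    rw [hs1]; push_cast at this ⊢
    rw [one_mul] at this
    rw [show (-1 : ℝ) * x * eta p q * (1 / K.cH) = -(x * eta p q * (1 / K.cH)) by ring, rd_neg,
      neg_mul, rd_neg, this]; ring
  subst h0
  have hclose : ∀ z, |z - 1| < 1 / 2 → rd p q (z * eta p q) = eta p q := fun z hz => by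
    refine rd_eq_of_close eta_mem ?_
    rw [show z * eta p q - eta p q = (z - 1) * eta p q by ring, abs_mul, abs_of_pos he]
    nlinarith
  push_cast
  rw [one_mul, one_mul]
  rcases K.cH_eq with ⟨hc, _⟩ | ⟨hc, _⟩ <;> rw [hc]
  · rw [div_one, mul_one, mul_one, rd_of_mem (rd_mem _)]
    exact hclose x (by rw [abs_lt]; constructor <;> linarith)
  · -- the value between the two roundings is 3, 4 or 5
    obtain ⟨n, hn⟩ := exists_int_eta (rd_mem (p := p) (q := q) (x * eta p q * (1 / (1 / 4))))
    have hr : |4 * x - (_root_.round (4 * x) : ℤ)| ≤ 1 / 2 := abs_sub_round _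
    set m : ℤ := _root_.round (4 * x)
    rw [abs_le] at hr
    have hm3 : (2 : ℝ) < m := by linarith
    have hm5 : (m : ℝ) < 6 := by linarith
    have hm3' : 2 < m := by exact_mod_cast hm3
    have hm5' : m < 6 := by exact_mod_cast hm5
    have h8 : (8 : ℤ) ≤ 2 ^ (p + 1) := by
      calc (8 : ℤ) = 2 ^ 3 := by norm_num
        _ ≤ _ := pow_le_pow_right₀ (by norm_num) (by have := h.two_le; omega)
    have hd := abs_rd_sub_le (p := p) (q := q) (x * eta p q * (1 / (1 / 4)))
      (mem_eta m (by rw [abs_of_pos (by omega)]; omega))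
    rw [hn] at hd ⊢
    have hd' : |4 * x - n| ≤ 1 / 2 := by
      have e1 : x * eta p q * (1 / (1 / 4)) - n * eta p q = (4 * x - n) * eta p q := by ring
      have e2 : x * eta p q * (1 / (1 / 4)) - m * eta p q = (4 * x - m) * eta p q := by ring
      rw [e1, e2, abs_mul, abs_mul, abs_of_pos he] at hd
      have := le_of_mul_le_mul_right hd he
      refine this.trans (abs_le.2 hr)
    rw [abs_le] at hd'
    have hn3 : (2 : ℝ) < n := by linarith
    have hn5 : (n : ℝ) < 6 := by linarith
    have hn3' : 3 ≤ n := by have : 2 < n := by exact_mod_cast hn3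
                            omega
    have hn5' : n ≤ 5 := by have : n < 6 := by exact_mod_cast hn5
                            omega
    have h3 : (3 : ℝ) ≤ n := by exact_mod_cast hn3'
    have h5 : (n : ℝ) ≤ 5 := by exact_mod_cast hn5'
    rw [show (n : ℝ) * eta p q * (1 / 4) = (n / 4) * eta p q by ring]
    exact hclose _ (by rw [abs_lt]; constructor <;> linarith)

open Classical in
/-- The gradient `y0` of the output is turned into the least positive float, up to the sign `s`. With
the significand `μ` of `y0`, the first shifts lead to `μ` times the least positive float, and the
  last
weight cancels `μ` by rounding. -/
theorem exists_normalize [h : Ok p q] {y : ι → ℝ}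
    (hy : ∀ i, y i ∈ floatSet p q) (hyH : ∀ i, |y i| ≤ H) {y0 : ℝ} (hy0 : y0 ∈ floatSet p q)
    (hy0H : |y0| ≤ H) (h0 : y0 ≠ 0) {on : ι → Prop}
    (hon : ∀ i, on i → y i = y0) {s : ℤ} (hs : s = 1 ∨ s = -1) {m : ℕ} (hm : 3 ≤ m) :
    ∃ (U : Layer ι) (β : ι → ℝ), Top (p := p) (q := q) y (· = F 0) U (fun _ => 0) ∧
      Chain σ σ' m U (pairLayer [()] (fun i _ => if on i then K.vH else K.kap) fun i _ => β i) ∧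
      ∀ i, on i → XFlt.mul (F (β i) : XFlt p q) (F K.cH) = F (s * eta p q) := by
  have hy0b : |y0| ≤ K.bd := hy0H.trans K.le_bd
  have hc := K.cH_pos
  have hE := h.seven_le
  have hmin := h.emin_eq
  have hpE := h.add_le
  have hp2 := h.two_le
  have hp8 := h.p_le
  obtain ⟨μ, k, hμ, h1, h2, h3, _⟩ := mem_canon hy0
  have hμ0 : μ ≠ 0 := by rintro rfl; simp at hμ; exact h0 hμ
  obtain ⟨j, hj⟩ := Int.eq_ofNat_of_zero_le (show 0 ≤ k - (emin q - p) by omega)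
  obtain ⟨E, hEE⟩ := Int.eq_ofNat_of_zero_le (show 0 ≤ emax q + p - 1 by omega)
  -- two exact shifts lead to a small multiple of the least positive float
  set s1 := min j E with hs1
  have hs1j : s1 ≤ j := min_le_left _ _
  have hs1E : s1 ≤ E := min_le_right _ _
  have hs2E : j - s1 ≤ E := by omega
  let A : ℕ → Unit → ℝ := fun n _ =>
    (2 : ℝ) ^ (if n = 0 then -(s1 : ℤ) else if n = 1 then -((j - s1 : ℕ) : ℤ) else 0) * (1 / K.cH)
  have hA' : ∀ n u, A n u ∈ floatSet p q ∧ |A n u| ≤ 1 / K.cH := fun n _ =>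
    K.pow_div_cH_mem _ (by split_ifs <;> omega) (by split_ifs <;> omega)
  have hA := fun n u => (hA' n u).1
  have hA1 := fun n u => (hA' n u).2
  have hshift : ∀ a t : ℕ, a + t ≤ j →
      (2 : ℝ) ^ (-(t : ℤ)) * (μ * 2 ^ (k - a)) ∈ floatSet p q ∧
      |(2 : ℝ) ^ (-(t : ℤ)) * (μ * 2 ^ (k - a))| ≤ K.bd ∧
      (2 : ℝ) ^ (-(t : ℤ)) * (μ * 2 ^ (k - a)) = μ * 2 ^ (k - (a + t : ℕ)) := by
    intro a t ht
    have e : (2 : ℝ) ^ (-(t : ℤ)) * (μ * 2 ^ (k - a)) = μ * 2 ^ (k - (a + t : ℕ)) := by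
      rw [mul_left_comm, ← zpow_add₀ (by norm_num)]; congr 2; push_cast; ring
    refine ⟨e ▸ mem_int μ _ h1 (by omega) (by omega), ?_, e⟩
    rw [e]
    refine le_trans ?_ hy0b
    rw [hμ, abs_mul, abs_mul]
    refine mul_le_mul_of_nonneg_left ?_ (abs_nonneg _)
    rw [abs_of_pos (by positivity), abs_of_pos (by positivity)]
    exact two_pow_le (by omega)
  have hiter : ∀ n, 2 ≤ n → K.iter A y0 n () = μ * eta p q := by
    intro n hn
    induction n, hn using Nat.le_induction with
    | base =>
      have q1 := hshift 0 s1 (by omega)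
      have q2 := hshift s1 (j - s1) (by omega)
      simp only [iter, A, if_true, one_ne_zero, if_false]
      have e0 : y0 = μ * 2 ^ (k - (0 : ℕ)) := by simpa using hμ
      rw [e0, K.stp_exact q1.1 q1.2.1, q1.2.2, zero_add, K.stp_exact q2.1 q2.2.1, q2.2.2]
      unfold eta
      congr 2; omega
    | succ n hn ih =>
      simp only [iter] at ih ⊢
      rw [ih]
      have q1 := hshift j 0 (by omega)
      have e : (μ : ℝ) * eta p q = μ * 2 ^ (k - j) := by unfold eta; congr 2; omega
      rw [← e] at q1
      have : A n () = 2 ^ (-((0 : ℕ) : ℤ)) * (1 / K.cH) := by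
        simp [A, show n ≠ 0 by omega, show n ≠ 1 by omega]
      rw [this, K.stp_exact q1.1 q1.2.1]
      simp
  obtain ⟨m, rfl⟩ := Nat.exists_eq_add_of_le' (show 1 ≤ m by omega)
  obtain ⟨U, β, hU, hch, hβ⟩ := K.exists_iter (List.nodup_singleton ()) hA hA1 hy hyH m
  obtain ⟨t, htp, ht1, ht2⟩ := exists_two_pow_scale hμ0 h1
  -- the last weight also determines the sign
  set g : ℤ := s * μ.sign
  have hg : |(g : ℝ)| = 1 := by
    have : |g| = 1 := by
      rw [abs_mul, Int.abs_sign_of_ne_zero hμ0]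
      rcases hs with rfl | rfl <;> simp
    exact_mod_cast this
  have hgμ : (g : ℝ) * μ = s * |(μ : ℝ)| := by
    have : μ.sign * μ = |μ| := Int.sign_mul_self_eq_abs μ
    have : g * μ = s * |μ| := by rw [← this]; ring
    exact_mod_cast this
  have hB' := K.pow_div_cH_mem (-(t : ℤ)) (by omega) (by omega)
  have hB : g * (2 ^ (-(t : ℤ)) * (1 / K.cH)) ∈ floatSet p q := by
    rcases (abs_eq (by norm_num)).1 hg with h | h <;> rw [h]
    · rw [one_mul]; exact hB'.1
    · rw [neg_one_mul]; exact neg_mem_floatSet hB'.1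
  have hB1 : |g * (2 ^ (-(t : ℤ)) * (1 / K.cH))| ≤ 1 / K.cH := by
    rw [abs_mul, hg, one_mul]; exact hB'.2
  set B := (g : ℝ) * (2 ^ (-(t : ℤ)) * (1 / K.cH))
  have hyb := fun i => (hyH i).trans K.le_bd
  have hst := fun i => K.step (K.iter_bd hA hA1 (hy i) (hyb i) m ()).1
      (K.iter_bd hA hA1 (hy i) (hyb i) m ()).2 hB hB1
  refine ⟨U, fun i => K.iter A (y i) m () * B, hU, ⟨_, hch, ?_⟩, fun i hi => ?_⟩
  · refine link_pair K.sig_onH K.dsig_onH (fun _ _ => B) hβ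
      (fun i _ _ _ _ => K.exists_mul_gate (hB1.trans (by gcongr; norm_num)) (on i))
        (fun i _ _ => ?_)
    simp only [lsum_cons, lsum_nil, zero_add_X]
    exact (hst i).1
  · rw [(hst i).2.1, hon i hi, stp, hiter m (by omega)]
    rw [show (μ : ℝ) * eta p q * B = s * (|(μ : ℝ)| * 2 ^ (-(t : ℤ))) * eta p q * (1 / K.cH) by
      rw [show (s : ℝ) * (|(μ : ℝ)| * 2 ^ (-(t : ℤ))) = s * |(μ : ℝ)| * 2 ^ (-(t : ℤ)) by ring,
        ← hgμ]
      simp only [B]; ring, K.stp_eta ht1 ht2 hs]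

end Kit
end

/-! ### Recognition of the gradient of the output by its rounding errors -/

/-- Repeated halving with rounding: a gradient passes through layers with the weight `1 / 2`. -/
noncomputable def halve (p q : ℕ) (y : ℝ) : ℕ → ℝ
  | 0 => y
  | n + 1 => rd p q (halve p q y n / 2)

theorem halve_mem {y : ℝ} (hy : y ∈ floatSet p q) (n : ℕ) : halve p q y n ∈ floatSet p q := by
  cases n with
  | zero => exact hy
  | succ n => exact rd_mem _

/-- The size of the halvings; at subnormal size the bound survives the rounding because it is a
float. -/
theorem half_bound [h : Ok p q] {y : ℝ} (hy : y ∈ floatSet p q) (n : ℕ) (hn : 1 ≤ n)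
    (hn' : n ≤ 2 * emax q + p) : |halve p q y n| ≤ 2 ^ (emax q + 1 - n) := by
  have hE := h.seven_le
  have hmin := h.emin_eq
  induction n, hn using Nat.le_induction with
  | base =>
    refine abs_rd_le ?_ (mem_zpow _ (by push_cast; omega) (by push_cast; omega))
    have h1 := abs_le_Omega hy
    have h2 := Omega_le (p := p) (q := q)
    have h3 := four_T (q := q)
    simp only [halve]
    rw [abs_div, abs_two]
    push_cast
    rw [add_sub_cancel_right, ← h3]; linarith
  | succ n hn ih =>
    push_cast at hn'
    have ih := ih (by omega)
    refine abs_rd_le ?_ (mem_zpow _ (by push_cast; omega) (by push_cast; omega))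
    rw [abs_div, abs_two]
    push_cast
    rw [show emax q + 1 - ((n : ℤ) + 1) = emax q + 1 - n - 1 by ring, zpow_sub₀ (by norm_num)]
    simpa using div_le_div_of_nonneg_right ih zero_le_two

/-- Half of the least positive float is rounded to zero. -/
theorem rd_half_eta [h : Ok p q] {r : ℝ} (hr : |r| ≤ eta p q / 2) : rd p q r = 0 := by
  have he := eta_pos (p := p) (q := q)
  have : nearest p q r = 0 := by
    refine nearest_eq_of_even (okE p q) h.one_le (fun z => ?_)
      ⟨0, by simp, by positivity, 1, by simp, Or.inr (by simp; rfl)⟩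
    change |r - 0| ≤ _
    rw [sub_zero]
    by_cases hz : (z : ℝ) = 0
    · rw [hz, sub_zero]
    · have h1 := eta_le_abs z.2 hz
      have h2 := abs_sub_abs_le_abs_sub (z : ℝ) r
      rw [abs_sub_comm] at h2
      linarith
  unfold rd; rw [this]; rfl

/-- After `2 emax + p + 1` halvings every float has become zero. -/
theorem halve_end [h : Ok p q] {y : ℝ} (hy : y ∈ floatSet p q) (n : ℕ)
    (hn : n = 2 * emax q + p + 1) : halve p q y n = 0 := by
  have hE := h.seven_le
  have hmin := h.emin_eq
  obtain ⟨n, rfl⟩ := Nat.exists_eq_add_of_le' (show 1 ≤ n by omega)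
  have h1 := half_bound hy n (by omega) (by push_cast at hn; omega)
  refine rd_half_eta ?_
  rw [abs_div, abs_two]
  refine div_le_div_of_nonneg_right (h1.trans ?_) zero_le_two
  unfold eta
  exact Kit.two_pow_le (by push_cast at hn; omega)

theorem halve_neg [Ok p q] (y : ℝ) (n : ℕ) : halve p q (-y) n = -halve p q y n := by
  induction n with
  | zero => rfl
  | succ n ih => simp only [halve]; rw [ih, neg_div, rd_neg]

/-- The rounding errors of the halvings are signed binary digits. -/
theorem exists_digit [h : Ok p q] {y : ℝ} (hy : y ∈ floatSet p q) (n : ℕ) :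
    ∃ d : ℤ, |d| ≤ 1 ∧ halve p q y n - 2 * halve p q y (n + 1) = d * eta p q := by
  have he := eta_pos (p := p) (q := q)
  obtain ⟨a, ha⟩ := exists_int_eta (halve_mem hy n)
  obtain ⟨b, hb⟩ := exists_int_eta (halve_mem hy (n + 1))
  refine ⟨a - 2 * b, ?_, by rw [ha, hb]; push_cast; ring⟩
  have h1 := abs_rd_scale_sub_le (halve_mem hy n) (-1) (by
    refine le_trans ?_ (abs_le_Omega (halve_mem hy n))
    rw [abs_mul]; norm_num
    linarith [abs_nonneg (halve p q y n)])
  rw [show halve p q y n * 2 ^ (-1 : ℤ) = halve p q y n / 2 by norm_num; ring] at h1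
  change |halve p q y (n + 1) - halve p q y n / 2| ≤ _ at h1
  rw [ha, hb, show (b : ℝ) * eta p q - a * eta p q / 2 = -((a - 2 * b) * eta p q / 2) by ring,
    abs_neg, abs_div, abs_two, abs_mul, abs_of_pos he] at h1
  have h2 : |(a : ℝ) - 2 * b| ≤ 1 := by
    have : |(a : ℝ) - 2 * b| * eta p q ≤ 1 * eta p q := by linarith
    exact le_of_mul_le_mul_right this he
  exact_mod_cast h2

/-- A float is determined by the rounding errors of its halvings, since these end at zero; moreover,
if the rounding errors of two floats are proportional then so are the floats. -/
theorem eq_of_digits [h : Ok p q] {y z : ℝ} (hy : y ∈ floatSet p q) (hz : z ∈ floatSet p q)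
    {d d' : ℕ → ℤ} (hd : ∀ n, halve p q y n - 2 * halve p q y (n + 1) = d n * eta p q)
    (hd' : ∀ n, halve p q z n - 2 * halve p q z (n + 1) = d' n * eta p q) {N : ℕ}
    (hN : N = 2 * emax q + p + 1) (c : ℤ) (hc : ∀ n < N, d n = c * d' n) : y = c * z := by
  have key : ∀ n, n ≤ N → halve p q y (N - n) = c * halve p q z (N - n) := by
    intro n
    induction n with
    | zero =>
      intro _
      rw [Nat.sub_zero, halve_end hy N hN, halve_end hz N hN, mul_zero]
    | succ n ih =>
      intro hn
      have ih := ih (by omega)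
      have h1 := hd (N - (n + 1))
      have h2 := hd' (N - (n + 1))
      rw [show N - (n + 1) + 1 = N - n by omega] at h1 h2
      rw [hc _ (by omega)] at h1
      push_cast at h1
      rw [ih] at h1
      linear_combination h1 - c * h2
  have := key N le_rfl
  rwa [Nat.sub_self] at this

section
variable {ι : Type} {σ σ' : XFlt p q → XFlt p q} {M H : ℝ}

/-- Of pairs of opposite terms, every nonzero one wipes out a small initial value. -/
theorem lsum_wipe [h : Ok p q] {α : Type} {k : ℤ} (hk : emin q - p ≤ k)
    (hk' : k + p + 4 ≤ emax q) {v : ℤ} (hv : |v| ≤ 1) (n : α → ℤ) (hn : ∀ a, |n a| ≤ 2)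
    (l : List α) {f : α × Bool → XFlt p q}
      (hf : ∀ a ∈ l, ∀ b, f (a, b) = F (sgn b * (n a * 2 ^ (k + p + 2)))) :
    lsum (F (v * 2 ^ k)) (l.flatMap fun a => [(a, false), (a, true)]) f =
      (F ((if ∀ a ∈ l, n a = 0 then v else 0 : ℤ) * 2 ^ k) : XFlt p q) := by
  have hp2 := h.two_le
  have hmem : ∀ a, (n a : ℝ) * 2 ^ (k + p + 2) ∈ floatSet p q := fun a =>
    mem_small (n a) _ ((hn a).trans (by norm_num)) (by omega) (by omega)
  induction l generalizing v with
  | nil => simp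
  | cons a l ih =>
    rw [List.flatMap_cons, lsum_append]
    simp only [lsum_cons, lsum_nil]
    rw [hf a (by simp), hf a (by simp)]
    simp only [sgn_false, sgn_true, one_mul, neg_one_mul]
    have hf' := fun a ha => hf a (List.mem_cons_of_mem _ ha)
    by_cases ha : n a = 0
    · rw [ha]
      simp only [Int.cast_zero, zero_mul, neg_zero, add_zero_F]
      rw [ih hv hf']
      simp [ha]
    · have hab : (F (v * 2 ^ k)).add (F (n a * 2 ^ (k + p + 2))) =
          (F (n a * 2 ^ (k + p + 2)) : XFlt p q) := by
        have hv' : |(v : ℝ)| ≤ 1 := by exact_mod_cast hv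
        have hv2 : |(v : ℝ) * 2 ^ k| ≤ 2 ^ k := by
          rw [abs_mul, abs_of_pos (by positivity : (0:ℝ) < 2 ^ k)]
          exact mul_le_of_le_one_left (by positivity) hv'
        have key : ∃ (e : ℤ), k + p + 2 ≤ e ∧ e ≤ k + p + 3 ∧
            ((n a : ℝ) * 2 ^ (k + p + 2) = 2 ^ e ∨ (n a : ℝ) * 2 ^ (k + p + 2) = -2 ^ e) := by
          have h3 : k + p + 3 = 1 + (k + p + 2) := by ring
          have h2 : n a = 1 ∨ n a = -1 ∨ n a = 2 ∨ n a = -2 := by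
            have := abs_le.1 (hn a); omega
          rcases h2 with h2 | h2 | h2 | h2 <;> rw [h2]
          · exact ⟨k + p + 2, le_rfl, by omega, Or.inl (by simp)⟩
          · exact ⟨k + p + 2, le_rfl, by omega, Or.inr (by simp)⟩
          · refine ⟨k + p + 3, by omega, le_rfl, Or.inl ?_⟩
            rw [h3, zpow_one_add₀ (by norm_num)]; push_cast; ring
          · refine ⟨k + p + 3, by omega, le_rfl, Or.inr ?_⟩
            rw [h3, zpow_one_add₀ (by norm_num)]; push_cast; ring
        obtain ⟨e, he, he', h2⟩ := key
        have hle : (2 : ℝ) ^ k ≤ 2 ^ (e - p - 2) := Kit.two_pow_le (by omega)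
        have hsum : |(v : ℝ) * 2 ^ k + n a * 2 ^ (k + p + 2)| ≤ Omega p q := by
          have h7 := seven_T_le (p := p) (q := q)
          have h4 := four_T (q := q)
          have hT := T_pos (q := q)
          have e1 : |(n a : ℝ) * 2 ^ (k + p + 2)| = 2 ^ e := by
            rcases h2 with h2 | h2 <;> rw [h2]
            · rw [abs_of_pos (by positivity)]
            · rw [abs_neg, abs_of_pos (by positivity)]
          have e2 : (2 : ℝ) ^ k ≤ 2 ^ (emax q - 2) := Kit.two_pow_le (by omega)
          have e3 : (2 : ℝ) ^ e ≤ 2 ^ emax q := Kit.two_pow_le (by omega)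
          refine (abs_add_le _ _).trans ?_
          change _ ≤ T q at e2
          linarith
        rw [add_F (Kit.mem_sign_zpow hv hk (by omega)) (hmem a) hsum, F_eq_iff, rd_of_mem (hmem a)]
        rcases h2 with h2 | h2 <;> rw [h2, add_comm]
        · exact rd_absorb (by omega) (by omega) (hv2.trans hle)
        · exact rd_absorb_neg (by omega) (by omega) (hv2.trans hle)
      rw [hab, add_neg_F]
      have := ih (v := 0) (by norm_num) hf'
      simp only [Int.cast_zero, zero_mul, ite_self] at this
      rw [this]
      simp [ha]

namespace Kit
variable (K : Kit p q σ σ' M H)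

/-- A layer of the upper part can halve a gradient, with a single rounding. -/
theorem stp_half [h : Ok p q] {X : ℝ} (hX : X ∈ floatSet p q) (hXb : |X| ≤ K.bd) :
    K.stp (2 ^ (-1 : ℤ) * (1 / K.cH)) X = rd p q (X / 2) := by
  rcases K.bd_eq with ⟨h1, h2⟩ | ⟨h1, h2⟩ <;> rw [stp, h1]
  · rw [div_one, mul_one, mul_one, rd_of_mem (rd_mem _), zpow_neg_one, div_eq_mul_inv]
  · rw [h2] at hXb
    have hT := T_pos (q := q)
    have h7 := seven_T_le (p := p) (q := q)
    have := mem_scale hX 1 (by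
      rw [abs_mul, abs_of_pos (by positivity : (0:ℝ) < 2 ^ (1 : ℤ))]
      norm_num; linarith) (Or.inl (by norm_num))
    rw [show X * (2 ^ (-1 : ℤ) * (1 / (1 / 4))) = X * 2 ^ (1 : ℤ) by norm_num, rd_of_mem this]
    congr 1; norm_num; ring

theorem inv_cH : ∃ a : ℕ, a ≤ 2 ∧ 1 / K.cH = 2 ^ (a : ℤ) := by
  rcases K.cH_eq with ⟨h, _⟩ | ⟨h, _⟩ <;> rw [h]
  · exact ⟨0, by norm_num, by norm_num⟩
  · exact ⟨2, by norm_num, by norm_num⟩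

/-- Twice a rounded half is a float, so that the rounding error is computed exactly. -/
theorem two_mul_rd_half [h : Ok p q] {X : ℝ} (hXb : |X| ≤ K.bd) :
    2 * rd p q (X / 2) ∈ floatSet p q ∧ |2 * rd p q (X / 2)| ≤ K.bd := by
  have hT := T_pos (q := q)
  have h7 := seven_T_le (p := p) (q := q)
  have key : K.bd / 2 ∈ floatSet p q ∧ K.bd ≤ Omega p q := by
    have hp := h.add_le; have hm := h.emin_eq; have h2 := h.two_le
    rcases K.bd_eq with ⟨-, h2⟩ | ⟨-, h2⟩ <;> rw [h2]
    · have := mem_int (p := p) (q := q) (2 ^ (p + 1) - 1) (emax q - p - 1)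
        (by have : (1 : ℤ) ≤ 2 ^ (p + 1) := one_le_pow₀ (by norm_num)
            rw [abs_of_nonneg (by omega)]; omega) (by omega) (by omega)
      refine ⟨?_, le_rfl⟩
      rw [Omega_eq]
      rw [zpow_sub_one₀ (by norm_num)] at this
      convert this using 1
      push_cast; ring
    · refine ⟨?_, by linarith⟩
      have := mem_zpow (p := p) (q := q) (emax q - 2 - 2 - 1) (by omega) (by omega)
      rw [zpow_sub₀ (by norm_num), zpow_sub₀ (by norm_num)] at this
      unfold T; norm_num at this ⊢; exact this
  have h1 : |rd p q (X / 2)| ≤ K.bd / 2 := abs_rd_le (by rw [abs_div, abs_two]; linarith) key.1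
  have h2 : |2 * rd p q (X / 2)| ≤ K.bd := by rw [abs_mul, abs_two]; linarith
  refine ⟨?_, h2⟩
  have := mem_scale (rd_mem (p := p) (q := q) (X / 2)) 1 (by
    rw [zpow_one, mul_comm]; exact h2.trans key.2) (Or.inl (by norm_num))
  rwa [zpow_one, mul_comm] at this

open Classical in
/-- The gradients `y0` and `-y0` of the output are turned into the least positive float and its
opposite, up to the sign `s`, and all other gradients into zero. Let `d k` and `d0 k` be the
  rounding
errors of the halvings of the gradient `y` and of `y0`, and `ε = d0 ks ≠ 0`. The gradient
`s * ε * d ks` is `s` for `y = y0` and `-s` for `y = -y0`. To this, the large opposite numbers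
`± (d k - ε * d0 k * d ks) 2 ^ (p + 2)` are added for all `k`: if one of them is not zero, they wipe
out the result; if all are zero, then `y` is a multiple of `y0` by `ε * d ks`. -/
theorem exists_recognize [h : Ok p q] {y : ι → ℝ}
    (hy : ∀ i, y i ∈ floatSet p q) (hyH : ∀ i, |y i| ≤ H) {y0 : ℝ} (hy0 : y0 ∈ floatSet p q)
    (h0 : y0 ≠ 0) (on : ι → Prop) {s : ℤ} (hs : s = 1 ∨ s = -1) {m : ℕ}
    (hm : 2 * emax q + p + 4 ≤ m) :
    ∃ (U : Layer ι) (β : ι → ℝ), Top (p := p) (q := q) y (· = F 0) U (fun _ => 0) ∧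
      Chain σ σ' m U (pairLayer [()] (fun i _ => if on i then K.vH else K.kap) fun i _ => β i) ∧
      ∀ i, XFlt.mul (F (β i) : XFlt p q) (F K.cH) =
        F ((s * (if y i = y0 then 1 else if y i = -y0 then -1 else 0) : ℤ) * eta p q) := by
  have hE := h.seven_le
  have hmin := h.emin_eq
  have hpE := h.add_le
  have hp2 := h.two_le
  have hp8 := h.p_le
  have hT := T_pos (q := q)
  have h7 := seven_T_le (p := p) (q := q)
  have hc := K.cH_pos
  have hlc := K.lc_le
  have he := eta_pos (p := p) (q := q)
  have hyb := fun i => (hyH i).trans K.le_bd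
  obtain ⟨lh, hlh, hlh'⟩ := K.inv_cH
  obtain ⟨R, hR⟩ := Int.eq_ofNat_of_zero_le (show 0 ≤ 2 * emax q + p + 1 by omega)
  choose d hd1 hd2 using fun i k => exists_digit (hy i) k
  choose d0 hd01 hd02 using fun k => exists_digit hy0 k
  -- a place at which `y0` has a rounding error
  obtain ⟨ks, hks, hks0⟩ : ∃ k < R, d0 k ≠ 0 := by
    by_contra hne
    push Not at hne
    refine h0 ?_
    have := eq_of_digits hy0 hy0 hd02 hd02 hR.symm 0 fun n hn => by rw [hne n hn, zero_mul]
    simpa using this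
  set ε := d0 ks
  have hε : ε * ε = 1 := by
    have := abs_le.1 (hd01 ks)
    have : ε = 1 ∨ ε = -1 := by omega
    rcases this with h | h <;> rw [h] <;> norm_num
  have hεabs : |ε| ≤ 1 := hd01 ks
  have hsabs : |s| ≤ 1 := by rcases hs with rfl | rfl <;> simp
  -- the halvings: the neuron `(k, b)` halves `k + b` times and then keeps the gradient
  let l1 : List (Σ _ : ℕ, Bool) := (List.range R).sigma fun _ => [false, true]
  have hl1 : l1.Nodup := List.nodup_range.sigma fun _ => by simp
  let A1 : ℕ → (Σ _ : ℕ, Bool) → ℝ := fun n j =>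
    (2 : ℝ) ^ (if n < j.1 + (if j.2 then 1 else 0) then (-1 : ℤ) else 0) * (1 / K.cH)
  have hA1 : ∀ n j, A1 n j ∈ floatSet p q ∧ |A1 n j| ≤ 1 / K.cH := fun n j =>
    K.pow_div_cH_mem _ (by split_ifs <;> omega) (by split_ifs <;> omega)
  have hbd := fun i => K.iter_bd (fun n j => (hA1 n j).1) (fun n j => (hA1 n j).2) (hy i) (hyb i)
  have hiter : ∀ i n j, K.iter A1 (y i) n j =
      halve p q (y i) (min n (j.1 + if j.2 then 1 else 0)) := by
    intro i n j
    induction n with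
    | zero => simp [iter, halve]
    | succ n ih =>
      have hb := hbd i n j
      simp only [iter]
      by_cases hn : n < j.1 + (if j.2 then 1 else 0)
      · rw [min_eq_left hn.le] at ih
        rw [min_eq_left (show n + 1 ≤ _ from hn)]
        simp only [A1, if_pos hn, halve]
        rw [K.stp_half hb.1 hb.2, ih]
      · rw [min_eq_right (not_lt.1 hn)] at ih
        rw [min_eq_right ((not_lt.1 hn).trans n.le_succ), ← ih]
        have := K.stp_exact (a := 1) (by rw [one_mul]; exact hb.1) (by rw [one_mul]; exact hb.2)
        simp only [A1, if_neg hn, zpow_zero]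
        rw [this, one_mul]
  obtain ⟨N, rfl⟩ := Nat.exists_eq_add_of_le' (show 3 ≤ m by omega)
  obtain ⟨U, β, hU, hch, hβ⟩ := K.exists_iter hl1 (fun n j => (hA1 n j).1) (fun n j => (hA1 n j).2)
    hy hyH N
  have hhalf : ∀ i k, halve p q (y i) k ∈ floatSet p q ∧ |halve p q (y i) k| ≤ K.bd := fun i k => by
    have := hbd i k ⟨k, false⟩
    rw [hiter] at this
    simpa using this
  have hβ : ∀ i, ∀ j ∈ l1, XFlt.mul (F (β i j) : XFlt p q) (F K.cH) =
      F (halve p q (y i) (j.1 + if j.2 then 1 else 0)) := by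
    intro i j hj
    rw [hβ i j hj, hiter, min_eq_right]
    obtain ⟨hj, _⟩ := List.mem_sigma.1 hj
    rw [List.mem_range] at hj
    split_ifs <;> omega
  -- their rounding errors
  have hc1 : |1 / K.cH| ≤ 2 / K.cH := by
    rw [abs_of_pos (by positivity)]; gcongr; norm_num
  have hc2 : |-(2 / K.cH)| ≤ 2 / K.cH := by rw [abs_neg, abs_of_pos (by positivity)]
  have hc0 : |(0 : ℝ)| ≤ 2 / K.cH := by rw [abs_zero]; positivity
  have hdm : ∀ (e : ℤ), |e| ≤ 1 → (e : ℝ) * eta p q * (1 / K.cH) ∈ floatSet p q := fun e he => by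
    have := mem_sign_zpow (p := p) (q := q) he (n := emin q - p + lh) (by omega) (by omega)
    rw [zpow_add₀ (by norm_num), ← hlh', ← mul_assoc] at this
    exact this
  have hD : Link σ σ' (pairLayer l1 (fun _ _ => K.vH) β)
      (pairLayer (List.range R) (fun _ _ => K.vH) fun i k => d i k * eta p q * (1 / K.cH)) := by
    refine link_pair K.sig_onH K.dsig_onH
      (fun j k => if j.1 = k then (if j.2 then -(2 / K.cH) else 1 / K.cH) else 0) hβ
      (fun i j _ k _ => K.exists_mul_vH (by split_ifs <;> assumption)) (fun i k hk => ?_)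
    have hlist : l1 = (List.range R).flatMap fun k => [⟨k, false⟩, ⟨k, true⟩] := rfl
    rw [hlist, lsum_block List.nodup_range hk (fun k' _ hne b hb => by
      have : b.1 = k' := by
        simp only [List.mem_cons, List.not_mem_nil, or_false] at hb
        rcases hb with rfl | rfl <;> rfl
      rw [if_neg (show ¬ b.1 = k by rw [this]; exact hne), mul_zero_F])]
    simp only [lsum_cons, lsum_nil, if_true, Bool.false_eq_true, if_false, zero_add_X, add_zero]
    have h1 := K.div_cH_mem (hhalf i k).1 (hhalf i k).2
    have h2 := K.two_mul_rd_half (hhalf i k).2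
    have h3 := K.div_cH_mem h2.1 h2.2
    change 2 * halve p q (y i) (k + 1) * (1 / K.cH) ∈ floatSet p q at h3
    have hc1m : 1 / K.cH ∈ floatSet p q := by
      rw [hlh']; exact mem_zpow _ (by omega) (by omega)
    have hc2m : -(2 / K.cH) ∈ floatSet p q := by
      have := mem_zpow (p := p) (q := q) (1 + lh) (by omega) (by omega)
      rw [zpow_add₀ (by norm_num), zpow_one, ← hlh', mul_one_div] at this
      exact neg_mem_floatSet this
    rw [mul_F_mem (hhalf i k).1 hc1m rfl h1, mul_F_mem (hhalf i (k + 1)).1 hc2m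
      (by ring : _ = -(2 * halve p q (y i) (k + 1) * (1 / K.cH))) (neg_mem_floatSet h3)]
    exact add_F_mem h1 (neg_mem_floatSet h3) (by rw [← hd2]; ring) (hdm _ (hd1 i k))
  have hβD : ∀ i, ∀ k ∈ List.range R, XFlt.mul (F (d i k * eta p q * (1 / K.cH)) : XFlt p q)
      (F K.cH) = F (d i k * 2 ^ (emin q - p)) := fun i k _ => by
    refine mul_F_mem (hdm _ (hd1 i k)) K.cH_mem ?_ (mem_sign_zpow (hd1 i k) le_rfl (by omega))
    rw [mul_assoc, one_div_mul_cancel hc.ne', mul_one]; rfl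
  -- the deviations from multiples of the rounding errors of `y0`
  let l2 : List (Option (ℕ × Bool)) := none ::
    ((List.range R).flatMap fun k => [(k, false), (k, true)]).map some
  let a : ℕ → Option (ℕ × Bool) → ℤ := fun k' t => match t with
    | none => if k' = ks then s * ε else 0
    | some t => (if k' = t.1 then 1 else 0) - (if k' = ks then ε * d0 t.1 else 0)
  -- the exponents that separate the large terms from the small one
  let w : Option (ℕ × Bool) → ℤ := fun t => match t with
    | none => K.lc
    | some _ => p + 1 + K.lc
  let n : ι → ℕ → ℤ := fun i k => d i k - ε * d0 k * d i ks
  have hn : ∀ i k, |n i k| ≤ 2 := fun i k => by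
    have h1 := abs_sub (d i k) (ε * d0 k * d i ks)
    have h2 := hd1 i k
    have h3 : |ε| * |d0 k| * |d i ks| ≤ 1 * 1 * 1 := by
      gcongr
      · exact hd01 k
      · exact hd1 i ks
    rw [← abs_mul, ← abs_mul] at h3
    change |d i k - ε * d0 k * d i ks| ≤ 2
    omega
  let c : ι → Option (ℕ × Bool) → ℤ := fun i t => match t with
    | none => s * ε * d i ks
    | some t => n i t.1
  have hv : ∀ i, |s * ε * d i ks| ≤ 1 := fun i => by
    have h3 : |s| * |ε| * |d i ks| ≤ 1 * 1 * 1 := by gcongr; exact hd1 i ks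
    rwa [← abs_mul, ← abs_mul] at h3
  have hc2 : ∀ i t, |c i t| ≤ 2 := fun i t => by
    rcases t with _ | t
    · exact (hv i).trans (by norm_num)
    · exact hn i t.1
  have hw : ∀ t, 0 ≤ w t ∧ w t ≤ p + 1 + K.lc := fun t => by
    rcases t with _ | t
    · exact ⟨show (0 : ℤ) ≤ K.lc by omega, show (K.lc : ℤ) ≤ p + 1 + K.lc by omega⟩
    · exact ⟨show (0 : ℤ) ≤ p + 1 + K.lc by omega, le_rfl⟩
  have ha : ∀ k' t, |a k' t| ≤ 1 := fun k' t => by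
    rcases t with _ | t
    · have h3 : |s| * |ε| ≤ 1 * 1 := by gcongr
      rw [← abs_mul] at h3
      change |if k' = ks then s * ε else 0| ≤ 1
      split_ifs
      · exact h3
      · simp
    · change |(if k' = t.1 then 1 else 0) - (if k' = ks then ε * d0 t.1 else 0)| ≤ 1
      have h3 : |ε| * |d0 t.1| ≤ 1 * 1 := by gcongr; exact hd01 _
      rw [← abs_mul] at h3
      split_ifs with h1 h2 h2
      · have : d0 t.1 = ε := by rw [← h1, h2]
        rw [this, hε]; norm_num
      · norm_num
      · rwa [zero_sub, abs_neg]
      · norm_num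
  have hmem2 : ∀ k b, some (k, b) ∈ l2 → k < R := fun k b h => by
    obtain ⟨a, ha, h | h⟩ : ∃ a < R, k = a ∧ b = false ∨ k = a ∧ b = true := by simpa [l2] using h
    · exact h.1 ▸ ha
    · exact h.1 ▸ ha
  have hsum : ∀ i, ∀ t ∈ l2, ((List.range R).map fun k' => d i k' * a k' t).sum = c i t := by
    intro i t ht
    rw [← List.sum_toFinset _ List.nodup_range, List.toFinset_range]
    rcases t with _ | ⟨k, b⟩
    · change ∑ k' ∈ Finset.range R, d i k' * (if k' = ks then s * ε else 0) = s * ε * d i ks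
      simp [hks, mul_comm]
    · have hk := hmem2 k b ht
      change ∑ k' ∈ Finset.range R, d i k' * ((if k' = k then 1 else 0) -
        (if k' = ks then ε * d0 k else 0)) = d i k - ε * d0 k * d i ks
      simp [mul_sub, Finset.sum_sub_distrib, hks, hk, mul_comm]
  have hsum2 : ∀ i, ∀ t ∈ l2, ((List.range R).map fun k' => |d i k' * a k' t|).sum ≤ 2 := by
    intro i t ht
    rw [← List.sum_toFinset _ List.nodup_range, List.toFinset_range]
    have key : ∀ x : ℕ, (∀ k', k' ≠ x → k' ≠ ks → a k' t = 0) →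
        ∑ k' ∈ Finset.range R, |d i k' * a k' t| ≤ 2 := fun x hx => by
      have h1 : ∀ k' ∈ Finset.range R, |d i k' * a k' t| ≤
          (if k' = x then 1 else 0) + (if k' = ks then 1 else 0) := fun k' _ => by
        have h3 : |d i k'| * |a k' t| ≤ 1 * 1 := by gcongr; exacts [hd1 i k', ha k' t]
        rw [← abs_mul] at h3
        split_ifs with e1 e2 e2 <;> try omega
        rw [hx k' e1 e2]; simp
      refine (Finset.sum_le_sum h1).trans ?_
      rw [Finset.sum_add_distrib, Finset.sum_ite_eq', Finset.sum_ite_eq']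
      split_ifs <;> norm_num
    rcases t with _ | ⟨k, b⟩
    · exact key ks fun k' h _ => if_neg h
    · refine key k fun k' h1 h2 => ?_
      change (if k' = k then (1 : ℤ) else 0) - (if k' = ks then ε * d0 k else 0) = 0
      rw [if_neg h1, if_neg h2, sub_zero]
  have h8 : (8 : ℤ) ≤ 2 ^ (p + 1) := by
    calc (8 : ℤ) = 2 ^ 3 := by norm_num
      _ ≤ _ := pow_le_pow_right₀ (by norm_num) (by omega)
  have hcm : ∀ i t (e : ℤ), emin q - p ≤ e → e ≤ emax q - 2 → (c i t : ℝ) * 2 ^ e ∈ floatSet p q :=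
    fun i t e h1 h2 => mem_small _ _ ((hc2 i t).trans (by norm_num)) h1 h2
  have hvL1 : |K.vL| ≤ 1 := by rw [abs_of_nonneg K.vL_nonneg]; exact K.vL_le
  have hT2 : Link σ σ' (pairLayer (List.range R) (fun _ _ => K.vH)
      fun i k => d i k * eta p q * (1 / K.cH))
      (pairLayer l2 (fun _ _ => K.vL) fun i t => c i t * 2 ^ (emin q - p + w t)) := by
    refine link_pair K.sig_onH K.dsig_onH (fun k' t => a k' t * 2 ^ w t) hβD
      (fun _ k' _ t _ => ?_) (fun i t ht => ?_)
    · have h1 := hw t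
      have h2 : (2 : ℝ) ^ w t ≤ 2 ^ emax q := two_pow_le (by omega)
      have h3 : |(a k' t : ℝ)| ≤ 1 := by exact_mod_cast ha k' t
      have h4 : |a k' t * (2 : ℝ) ^ w t| ≤ 4 * T q := by
        rw [abs_mul, abs_of_pos (by positivity : (0:ℝ) < 2 ^ w t), four_T]
        exact (mul_le_of_le_one_left (by positivity) h3).trans h2
      obtain ⟨r, hr, _⟩ := exists_mul_F (p := p) (q := q) h4 hvL1
        (mT 4 (by norm_num) (by norm_num)) one_mem (by linarith)
      exact ⟨r, hr⟩
    · have h1 := hw t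
      have h2 := lsum_int (p := p) (q := q) (k := emin q - p + w t) (by omega) (by omega)
        (List.range R) (fun k' => d i k' * a k' t) 0 (by
          have := hsum2 i t ht; rw [abs_zero]; omega)
      rw [hsum i t ht] at h2
      simp only [Int.cast_zero, zero_mul, zero_add] at h2
      rw [← h2]
      refine lsum_congr fun k' _ => ?_
      have h3 : |d i k'| * |a k' t| ≤ 1 * 1 := by gcongr; exacts [hd1 i k', ha k' t]
      rw [← abs_mul] at h3
      refine mul_F_mem (mem_sign_zpow (hd1 i k') le_rfl (by omega))
        (mem_sign_zpow (ha k' t) (by omega) (by omega)) ?_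
        (mem_sign_zpow h3 (by omega) (by omega))
      rw [zpow_add₀ (by norm_num)]; push_cast; ring
  have hβT : ∀ i, ∀ t ∈ l2, XFlt.mul (F (c i t * 2 ^ (emin q - p + w t)) : XFlt p q)
      (F (2 ^ (-(K.lc : ℤ)))) = F (c i t * 2 ^ (emin q - p + w t - K.lc)) := fun i t _ => by
    have h1 := hw t
    have h2 : K.lc ≤ w t := by
      rcases t with _ | t
      · exact le_rfl
      · exact (show (K.lc : ℤ) ≤ p + 1 + K.lc by omega)
    refine mul_F_mem (hcm i t _ (by omega) (by omega)) (mem_zpow _ (by omega) (by omega)) ?_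
      (hcm i t _ (by omega) (by omega))
    rw [mul_assoc, ← zpow_add₀ (by norm_num)]; congr 2
  -- the gate receives the sum of all this, the term that is to be wiped out coming first
  let Ag : Option (ℕ × Bool) → ℝ := fun t => match t with
    | none => 2 ^ (lh : ℤ)
    | some t => sgn t.2 * 2 ^ (1 + lh : ℤ)
  let v : ι → ℤ := fun i => if ∀ k ∈ List.range R, n i k = 0 then s * ε * d i ks else 0
  have hv' : ∀ i, |v i| ≤ 1 := fun i => by
    simp only [v]
    split_ifs
    · exact hv i
    · simp
  have hG : Link σ σ' (pairLayer l2 (fun _ _ => K.vL) fun i t => c i t * 2 ^ (emin q - p + w t))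
      (pairLayer [()] (fun i _ => if on i then K.vH else K.kap)
        fun i _ => v i * 2 ^ (emin q - p + lh)) := by
    refine link_pair K.sig_onL K.dsig_onL (fun t _ => Ag t) hβT
      (fun i t _ _ _ => K.exists_mul_gate ?_ (on i)) (fun i _ _ => ?_)
    · rcases t with _ | ⟨k, b⟩
      · change |(2 : ℝ) ^ (lh : ℤ)| ≤ _
        rw [← hlh']; exact hc1
      · have : |sgn b * (2 : ℝ) ^ (1 + lh : ℤ)| = 2 / K.cH := by
          have h1 : |sgn b| = 1 := by cases b <;> simp
          rw [abs_mul, h1, one_mul, abs_of_pos (by positivity), zpow_add₀ (by norm_num), ← hlh']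
          ring
        exact this.le
    · have h1 : XFlt.mul (F (c i none * 2 ^ (emin q - p + w none - K.lc)) : XFlt p q)
          (F (Ag none)) = F ((s * ε * d i ks : ℤ) * 2 ^ (emin q - p + lh)) := by
        change XFlt.mul (F ((s * ε * d i ks : ℤ) * 2 ^ (emin q - p + K.lc - K.lc)))
          (F (2 ^ (lh : ℤ))) = _
        refine mul_F_mem (mem_sign_zpow (hv i) (by omega) (by omega))
          (mem_zpow _ (by omega) (by omega)) ?_ (mem_sign_zpow (hv i) (by omega) (by omega))
        rw [mul_assoc, ← zpow_add₀ (by norm_num)]; congr 2; ring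
      rw [lsum_cons, h1, zero_add_F, lsum_map]
      refine lsum_wipe (by omega) (by omega) (hv i) (n i) (hn i) (List.range R) fun k _ b => ?_
      change XFlt.mul (F (n i k * 2 ^ (emin q - p + (p + 1 + K.lc) - K.lc)))
        (F (sgn b * 2 ^ (1 + lh : ℤ))) = _
      refine mul_sgn_right b (mul_F_mem (hcm i (some (k, b)) _ (by omega) (by omega))
        (mem_zpow _ (by omega) (by omega)) ?_ (hcm i (some (k, b)) _ (by omega) (by omega)))
      rw [mul_assoc, ← zpow_add₀ (by norm_num)]; congr 2; ring
  refine ⟨U, fun i => v i * 2 ^ (emin q - p + lh), hU, ⟨_, ⟨_, ⟨_, hch, hD⟩, hT2⟩, hG⟩, fun i => ?_⟩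
  have hvi : v i = s * (if y i = y0 then 1 else if y i = -y0 then -1 else 0) := by
    have hη := he.ne'
    by_cases hy1 : y i = y0
    · have hdd : ∀ k, d i k = d0 k := fun k => by
        have := hd2 i k
        rw [hy1, hd02] at this
        exact_mod_cast (mul_right_cancel₀ hη this).symm
      have hz : ∀ k ∈ List.range R, n i k = 0 := fun k _ => by
        simp only [n, hdd]; linear_combination -(d0 k) * hε
      simp only [v]
      rw [if_pos hz, if_pos hy1, hdd]
      linear_combination s * hε
    by_cases hy2 : y i = -y0
    · have hdd : ∀ k, d i k = -d0 k := fun k => by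
        have := hd2 i k
        rw [hy2, halve_neg, halve_neg, show -halve p q y0 k - 2 * -halve p q y0 (k + 1) =
          -(halve p q y0 k - 2 * halve p q y0 (k + 1)) by ring, hd02, ← neg_mul] at this
        exact_mod_cast (mul_right_cancel₀ hη this).symm
      have hz : ∀ k ∈ List.range R, n i k = 0 := fun k _ => by
        simp only [n, hdd]; linear_combination (d0 k) * hε
      simp only [v]
      rw [if_pos hz, if_neg hy1, if_pos hy2, hdd]
      linear_combination -s * hε
    · rw [if_neg hy1, if_neg hy2, mul_zero]
      simp only [v]
      split_ifs with hz
      · -- then `y i` is a multiple of `y0`, hence zero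
        have heq := eq_of_digits (hy i) hy0 (hd2 i) hd02 hR.symm (ε * d i ks) fun k hk => by
          have := hz k (List.mem_range.2 hk)
          simp only [n] at this
          linear_combination this
        have habs : |ε * d i ks| ≤ 1 := by
          have h3 : |ε| * |d i ks| ≤ 1 * 1 := by gcongr; exact hd1 i ks
          rwa [← abs_mul] at h3
        have := abs_le.1 habs
        have h3 : ε * d i ks = 0 ∨ ε * d i ks = 1 ∨ ε * d i ks = -1 := by omega
        rcases h3 with h3 | h3 | h3
        · rw [mul_assoc, h3, mul_zero]
        · rw [h3] at heq; exact absurd (by simpa using heq) hy1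
        · rw [h3] at heq; exact absurd (by simpa using heq) hy2
      · rfl
  rw [← hvi]
  refine mul_F_mem (mem_sign_zpow (hv' i) (by omega) (by omega)) K.cH_mem ?_
    (mem_sign_zpow (hv' i) le_rfl (by omega))
  rw [zpow_add₀ (by norm_num), ← hlh', eta, mul_assoc, mul_assoc, one_div_mul_cancel hc.ne',
    mul_one]

end Kit
end

/-! ### Networks for activation functions with the required properties -/

section
variable {σ σ' : XFlt p q → XFlt p q} {M H : ℝ}

theorem coe_neg_flt (y : Flt p q) : ((-y : Flt p q) : ℝ) = -(y : ℝ) := rfl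

namespace Kit
variable (K : Kit p q σ σ' M H) {d : ℕ} {D : Set (Fin d → Flt p q)}

/-- If the gradient of the output is a function `hs` of the input, there is one unit for every input
point with `hs x ≠ 0`, which normalizes the known gradient `hs x`. -/
theorem exists_net_of_gradient [h : Ok p q] (hD : ∀ x ∈ D, ∀ j, |(x j : ℝ)| ≤ M)
    (fs hs : D → Flt p q) (gs : (Fin d → Flt p q) → (Fin d → Flt p q))
    (hH : ∀ x, |(hs x : ℝ)| ≤ H) (h0 : ∀ x : D, hs x = 0 → gs x = 0) {L : ℕ} (hL : K.nt + 6 ≤ L) :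
    ∃ f : Net p q L d 1, ∀ x : D, f.eval σ (toX x) = toX (fun _ => fs x) ∧
      f.grad σ σ' (toX x) (toX fun _ => hs x) = toX (gs x) := by
  classical
  have : Finite (Flt p q) := (floatSet_finite p q).to_subtype
  obtain ⟨m, rfl⟩ := Nat.exists_eq_add_of_le' (show K.nt + 3 ≤ L by omega)
  rw [← add_assoc]
  obtain ⟨N, hN⟩ := K.exists_net (X := fun x : D => (x : Fin d → Flt p q)) Subtype.val_injective
    (fun x => hD x x.2) id (y := fun x => (hs x : ℝ)) (fun x => (hs x).2) hH fs
    (fun w : {x : D // hs x ≠ 0} => w.1) (fun w x => if x = w.1 then (1 : ℤ) else 0)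
    (fun w x => by split_ifs <;> simp) (fun w x hx => if_neg hx) (fun w => gs w.1)
    (fun x j => (gs x j : ℝ)) (fun x j => by
      by_cases hx : hs x = 0
      · refine Or.inl ⟨fun w => if_neg fun e : x = w.1 => w.2 (e ▸ hx), ?_⟩
        rw [h0 x hx]; rfl
      · refine Or.inr ⟨⟨x, hx⟩, fun w hw => if_neg fun e : x = w.1 => hw (Subtype.ext e.symm), ?_⟩
        simp)
    (m := m) (by omega) (fun w s hs' => by
      obtain ⟨U, β, h1, h2, h3⟩ := K.exists_normalize (y := fun x => (hs x : ℝ))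
        (fun x => (hs x).2) hH (hs w.1).2 (hH w.1) (fun e => w.2 (Subtype.ext e))
        (on := fun x => x = w.1) (fun x hx => by rw [hx]) hs' (m := m) (by omega)
      refine ⟨U, β, h1, h2, fun x hx => ?_⟩
      rw [h3 x hx, if_pos (show x = w.1 from hx), mul_one])
  refine ⟨N, fun x => ?_⟩
  obtain ⟨h1, h2⟩ := hN x
  have e : ∀ {n} (v : Fin n → Flt p q), (fun j => (F (v j : ℝ) : XFlt p q)) = toX v :=
    fun v => funext fun j => F_coe _
  exact ⟨h1.trans (e _), (congrArg _ (e _).symm).trans (h2.trans (e _))⟩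

/-- If the gradient `y` of the output is arbitrary, there is one unit for every input point and every
positive float; it recognizes the gradients that are equal or opposite to this float. -/
theorem exists_net_of_odd_gradient [h : Ok p q] (hD : ∀ x ∈ D, ∀ j, |(x j : ℝ)| ≤ M)
    (fs : D → Flt p q) (gs : (Fin d → Flt p q) → Flt p q → (Fin d → Flt p q))
    (hgs : ∀ x y, gs x (-y) = -gs x y) {L : ℕ} (hL : 2 * emax q + p + K.nt + 7 ≤ L) :
    ∃ f : Net p q L d 1, ∀ x : D, ∀ y : Flt p q, |(y : ℝ)| ≤ H →
      f.eval σ (toX x) = toX (fun _ => fs x) ∧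
      f.grad σ σ' (toX x) (toX fun _ => y) = toX (gs x y) := by
  classical
  have : Finite (Flt p q) := (floatSet_finite p q).to_subtype
  have hE := h.seven_le
  obtain ⟨m, rfl⟩ := Nat.exists_eq_add_of_le' (show K.nt + 3 ≤ L by omega)
  rw [← add_assoc]
  push_cast at hL
  have hodd : ∀ x y j, ((gs x (-y) j : Flt p q) : ℝ) = -(gs x y j : ℝ) := fun x y j => by
    rw [hgs]; rfl
  let e : D × {y : Flt p q // 0 < (y : ℝ)} → D × {y : Flt p q // |(y : ℝ)| ≤ H} → ℤ := fun w i =>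
    if i.1 = w.1 then
      (if (i.2.1 : ℝ) = (w.2.1 : ℝ) then 1 else if (i.2.1 : ℝ) = -(w.2.1 : ℝ) then -1 else 0) else 0
  obtain ⟨N, hN⟩ := K.exists_net (X := fun x : D => (x : Fin d → Flt p q)) Subtype.val_injective
    (fun x => hD x x.2) (fun i : D × {y : Flt p q // |(y : ℝ)| ≤ H} => i.1)
    (y := fun i => (i.2.1 : ℝ)) (fun i => i.2.1.2) (fun i => i.2.2) fs
    (fun w : D × {y : Flt p q // 0 < (y : ℝ)} => w.1) e
    (fun w i => by simp only [e]; split_ifs <;> simp) (fun w i hi => if_neg hi)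
    (fun w => gs w.1 w.2.1) (fun i j => (gs i.1 i.2.1 j : ℝ)) (fun i j => by
      obtain ⟨x, y, hy⟩ := i
      rcases lt_trichotomy (y : ℝ) 0 with hy0 | hy0 | hy0
      · refine Or.inr ⟨⟨x, -y, by rw [coe_neg_flt]; linarith⟩, fun w hw => ?_, ?_⟩
        · obtain ⟨x', y', hy'⟩ := w
          by_cases hx : x = x'
          · have h1 : (y : ℝ) ≠ y' := by linarith
            have h2 : (y : ℝ) ≠ -(y' : ℝ) := fun h2 => hw (by
              have : y' = -y := Subtype.ext (by rw [coe_neg_flt]; linarith)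
              subst hx; subst this; rfl)
            simp only [e, hx, h1, h2, if_true, if_false]
          · simp only [e, hx, if_false]
        · have h1 : (y : ℝ) ≠ ((-y : Flt p q) : ℝ) := by rw [coe_neg_flt]; linarith
          have h2 : (y : ℝ) = -((-y : Flt p q) : ℝ) := by rw [coe_neg_flt]; ring
          simp only [e]
          rw [if_pos trivial, if_neg h1, if_pos h2, hodd]; push_cast; ring
      · left
        have hy1 : y = 0 := Subtype.ext hy0
        refine ⟨fun w => ?_, ?_⟩
        · obtain ⟨x', y', hy'⟩ := w
          have h1 : (y : ℝ) ≠ y' := by linarith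
          have h2 : (y : ℝ) ≠ -(y' : ℝ) := by linarith
          simp only [e, h1, h2, if_false, ite_self]
        · have h1 := hodd x y j
          have h2 : -y = y := Subtype.ext (by rw [coe_neg_flt]; linarith)
          rw [h2] at h1
          simp only
          linarith
      · refine Or.inr ⟨⟨x, y, hy0⟩, fun w hw => ?_, ?_⟩
        · obtain ⟨x', y', hy'⟩ := w
          by_cases hx : x = x'
          · have h2 : (y : ℝ) ≠ -(y' : ℝ) := by linarith
            have h1 : (y : ℝ) ≠ y' := fun h2 => hw (by
              have : y' = y := Subtype.ext h2.symm
              subst hx; subst this; rfl)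
            simp only [e, hx, h1, h2, if_true, if_false]
          · simp only [e, hx, if_false]
        · simp [e])
    (m := m) (by omega) (fun w s hs' => by
      obtain ⟨U, β, h1, h2, h3⟩ := K.exists_recognize
        (y := fun i : D × {y : Flt p q // |(y : ℝ)| ≤ H} => (i.2.1 : ℝ))
        (fun i => i.2.1.2) (fun i => i.2.2) w.2.1.2 w.2.2.ne'
        (fun i => i.1 = w.1) hs' (m := m) (by omega)
      refine ⟨U, β, h1, h2, fun i hi => ?_⟩
      rw [h3 i]
      simp only [e]
      rw [if_pos hi])
  refine ⟨N, fun x y hy => ?_⟩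
  obtain ⟨h1, h2⟩ := hN ⟨x, y, hy⟩
  have e : ∀ {n} (v : Fin n → Flt p q), (fun j => (F (v j : ℝ) : XFlt p q)) = toX v :=
    fun v => funext fun j => F_coe _
  exact ⟨h1.trans (e _), (congrArg _ (e _).symm).trans (h2.trans (e _))⟩

end Kit
end

/-! ### Rounded real functions -/

section
variable {φ : ℝ → ℝ}

theorem roundFun_F {x : ℝ} (hx : x ∈ floatSet p q) (h : |φ x| ≤ Omega p q) :
    roundFun p q φ (F x) = F (φ x) := by
  rw [F_of_mem hx, ← round_eq h]; rfl

theorem roundLim_eq {l : Filter ℝ} [l.NeBot] {a : ℝ} (h : Tendsto φ l (𝓝 a)) :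
    roundLim p q φ l = round p q a := by
  have h' : Tendsto (fun x => (φ x : EReal)) l (𝓝 (a : EReal)) :=
    (continuous_coe_real_ereal.tendsto a).comp h
  have hex : ∃ b : EReal, Tendsto (fun x => (φ x : EReal)) l (𝓝 b) := ⟨a, h'⟩
  unfold roundLim
  rw [dif_pos hex, tendsto_nhds_unique hex.choose_spec h']
  simp [roundEReal]

theorem eight_mem [Ok p q] : (8 : ℝ) ∈ floatSet p q := by
  have := Kit.two_pow_mem (p := p) (q := q) 3 (by norm_num); norm_num at this; exact this

theorem two_le_Omega [Ok p q] : 2 ≤ Omega p q := by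
  have := seven_T_le (p := p) (q := q); have := T_ge (q := q) p; linarith

/-- A small deviation from `0`, `1` or `-1` disappears by rounding. -/
theorem rd_near [h : Ok p q] {k r : ℝ} (hk : k = 0 ∨ k = 1 ∨ k = -1) (hr : |r - k| ≤ eta p q / 2) :
    rd p q r = k := by
  have hE := h.seven_le
  have hm := h.emin_eq
  have hp := h.p_le
  have he : eta p q / 2 ≤ 2 ^ (0 - (p : ℤ) - 2) := by
    rw [eta, div_eq_mul_inv, ← zpow_neg_one, ← zpow_add₀ (by norm_num)]
    exact Kit.two_pow_le (by omega)
  have e : r = k + (r - k) := by ring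
  rcases hk with rfl | rfl | rfl
  · exact rd_half_eta (by simpa using hr)
  · have := rd_absorb (p := p) (q := q) (e := 0) (by omega) (by omega) (hr.trans he)
    rw [zpow_zero] at this
    rwa [← e] at this
  · have := rd_absorb_neg (p := p) (q := q) (e := 0) (by omega) (by omega) (hr.trans he)
    rw [zpow_zero] at this
    rwa [← e] at this

/-- The estimates `1 / (2 z ^ 2)` are chosen such that for `|z| ≥ T` they are below half of the least
positive float. -/
theorem inv_T_sq_le [h : Ok p q] : 1 / (2 * T q ^ 2) ≤ eta p q / 2 := by
  have hE := h.add_le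
  have hm := h.emin_eq
  have e1 : 1 / (2 * T q ^ 2) = (2 : ℝ) ^ (3 - 2 * emax q) := by
    rw [T, ← zpow_natCast, ← zpow_mul, one_div, ← zpow_one_add₀ (by norm_num), ← zpow_neg]
    congr 1; push_cast; ring
  have e2 : eta p q / 2 = (2 : ℝ) ^ (emin q - p - 1) := by
    rw [eta, zpow_sub_one₀ (by norm_num), div_eq_mul_inv]
  rw [e1, e2]
  exact Kit.two_pow_le (by omega)

theorem inv_sq_le [h : Ok p q] {z : ℝ} (hz : z ≤ -T q ∨ T q ≤ z) : 1 / (2 * z ^ 2) ≤ eta p q /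
    2 := by
  have hT := T_pos (q := q)
  refine le_trans ?_ inv_T_sq_le
  have : T q ^ 2 ≤ z ^ 2 := by
    rcases hz with hz | hz <;> nlinarith
  gcongr

theorem tendsto_inv_sq {l : Filter ℝ} (hl : Tendsto (fun x : ℝ => |x|) l atTop) :
    Tendsto (fun x : ℝ => 1 / (2 * x ^ 2)) l (𝓝 0) := by
  have h1 : Tendsto (fun x : ℝ => 2 * |x| ^ 2) l atTop :=
    ((tendsto_pow_atTop two_ne_zero).comp hl).const_mul_atTop two_pos
  have := h1.inv_tendsto_atTop
  refine this.congr fun x => ?_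
  simp [sq_abs]

theorem roundFun_F_near [h : Ok p q] {k x : ℝ} (hk : k = 0 ∨ k = 1 ∨ k = -1)
    (hx : x ∈ floatSet p q) (hφ : |φ x - k| ≤ eta p q / 2) : roundFun p q φ (F x) = F k := by
  have he : eta p q ≤ 1 := by
    unfold eta
    have := h.emin_eq; have := h.seven_le
    exact zpow_le_one_of_nonpos₀ (by norm_num) (by omega)
  have h2 : |φ x| ≤ Omega p q := by
    have h3 : |k| ≤ 1 := by rcases hk with rfl | rfl | rfl <;> norm_num
    have h4 := two_le_Omega (p := p) (q := q)
    have h5 := abs_add_le (φ x - k) k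
    rw [sub_add_cancel] at h5
    linarith
  rw [roundFun_F hx h2, ← F_rd, rd_near hk hφ]

theorem roundLim_of_inv_sq [Ok p q] {k : ℝ} {l : Filter ℝ} [l.NeBot]
    (hl : Tendsto (fun x : ℝ => |x|) l atTop) (hk : k = 0 ∨ k = 1 ∨ k = -1)
    (hφ : ∀ᶠ z in l, |φ z - k| ≤ 1 / (2 * z ^ 2)) : roundLim p q φ l = F k := by
  have hlim : Tendsto φ l (𝓝 k) := by
    rw [tendsto_iff_dist_tendsto_zero]
    refine squeeze_zero' (Eventually.of_forall fun _ => dist_nonneg) ?_ (tendsto_inv_sq hl)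
    filter_upwards [hφ] with z hz using hz
  have hkm : k ∈ floatSet p q := by
    rcases hk with rfl | rfl | rfl
    · exact zero_mem
    · exact one_mem
    · exact neg_mem_floatSet one_mem
  rw [roundLim_eq hlim, round_of_mem hkm]

/-- A function that approaches its limit at `-∞` fast takes the limit as its rounded value. -/
theorem roundFun_low [h : Ok p q] {k : ℝ} (hk : k = 0 ∨ k = -1)
    (hφ : ∀ z ≤ -32, |φ z - k| ≤ 1 / (2 * z ^ 2)) {z : XFlt p q} (hz : LeX z (-T q)) :
    roundFun p q φ z = F k := by
  have hT := T_ge (q := q) p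
  have hk' : k = 0 ∨ k = 1 ∨ k = -1 := hk.imp_right Or.inr
  rcases hz with rfl | ⟨x, hx, rfl, hxT⟩
  · exact roundLim_of_inv_sq tendsto_abs_atBot_atTop hk'
      ((eventually_le_atBot (-32)).mono hφ)
  · exact roundFun_F_near hk' hx ((hφ x (by linarith)).trans (inv_sq_le (Or.inl hxT)))

/-- A function that approaches its limit at `∞` fast takes the limit as its rounded value. -/
theorem roundFun_high [h : Ok p q] {k : ℝ} (hk : k = 0 ∨ k = 1)
    (hφ : ∀ z, 32 ≤ z → |φ z - k| ≤ 1 / (2 * z ^ 2)) {z : XFlt p q} (hz : GeX z (T q)) :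
    roundFun p q φ z = F k := by
  have hT := T_ge (q := q) p
  have hk' : k = 0 ∨ k = 1 ∨ k = -1 := hk.imp_right Or.inl
  rcases hz with rfl | ⟨x, hx, rfl, hxT⟩
  · exact roundLim_of_inv_sq tendsto_abs_atTop_atTop hk'
      ((eventually_ge_atTop 32).mono hφ)
  · exact roundFun_F_near hk' hx ((hφ x (by linarith)).trans (inv_sq_le (Or.inr hxT)))

/-- A small deviation from `6 T` disappears by rounding. Unlike the power of two `4 T`, this float has
the same distance to its two neighbours, and its significand is even, so that a deviation by half of
that distance is tolerated in either direction. -/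
theorem rd_six_T [h : Ok p q] {t : ℝ} (ht : |t| ≤ 2 ^ (emax q - p - 1)) :
    rd p q (6 * T q + t) = 6 * T q := by
  have hE := okE p q
  have hp := h.two_le
  have hmem : 6 * T q ∈ floatSet p q := by exact_mod_cast mem_T (p := p) (q := q) 6 (by norm_num)
  have hpow : (2 : ℝ) ^ (emax q - p) = 2 * 2 ^ (emax q - p - 1) := by
    rw [zpow_sub_one₀ (by norm_num)]; ring
  have hc : Canon p q (6 * T q) (3 * 2 ^ (p - 1)) (emax q - p) := by
    obtain ⟨r, rfl⟩ := Nat.exists_eq_add_of_le' h.one_le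
    refine ⟨?_, ?_, by omega, le_rfl, Or.inl ?_⟩
    · have := four_T (q := q)
      rw [zpow_sub₀ (by norm_num), ← this]
      simp only [Nat.add_sub_cancel]
      push_cast
      rw [zpow_add₀ (by norm_num), zpow_natCast]
      field_simp; ring
    · simp only [Nat.add_sub_cancel, pow_succ]
      have : 0 < 2 ^ r := by positivity
      omega
    · simp only [Nat.add_sub_cancel, pow_succ]
      omega
  have heven : Even (3 * 2 ^ (p - 1)) := by
    obtain ⟨r, rfl⟩ := Nat.exists_eq_add_of_le' hp
    simp [parity_simps]
  obtain ⟨i, hi, hrep⟩ := hc.hasRep h.one_le heven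
  have hT := T_pos (q := q)
  -- the distance to every other float is at least `2 ^ (emax q - p)`
  have hdist : ∀ z ∈ floatSet p q, z ≠ 6 * T q → 2 ^ (emax q - p) ≤ |6 * T q - z| := by
    intro z hz hne
    rcases hne.lt_or_gt with hlt | hgt
    · rw [abs_of_pos (by linarith)]
      by_cases hz4 : z ≤ 4 * T q
      · have h1 : (2 : ℝ) ^ (emax q - p) ≤ 2 ^ (emax q - 1) := Kit.two_pow_le (by omega)
        have h2 : (2 : ℝ) ^ (emax q - 1) = 2 * T q := by
          rw [zpow_sub_one₀ (by norm_num), ← four_T]; ring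
        linarith
      · push Not at hz4
        obtain ⟨n, k, hcz⟩ := mem_floatSet.exists_canon hE hz
        rw [abs_of_pos (by linarith)] at hcz
        have h1 := (hcz.add_le hc hlt).2
        have hk : emax q - p ≤ k := by
          obtain ⟨hz', hn, _, _, _⟩ := hcz
          by_contra hlt
          push Not at hlt
          have h3 : (2 : ℝ) ^ k ≤ 2 ^ (emax q - p - 1) := Kit.two_pow_le (by omega)
          have h4 : (n : ℝ) ≤ 2 ^ (p + 1) := by exact_mod_cast hn.le
          have h5 : z ≤ 2 ^ (p + 1) * 2 ^ (emax q - p - 1) := by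
            rw [hz']; gcongr
          rw [← zpow_natCast, ← zpow_add₀ (by norm_num)] at h5
          rw [show ((p + 1 : ℕ) : ℤ) + (emax q - p - 1) = emax q by push_cast; ring, ← four_T] at h5
          linarith
        have h3 : (2 : ℝ) ^ (emax q - p) ≤ 2 ^ k := Kit.two_pow_le hk
        linarith
    · obtain ⟨n, k, hcz⟩ := mem_floatSet.exists_canon hE hz
      rw [abs_of_pos (by linarith)] at hcz
      have h1 := (hc.add_le hcz hgt).2
      rw [abs_sub_comm, abs_of_pos (by linarith)]
      linarith
  have : nearest p q (6 * T q + t) = ⟨6 * T q, hmem⟩ := by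
    refine nearest_eq_of_even hE h.one_le (fun z => ?_) ⟨i, hi, hrep⟩
    simp only [add_sub_cancel_left]
    by_cases hz : (z : ℝ) = 6 * T q
    · rw [hz, add_sub_cancel_left]
    · have h1 := hdist z z.2 hz
      have h2 := abs_add_le (6 * T q + t - z) (-t)
      rw [show 6 * T q + t - z + -t = 6 * T q - z by ring, abs_neg] at h2
      linarith
  unfold rd; rw [this]

end

/-! ### Activation functions that resemble the positive part -/

/-- The function `φ`, with derivative `ψ`, is close to the identity on the right and to the constant
`kap` on the left; `lc` determines a point where the derivative is a power of two. The bound `32` is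
below the unit `T`. -/
structure Rectifier (φ ψ : ℝ → ℝ) (kap : ℝ) (lc : ℕ) : Prop where
  kap_eq : kap = 0 ∨ kap = -1
  zero : φ 0 = 0
  nonpos : ∀ z ≤ 0, -1 ≤ φ z ∧ φ z ≤ 0
  pos : ∀ z, 0 < z → z / 2 ≤ φ z ∧ φ z ≤ z
  one : 5 / 8 ≤ φ 1
  large : ∀ z, 2 ≤ z → z - 1 / 4 < φ z
  low : ∀ z ≤ -32, |φ z - kap| ≤ 1 / (2 * z ^ 2)
  deriv_low : ∀ z ≤ -32, |ψ z - 0| ≤ 1 / (2 * z ^ 2)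
  deriv_large : ∀ z, 32 ≤ z → |ψ z - 1| ≤ 1 / (2 * z ^ 2)
  deriv_bd : ∀ z, |ψ z| ≤ 2
  gate : (lc = 0 ∧ φ 1 = 1 ∧ ψ 1 = 1) ∨ (lc = 1 ∧ ψ 0 = 1 / 2)

namespace Rectifier
variable {φ ψ : ℝ → ℝ} {kap : ℝ} {lc : ℕ}

theorem abs_kap (h : Rectifier φ ψ kap lc) : |kap| ≤ 1 := by
    rcases h.kap_eq with h | h <;> rw [h] <;> norm_num

theorem abs_fn_le (h : Rectifier φ ψ kap lc) (z : ℝ) : |φ z| ≤ max 1 z := by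
  rcases le_or_gt z 0 with hz | hz
  · have := h.nonpos z hz
    exact (abs_le.2 ⟨this.1, by linarith⟩).trans (le_max_left _ _)
  · have := h.pos z hz
    rw [abs_of_nonneg (by linarith)]
    exact this.2.trans (le_max_right _ _)

theorem fn_F (h : Rectifier φ ψ kap lc) [Ok p q] {z : ℝ} (hz : z ∈ floatSet p q) : roundFun p q φ
    (F z) = F (φ z) := by
  have h2 := two_le_Omega (p := p) (q := q)
  exact roundFun_F hz ((h.abs_fn_le z).trans
    (max_le (by linarith) ((le_abs_self z).trans (abs_le_Omega hz))))

theorem deriv_F (h : Rectifier φ ψ kap lc) [Ok p q] {z : ℝ} (hz : z ∈ floatSet p q) : roundFun p q ψ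
    (F z) = F (ψ z) :=
  roundFun_F hz ((h.deriv_bd z).trans two_le_Omega)

theorem fn_low (h : Rectifier φ ψ kap lc) [Ok p q] {z : XFlt p q} (hz : LeX z (-T q)) :
    roundFun p q φ z = F kap ∧ roundFun p q ψ z = F 0 :=
  ⟨roundFun_low h.kap_eq h.low hz, roundFun_low (Or.inl rfl) h.deriv_low hz⟩

theorem out_nonpos (h : Rectifier φ ψ kap lc) [Ok p q] {z : XFlt p q} (hz : LeX z 0) :
    Out (roundFun p q φ) (roundFun p q ψ) z fun v => -1 ≤ v ∧ v ≤ 0 := by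
  rcases hz with rfl | ⟨x, hx, rfl, hx0⟩
  · obtain ⟨h1, h2⟩ := h.fn_low (p := p) (q := q) (z := .negInf) (Or.inl rfl)
    refine ⟨kap, 0, ?_, h1, h2⟩
    rcases h.kap_eq with h | h <;> rw [h] <;> norm_num
  · exact ⟨φ x, ψ x, h.nonpos x hx0, h.fn_F hx, h.deriv_F hx⟩

theorem out_pos (h : Rectifier φ ψ kap lc) [Ok p q] {x : ℝ} (hx : x ∈ floatSet p q) (h0 : 0 < x) :
    Out (roundFun p q φ) (roundFun p q ψ) (F x) fun v => x / 2 ≤ v ∧ v ≤ x :=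
  ⟨φ x, ψ x, h.pos x h0, h.fn_F hx, h.deriv_F hx⟩

/-- Large powers of two are fixed points. -/
theorem fn_zpow (h : Rectifier φ ψ kap lc) [ok : Ok p q] {e : ℤ} (he : emax q - 2 ≤ e)
    (he' : e ≤ emax q) :
    roundFun p q φ (F (2 ^ e)) = F (2 ^ e) ∧ roundFun p q ψ (F (2 ^ e)) = F 1 := by
  have hE := ok.seven_le
  have hm := ok.emin_eq
  have hpE := ok.add_le
  have hmem := mem_zpow (p := p) (q := q) e (by omega) he'
  have hT : T q ≤ 2 ^ e := Kit.two_pow_le he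
  have hT32 := T_ge (q := q) p
  rw [h.fn_F hmem, h.deriv_F hmem, F_eq_iff, F_eq_iff, rd_of_mem hmem, rd_of_mem one_mem]
  constructor
  · have h1 := h.large (2 ^ e) (by linarith)
    have h2 := (h.pos (2 ^ e) (by positivity)).2
    have e1 : φ (2 ^ e) = 2 ^ e + (φ (2 ^ e) - 2 ^ e) := by ring
    rw [e1]
    refine rd_absorb (by omega) he' ?_
    have h3 : (2 : ℝ) ^ (-2 : ℤ) ≤ 2 ^ (e - p - 2) := Kit.two_pow_le (by omega)
    norm_num at h3
    rw [abs_of_nonpos (by linarith)]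
    linarith
  · exact rd_near (Or.inr (Or.inl rfl)) ((h.deriv_large _ (by linarith)).trans
      (inv_sq_le (Or.inr hT)))

theorem fn_T (h : Rectifier φ ψ kap lc) [ok : Ok p q] :
    (roundFun p q φ (F (T q)) = F (T q) ∧ roundFun p q ψ (F (T q)) = F 1) ∧
    (roundFun p q φ (F (2 * T q)) = F (2 * T q) ∧ roundFun p q ψ (F (2 * T q)) = F 1) ∧
    (roundFun p q φ (F (4 * T q)) = F (4 * T q) ∧ roundFun p q ψ (F (4 * T q)) = F 1) := by
  refine ⟨h.fn_zpow le_rfl (by omega), ?_, ?_⟩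
  · have := h.fn_zpow (p := p) (q := q) (e := emax q - 1) (by omega) (by omega)
    rwa [zpow_sub_one₀ (by norm_num), ← four_T, show 4 * T q * 2⁻¹ = 2 * T q by ring] at this
  · rw [four_T]; exact h.fn_zpow (by omega) le_rfl

/-- The rounded values at powers of two are so close to these that the error disappears by rounding
after a multiplication by the least positive float. -/
theorem abs_rd_sub_lt (h : Rectifier φ ψ kap lc) [ok : Ok p q] (j : ℕ)
    (hj : (2 : ℝ) ^ j ∈ floatSet p q) :
    |rd p q (φ (2 ^ j)) - 2 ^ j| < 1 / 2 := by
  cases j with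
  | zero =>
    have h5 : (5 / 8 : ℝ) ∈ floatSet p q := by
      have hE := ok.seven_le
      have hm := ok.emin_eq
      have := mem_small (p := p) (q := q) 5 (-3) (by norm_num) (by have := ok.two_le; omega)
        (by omega)
      norm_num at this ⊢; exact this
    rw [pow_zero]
    have h1 := le_rd h.one h5
    have h2 := rd_le (p := p) (q := q) (h.pos 1 one_pos).2 one_mem
    rw [abs_lt]; constructor <;> linarith
  | succ j =>
    have h2 : (2 : ℝ) ≤ 2 ^ (j + 1) := by
      rw [pow_succ]; have : (1 : ℝ) ≤ 2 ^ j := one_le_pow₀ (by norm_num)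
      linarith
    have h1 := h.large _ h2
    have h3 := (h.pos (2 ^ (j + 1)) (by positivity)).2
    have h4 := abs_rd_sub_le (p := p) (q := q) (φ (2 ^ (j + 1))) hj
    have h5 : |φ (2 ^ (j + 1)) - 2 ^ (j + 1)| < 1 / 4 := by rw [abs_lt]; constructor <;> linarith
    have h6 := abs_add_le (rd p q (φ (2 ^ (j + 1))) - φ (2 ^ (j + 1)))
      (φ (2 ^ (j + 1)) - 2 ^ (j + 1))
    rw [sub_add_sub_cancel, abs_sub_comm _ (φ (2 ^ (j + 1)))] at h6
    linarith

/-- A bit that is on has the value `2 ^ e` when it is read with weight `2 ^ (e - emax q)`. -/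
theorem row [ok : Ok p q] (e : ℤ) (he : emin q - p + emax q ≤ e) (he' : e ≤ emax q) :
    lsum (F 0) cellList (fun c => XFlt.mul (F (sgn c.2 * 2 ^ (e - emax q)))
      (F (if c.2 then T q else 2 * T q))) = (F (2 ^ e) : XFlt p q) := by
  have hE := ok.seven_le
  have hm := ok.emin_eq
  have hp := ok.two_le
  have hw := mem_zpow (p := p) (q := q) (e - emax q) (by omega) (by omega)
  have hpow : (2 : ℝ) ^ e = 4 * 2 ^ (e - 2) := by
    rw [zpow_sub₀ (by norm_num)]; norm_num; ring
  have hmm : ∀ m : ℤ, |m| ≤ 7 → (m : ℝ) * 2 ^ (e - 2) ∈ floatSet p q := fun m hm7 =>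
    mem_small m _ hm7 (by omega) (by omega)
  have hx : (2 : ℝ) ^ (e - emax q) * T q = 2 ^ (e - 2) := by
    rw [T, ← zpow_add₀ (by norm_num)]; congr 1; ring
  have h1 : XFlt.mul (F (2 ^ (e - emax q)) : XFlt p q) (F (2 * T q)) = F ((2 : ℤ) * 2 ^ (e - 2)) :=
    mul_F_mem hw (Kit.mT 2 (by norm_num) (by norm_num)) (by push_cast; linear_combination 2 * hx)
      (hmm 2 (by norm_num))
  have h2 : XFlt.mul (F (-2 ^ (e - emax q)) : XFlt p q) (F (T q)) = F ((-1 : ℤ) * 2 ^ (e - 2)) :=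
    mul_F_mem (neg_mem_floatSet hw) (Kit.mT 1 (by norm_num) (by norm_num))
      (by push_cast; linear_combination -hx) (hmm (-1) (by norm_num))
  have hadd : ∀ a b c : ℤ, a + b = c → |a| ≤ 7 → |b| ≤ 7 → |c| ≤ 7 →
      (F (a * 2 ^ (e - 2)) : XFlt p q).add (F (b * 2 ^ (e - 2))) = F (c * 2 ^ (e - 2)) :=
    fun a b c habc ha hb hc => add_F_mem (hmm a ha) (hmm b hb) (by rw [← habc]; push_cast; ring)
      (hmm c hc)
  have hl : cellList = [(0, false), (0, true), (1, false), (1, true), (2, false), (2, true),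
    (3, false), (3, true)] := by decide
  rw [hl]
  simp only [lsum_cons, lsum_nil, sgn_false, sgn_true, one_mul, neg_one_mul, if_true,
    Bool.false_eq_true, if_false, h1, h2, zero_add_F]
  rw [hadd 2 (-1) 1, hadd 1 2 3, hadd 3 (-1) 2, hadd 2 2 4, hadd 4 (-1) 3, hadd 3 2 5,
    hadd 5 (-1) 4, hpow] <;> norm_num

end Rectifier

/-! ### Comparisons with rectifiers -/

/-- A product with a negative weight is bounded above, also if it overflows. -/
theorem mul_neg_leX [Ok p q] {a c B v : ℝ} (ha : a ∈ floatSet p q) (ha0 : 0 ≤ a)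
    (hc : c ∈ floatSet p q) (hB : B ∈ floatSet p q) (h : a * c = B) (hv : c ≤ v) :
    LeX (XFlt.mul (F (-a)) (F v) : XFlt p q) (-B) := by
  have h1 := le_rd (p := p) (q := q) hv hc
  rw [← F_rd v, mul_F' (neg_mem_floatSet ha) (rd_mem v)]
  refine round_leX ?_ (neg_mem_floatSet hB)
  rw [← h]; nlinarith

/-- A value between `-1` and `0` does not disturb the sign of a positive bias. -/
theorem exists_mul_neg [Ok p q] {a v : ℝ} (ha : a ∈ floatSet p q) (ha0 : 0 ≤ a)
    (hv : -1 ≤ v ∧ v ≤ 0) : ∃ t, XFlt.mul (F (-a) : XFlt p q) (F v) = F t ∧ 0 ≤ t ∧ t ≤ a := by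
  have h1 := le_rd (p := p) (q := q) hv.1 (neg_mem_floatSet one_mem)
  have h2 := rd_le (p := p) (q := q) hv.2 zero_mem
  have h3 := abs_le_Omega ha
  rw [abs_of_nonneg ha0] at h3
  refine ⟨-a * rd p q v, ?_, by nlinarith, by nlinarith⟩
  rw [← F_rd v, mul_F (neg_mem_floatSet ha) (rd_mem v)]
  rw [abs_of_nonneg (by nlinarith)]; nlinarith

theorem exists_add_pos [Ok p q] {t a b c : ℝ} (ht : 0 ≤ t ∧ t ≤ a) (ha : a ∈ floatSet p q)
    (hb : b ∈ floatSet p q) (hb0 : 0 ≤ b) (hc : c ∈ floatSet p q) (h : a + b ≤ c) :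
    ∃ x ∈ floatSet p q, (F t : XFlt p q).add (F b) = F x ∧ b ≤ x ∧ x ≤ c := by
  have h1 := le_rd (p := p) (q := q) ht.1 zero_mem
  have h2 := rd_le (p := p) (q := q) ht.2 ha
  have h3 := abs_le_Omega hc
  rw [abs_of_nonneg (by linarith [ht.1, ht.2])] at h3
  refine ⟨rd p q (rd p q t + b), rd_mem _, ?_, le_rd (by linarith) hb, rd_le (by linarith) hc⟩
  rw [F_rd, ← F_rd t, add_F (rd_mem t) hb (by rw [abs_of_nonneg (by linarith)]; linarith)]

/-- Different floats differ at least by the least float. -/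
theorem eta_le_sub [Ok p q] {a b : ℝ} (ha : a ∈ floatSet p q) (hb : b ∈ floatSet p q)
    (h : a < b) : eta p q ≤ b - a := by
  obtain ⟨m, rfl⟩ := exists_int_eta ha
  obtain ⟨n, rfl⟩ := exists_int_eta hb
  have he := eta_pos (p := p) (q := q)
  have h1 : m < n := by exact_mod_cast lt_of_mul_lt_mul_right h he.le
  have h2 : (m : ℝ) + 1 ≤ n := by exact_mod_cast h1
  nlinarith

namespace Rectifier
variable {φ ψ : ℝ → ℝ} {kap : ℝ} {lc : ℕ}

/-- Values on the way to the outcome that a comparison is satisfied. The difference of threshold and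
input is first enlarged from the least positive float to a sizeable number and then reversed in sign
in each layer, until it leads to `kap`. -/
def good (p q : ℕ) (kap : ℝ) : ℕ → ℝ → Prop
  | 0, v => eta p q ≤ v
  | 1, v => -1 ≤ v ∧ v ≤ 0
  | 2, v => 2 ^ (emax q - p - 1) ≤ v
  | _, v => v = kap

/-- Values on the way to the outcome that a comparison is violated: in each layer, the biases provide
the sign opposite to that of `good`. -/
def viol (p q : ℕ) : ℕ → ℝ → Prop
  | 0, v => -1 ≤ v ∧ v ≤ 0
  | 1, v => 2 ^ (-(p : ℤ)) ≤ v
  | 2, v => -1 ≤ v ∧ v ≤ 0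
  | _, v => 2 * T q ≤ v ∧ v ≤ 3 * T q

/-- The weights of a comparison. -/
noncomputable def tw (p q : ℕ) : ℕ → ℝ
  | 0 => -(4 * T q)
  | 1 => -(4 * T q)
  | _ => -2 ^ ((p : ℤ) + 1)

/-- The biases of a comparison. -/
noncomputable def tb (p q : ℕ) : ℕ → ℝ
  | 0 => 2 ^ (1 - (p : ℤ))
  | 1 => 2 ^ (emax q - p)
  | _ => 2 * T q

/-- Large powers of two are lower bounds that rounded values preserve. -/
theorem le_rd_fn (h : Rectifier φ ψ kap lc) [ok : Ok p q] {e : ℤ} (he : emax q - 2 ≤ e)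
    (he' : e ≤ emax q) {x : ℝ} (hx : 2 ^ e ≤ x) : 2 ^ e ≤ rd p q (φ x) := by
  have hE := ok.seven_le
  have hm := ok.emin_eq
  have hpE := ok.add_le
  have hT : T q ≤ 2 ^ e := Kit.two_pow_le he
  have hT32 := T_ge (q := q) p
  have h1 := h.large x (by linarith)
  have h3 : (2 : ℝ) ^ (-2 : ℤ) ≤ 2 ^ (e - p - 2) := Kit.two_pow_le (by omega)
  have h2 := rd_absorb (p := p) (q := q) (e := e) (t := -(1 / 4)) (by omega) he' (by
    norm_num at h3 ⊢; exact h3)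
  rw [← h2]
  exact rd_mono (by linarith)

/-- A comparison starts with twice the difference of threshold and input; the factor `2` makes up for
`φ z ≥ z / 2`. -/
theorem start_eq [ok : Ok p q] {x t : ℝ} (hx : x ∈ floatSet p q) (ht : t ∈ floatSet p q)
    (hxM : |x| ≤ T q) (htM : |t| ≤ T q) {s : ℝ} (hs : s = 1 ∨ s = -1) :
    (XFlt.mul (F (-s * 2) : XFlt p q) (F x)).add (F (s * 2 * t)) = F (2 * (s * t - s * x)) := by
  have hT := T_pos (q := q)
  have h7 := seven_T_le (p := p) (q := q)
  have h2 : (2 : ℝ) ∈ floatSet p q := by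
    simpa using Kit.two_pow_mem (p := p) (q := q) 1 (by norm_num)
  have hdbl : ∀ y ∈ floatSet p q, |y| ≤ T q → 2 * y ∈ floatSet p q := fun y hy hyT => by
    have := mem_scale hy 1 (by rw [abs_mul]; norm_num; linarith) (Or.inl (by norm_num))
    rwa [zpow_one, mul_comm] at this
  have hx2 := hdbl x hx hxM
  have ht2 := hdbl t ht htM
  have hb : |2 * (s * t - s * x)| ≤ Omega p q := by
    have h1 := abs_sub t x
    have : |s| = 1 := by rcases hs with rfl | rfl <;> simp
    rw [← mul_sub, abs_mul, abs_mul, this]; norm_num; linarith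
  rcases hs with rfl | rfl
  · rw [mul_F_mem (t := -(2 * x)) (by simpa using neg_mem_floatSet h2) hx (by ring)
      (neg_mem_floatSet hx2), add_F (neg_mem_floatSet hx2) (by simpa using ht2) (by
        convert hb using 2; ring)]
    congr 1; ring
  · rw [mul_F_mem (t := 2 * x) (by simpa using h2) hx (by ring)
      hx2, add_F hx2 (by simpa using neg_mem_floatSet ht2) (by
        convert hb using 2; ring)]
    congr 1; ring

theorem good_start (h : Rectifier φ ψ kap lc) [ok : Ok p q] {x t : ℝ} (hx : x ∈ floatSet p q)
    (ht : t ∈ floatSet p q) (hxM : |x| ≤ T q) (htM : |t| ≤ T q) {s : ℝ} (hlt : s * x < s * t)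
    (hs : s = 1 ∨ s = -1) :
    Out (roundFun p q φ) (roundFun p q ψ)
      ((XFlt.mul (F (-s * 2)) (F x)).add (F (s * 2 * t))) (good p q kap 0) := by
  rw [start_eq hx ht hxM htM hs]
  have he := eta_pos (p := p) (q := q)
  have h1 : eta p q ≤ s * t - s * x := by
    have hx' := neg_mem_floatSet hx
    have ht' := neg_mem_floatSet ht
    rcases hs with rfl | rfl <;> exact eta_le_sub (by simpa) (by simpa) hlt
  rw [← F_rd]
  have h2 : 2 * eta p q ≤ rd p q (2 * (s * t - s * x)) := by
    have := mem_eta (p := p) (q := q) 2 (by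
      have : (2 : ℤ) ^ 1 < 2 ^ (p + 1) := pow_lt_pow_right₀ (by norm_num)
        (by have := ok.two_le; omega)
      norm_num at this ⊢; exact this)
    refine le_rd (by linarith) (by exact_mod_cast this)
  obtain ⟨v, d, hv, h3, h4⟩ := h.out_pos (rd_mem (p := p) (q := q) (2 * (s * t - s * x)))
    (by linarith)
  exact ⟨v, d, show eta p q ≤ v by linarith [hv.1], h3, h4⟩

theorem viol_start (h : Rectifier φ ψ kap lc) [ok : Ok p q] {x t : ℝ} (hx : x ∈ floatSet p q)
    (ht : t ∈ floatSet p q) (hxM : |x| ≤ T q) (htM : |t| ≤ T q) {s : ℝ} (hle : s * t ≤ s * x)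
    (hs : s = 1 ∨ s = -1) :
    Out (roundFun p q φ) (roundFun p q ψ)
      ((XFlt.mul (F (-s * 2)) (F x)).add (F (s * 2 * t))) (viol p q 0) := by
  rw [start_eq hx ht hxM htM hs]
  exact h.out_nonpos (Kit.leX_F' zero_mem (by linarith))

theorem good_step (h : Rectifier φ ψ kap lc) [ok : Ok p q] (l : ℕ) (hl : l + 1 < 4) {v : ℝ}
    (hv : good p q kap l v) : Out (roundFun p q φ) (roundFun p q ψ)
      ((XFlt.mul (F (tw p q l)) (F v)).add (F (tb p q l))) (good p q kap (l + 1)) := by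
  have hE := ok.seven_le
  have hm := ok.emin_eq
  have hpE := ok.add_le
  have hp2 := ok.two_le
  have hT := T_pos (q := q)
  have h4m : 4 * T q ∈ floatSet p q := Kit.mT 4 (by norm_num) (by norm_num)
  have h5m : 5 * T q ∈ floatSet p q := Kit.mT 5 (by norm_num) (by norm_num)
  have h2m : 2 * T q ∈ floatSet p q := Kit.mT 2 (by norm_num) (by norm_num)
  match l, hl with
  | 0, _ =>
    have hb := mem_zpow (p := p) (q := q) (1 - (p : ℤ)) (by omega) (by omega)
    have h1 : 4 * T q * eta p q = 2 ^ (1 - (p : ℤ)) := by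
      rw [four_T, eta, ← zpow_add₀ (by norm_num)]; congr 1; omega
    exact h.out_nonpos ((mul_neg_leX h4m (by linarith) eta_mem hb h1 hv).add hb zero_mem
      (neg_add_cancel _).le)
  | 1, _ =>
    have hb := mem_zpow (p := p) (q := q) (emax q - p) (by omega) (by omega)
    have hbT : (2 : ℝ) ^ (emax q - p) ≤ T q := Kit.two_pow_le (by omega)
    obtain ⟨t, ht, ht'⟩ := exists_mul_neg h4m (by linarith) hv
    obtain ⟨x, hx, hx1, hx2, hx3⟩ := exists_add_pos ht' h4m hb (by positivity) h5m (by linarith)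
    have hpos : (0 : ℝ) < 2 ^ (emax q - p) := by positivity
    obtain ⟨v', d, hv', h3, h4⟩ := h.out_pos hx (by linarith)
    refine ⟨v', d, ?_, ?_, ?_⟩
    · change (2 : ℝ) ^ (emax q - p - 1) ≤ v'
      rw [zpow_sub_one₀ (by norm_num)]; linarith
    · simp only [tw, tb]; rw [ht, hx1, h3]
    · simp only [tw, tb]; rw [ht, hx1, h4]
  | 2, _ =>
    have hb := mem_zpow (p := p) (q := q) ((p : ℤ) + 1) (by omega) (by omega)
    have hc := mem_zpow (p := p) (q := q) (emax q - p - 1) (by omega) (by omega)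
    have h1 : (2 : ℝ) ^ ((p : ℤ) + 1) * 2 ^ (emax q - p - 1) = 4 * T q := by
      rw [four_T, ← zpow_add₀ (by norm_num)]; congr 1; omega
    have := (mul_neg_leX hb (by positivity) hc h4m h1 hv).add h2m
      (Kit.mT (-1) (by norm_num) rfl) (by push_cast; linarith)
    obtain ⟨h3, h4⟩ := h.fn_low (this.mono (by push_cast; linarith))
    exact ⟨kap, 0, rfl, h3, h4⟩

theorem viol_step (h : Rectifier φ ψ kap lc) [ok : Ok p q] (l : ℕ) (hl : l + 1 < 4) {v : ℝ}
    (hv : viol p q l v) : Out (roundFun p q φ) (roundFun p q ψ)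
      ((XFlt.mul (F (tw p q l)) (F v)).add (F (tb p q l))) (viol p q (l + 1)) := by
  have hE := ok.seven_le
  have hm := ok.emin_eq
  have hpE := ok.add_le
  have hp2 := ok.two_le
  have hT := T_pos (q := q)
  have h4m : 4 * T q ∈ floatSet p q := Kit.mT 4 (by norm_num) (by norm_num)
  have h5m : 5 * T q ∈ floatSet p q := Kit.mT 5 (by norm_num) (by norm_num)
  have h2m : 2 * T q ∈ floatSet p q := Kit.mT 2 (by norm_num) (by norm_num)
  have h3m : 3 * T q ∈ floatSet p q := Kit.mT 3 (by norm_num) (by norm_num)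
  match l, hl with
  | 0, _ =>
    have hb := mem_zpow (p := p) (q := q) (1 - (p : ℤ)) (by omega) (by omega)
    have hbT : (2 : ℝ) ^ (1 - (p : ℤ)) ≤ T q := Kit.two_pow_le (by omega)
    obtain ⟨t, ht, ht'⟩ := exists_mul_neg h4m (by linarith) hv
    obtain ⟨x, hx, hx1, hx2, hx3⟩ := exists_add_pos ht' h4m hb (by positivity) h5m (by linarith)
    have hpos : (0 : ℝ) < 2 ^ (1 - (p : ℤ)) := by positivity
    obtain ⟨v', d, hv', h3, h4⟩ := h.out_pos hx (by linarith)
    refine ⟨v', d, ?_, ?_, ?_⟩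
    · change (2 : ℝ) ^ (-(p : ℤ)) ≤ v'
      rw [sub_eq_add_neg, zpow_one_add₀ (by norm_num)] at hx2; linarith
    · simp only [tw, tb]; rw [ht, hx1, h3]
    · simp only [tw, tb]; rw [ht, hx1, h4]
  | 1, _ =>
    have hb := mem_zpow (p := p) (q := q) (emax q - p) (by omega) (by omega)
    have hc := mem_zpow (p := p) (q := q) (-(p : ℤ)) (by omega) (by omega)
    have h1 : 4 * T q * 2 ^ (-(p : ℤ)) = 2 ^ (emax q - p) := by
      rw [four_T, ← zpow_add₀ (by norm_num)]; congr 1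
    exact h.out_nonpos ((mul_neg_leX h4m (by linarith) hc hb h1 hv).add hb zero_mem
      (neg_add_cancel _).le)
  | 2, _ =>
    have hb := mem_zpow (p := p) (q := q) ((p : ℤ) + 1) (by omega) (by omega)
    have hbT : (2 : ℝ) ^ ((p : ℤ) + 1) ≤ T q := Kit.two_pow_le (by omega)
    obtain ⟨t, ht, ht'⟩ := exists_mul_neg hb (by positivity) hv
    obtain ⟨x, hx, hx1, hx2, hx3⟩ := exists_add_pos ht' hb h2m (by linarith) h3m (by linarith)
    refine ⟨rd p q (φ x), ψ x, ⟨?_, ?_⟩, ?_, ?_⟩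
    · have h2 : 2 * T q = 2 ^ (emax q - 1) := by
        rw [zpow_sub_one₀ (by norm_num), ← four_T]; ring
      rw [h2] at hx2 ⊢
      exact h.le_rd_fn (by omega) (by omega) hx2
    · exact rd_le ((h.pos x (by linarith)).2.trans hx3) h3m
    · simp only [tw, tb]; rw [ht, hx1, h.fn_F hx, F_rd]
    · simp only [tw, tb]; rw [ht, hx1, h.deriv_F hx]

theorem and_good (h : Rectifier φ ψ kap lc) [ok : Ok p q] {z : XFlt p q} (hz : LeX z (-4 * T q)) :
    LeX ((z.add (XFlt.mul (F (-2)) (F kap))).add (XFlt.mul (F 2) (F kap))) (-4 * T q) := by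
  rcases h.kap_eq with hk | hk <;> rw [hk]
  · rw [mul_zero_F, mul_zero_F, add_zero_X, add_zero_X]; exact hz
  · have h2 : (2 : ℝ) ∈ floatSet p q := by
      simpa using Kit.two_pow_mem (p := p) (q := q) 1 (by norm_num)
    have h4m : -4 * T q ∈ floatSet p q := Kit.mT (-4) (by norm_num) (by norm_num)
    have h7 := seven_T_le (p := p) (q := q)
    have hT := T_pos (q := q)
    have hE := ok.seven_le
    have hm := ok.emin_eq
    have hpE := ok.add_le
    have h32 := T_ge (q := q) p
    rw [mul_F_mem (t := 2) (neg_mem_floatSet h2) (neg_mem_floatSet one_mem) (by norm_num) h2,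
      mul_F_mem (t := -2) h2 (neg_mem_floatSet one_mem) (by norm_num) (neg_mem_floatSet h2)]
    have habs := rd_absorb_neg (p := p) (q := q) (e := emax q) (t := 2) (by omega) le_rfl (by
      have : (2 : ℝ) ^ (1 : ℤ) ≤ 2 ^ (emax q - p - 2) := Kit.two_pow_le (by omega)
      rw [zpow_one] at this; rwa [abs_two])
    rw [← four_T, ← neg_mul] at habs
    exact (hz.add_rd h2 (by linarith) habs.le).add (neg_mem_floatSet h2) h4m (by linarith)

theorem and_viol (h : Rectifier φ ψ kap lc) [ok : Ok p q] {z : XFlt p q} {v : ℝ} (hz : LeX z 0)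
    (hv : viol p q 3 v) :
    LeX ((z.add (XFlt.mul (F (-2)) (F v))).add (XFlt.mul (F 2) (F kap))) (-4 * T q) := by
  have h2 : (2 : ℝ) ∈ floatSet p q := by
    simpa using Kit.two_pow_mem (p := p) (q := q) 1 (by norm_num)
  have h4m : -4 * T q ∈ floatSet p q := Kit.mT (-4) (by norm_num) (by norm_num)
  have h7 := seven_T_le (p := p) (q := q)
  have hT := T_pos (q := q)
  have h1 := le_rd (p := p) (q := q) hv.1 (Kit.mT 2 (by norm_num) (by norm_num))
  have h3 := rd_le (p := p) (q := q) hv.2 (Kit.mT 3 (by norm_num) (by norm_num))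
  have hz1 : LeX (z.add (XFlt.mul (F (-2)) (F v))) (-4 * T q) := by
    rw [← F_rd v, mul_F (neg_mem_floatSet h2) (rd_mem v)
      (by rw [abs_of_nonpos] <;> linarith), ← F_rd]
    exact hz.add (rd_mem _) h4m
      (by have := rd_le (p := p) (q := q) (r := -2 * rd p q v) (by linarith) h4m; linarith)
  rcases h.kap_eq with hk | hk <;> rw [hk]
  · rwa [mul_zero_F, add_zero_X]
  · rw [mul_F_mem (t := -2) h2 (neg_mem_floatSet one_mem) (by norm_num) (neg_mem_floatSet h2)]
    exact hz1.add (neg_mem_floatSet h2) h4m (by linarith)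

end Rectifier

/-! ### The neurons of a network with a rectifier -/

namespace Rectifier
variable {φ ψ : ℝ → ℝ} {kap : ℝ} {lc : ℕ}

theorem lc_le (h : Rectifier φ ψ kap lc) : lc ≤ 1 := by
  rcases h.gate with h | h <;> omega

/-- A gradient neuron of the first layer has derivative `1` for all inputs, and the constants that
accompany it absorb its value. With the weight `2 ^ (1 - p)`, the value lies between `u` and `3 u`
for `u = 2 ^ (emax - p - 1)`; after subtraction of `2 u`, it is absorbed by `6 T`. -/
theorem first (h : Rectifier φ ψ kap lc) [ok : Ok p q] {x : ℝ} (hx : x ∈ floatSet p q)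
    (hxM : |x| ≤ T q) : ∃ v,
    roundFun p q φ ((F x).add (F (2 * T q))) = F v ∧
    roundFun p q ψ ((F x).add (F (2 * T q))) = F 1 ∧
    ((((F 0).add (XFlt.mul (F (2 ^ (1 - (p : ℤ)))) (F v))).add
      (XFlt.mul (F (-2 ^ (-(p : ℤ)))) (F (4 * T q)))).add
      (XFlt.mul (F (3 / 2)) (F (4 * T q)))).add (XFlt.mul (F (-(3 / 2))) (F (4 * T q)))
      = (F 0 : XFlt p q) := by
  have hE := ok.seven_le
  have hm := ok.emin_eq
  have hpE := ok.add_le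
  have hp := ok.two_le
  have hT := T_pos (q := q)
  have h7 := seven_T_le (p := p) (q := q)
  have h1m : T q ∈ floatSet p q := Kit.mT 1 (by norm_num) (by norm_num)
  have h2m : 2 * T q ∈ floatSet p q := Kit.mT 2 (by norm_num) (by norm_num)
  have h3m : 3 * T q ∈ floatSet p q := Kit.mT 3 (by norm_num) (by norm_num)
  have h4m : 4 * T q ∈ floatSet p q := Kit.mT 4 (by norm_num) (by norm_num)
  have h6m : 6 * T q ∈ floatSet p q := Kit.mT 6 (by norm_num) (by norm_num)
  rw [abs_le] at hxM
  rw [add_F hx h2m (by rw [abs_of_nonneg] <;> linarith), ← F_rd]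
  set z := rd p q (x + 2 * T q) with hz
  have hzm : z ∈ floatSet p q := rd_mem _
  have hz1 : T q ≤ z := le_rd (by linarith) h1m
  have hz3 : z ≤ 3 * T q := rd_le (by linarith) h3m
  have hv1 : T q ≤ rd p q (φ z) := h.le_rd_fn le_rfl (by omega) hz1
  have hv3 : rd p q (φ z) ≤ 3 * T q := rd_le ((h.pos z (by linarith)).2.trans hz3) h3m
  refine ⟨rd p q (φ z), by rw [h.fn_F hzm, F_rd], ?_, ?_⟩
  · have h32 := T_ge (q := q) p
    rw [h.deriv_F hzm, F_eq_iff, rd_of_mem one_mem]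
    exact rd_near (Or.inr (Or.inl rfl)) ((h.deriv_large _ (by linarith)).trans
      (inv_sq_le (Or.inr hz1)))
  -- the unit of the calculation
  set u : ℝ := 2 ^ (emax q - p - 1) with hu
  have hu0 : 0 < u := by positivity
  have hum : ∀ m : ℤ, |m| ≤ 7 → (m : ℝ) * u ∈ floatSet p q := fun m h7 =>
    mem_small m _ h7 (by omega) (by omega)
  have e1 : (2 : ℝ) ^ (1 - (p : ℤ)) * T q = u := by
    rw [T, hu, ← zpow_add₀ (by norm_num)]; congr 1; ring
  have e2 : (2 : ℝ) ^ (-(p : ℤ)) * (4 * T q) = 2 * u := by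
    rw [four_T, hu, ← zpow_add₀ (by norm_num), ← zpow_one_add₀ (by norm_num)]; congr 1; ring
  have hw : (2 : ℝ) ^ (1 - (p : ℤ)) ∈ floatSet p q := mem_zpow _ (by omega) (by omega)
  have hw' : (2 : ℝ) ^ (-(p : ℤ)) ∈ floatSet p q := mem_zpow _ (by omega) (by omega)
  have h32m : (3 / 2 : ℝ) ∈ floatSet p q := by
    have := mem_small (p := p) (q := q) 3 (-1) (by norm_num) (by omega) (by omega)
    norm_num at this ⊢; exact this
  have hpw : (0 : ℝ) < 2 ^ (1 - (p : ℤ)) := by positivity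
  have huT : u ≤ T q := Kit.two_pow_le (by omega)
  have ha1 : u ≤ 2 ^ (1 - (p : ℤ)) * rd p q (φ z) := by rw [← e1]; gcongr
  have ha3 : 2 ^ (1 - (p : ℤ)) * rd p q (φ z) ≤ 3 * u := by
    rw [← e1]
    calc _ ≤ (2 : ℝ) ^ (1 - (p : ℤ)) * (3 * T q) := by gcongr
      _ = _ := by ring
  rw [mul_F hw (rd_mem _) (by rw [abs_of_nonneg (by linarith)]; linarith),
    ← F_rd (2 ^ (1 - (p : ℤ)) * _), zero_add_F,
    mul_F_mem (t := (-2 : ℤ) * u) (neg_mem_floatSet hw') h4m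
      (by push_cast; linear_combination -e2) (hum _ (by norm_num)),
    mul_F_mem h32m h4m (by ring) h6m,
    mul_F_mem (t := -(6 * T q)) (neg_mem_floatSet h32m) h4m (by ring) (neg_mem_floatSet h6m)]
  have hs1 := le_rd (p := p) (q := q) ha1 (by simpa using hum 1 (by norm_num))
  have hs3 := rd_le (p := p) (q := q) ha3 (by simpa using hum 3 (by norm_num))
  set s := rd p q (2 ^ (1 - (p : ℤ)) * rd p q (φ z))
  have ht : |s + (-2 : ℤ) * u| ≤ u := by
    push_cast; rw [abs_le]; constructor <;> linarith
  have ht' := abs_rd_le (p := p) (q := q) ht (by simpa using hum 1 (by norm_num))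
  rw [add_F (rd_mem _) (hum _ (by norm_num)) (by linarith), ← F_rd (_ + _),
    add_F (rd_mem _) h6m (by
      rw [abs_le] at ht' ⊢; constructor <;> linarith),
    show (F (rd p q (s + (-2 : ℤ) * u) + 6 * T q) : XFlt p q) = F (6 * T q) by
      rw [F_eq_iff, add_comm, rd_six_T ht', rd_of_mem h6m], add_neg_F]

/-- The pre-activation at which the neurons of the lower part have a power of two as their
derivative. -/
noncomputable def on (lc : ℕ) : ℝ := if lc = 0 then 1 else 0

theorem gate_on (h : Rectifier φ ψ kap lc) [ok : Ok p q] :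
    roundFun p q φ (F (on lc)) = F (on lc) ∧
    roundFun p q ψ (F (on lc)) = F (2 ^ (-(lc : ℤ))) := by
  rcases h.gate with ⟨rfl, h1, h2⟩ | ⟨rfl, h2⟩
  · simp only [on, if_true]
    rw [h.fn_F one_mem, h.deriv_F one_mem, h1, h2]; simp
  · simp only [on, one_ne_zero, if_false]
    rw [h.fn_F zero_mem, h.deriv_F zero_mem, h.zero, h2]; norm_num

/-- A neuron that holds the power of two `2 ^ k`, scaled so as to be recovered exactly. -/
theorem exists_value (h : Rectifier φ ψ kap lc) [ok : Ok p q] {k : ℤ} (hk : emin q - p ≤ k)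
    (hk' : k ≤ emax q - p) : ∃ e W : ℝ, ∃ j : ℤ, e = 2 ^ j ∧ emin q - p + emax q ≤ j ∧ j ≤ emax q ∧
      |W| ≤ 1 / 4 ∧
      XFlt.mul (F W) (F (φ e)) = (F (2 ^ k) : XFlt p q) := by
  have hE := ok.seven_le
  have hm := ok.emin_eq
  have hpE := ok.add_le
  have hp := ok.two_le
  have hquart : ∀ i : ℤ, i ≤ -2 → |(2 : ℝ) ^ i| ≤ 1 / 4 := fun i hi => by
    rw [abs_of_pos (by positivity)]
    have : (2 : ℝ) ^ i ≤ 2 ^ (-2 : ℤ) := Kit.two_pow_le hi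
    norm_num at this ⊢; exact this
  have hkm : (2 : ℝ) ^ k ∈ floatSet p q := mem_zpow k hk (by omega)
  by_cases hc : emin q - p + emax q ≤ k
  · refine ⟨2 ^ emax q, 2 ^ (k - emax q), emax q, rfl, by omega, le_rfl, hquart _ (by omega), ?_⟩
    have hEm : (2 : ℝ) ^ emax q ∈ floatSet p q := mem_zpow _ (by omega) le_rfl
    rw [← h.fn_F hEm, (h.fn_zpow (by omega) le_rfl).1]
    refine mul_F_mem (mem_zpow _ (by omega) (by omega)) hEm ?_ hkm
    rw [← zpow_add₀ (by norm_num)]; congr 1; ring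
  · obtain ⟨j, hj⟩ := Int.le.dest hk
    have hjm : (2 : ℝ) ^ j ∈ floatSet p q := by
      rw [← zpow_natCast]; exact mem_zpow _ (by omega) (by omega)
    refine ⟨2 ^ j, eta p q, j, (zpow_natCast _ _).symm, by omega, by omega,
      hquart _ (by omega), ?_⟩
    have he := eta_pos (p := p) (q := q)
    have hsub := h.abs_rd_sub_lt (p := p) (q := q) j hjm
    have hk2 : (2 : ℝ) ^ k = eta p q * 2 ^ j := by
      rw [eta, ← zpow_natCast, ← zpow_add₀ (by norm_num), hj]
    have hclose : |eta p q * rd p q (φ (2 ^ j)) - 2 ^ k| < eta p q / 2 := by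
      rw [hk2, ← mul_sub, abs_mul, abs_of_pos he]; nlinarith
    rw [← F_rd (φ _), mul_F eta_mem (rd_mem _), F_eq_iff, rd_eq_of_close hkm hclose, rd_of_mem hkm]
    have h1 : (2 : ℝ) ^ k ≤ 1 := zpow_le_one_of_nonpos₀ (by norm_num) (by omega)
    have h2 := hquart (emin q - p) (by omega)
    rw [← eta, abs_of_pos he] at h2
    have h3 := two_le_Omega (p := p) (q := q)
    have h4 := abs_add_le (eta p q * rd p q (φ (2 ^ j)) - 2 ^ k) (2 ^ k)
    rw [sub_add_cancel, abs_of_pos (by positivity : (0 : ℝ) < 2 ^ k)] at h4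
    linarith

/-- The neuron that contributes a power of two to the output. -/
theorem value (h : Rectifier φ ψ kap lc) [ok : Ok p q] (k : ℤ) (hk : emin q - p ≤ k)
    (hk' : k ≤ emax q - p) : ∃ wv bv W r v0 v1 d0 d1 z : ℝ,
    0 ≤ wv ∧ wv ≤ T q ∧
    lsum (F 0) cellList
      (fun c => XFlt.mul (F (sgn c.2 * wv)) (F (if c.2 then T q else 2 * T q)))
      = (F r : XFlt p q) ∧ (F r).add (F bv) = (F z : XFlt p q) ∧
    roundFun p q φ (F z) = F v1 ∧ roundFun p q ψ (F z) = F d1 ∧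
    roundFun p q φ (F bv) = F v0 ∧ roundFun p q ψ (F bv) = F d0 ∧
    XFlt.mul (F W) (F v1) = (F (2 ^ k) : XFlt p q) ∧ XFlt.mul (F W) (F v0) = (F 0 : XFlt p q) ∧
    ∀ y ∈ floatSet p q, |y| ≤ Omega p q → ∃ γ, XFlt.mul (F y) (F W) = (F γ : XFlt p q) ∧
      ∀ d, d = d0 ∨ d = d1 → ∃ δ g, XFlt.mul (F γ) (F d) = (F δ : XFlt p q) ∧
        XFlt.mul (F δ) (F wv) = (F g : XFlt p q) := by
  have hm := ok.emin_eq
  have hT32 := T_ge (q := q) p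
  obtain ⟨e, W, j, rfl, hj, hj', hW, hWe⟩ := h.exists_value hk hk'
  have hem : (2 : ℝ) ^ j ∈ floatSet p q := mem_zpow j (by have := ok.seven_le; omega) hj'
  have hwv : (2 : ℝ) ^ (j - emax q) ≤ 1 := zpow_le_one_of_nonpos₀ (by norm_num) (by omega)
  have hO8 := Omega_le (p := p) (q := q)
  have h7 := seven_T_le (p := p) (q := q)
  have h2 : (2 : ℝ) ∈ floatSet p q := by
    simpa using Kit.two_pow_mem (p := p) (q := q) 1 (by norm_num)
  have hq : (1 / 4 : ℝ) ∈ floatSet p q := Kit.quarter_mem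
  refine ⟨2 ^ (j - emax q), 0, W, 2 ^ j, 0, φ (2 ^ j), ψ 0, ψ (2 ^ j), 2 ^ j, by positivity,
    by linarith, row j hj hj', add_zero_F _, h.fn_F hem, h.deriv_F hem,
    by rw [h.fn_F zero_mem, h.zero], h.deriv_F zero_mem, hWe, mul_zero_F _, ?_⟩
  intro y hy hyO
  obtain ⟨γ, hγ, hγ'⟩ := exists_mul_F (p := p) (q := q) hyO hW Omega_mem hq (by linarith)
  refine ⟨γ, hγ, fun d hd => ?_⟩
  have hd2 : |d| ≤ 2 := by rcases hd with rfl | rfl <;> exact h.deriv_bd _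
  obtain ⟨δ, hδ, hδ'⟩ := exists_mul_F (p := p) (q := q) (hγ'.trans (by linarith : _ ≤ 2 * T q))
    hd2 (Kit.mT 2 (by norm_num) (by norm_num)) h2 (by linarith)
  obtain ⟨g, hg, -⟩ := exists_mul_F (p := p) (q := q) (hδ'.trans (by linarith : _ ≤ 4 * T q))
    (s := 2 ^ (j - emax q)) (by rwa [abs_of_pos (by positivity)])
      (Kit.mT 4 (by norm_num) (by norm_num)) one_mem (by linarith)
  exact ⟨δ, g, hδ, hg⟩

/-- The neurons of a network whose activation function resembles the positive part. -/
noncomputable def kit (h : Rectifier φ ψ kap lc) [ok : Ok p q] :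
    Kit p q (roundFun p q φ) (roundFun p q ψ) (T q) (Omega p q) where
  kap := kap
  abs_kap := h.abs_kap
  low _ hz := h.fn_low hz
  onH := 2 * T q
  vH := 2 * T q
  cH := 1
  onH_eq := Or.inr rfl
  sig_onH := h.fn_T.2.1.1
  dsig_onH := h.fn_T.2.1.2
  vH_nonneg := by have := T_pos (q := q); linarith
  vH_le := by linarith
  cH_eq := Or.inl ⟨rfl, le_rfl⟩
  onL := on lc
  vL := on lc
  lc := lc
  lc_le := by have := h.lc_le; omega
  sig_onL := h.gate_on.1
  dsig_onL := h.gate_on.2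
  vL_nonneg := by unfold on; split_ifs <;> norm_num
  vL_le := by unfold on; split_ifs <;> norm_num
  vL_le' := by unfold on; split_ifs with h0 <;> simp [h0]
  soft := False
  soft_spec := False.elim
  w := 1
  b' := -3 * T q
  vOn := 2 * T q
  vOn' := T q
  dOn := 1
  w_bd := by have := T_ge (q := q) p; constructor <;> linarith
  b'_eq := Or.inl rfl
  on1 := h.fn_T.2.1
  on2 := by
    rw [show 4 * T q + -3 * T q = T q by ring]; exact h.fn_T.1
  dOn_eq := Or.inr ⟨rfl, rfl⟩
  row_on := by
    have := row (p := p) (q := q) (emax q) (by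
      have := ok.emin_eq; have := ok.seven_le; omega) le_rfl
    rw [sub_self, zpow_zero, ← four_T] at this
    exact this
  nt := 4
  nt_ge := by norm_num
  tw := tw p q
  tb := tb p q
  good := good p q kap
  viol := viol p q
  ta _ := 2
  good_start _ hx _ ht hxM htM _ hlt hs := h.good_start hx ht hxM htM hlt hs
  viol_start _ hx _ ht hxM htM _ hle hs := h.viol_start hx ht hxM htM hle hs
  good_step l hl _ hv := h.good_step l hl hv
  viol_step l hl _ hv := h.viol_step l hl hv
  good_end _ hv := hv
  wA := 2
  wA_bd := by have := T_ge (q := q) p; constructor <;> linarith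
  and_good _ hz := h.and_good hz
  and_viol _ _ hz hv := h.and_viol hz hv
  m2 := p - 1
  m2_le := by have := ok.two_le; have := h.lc_le; omega
  m2_lt := by have := ok.two_le; omega
  reach := by
    have := h.lc_le; have := ok.add_le; have := ok.two_le
    push_cast
    omega
  b1 _ := 2 * T q
  zc := 4 * T q
  vc := 4 * T q
  dc := 1
  d1 := 1
  A2 := 2 ^ (1 - (p : ℤ))
  A2' := -2 ^ (-(p : ℤ))
  C2 := 3 / 2
  sig_zc := h.fn_T.2.2
  dc_bd := by norm_num
  d1_bd := ⟨0, by norm_num, by norm_num⟩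
  A2_eq := by
    rw [mul_one]; congr 1; have := ok.two_le; omega
  A2'_bd := by
    rw [abs_neg, abs_of_pos (by positivity)]
    exact Kit.two_pow_le (by omega)
  C2_bd := by norm_num
  first x hx _ _ hxM _ := by
    obtain ⟨v, h1, h2, h3⟩ := h.first (p := p) (q := q) hx hxM
    exact ⟨v, 1, h1, h2, fun _ => rfl, 0, h3, by simpa using T_pos.le, fun _ => rfl⟩
  value k hk hk' := h.value k hk hk'

end Rectifier

/-! ### ReLU, ELU and Swish -/

theorem four_pow_three_le_exp {y : ℝ} (hy : 32 ≤ y) : 4 * y ^ 3 ≤ Real.exp y := by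
  have h1 := Real.pow_div_factorial_le_exp y (by linarith) 5
  refine le_trans ?_ h1
  rw [show Nat.factorial 5 = 120 by rfl, le_div_iff₀ (by norm_num)]
  have h3 : 0 < y ^ 3 := by positivity
  have h2 : (480 : ℝ) ≤ y ^ 2 := by nlinarith
  push_cast
  nlinarith

/-- The exponential function decays faster than every power. -/
theorem two_mul_exp_neg_le {y : ℝ} (hy : 32 ≤ y) : 2 * y * Real.exp (-y) ≤ 1 / (2 * y ^ 2) := by
  have h := four_pow_three_le_exp hy
  rw [Real.exp_neg, ← div_eq_mul_inv, div_le_div_iff₀ (Real.exp_pos y) (by positivity)]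
  nlinarith

theorem exp_neg_le {y : ℝ} (hy : 32 ≤ y) : Real.exp (-y) ≤ 1 / (2 * y ^ 2) :=
  le_trans (by nlinarith [Real.exp_pos (-y)]) (two_mul_exp_neg_le hy)

theorem relu_rectifier : Rectifier Act.relu.fn Act.relu.dfn 0 0 where
  kap_eq := Or.inl rfl
  zero := by simp [Act.fn]
  nonpos z hz := by simp [Act.fn, hz]
  pos z hz := by simp only [Act.fn, max_eq_right hz.le]; constructor <;> linarith
  one := by norm_num [Act.fn]
  large z hz := by
    simp only [Act.fn]; have := le_max_right 0 z; linarith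
  low z hz := by
    simp only [Act.fn, max_eq_left (by linarith : z ≤ 0)]; simp; positivity
  deriv_low z hz := by
    simp only [Act.dfn, if_neg (by linarith : ¬ 0 < z)]; simp; positivity
  deriv_large z hz := by
    simp only [Act.dfn, if_pos (by linarith : 0 < z)]; simp; positivity
  deriv_bd z := by simp only [Act.dfn]; split_ifs <;> norm_num
  gate := Or.inl ⟨rfl, by norm_num [Act.fn], by norm_num [Act.dfn]⟩

theorem elu_of_nonneg {z : ℝ} (hz : 0 ≤ z) : Act.elu.fn z = z := by simp [Act.fn, hz]

theorem elu_of_nonpos {z : ℝ} (hz : z ≤ 0) : Act.elu.fn z = Real.exp z - 1 := by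
  rcases hz.lt_or_eq with hz | rfl
  · simp [Act.fn, not_le.2 hz]
  · simp [Act.fn]

theorem hasDerivAt_elu_neg {z : ℝ} (hz : z < 0) : HasDerivAt Act.elu.fn (Real.exp z) z := by
  refine ((Real.hasDerivAt_exp z).sub_const 1).congr_of_eventuallyEq ?_
  filter_upwards [eventually_lt_nhds hz] with x hx using elu_of_nonpos hx.le

theorem hasDerivAt_elu_nonneg {z : ℝ} (hz : 0 ≤ z) : HasDerivAt Act.elu.fn 1 z := by
  rcases hz.eq_or_lt with rfl | hz
  · have h1 : HasDerivWithinAt Act.elu.fn 1 (Set.Ici 0) 0 :=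
      (hasDerivWithinAt_id _ _).congr (fun x hx => elu_of_nonneg hx) (elu_of_nonneg le_rfl)
    have h2 : HasDerivWithinAt Act.elu.fn 1 (Set.Iic 0) 0 := by
      have h3 := ((Real.hasDerivAt_exp 0).sub_const 1).hasDerivWithinAt (s := Set.Iic 0)
      rw [Real.exp_zero] at h3
      exact h3.congr (fun x hx => elu_of_nonpos hx) (elu_of_nonpos le_rfl)
    have h3 := h2.union h1
    rwa [Set.Iic_union_Ici, hasDerivWithinAt_univ] at h3
  · refine (hasDerivAt_id z).congr_of_eventuallyEq ?_
    filter_upwards [eventually_gt_nhds hz] with x hx using elu_of_nonneg hx.le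

theorem elu_rectifier : Rectifier Act.elu.fn Act.elu.dfn (-1) 0 where
  kap_eq := Or.inr rfl
  zero := elu_of_nonneg le_rfl
  nonpos z hz := by
    rw [elu_of_nonpos hz]
    have := Real.exp_pos z
    have := Real.exp_le_one_iff.2 hz
    constructor <;> linarith
  pos z hz := by rw [elu_of_nonneg hz.le]; constructor <;> linarith
  one := by rw [elu_of_nonneg one_pos.le]; norm_num
  large z hz := by rw [elu_of_nonneg (by linarith)]; linarith
  low z hz := by
    have := exp_neg_le (y := -z) (by linarith)
    rw [neg_neg, neg_sq] at this
    rw [elu_of_nonpos (by linarith), sub_neg_eq_add, sub_add_cancel, abs_of_pos (Real.exp_pos z)]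
    exact this
  deriv_low z hz := by
    have := exp_neg_le (y := -z) (by linarith)
    rw [neg_neg, neg_sq] at this
    simp only [Act.dfn]
    rw [(hasDerivAt_elu_neg (by linarith)).deriv, sub_zero, abs_of_pos (Real.exp_pos z)]
    exact this
  deriv_large z hz := by
    simp only [Act.dfn]
    rw [(hasDerivAt_elu_nonneg (by linarith)).deriv, sub_self, abs_zero]
    positivity
  deriv_bd z := by
    simp only [Act.dfn]
    rcases lt_or_ge z 0 with hz | hz
    · rw [(hasDerivAt_elu_neg hz).deriv, abs_of_pos (Real.exp_pos z)]
      linarith [Real.exp_le_one_iff.2 hz.le]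
    · rw [(hasDerivAt_elu_nonneg hz).deriv]; norm_num
  gate := Or.inl ⟨rfl, elu_of_nonneg one_pos.le, (hasDerivAt_elu_nonneg one_pos.le).deriv⟩

theorem sigmoid_pos (z : ℝ) : 0 < Act.sigmoid.fn z := by
  have := Real.exp_pos (-z)
  simp only [Act.fn]; positivity

theorem sigmoid_lt_one (z : ℝ) : Act.sigmoid.fn z < 1 := by
  have := Real.exp_pos (-z)
  simp only [Act.fn]; rw [div_lt_one (by positivity)]; linarith

theorem sigmoid_neg (z : ℝ) : Act.sigmoid.fn (-z) = 1 - Act.sigmoid.fn z := by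
  simp only [Act.fn]
  rw [neg_neg, Real.exp_neg]
  have := Real.exp_pos z
  field_simp
  ring

theorem sigmoid_le_exp (z : ℝ) : Act.sigmoid.fn z ≤ Real.exp z := by
  simp only [Act.fn]
  have h1 := Real.exp_pos (-z)
  rw [div_le_iff₀ (by positivity), mul_add, mul_one, ← Real.exp_add, add_neg_cancel, Real.exp_zero]
  linarith [Real.exp_pos z]

theorem sigmoid_zero : Act.sigmoid.fn 0 = 1 / 2 := by norm_num [Act.fn]

theorem sigmoid_monotone : Monotone Act.sigmoid.fn := by
  intro x y hxy
  simp only [Act.fn]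
  have := Real.exp_pos (-y)
  gcongr

theorem hasDerivAt_sigmoid (z : ℝ) :
    HasDerivAt Act.sigmoid.fn (Act.sigmoid.fn z * (1 - Act.sigmoid.fn z)) z := by
  have h := Real.exp_pos (-z)
  have h1 : HasDerivAt (fun x : ℝ => 1 + Real.exp (-x)) (-Real.exp (-z)) z := by
    have := ((hasDerivAt_neg z).exp).const_add 1
    simpa using this
  have h2 := (hasDerivAt_const z (1 : ℝ)).div h1 (by positivity)
  refine HasDerivAt.congr_deriv (f := Act.sigmoid.fn) h2 ?_
  simp only [Act.fn]
  field_simp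
  ring

theorem swish_eq (z : ℝ) : Act.swish.fn z = z * Act.sigmoid.fn z := by
  simp only [Act.fn]; ring

theorem hasDerivAt_swish (z : ℝ) : HasDerivAt Act.swish.fn
    (Act.sigmoid.fn z + z * (Act.sigmoid.fn z * (1 - Act.sigmoid.fn z))) z := by
  have h := (hasDerivAt_id z).mul (hasDerivAt_sigmoid z)
  have e : Act.swish.fn = id * Act.sigmoid.fn := funext swish_eq
  rw [e]
  simpa using h

theorem swish_rectifier : Rectifier Act.swish.fn Act.swish.dfn 0 1 where
  kap_eq := Or.inl rfl
  zero := by rw [swish_eq, zero_mul]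
  nonpos z hz := by
    rw [swish_eq]
    have h1 := sigmoid_pos z
    have h2 := sigmoid_le_exp z
    have h3 := Real.add_one_le_exp (-z)
    have h4 : -z * Real.exp z ≤ 1 := by
      have : Real.exp (-z) * Real.exp z = 1 := by rw [← Real.exp_add]; simp
      nlinarith [Real.exp_pos z]
    constructor <;> nlinarith
  pos z hz := by
    rw [swish_eq]
    have h1 := sigmoid_lt_one z
    have h2 := sigmoid_monotone hz.le
    rw [sigmoid_zero] at h2
    constructor <;> nlinarith
  one := by
    simp only [Act.fn]
    have h := Real.exp_one_gt_d9
    have h1 : Real.exp (-1) ≤ 3 / 5 := by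
      rw [Real.exp_neg, inv_le_comm₀ (Real.exp_pos 1) (by norm_num)]; linarith
    have := Real.exp_pos (-1)
    rw [le_div_iff₀ (by positivity)]; linarith
  large z hz := by
    have h0 : Act.swish.fn z = z - z * Act.sigmoid.fn (-z) := by rw [swish_eq, sigmoid_neg]; ring
    rw [h0]
    have h1 := Real.exp_one_gt_d9
    have h2 : 738 / 100 < Real.exp 2 := by
      rw [show (2 : ℝ) = 1 + 1 by norm_num, Real.exp_add]; nlinarith
    have h3 : Real.exp 2 * (z - 1) ≤ Real.exp z := by
      have h4 := Real.add_one_le_exp (z - 2)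
      have h5 : Real.exp z = Real.exp 2 * Real.exp (z - 2) := by rw [← Real.exp_add]; simp
      rw [h5]; gcongr; linarith
    have h6 : Act.sigmoid.fn (-z) = 1 / (1 + Real.exp z) := by simp [Act.fn]
    have h7 := Real.exp_pos z
    have h8 : z * Act.sigmoid.fn (-z) < 1 / 4 := by
      rw [h6, mul_one_div, div_lt_iff₀ (by positivity)]; nlinarith
    linarith
  low z hz := by
    have h := two_mul_exp_neg_le (y := -z) (by linarith)
    rw [neg_neg, neg_sq] at h
    have h1 := sigmoid_pos z
    have h2 := sigmoid_le_exp z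
    rw [swish_eq, sub_zero, abs_of_nonpos (by nlinarith)]
    nlinarith
  deriv_low z hz := by
    have h := two_mul_exp_neg_le (y := -z) (by linarith)
    rw [neg_neg, neg_sq] at h
    have h1 := sigmoid_pos z
    have h2 := sigmoid_le_exp z
    have h3 := sigmoid_lt_one z
    simp only [Act.dfn]
    rw [(hasDerivAt_swish z).deriv, sub_zero]
    set s := Act.sigmoid.fn z
    have h4 : s * (1 - s) ≤ s := by nlinarith
    have h5 : 0 ≤ s * (1 - s) := by nlinarith
    rw [abs_le]; constructor <;> nlinarith
  deriv_large z hz := by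
    have h := two_mul_exp_neg_le hz
    have h1 := sigmoid_pos (-z)
    have h2 := sigmoid_le_exp (-z)
    have h3 := sigmoid_lt_one (-z)
    simp only [Act.dfn]
    rw [(hasDerivAt_swish z).deriv]
    have e : Act.sigmoid.fn z = 1 - Act.sigmoid.fn (-z) := by rw [sigmoid_neg]; ring
    rw [e]
    set s := Act.sigmoid.fn (-z)
    have h4 : s * (1 - s) ≤ s := by nlinarith
    have h5 : 0 ≤ s * (1 - s) := by nlinarith
    rw [abs_le]; constructor <;> nlinarith
  deriv_bd z := by
    have h1 := sigmoid_pos z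
    have h3 := sigmoid_lt_one z
    simp only [Act.dfn]
    rw [(hasDerivAt_swish z).deriv]
    have key : |z| * (Act.sigmoid.fn z * (1 - Act.sigmoid.fn z)) ≤ 1 := by
      have hneg : ∀ y, 0 ≤ y → y * (Act.sigmoid.fn (-y) * (1 - Act.sigmoid.fn (-y))) ≤ 1 := by
        intro y hy
        have h4 := sigmoid_le_exp (-y)
        have h5 := sigmoid_pos (-y)
        have h6 := Real.add_one_le_exp y
        have h7 : Real.exp y * Real.exp (-y) = 1 := by rw [← Real.exp_add]; simp
        have h8 : y * Real.exp (-y) ≤ 1 := by nlinarith [Real.exp_pos (-y)]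
        have h9 : Act.sigmoid.fn (-y) * (1 - Act.sigmoid.fn (-y)) ≤ Real.exp (-y) := by nlinarith
        exact (mul_le_mul_of_nonneg_left h9 hy).trans h8
      rcases le_total z 0 with hz | hz
      · have := hneg (-z) (by linarith)
        rw [neg_neg] at this
        rwa [abs_of_nonpos hz]
      · have := hneg z hz
        rw [sigmoid_neg] at this
        rw [abs_of_nonneg hz]
        linarith
    have h4 := abs_add_le (Act.sigmoid.fn z) (z * (Act.sigmoid.fn z * (1 - Act.sigmoid.fn z)))
    rw [abs_mul, abs_of_pos h1, abs_of_nonneg (mul_nonneg h1.le (by linarith) :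
      0 ≤ Act.sigmoid.fn z * (1 - Act.sigmoid.fn z))] at h4
    linarith
  gate := Or.inr ⟨rfl, by
    simp only [Act.dfn]
    rw [(hasDerivAt_swish 0).deriv, sigmoid_zero]; norm_num⟩

/-! ### The Gaussian integral -/

theorem continuous_gauss : Continuous fun t : ℝ => Real.exp (-t ^ 2) := by fun_prop

theorem intervalIntegrable_gauss (a b : ℝ) :
    IntervalIntegrable (fun t : ℝ => Real.exp (-t ^ 2)) MeasureTheory.volume a b :=
  continuous_gauss.intervalIntegrable a b

theorem tendsto_gauss :
    Tendsto (fun b : ℝ => ∫ t in (0 : ℝ)..b, Real.exp (-t ^ 2)) atTop (𝓝 (√Real.pi / 2)) := by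
  have h1 := integral_gaussian_Ioi 1
  have h2 : MeasureTheory.Integrable fun t : ℝ => Real.exp (-1 * t ^ 2) :=
    integrable_exp_neg_mul_sq one_pos
  simp only [neg_one_mul, div_one] at h1 h2
  rw [← h1]
  exact MeasureTheory.intervalIntegral_tendsto_integral_Ioi 0 h2.integrableOn tendsto_id

theorem gauss_le {a : ℝ} : ∫ t in (0 : ℝ)..a, Real.exp (-t ^ 2) ≤ √Real.pi / 2 := by
  refine ge_of_tendsto tendsto_gauss ?_
  filter_upwards [eventually_ge_atTop a] with b hb
  rw [← intervalIntegral.integral_add_adjacent_intervals (intervalIntegrable_gauss 0 a)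
    (intervalIntegrable_gauss a b)]
  have := intervalIntegral.integral_nonneg hb (μ := MeasureTheory.volume)
    fun t _ => (Real.exp_pos (-t ^ 2)).le
  linarith

/-- The tail of the Gaussian integral; it arises from comparing the integrand with
`t / a * exp (-t ^ 2)`. -/
theorem gauss_ge {a : ℝ} (ha : 0 < a) :
    √Real.pi / 2 - ∫ t in (0 : ℝ)..a, Real.exp (-t ^ 2) ≤ Real.exp (-a ^ 2) / (2 * a) := by
  rw [sub_le_iff_le_add]
  refine le_of_tendsto tendsto_gauss ?_
  filter_upwards [eventually_ge_atTop a] with b hb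
  rw [← intervalIntegral.integral_add_adjacent_intervals (intervalIntegrable_gauss 0 a)
    (intervalIntegrable_gauss a b)]
  have hderiv : ∀ t ∈ Set.uIcc a b, HasDerivAt (fun t : ℝ => -(Real.exp (-t ^ 2) / (2 * a)))
      (t / a * Real.exp (-t ^ 2)) t := by
    intro t _
    have h1 : HasDerivAt (fun t : ℝ => -t ^ 2) (-(2 * t)) t :=
      HasDerivAt.congr_deriv (f := fun t : ℝ => -t ^ 2) (hasDerivAt_pow 2 t).neg (by simp)
    refine ((h1.exp.div_const (2 * a)).neg).congr_deriv ?_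
    field_simp
  have h1 := intervalIntegral.integral_eq_sub_of_hasDerivAt hderiv
    ((by fun_prop : Continuous fun t : ℝ => t / a * Real.exp (-t ^ 2)).intervalIntegrable a b)
  have h2 := intervalIntegral.integral_mono_on hb (intervalIntegrable_gauss a b)
    ((by fun_prop : Continuous fun t : ℝ => t / a * Real.exp (-t ^ 2)).intervalIntegrable a b)
    (fun t ht => by
      have : 1 ≤ t / a := by rw [le_div_iff₀ ha]; linarith [ht.1]
      nlinarith [Real.exp_pos (-t ^ 2)])
  have h3 : 0 ≤ Real.exp (-b ^ 2) / (2 * a) := by positivity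
  linarith

/-- The probability that a standard normal variable exceeds `x`. -/
noncomputable def normalTail (x : ℝ) : ℝ :=
  1 / 2 - 1 / √Real.pi * ∫ t in (0 : ℝ)..(x / √2), Real.exp (-t ^ 2)

theorem normalTail_neg (x : ℝ) : normalTail (-x) = 1 - normalTail x := by
  have h := intervalIntegral.integral_comp_neg (a := (0 : ℝ)) (b := x / √2)
    fun t : ℝ => Real.exp (-t ^ 2)
  simp only [neg_sq, neg_zero] at h
  unfold normalTail
  rw [neg_div, intervalIntegral.integral_symm (-(x / √2)) 0, ← h]
  ring

theorem normalTail_nonneg (x : ℝ) : 0 ≤ normalTail x := by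
  have h := gauss_le (a := x / √2)
  have hp : 0 < √Real.pi := Real.sqrt_pos.2 Real.pi_pos
  unfold normalTail
  rw [one_div_mul_eq_div, sub_nonneg, div_le_iff₀ hp]
  linarith

theorem normalTail_le_one (x : ℝ) : normalTail x ≤ 1 := by
  have := normalTail_nonneg (-x)
  rw [normalTail_neg] at this; linarith

/-- The usual estimate for the tail of the normal distribution. -/
theorem mul_normalTail_le {x : ℝ} (hx : 0 ≤ x) :
    x * normalTail x ≤ Real.exp (-x ^ 2 / 2) / 2 := by
  rcases hx.eq_or_lt with rfl | hx
  · simp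
  have h2 : 0 < √2 := by positivity
  have h := gauss_ge (a := x / √2) (by positivity)
  have hp : √2 ≤ √Real.pi := Real.sqrt_le_sqrt (by linarith [Real.pi_gt_three])
  have e1 : -(x / √2) ^ 2 = -x ^ 2 / 2 := by
    rw [div_pow, Real.sq_sqrt (by norm_num)]; ring
  rw [e1] at h
  have e2 : x * normalTail x = x / √Real.pi *
      (√Real.pi / 2 - ∫ t in (0 : ℝ)..(x / √2), Real.exp (-t ^ 2)) := by
    unfold normalTail; field_simp
  rw [e2]
  calc _ ≤ x / √Real.pi * (Real.exp (-x ^ 2 / 2) / (2 * (x / √2))) := by gcongr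
    _ = √2 / √Real.pi * (Real.exp (-x ^ 2 / 2) / 2) := by field_simp
    _ ≤ 1 * (Real.exp (-x ^ 2 / 2) / 2) := by
      gcongr; rw [div_le_one (by positivity)]; exact hp
    _ = _ := one_mul _

theorem hasDerivAt_normalTail (x : ℝ) :
    HasDerivAt normalTail (-(1 / (√Real.pi * √2) * Real.exp (-x ^ 2 / 2))) x := by
  have h1 := (continuous_gauss.integral_hasStrictDerivAt 0 (x / √2)).hasDerivAt
  have h2 := HasDerivAt.comp (h := fun x : ℝ => x / √2) x h1 ((hasDerivAt_id x).div_const √2)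
  refine HasDerivAt.congr_deriv (f := normalTail) ((h2.const_mul (1 / √Real.pi)).const_sub (1 / 2))
    ?_
  rw [div_pow, Real.sq_sqrt (by norm_num), neg_div]
  field_simp

/-! ### GELU -/

theorem gelu_eq (x : ℝ) : Act.gelu.fn x = x * (1 - normalTail x) := by
  simp only [Act.fn, normalTail]; ring

theorem hasDerivAt_gelu (x : ℝ) : HasDerivAt Act.gelu.fn
    (1 - normalTail x + x * (1 / (√Real.pi * √2) * Real.exp (-x ^ 2 / 2))) x := by
  have e : Act.gelu.fn = id * fun x => 1 - normalTail x := funext gelu_eq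
  rw [e]
  simpa using (hasDerivAt_id x).mul ((hasDerivAt_normalTail x).const_sub 1)

theorem density_bd (x : ℝ) : 0 ≤ 1 / (√Real.pi * √2) * Real.exp (-x ^ 2 / 2) ∧
    1 / (√Real.pi * √2) * Real.exp (-x ^ 2 / 2) ≤ Real.exp (-x ^ 2 / 2) / 2 := by
  refine ⟨by positivity, ?_⟩
  have h : 2 ≤ √Real.pi * √2 := by
    rw [← Real.sqrt_mul Real.pi_pos.le]
    exact Real.le_sqrt_of_sq_le (by linarith [Real.pi_gt_three])
  have := mul_le_mul_of_nonneg_right (one_div_le_one_div_of_le two_pos h)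
    (Real.exp_pos (-x ^ 2 / 2)).le
  linarith

theorem exp_neg_sq_le {x : ℝ} (hx : 32 ≤ x) : Real.exp (-x ^ 2 / 2) ≤ Real.exp (-x) :=
  Real.exp_le_exp.2 (by nlinarith)

theorem gelu_rectifier : Rectifier Act.gelu.fn Act.gelu.dfn 0 1 where
  kap_eq := Or.inl rfl
  zero := by rw [gelu_eq, zero_mul]
  nonpos z hz := by
    have h1 := mul_normalTail_le (x := -z) (by linarith)
    have h2 := normalTail_nonneg (-z)
    have h3 : Real.exp (-(-z) ^ 2 / 2) ≤ 1 := Real.exp_le_one_iff.2 (by nlinarith [sq_nonneg z])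
    have e : Act.gelu.fn z = -(-z * normalTail (-z)) := by rw [gelu_eq, normalTail_neg]; ring
    rw [e]
    constructor <;> nlinarith
  pos z hz := by
    have h2 := normalTail_nonneg z
    rw [gelu_eq]
    have h3 : normalTail z ≤ 1 / 2 := by
      have : 0 ≤ ∫ t in (0 : ℝ)..(z / √2), Real.exp (-t ^ 2) :=
        intervalIntegral.integral_nonneg (by positivity) fun t _ => (Real.exp_pos (-t ^ 2)).le
      unfold normalTail
      have : 0 ≤ 1 / √Real.pi * ∫ t in (0 : ℝ)..(z / √2), Real.exp (-t ^ 2) := by positivity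
      linarith
    constructor <;> nlinarith
  one := by
    have h1 := mul_normalTail_le (x := 1) zero_le_one
    have h3 : Real.exp (-1 ^ 2 / 2) ≤ 2 / 3 := by
      have := Real.add_one_le_exp (1 / 2)
      rw [show (-1 ^ 2 / 2 : ℝ) = -(1 / 2) by norm_num, Real.exp_neg,
        inv_le_comm₀ (Real.exp_pos _) (by norm_num)]
      linarith
    rw [gelu_eq]
    linarith
  large z hz := by
    have h1 := mul_normalTail_le (x := z) (by linarith)
    have h3 : Real.exp (-z ^ 2 / 2) ≤ 1 / 3 := by
      have := Real.add_one_le_exp (z ^ 2 / 2)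
      rw [neg_div, Real.exp_neg, inv_le_comm₀ (Real.exp_pos _) (by norm_num)]
      nlinarith
    rw [gelu_eq]
    linarith
  low z hz := by
    have h1 := mul_normalTail_le (x := -z) (by linarith)
    have h2 := normalTail_nonneg (-z)
    have h3 := exp_neg_sq_le (x := -z) (by linarith)
    have h4 := exp_neg_le (y := -z) (by linarith)
    rw [neg_sq z] at h4
    have e : Act.gelu.fn z = -(-z * normalTail (-z)) := by rw [gelu_eq, normalTail_neg]; ring
    have h5 := Real.exp_pos (-(-z))
    rw [e, sub_zero, abs_neg, abs_of_nonneg (mul_nonneg (by linarith) h2)]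
    linarith
  deriv_low z hz := by
    have h1 := mul_normalTail_le (x := -z) (by linarith)
    have h2 := normalTail_nonneg (-z)
    have h3 := exp_neg_sq_le (x := -z) (by linarith)
    have h4 := two_mul_exp_neg_le (y := -z) (by linarith)
    have h5 := density_bd (-z)
    have h6 := Real.exp_pos (-(-z) ^ 2 / 2)
    simp only [Act.dfn]
    rw [(hasDerivAt_gelu z).deriv, sub_zero, ← normalTail_neg, ← neg_sq z]
    have h7 : normalTail (-z) ≤ -z * normalTail (-z) := by nlinarith
    generalize 1 / (√Real.pi * √2) * Real.exp (-(-z) ^ 2 / 2) = D at *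
    have h8 : -z * D ≤ -z * Real.exp (-(-z)) := by
      refine mul_le_mul_of_nonneg_left ?_ (by linarith)
      linarith
    have h9 : 0 ≤ -z * D := mul_nonneg (by linarith) h5.1
    have h10 : Real.exp (-(-z)) ≤ -z * Real.exp (-(-z)) := by
      nlinarith [Real.exp_pos (-(-z))]
    rw [abs_le]; constructor <;> linarith
  deriv_large z hz := by
    have h1 := mul_normalTail_le (x := z) (by linarith)
    have h2 := normalTail_nonneg z
    have h3 := exp_neg_sq_le hz
    have h4 := two_mul_exp_neg_le hz
    have h5 := density_bd z
    have h6 := Real.exp_pos (-z ^ 2 / 2)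
    simp only [Act.dfn]
    rw [(hasDerivAt_gelu z).deriv]
    have h7 : normalTail z ≤ z * normalTail z := by nlinarith
    generalize 1 / (√Real.pi * √2) * Real.exp (-z ^ 2 / 2) = D at *
    have h8 : z * D ≤ z * Real.exp (-z) := by
      refine mul_le_mul_of_nonneg_left ?_ (by linarith)
      linarith
    have h9 : 0 ≤ z * D := mul_nonneg (by linarith) h5.1
    have h10 : Real.exp (-z) ≤ z * Real.exp (-z) := by
      nlinarith [Real.exp_pos (-z)]
    rw [abs_le]; constructor <;> linarith
  deriv_bd z := by
    have h2 := normalTail_nonneg z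
    have h3 := normalTail_le_one z
    have h5 := density_bd z
    simp only [Act.dfn]
    rw [(hasDerivAt_gelu z).deriv]
    have h4 : |z| * Real.exp (-z ^ 2 / 2) ≤ 1 := by
      have h6 := Real.add_one_le_exp (z ^ 2 / 2)
      have h7 : Real.exp (z ^ 2 / 2) * Real.exp (-z ^ 2 / 2) = 1 := by
        rw [← Real.exp_add, neg_div, add_neg_cancel, Real.exp_zero]
      have h8 : |z| ≤ Real.exp (z ^ 2 / 2) := by
        nlinarith [sq_nonneg (|z| - 1), sq_abs z]
      rw [← h7]
      gcongr
    generalize 1 / (√Real.pi * √2) * Real.exp (-z ^ 2 / 2) = D at *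
    have h6 : |z * D| ≤ 1 := by
      rw [abs_mul, abs_of_nonneg h5.1]
      refine le_trans (mul_le_mul_of_nonneg_left ?_ (abs_nonneg z)) h4
      linarith [Real.exp_pos (-z ^ 2 / 2)]
    rw [abs_le] at h6 ⊢
    constructor <;> linarith [h6.1, h6.2]
  gate := Or.inr ⟨rfl, by
    simp only [Act.dfn]
    rw [(hasDerivAt_gelu 0).deriv]
    norm_num [normalTail]⟩

/-! ### Bounded activation functions -/

/-- The monotone function `φ`, with derivative `ψ`, tends to `kap` on the left and to `1` on the
right. -/
structure Saturating (φ ψ : ℝ → ℝ) (kap : ℝ) : Prop where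
  kap_eq : kap = 0 ∨ kap = -1
  mono : Monotone φ
  bd : ∀ z, kap ≤ φ z ∧ φ z ≤ 1
  low : ∀ z ≤ -32, |φ z - kap| ≤ 1 / (2 * z ^ 2)
  high : ∀ z, 32 ≤ z → |φ z - 1| ≤ 1 / (2 * z ^ 2)
  deriv_low : ∀ z ≤ -32, |ψ z - 0| ≤ 1 / (2 * z ^ 2)
  deriv_high : ∀ z, 32 ≤ z → |ψ z - 0| ≤ 1 / (2 * z ^ 2)
  deriv_bd : ∀ z, |ψ z| ≤ 1

namespace Saturating
variable {φ ψ : ℝ → ℝ} {kap : ℝ}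

theorem abs_kap (h : Saturating φ ψ kap) : |kap| ≤ 1 := by
  rcases h.kap_eq with h | h <;> rw [h] <;> norm_num

theorem kap_mem (h : Saturating φ ψ kap) [Ok p q] : kap ∈ floatSet p q := by
  rcases h.kap_eq with h | h <;> rw [h]
  · exact zero_mem
  · exact neg_mem_floatSet one_mem

theorem abs_fn_le (h : Saturating φ ψ kap) (z : ℝ) : |φ z| ≤ 1 := by
  have h1 := h.bd z
  have h2 := (abs_le.1 h.abs_kap).1
  exact abs_le.2 ⟨by linarith, h1.2⟩

theorem fn_F (h : Saturating φ ψ kap) [Ok p q] {z : ℝ} (hz : z ∈ floatSet p q) :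
    roundFun p q φ (F z) = F (φ z) :=
  roundFun_F hz (by have := h.abs_fn_le z; have := two_le_Omega (p := p) (q := q); linarith)

theorem deriv_F (h : Saturating φ ψ kap) [Ok p q] {z : ℝ} (hz : z ∈ floatSet p q) :
    roundFun p q ψ (F z) = F (ψ z) :=
  roundFun_F hz (by have := h.deriv_bd z; have := two_le_Omega (p := p) (q := q); linarith)

theorem fn_low (h : Saturating φ ψ kap) [Ok p q] {z : XFlt p q} (hz : LeX z (-T q)) :
    roundFun p q φ z = F kap ∧ roundFun p q ψ z = F 0 :=
  ⟨roundFun_low h.kap_eq h.low hz, roundFun_low (Or.inl rfl) h.deriv_low hz⟩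

theorem fn_high (h : Saturating φ ψ kap) [Ok p q] {z : XFlt p q} (hz : GeX z (T q)) :
    roundFun p q φ z = F 1 ∧ roundFun p q ψ z = F 0 :=
  ⟨roundFun_high (Or.inr rfl) h.high hz, roundFun_high (Or.inl rfl) h.deriv_high hz⟩

/-- The two pre-activations at which the neurons of a bit are switched on. -/
theorem fn_on (h : Saturating φ ψ kap) [Ok p q] :
    (roundFun p q φ (F (2 * T q)) = F 1 ∧ roundFun p q ψ (F (2 * T q)) = F 0) ∧
    (roundFun p q φ (F (-2 * T q)) = F kap ∧ roundFun p q ψ (F (-2 * T q)) = F 0) := by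
  have hT := T_pos (q := q)
  exact ⟨h.fn_high (geX_F (Kit.mT 2 (by norm_num) (by norm_num)) (by linarith)),
    h.fn_low (leX_F (Kit.mT (-2) (by norm_num) (by norm_num)) (by linarith))⟩

theorem out_ge (h : Saturating φ ψ kap) [Ok p q] {z : XFlt p q} {r : ℝ} (hz : GeX z r) :
    Out (roundFun p q φ) (roundFun p q ψ) z fun v => rd p q (φ r) ≤ v ∧ v ≤ 1 := by
  rcases hz with rfl | ⟨x, hx, rfl, hrx⟩
  · obtain ⟨h1, h2⟩ := h.fn_high (p := p) (q := q) (z := .posInf) (Or.inl rfl)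
    exact ⟨1, 0, ⟨rd_le (h.bd r).2 one_mem, le_rfl⟩, h1, h2⟩
  · exact ⟨rd p q (φ x), ψ x, ⟨rd_mono (h.mono hrx), rd_le (h.bd x).2 one_mem⟩,
      by rw [h.fn_F hx, F_rd], h.deriv_F hx⟩

theorem out_le (h : Saturating φ ψ kap) [Ok p q] {z : XFlt p q} {r : ℝ} (hz : LeX z r) :
    Out (roundFun p q φ) (roundFun p q ψ) z fun v => kap ≤ v ∧ v ≤ rd p q (φ r) := by
  rcases hz with rfl | ⟨x, hx, rfl, hrx⟩
  · obtain ⟨h1, h2⟩ := h.fn_low (p := p) (q := q) (z := .negInf) (Or.inl rfl)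
    exact ⟨kap, 0, ⟨le_rfl, le_rd (h.bd r).1 h.kap_mem⟩, h1, h2⟩
  · exact ⟨rd p q (φ x), ψ x, ⟨le_rd (h.bd x).1 h.kap_mem, rd_mono (h.mono hrx)⟩,
      by rw [h.fn_F hx, F_rd], h.deriv_F hx⟩

theorem out_fin (h : Saturating φ ψ kap) [Ok p q] (r : ℝ) :
    Out (roundFun p q φ) (roundFun p q ψ) (F r) fun v => |v| ≤ 1 := by
  rw [← F_rd]
  exact ⟨φ (rd p q r), ψ (rd p q r), h.abs_fn_le _, h.fn_F (rd_mem r), h.deriv_F (rd_mem r)⟩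

/-- A gradient neuron of the first layer has the derivative `ψ 0`, and is cancelled by a constant
neuron, if its input is the one that it watches. -/
theorem first (h : Saturating φ ψ kap) [ok : Ok p q] {x x0 A d1 : ℝ} (hx : x ∈ floatSet p q)
    (hx0 : x0 ∈ floatSet p q) (hxM : |x| ≤ 2 * T q) (hxM0 : |x0| ≤ 2 * T q)
    (hA0 : 0 ≤ A) (hA4 : A ≤ 4) (hd1 : ψ 0 = d1) : ∃ v e,
    roundFun p q φ ((F x).add (F (-x0))) = F v ∧ roundFun p q ψ ((F x).add (F (-x0))) = F e ∧
    (x = x0 → e = d1) ∧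
    ∃ r, ((((F 0).add (XFlt.mul (F A) (F v))).add (XFlt.mul (F (-A)) (F (φ 0)))).add
      (XFlt.mul (F 0) (F (φ 0)))).add (XFlt.mul (F (-0)) (F (φ 0))) = (F r : XFlt p q) ∧
      |r| ≤ T q ∧ (x = x0 ∨ ¬ True → r = 0) := by
  have h7 := seven_T_le (p := p) (q := q)
  have hT := T_ge (q := q) p
  have h4m : (4 : ℝ) ∈ floatSet p q := by
    have := Kit.two_pow_mem (p := p) (q := q) 2 (by norm_num); norm_num at this; exact this
  have h8m := eight_mem (p := p) (q := q)
  rw [add_F hx (neg_mem_floatSet hx0) (by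
    have := abs_sub x x0; rw [← sub_eq_add_neg]; linarith), ← F_rd]
  have hz := rd_mem (p := p) (q := q) (x + -x0)
  refine ⟨φ (rd p q (x + -x0)), ψ (rd p q (x + -x0)), h.fn_F hz, h.deriv_F hz, ?_, ?_⟩
  · rintro rfl
    rw [add_neg_cancel, rd_of_mem zero_mem, hd1]
  · have hmul : ∀ z, ∃ t, XFlt.mul (F A : XFlt p q) (F (φ z)) = F t ∧ |t| ≤ 4 := fun z => by
      obtain ⟨t, ht, ht'⟩ := exists_mul_F (p := p) (q := q) (r := A) (a := 4) (b := 1)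
        (by rwa [abs_of_nonneg hA0]) (h.abs_fn_le z) h4m one_mem (by linarith)
      exact ⟨t, ht, by linarith⟩
    rw [neg_zero, zero_mul_F, add_zero_X, add_zero_X]
    by_cases hxx : x = x0
    · subst hxx
      rw [add_neg_cancel, rd_of_mem zero_mem]
      obtain ⟨t, ht, -⟩ := hmul 0
      exact ⟨0, pair_cancel_left ⟨t, ht⟩, by simpa using T_pos.le, fun _ => rfl⟩
    · obtain ⟨t, ht, ht4⟩ := hmul (rd p q (x + -x0))
      obtain ⟨s, hs, hs4⟩ := hmul 0
      rw [ht, nx_mul_F, hs, nx_F, zero_add_F]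
      have ht' := abs_rd_le ht4 h4m
      have hs' := abs_rd_le (p := p) (q := q) (abs_neg s ▸ hs4 : |-s| ≤ 4) h4m
      have hadd := abs_add_le (rd p q t) (rd p q (-s))
      rw [← F_rd t, ← F_rd (-s), add_F (rd_mem _) (rd_mem _) (by linarith)]
      refine ⟨_, rfl, by linarith, fun h => ?_⟩
      rcases h with h | h
      · exact absurd h hxx
      · exact absurd trivial h

end Saturating

/-- Products with a positive weight preserve one-sided bounds, also if they overflow. -/
theorem mul_geX [Ok p q] {a c B v : ℝ} (ha : a ∈ floatSet p q) (ha0 : 0 ≤ a)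
    (hc : c ∈ floatSet p q) (hB : B ∈ floatSet p q) (h : B ≤ a * c) (hv : c ≤ v) :
    GeX (XFlt.mul (F a) (F v) : XFlt p q) B := by
  have h1 := le_rd (p := p) (q := q) hv hc
  rw [← F_rd v, mul_F' ha (rd_mem v)]
  exact round_geX (h.trans (by gcongr)) hB

theorem mul_leX [Ok p q] {a c B v : ℝ} (ha : a ∈ floatSet p q) (ha0 : 0 ≤ a)
    (hc : c ∈ floatSet p q) (hB : B ∈ floatSet p q) (h : a * c ≤ B) (hv : v ≤ c) :
    LeX (XFlt.mul (F a) (F v) : XFlt p q) B := by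
  have h1 := rd_le (p := p) (q := q) hv hc
  rw [← F_rd v, mul_F' ha (rd_mem v)]
  exact round_leX (le_trans (by gcongr) h) hB

/-- The comparison of an input with a threshold starts with their scaled difference, which is
positive if the comparison is satisfied. -/
theorem compare_pos [Ok p q] {x t g s : ℝ} {j : ℕ} (hj : (2 : ℝ) ^ j ∈ floatSet p q)
    (hx : x ∈ floatSet p q) (ht : t ∈ floatSet p q) (htA : |t * 2 ^ j| ≤ 4 * T q)
    (hg : g ∈ floatSet p q) (hg3 : g ≤ 3 * T q) (hgap : g ≤ 2 ^ j * (s * t - s * x))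
    (hlt : s * x < s * t) (hs : s = 1 ∨ s = -1) :
    GeX ((XFlt.mul (F (-s * 2 ^ j) : XFlt p q) (F x)).add (F (s * 2 ^ j * t))) g := by
  have h7 := seven_T_le (p := p) (q := q)
  have hT := T_pos (q := q)
  have hsgn : ∀ y ∈ floatSet p q, s * y ∈ floatSet p q ∧ -s * y ∈ floatSet p q := fun y hy => by
    have := neg_mem_floatSet hy
    rcases hs with rfl | rfl <;> constructor <;> simpa
  have hsc : ∀ y ∈ floatSet p q, |y * 2 ^ j| ≤ Omega p q → y * 2 ^ j ∈ floatSet p q :=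
    fun y hy hyO => by
      have := mem_scale hy j (by rwa [zpow_natCast]) (Or.inl (by positivity))
      rwa [zpow_natCast] at this
  have htm : s * 2 ^ j * t ∈ floatSet p q := by
    rw [mul_assoc, mul_comm _ t]; exact (hsgn _ (hsc t ht (by linarith))).1
  have hpos : (0 : ℝ) < 2 ^ j := by positivity
  rw [mul_F' (hsgn _ hj).2 hx]
  by_cases hc : |x * 2 ^ j| ≤ Omega p q
  · have hxm := (hsgn _ (hsc x hx hc)).2
    rw [show -s * 2 ^ j * x = -s * (x * 2 ^ j) by ring, round_of_mem hxm, add_F' hxm htm]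
    exact round_geX (by linarith) hg
  -- an overflow has the right sign, because the scaled threshold is at most `4 T`
  · push Not at hc
    rw [abs_le] at htA
    have h1 : x * 2 ^ j * s < t * 2 ^ j * s := by nlinarith
    have h2 : Omega p q ≤ -s * 2 ^ j * x ∧ -(4 * T q) ≤ s * 2 ^ j * t := by
      rcases lt_abs.1 hc with hc | hc <;> rcases hs with rfl | rfl <;> constructor <;> linarith
    exact (round_geX h2.1 Omega_mem).add htm hg (by linarith)

/-- The scaled difference is not positive if the comparison is violated. -/
theorem compare_nonpos [Ok p q] {x t s : ℝ} {j : ℕ} (hj : (2 : ℝ) ^ j ∈ floatSet p q)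
    (hx : x ∈ floatSet p q) (ht : t ∈ floatSet p q) (htA : |t * 2 ^ j| ≤ 4 * T q)
    (hle : s * t ≤ s * x) (hs : s = 1 ∨ s = -1) :
    LeX ((XFlt.mul (F (-s * 2 ^ j) : XFlt p q) (F x)).add (F (s * 2 ^ j * t))) 0 := by
  have h7 := seven_T_le (p := p) (q := q)
  have hT := T_pos (q := q)
  have hsgn : ∀ y ∈ floatSet p q, s * y ∈ floatSet p q ∧ -s * y ∈ floatSet p q := fun y hy => by
    have := neg_mem_floatSet hy
    rcases hs with rfl | rfl <;> constructor <;> simpa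
  have hsc : ∀ y ∈ floatSet p q, |y * 2 ^ j| ≤ Omega p q → y * 2 ^ j ∈ floatSet p q :=
    fun y hy hyO => by
      have := mem_scale hy j (by rwa [zpow_natCast]) (Or.inl (by positivity))
      rwa [zpow_natCast] at this
  have htm : s * 2 ^ j * t ∈ floatSet p q := by
    rw [mul_assoc, mul_comm _ t]; exact (hsgn _ (hsc t ht (by linarith))).1
  have hpos : (0 : ℝ) < 2 ^ j := by positivity
  have h1 : t * 2 ^ j * s ≤ x * 2 ^ j * s := by nlinarith
  rw [mul_F' (hsgn _ hj).2 hx]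
  by_cases hc : |x * 2 ^ j| ≤ Omega p q
  · have hxm := (hsgn _ (hsc x hx hc)).2
    rw [show -s * 2 ^ j * x = -s * (x * 2 ^ j) by ring, round_of_mem hxm, add_F' hxm htm]
    exact round_leX (by linarith) zero_mem
  · push Not at hc
    rw [abs_le] at htA
    have h2 : -s * 2 ^ j * x ≤ -Omega p q ∧ s * 2 ^ j * t ≤ 4 * T q := by
      rcases lt_abs.1 hc with hc | hc <;> rcases hs with rfl | rfl <;> constructor <;> linarith
    exact (round_leX h2.1 (neg_mem_floatSet Omega_mem)).add htm zero_mem (by linarith)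

/-- Floats that are not small are integer multiples of a power of two. -/
theorem exists_int_zpow [Ok p q] {x : ℝ} (hx : x ∈ floatSet p q) {j : ℤ} (hj : 2 ^ j ≤ |x|) :
    ∃ m : ℤ, x = m * 2 ^ (j - p) := by
  obtain ⟨m, k, rfl, h2, h3, h4, h5⟩ := mem_canon hx
  have hk : j - p ≤ k := by
    by_contra hc
    have h6 : (2 : ℝ) ^ k ≤ 2 ^ (j - p - 1) := Kit.two_pow_le (by omega)
    have h7 : |(m : ℝ)| < 2 ^ (p + 1) := by exact_mod_cast h2
    have h8 : (2 : ℝ) ^ j = 2 ^ (p + 1) * 2 ^ (j - p - 1) := by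
      rw [← zpow_natCast, ← zpow_add₀ (by norm_num)]; congr 1; push_cast; ring
    have h9 : (0 : ℝ) < 2 ^ (j - p - 1) := by positivity
    rw [abs_mul, abs_of_pos (by positivity : (0 : ℝ) < 2 ^ k)] at hj
    have h10 : |(m : ℝ)| * 2 ^ k ≤ |(m : ℝ)| * 2 ^ (j - p - 1) := by gcongr
    nlinarith
  obtain ⟨i, hi⟩ := Int.le.dest hk
  refine ⟨m * 2 ^ i, ?_⟩
  rw [← hi, zpow_add₀ (by norm_num)]; push_cast; simp; ring

/-! ### The sigmoid function -/

theorem sigmoid_saturating : Saturating Act.sigmoid.fn Act.sigmoid.dfn 0 := by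
  have hlow : ∀ z ≤ -32, Act.sigmoid.fn z ≤ 1 / (2 * z ^ 2) := fun z hz => by
    have h := exp_neg_le (y := -z) (by linarith)
    rw [neg_neg, neg_sq] at h
    exact (sigmoid_le_exp z).trans h
  have hhigh : ∀ z, 32 ≤ z → 1 - Act.sigmoid.fn z ≤ 1 / (2 * z ^ 2) := fun z hz => by
    rw [← sigmoid_neg, ← neg_sq]; exact hlow (-z) (by linarith)
  have hd : ∀ z, Act.sigmoid.dfn z = Act.sigmoid.fn z * (1 - Act.sigmoid.fn z) :=
    fun z => (hasDerivAt_sigmoid z).deriv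
  refine ⟨Or.inl rfl, sigmoid_monotone, fun z => ⟨(sigmoid_pos z).le, (sigmoid_lt_one z).le⟩,
    fun z hz => ?_, fun z hz => ?_, fun z hz => ?_, fun z hz => ?_, fun z => ?_⟩ <;>
  have h1 := sigmoid_pos z <;> have h2 := sigmoid_lt_one z
  · rw [sub_zero, abs_of_pos h1]; exact hlow z hz
  · rw [abs_sub_comm, abs_of_pos (by linarith)]; exact hhigh z hz
  · rw [hd, sub_zero, abs_of_nonneg (by nlinarith)]; nlinarith [hlow z hz]
  · rw [hd, sub_zero, abs_of_nonneg (by nlinarith)]; nlinarith [hhigh z hz]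
  · rw [hd, abs_of_nonneg (by nlinarith)]; nlinarith

theorem sigmoid_dfn_zero : Act.sigmoid.dfn 0 = 1 / 4 := by
  have : Act.sigmoid.dfn 0 = Act.sigmoid.fn 0 * (1 - Act.sigmoid.fn 0) :=
    (hasDerivAt_sigmoid 0).deriv
  rw [this, sigmoid_zero]; norm_num

theorem half_mem [Ok p q] : (1 / 2 : ℝ) ∈ floatSet p q := by
  have h := mem_small (p := p) (q := q) 1 (-1) (by norm_num)
    (by have := Ok.emin_eq (p := p) (q := q); have := Ok.seven_le (p := p) (q := q); omega)
    (by have := Ok.add_le (p := p) (q := q); omega)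
  norm_num at h ⊢; exact h

theorem seven_eighths_mem [Ok p q] : (7 / 8 : ℝ) ∈ floatSet p q := by
  have h := mem_small (p := p) (q := q) 7 (-3) (by norm_num)
    (by
      have := Ok.emin_eq (p := p) (q := q)
      have := Ok.seven_le (p := p) (q := q)
      have := Ok.two_le (p := p) (q := q)
      omega)
    (by have := Ok.add_le (p := p) (q := q); omega)
  norm_num at h ⊢; exact h

theorem half_add_mem [ok : Ok p q] : (1 / 2 : ℝ) + 2 ^ (-(p : ℤ) - 1) ∈ floatSet p q := by
  have hm := ok.emin_eq
  have hE := ok.seven_le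
  have := mem_int (p := p) (q := q) (2 ^ p + 1) (-(p : ℤ) - 1) (by
    rw [abs_of_nonneg (by positivity), pow_succ]
    have : (2 : ℤ) ^ 1 ≤ 2 ^ p := pow_le_pow_right₀ (by norm_num) ok.one_le
    linarith) (by omega) (by omega)
  push_cast at this
  rw [add_mul, one_mul, ← zpow_natCast, ← zpow_add₀ (by norm_num),
    show (p : ℤ) + (-p - 1) = -1 by ring] at this
  norm_num at this ⊢
  exact this

/-- The sigmoid function lifts the least positive outcome of a scaled comparison to the successor
of `1 / 2`. -/
theorem le_rd_sigmoid [ok : Ok p q] :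
    1 / 2 + 2 ^ (-(p : ℤ) - 1) ≤ rd p q (Act.sigmoid.fn (2 ^ (1 - (p : ℤ)))) := by
  have hE := ok.seven_le
  have hm := ok.emin_eq
  have hp := ok.two_le
  set u : ℝ := 2 ^ (-(p : ℤ) - 1) with hu
  have hu0 : 0 < u := by positivity
  have hz : (2 : ℝ) ^ (1 - (p : ℤ)) = 4 * u := by
    rw [hu, show (4 : ℝ) = 2 ^ (2 : ℤ) by norm_num, ← zpow_add₀ (by norm_num)]; congr 1; ring
  have hu8 : u ≤ 1 / 8 := by
    have : u ≤ 2 ^ (-3 : ℤ) := Kit.two_pow_le (by omega)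
    norm_num at this ⊢; exact this
  have hhalf : (1 / 2 : ℝ) = 2 ^ p * u := by
    rw [hu, ← zpow_natCast, ← zpow_add₀ (by norm_num), show (p : ℤ) + (-p - 1) = -1 by ring]
    norm_num
  have hlow : 1 / 2 + 3 / 4 * u ≤ Act.sigmoid.fn (2 ^ (1 - (p : ℤ))) := by
    have h1 := Real.add_one_le_exp (2 ^ (1 - (p : ℤ)))
    rw [hz] at h1 ⊢
    simp only [Act.fn]
    rw [Real.exp_neg]
    have h2 := Real.exp_pos (4 * u)
    have h3 : (Real.exp (4 * u))⁻¹ ≤ (4 * u + 1)⁻¹ := by gcongr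
    have h4 : (4 * u + 1)⁻¹ * (4 * u + 1) = 1 := inv_mul_cancel₀ (by positivity)
    have h5 : 0 < (4 * u + 1)⁻¹ := by positivity
    set w := (4 * u + 1)⁻¹
    rw [le_div_iff₀ (by positivity)]
    calc _ ≤ (1 / 2 + 3 / 4 * u) * (w * (4 * u + 1) + w) := by rw [h4]; gcongr
      _ = (1 + 7 / 2 * u + 3 * u ^ 2) * w := by ring
      _ ≤ (4 * u + 1) * w := mul_le_mul_of_nonneg_right (by nlinarith) h5.le
      _ = 1 := by rw [mul_comm, h4]
  set r := Act.sigmoid.fn (2 ^ (1 - (p : ℤ)))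
  by_contra hc
  push Not at hc
  have h1 : 1 / 2 ≤ rd p q r := le_rd (by linarith) half_mem
  obtain ⟨m, hm'⟩ := exists_int_zpow (rd_mem (p := p) (q := q) r) (j := -1) (by
    rw [abs_of_nonneg (by linarith)]; norm_num at h1 ⊢; exact h1)
  rw [show (-1 - (p : ℤ)) = -(p : ℤ) - 1 by ring, ← hu] at hm'
  have h2 : (m : ℝ) < 2 ^ p + 1 := by
    rw [hm', hhalf] at hc
    have : (m : ℝ) * u < (2 ^ p + 1) * u := by linarith
    exact lt_of_mul_lt_mul_right this hu0.le
  have h3 : m ≤ 2 ^ p := by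
    have : m < 2 ^ p + 1 := by exact_mod_cast h2
    omega
  have h4 : rd p q r ≤ 1 / 2 := by
    have : (m : ℝ) ≤ 2 ^ p := by exact_mod_cast h3
    rw [hm', hhalf]; gcongr
  have hcm : 1 / 2 + u ∈ floatSet p q := half_add_mem
  have h5 := abs_rd_sub_le (p := p) (q := q) r hcm
  rw [abs_of_nonneg (by linarith : 0 ≤ r - rd p q r)] at h5
  rcases abs_cases (r - (1 / 2 + u)) with ⟨h6, _⟩ | ⟨h6, _⟩ <;> rw [h6] at h5 <;> linarith

namespace SigmoidKit

/-- Values on the way to the outcome that a comparison is satisfied. They are above `1 / 2` at first;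
the excess is amplified by the weight `4 T`, and the last weight reverses the sign so that the value
becomes `0`. -/
def good (p : ℕ) : ℕ → ℝ → Prop
  | 0, v => 1 / 2 + 2 ^ (-(p : ℤ) - 1) ≤ v ∧ v ≤ 1
  | 1, v => 7 / 8 ≤ v ∧ v ≤ 1
  | 2, v => 7 / 8 ≤ v ∧ v ≤ 1
  | _, v => v = 0

/-- Values on the way to the outcome that a comparison is violated. They are at most `1 / 2` at first,
and the second bias makes them `0`. -/
def viol : ℕ → ℝ → Prop
  | 0, v => 0 ≤ v ∧ v ≤ 1 / 2
  | 1, v => 0 ≤ v ∧ v ≤ 1 / 2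
  | 2, v => v = 0
  | _, v => v = 1

/-- The weights of a comparison. -/
noncomputable def tw (q : ℕ) : ℕ → ℝ
  | 0 => 4 * T q
  | 1 => 4 * T q
  | _ => -(4 * T q)

/-- The biases of a comparison. -/
noncomputable def tb (q : ℕ) : ℕ → ℝ
  | 0 => -2 * T q
  | 1 => -3 * T q
  | _ => 2 * T q

/-- The scale of a comparison with the threshold `t`. Close to zero, floats may differ by the least
positive float only, which the rounded sigmoid function does not notice; thus the scale has to be
  the
largest possible one. For large thresholds such a scale would produce an overflow, but the distance
to the next float is at least `2 ^ (-p)` there. -/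
noncomputable def ta (q : ℕ) (t : ℝ) : ℝ := if |t| ≤ 1 then 4 * T q else 2

theorem exists_ta [ok : Ok p q] {t : ℝ} (ht : |t| ≤ 2 * T q) : ∃ j : ℕ, ta q t = 2 ^ j ∧
    (2 : ℝ) ^ j ∈ floatSet p q ∧ |t * 2 ^ j| ≤ 4 * T q := by
  have hE := ok.seven_le
  have hm := ok.emin_eq
  have hT := T_pos (q := q)
  unfold ta
  split_ifs with h
  · refine ⟨(emax q).toNat, ?_, ?_, ?_⟩
    · rw [four_T, ← zpow_natCast, Int.toNat_of_nonneg (by omega)]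
    · rw [← zpow_natCast, Int.toNat_of_nonneg (by omega)]
      exact mem_zpow _ (by omega) le_rfl
    · rw [← zpow_natCast, Int.toNat_of_nonneg (by omega), ← four_T, abs_mul,
        abs_of_pos (by positivity : 0 < 4 * T q)]
      nlinarith
  · refine ⟨1, by norm_num, Kit.two_pow_mem 1 (by norm_num), ?_⟩
    rw [pow_one, abs_mul, abs_two]; linarith

/-- The scaled difference of different floats has a lower bound that does not depend on them. -/
theorem le_ta_mul_sub [ok : Ok p q] {a b : ℝ} (ha : a ∈ floatSet p q) (hb : b ∈ floatSet p q)
    (h : a < b) : 2 ^ (1 - (p : ℤ)) ≤ ta q b * (b - a) := by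
  have hm := ok.emin_eq
  unfold ta
  split_ifs with hb1
  · have h1 := eta_le_sub ha hb h
    have h2 : (2 : ℝ) ^ (1 - (p : ℤ)) = 4 * T q * eta p q := by
      rw [four_T, eta, ← zpow_add₀ (by norm_num)]; congr 1; omega
    rw [h2]
    have := T_pos (q := q)
    gcongr
  · push Not at hb1
    rw [zpow_sub₀ (by norm_num), zpow_one, div_eq_mul_inv, ← zpow_neg]
    refine mul_le_mul_of_nonneg_left ?_ (by norm_num)
    set u : ℝ := 2 ^ (-(p : ℤ)) with hu
    have hu0 : 0 < u := by positivity
    have hint : ∀ y ∈ floatSet p q, 1 ≤ |y| → ∃ m : ℤ, y = m * u := fun y hy hy1 => by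
      obtain ⟨m, hm⟩ := exists_int_zpow hy (j := 0) (by simpa using hy1)
      exact ⟨m, by rw [hm, hu, zero_sub]⟩
    have key : ∀ m n : ℤ, (m : ℝ) * u < n * u → u ≤ n * u - m * u := fun m n hmn => by
      have h1 : m < n := by exact_mod_cast lt_of_mul_lt_mul_right hmn hu0.le
      have h2 : (m : ℝ) + 1 ≤ n := by exact_mod_cast h1
      nlinarith
    obtain ⟨n, hn⟩ := hint b hb hb1.le
    have hone : ((2 ^ p : ℤ) : ℝ) * u = 1 := by
      rw [hu, zpow_neg, zpow_natCast]; push_cast; field_simp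
    by_cases ha1 : 1 ≤ |a|
    · obtain ⟨m, hm⟩ := hint a ha ha1
      rw [hm, hn] at h ⊢
      exact key m n h
    · push Not at ha1
      rw [abs_lt] at ha1
      have hb0 : 1 < b := by
        rcases lt_abs.1 hb1 with h | h <;> linarith
      have := key (2 ^ p) n (by rw [hone, ← hn]; exact hb0)
      rw [hone, ← hn] at this
      linarith

theorem good_start [ok : Ok p q] {x t : ℝ} (hx : x ∈ floatSet p q)
    (ht : t ∈ floatSet p q) (htM : |t| ≤ 2 * T q) {s : ℝ} (hlt : s * x < s * t)
    (hs : s = 1 ∨ s = -1) :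
    Out (Act.sigmoid.sigma p q) (Act.sigmoid.sigma' p q)
      ((XFlt.mul (F (-s * ta q t)) (F x)).add (F (s * ta q t * t))) (good p 0) := by
  have hE := ok.seven_le
  have hm := ok.emin_eq
  obtain ⟨j, hj, hj1, hj2⟩ := exists_ta (p := p) htM
  have hgap : (2 : ℝ) ^ (1 - (p : ℤ)) ≤ ta q t * (s * t - s * x) := by
    have hx' := neg_mem_floatSet hx
    have ht' := neg_mem_floatSet ht
    have hta : ta q (s * t) = ta q t := by
      unfold ta; rcases hs with rfl | rfl <;> simp
    rw [← hta]
    rcases hs with rfl | rfl <;> exact le_ta_mul_sub (by simpa) (by simpa) hlt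
  have hg3 : (2 : ℝ) ^ (1 - (p : ℤ)) ≤ 3 * T q := by
    have : (2 : ℝ) ^ (1 - (p : ℤ)) ≤ 1 :=
      zpow_le_one_of_nonpos₀ (by norm_num) (by have := ok.two_le; omega)
    linarith [T_ge (q := q) p]
  rw [hj] at hgap ⊢
  obtain ⟨v, d, ⟨hv, hv1⟩, h2⟩ := sigmoid_saturating.out_ge (compare_pos hj1 hx ht hj2
    (mem_zpow _ (by omega) (by have := ok.two_le; omega)) hg3 hgap hlt hs)
  exact ⟨v, d, ⟨le_rd_sigmoid.trans hv, hv1⟩, h2⟩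

theorem viol_start [ok : Ok p q] {x t : ℝ} (hx : x ∈ floatSet p q)
    (ht : t ∈ floatSet p q) (htM : |t| ≤ 2 * T q) {s : ℝ} (hle : s * t ≤ s * x)
    (hs : s = 1 ∨ s = -1) :
    Out (Act.sigmoid.sigma p q) (Act.sigmoid.sigma' p q)
      ((XFlt.mul (F (-s * ta q t)) (F x)).add (F (s * ta q t * t))) (viol 0) := by
  obtain ⟨j, hj, hj1, hj2⟩ := exists_ta (p := p) htM
  rw [hj]
  obtain ⟨v, d, ⟨hv, hv1⟩, h2⟩ :=
    sigmoid_saturating.out_le (compare_nonpos hj1 hx ht hj2 hle hs)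
  rw [sigmoid_zero, rd_of_mem half_mem] at hv1
  exact ⟨v, d, ⟨hv, hv1⟩, h2⟩

theorem sigmoid_ge {z : ℝ} (hz : 4 ≤ z) : 7 / 8 ≤ Act.sigmoid.fn z := by
  have h1 := Real.quadratic_le_exp_of_nonneg (by linarith : 0 ≤ z)
  simp only [Act.fn]
  have h3 : Real.exp (-z) ≤ 1 / 7 := by
    rw [Real.exp_neg, inv_le_comm₀ (Real.exp_pos _) (by norm_num)]; nlinarith
  have := Real.exp_pos (-z)
  rw [le_div_iff₀ (by positivity)]
  linarith

theorem seven_T_half_mem [ok : Ok p q] : 7 / 2 * T q ∈ floatSet p q := by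
  have := ok.emin_eq
  have := ok.seven_le
  have h := mem_small (p := p) (q := q) 7 (emax q - 3) (by norm_num) (by omega) (by omega)
  have e : T q = 2 * 2 ^ (emax q - 3) := by
    rw [T, ← zpow_one_add₀ (by norm_num)]; congr 1; ring
  rw [e]; convert h using 1; push_cast; ring

theorem good_step [ok : Ok p q] (l : ℕ) (hl : l + 1 < 4) {v : ℝ}
    (hv : good p l v) : Out (Act.sigmoid.sigma p q) (Act.sigmoid.sigma' p q)
      ((XFlt.mul (F (tw q l)) (F v)).add (F (tb q l))) (good p (l + 1)) := by
  have hE := ok.seven_le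
  have hm := ok.emin_eq
  have hpE := ok.add_le
  have hp2 := ok.two_le
  have hT := T_ge (q := q) p
  have h4m : 4 * T q ∈ floatSet p q := Kit.mT 4 (by norm_num) (by norm_num)
  have h2m : -2 * T q ∈ floatSet p q := Kit.mT (-2) (by norm_num) (by norm_num)
  have h3m : -3 * T q ∈ floatSet p q := Kit.mT (-3) (by norm_num) (by norm_num)
  have key : ∀ {z : XFlt p q} {r : ℝ}, 4 ≤ r → GeX z r →
      Out (Act.sigmoid.sigma p q) (Act.sigmoid.sigma' p q) z fun v => 7 / 8 ≤ v ∧ v ≤ 1 := by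
    intro z r hr hz
    obtain ⟨v, d, ⟨hv, hv1⟩, h2⟩ := sigmoid_saturating.out_ge hz
    exact ⟨v, d, ⟨(le_rd (sigmoid_ge hr) seven_eighths_mem).trans hv, hv1⟩, h2⟩
  match l, hl with
  | 0, _ =>
    have hu : (2 : ℝ) ^ (2 : ℤ) ≤ 2 ^ (emax q - p - 1) := Kit.two_pow_le (by omega)
    have hcm := half_add_mem (p := p) (q := q)
    have e : (2 : ℝ) ^ (emax q - p - 1) = 4 * T q * 2 ^ (-(p : ℤ) - 1) := by
      rw [four_T, ← zpow_add₀ (by norm_num)]; congr 1; ring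
    have h18 : (2 : ℝ) ^ (-(p : ℤ) - 1) ≤ 2 ^ (-3 : ℤ) := Kit.two_pow_le (by omega)
    norm_num at h18
    have hBm : 4 * T q * (1 / 2 + 2 ^ (-(p : ℤ) - 1)) ∈ floatSet p q := by
      have h7 := seven_T_le (p := p) (q := q)
      have := mem_scale hcm (emax q) (by
        rw [← four_T, abs_of_pos (by positivity)]; nlinarith) (Or.inl (by omega))
      rwa [← four_T, mul_comm] at this
    refine key (r := 2 ^ (emax q - p - 1)) (by norm_num at hu ⊢; exact hu) ?_
    refine (mul_geX h4m (by linarith) hcm hBm le_rfl hv.1).add h2m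
      (mem_zpow _ (by omega) (by omega)) ?_
    rw [e]; simp only [tb]; linarith
  | 1, _ =>
    have hT8 : T q = 8 * 2 ^ (emax q - 5) := by
      rw [T, show (8 : ℝ) = 2 ^ (3 : ℤ) by norm_num, ← zpow_add₀ (by norm_num)]; congr 1; ring
    have hT2 : T q / 2 ∈ floatSet p q := by
      have := mem_small (p := p) (q := q) 4 (emax q - 5) (by norm_num) (by omega) (by omega)
      rw [hT8]; convert this using 1; push_cast; ring
    refine key (r := T q / 2) (by linarith) ?_
    refine (mul_geX (B := 7 / 2 * T q) h4m (by linarith) seven_eighths_mem seven_T_half_mem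
      (by linarith) hv.1).add h3m hT2 ?_
    simp only [tb]; linarith
  | 2, _ =>
    have := (mul_neg_leX (B := 7 / 2 * T q) h4m (by linarith) seven_eighths_mem seven_T_half_mem
      (by ring) hv.1).add (t := 2 * T q) (Kit.mT 2 (by norm_num) (by norm_num))
      (Kit.mT (-1) (by norm_num) rfl) (by push_cast; linarith)
    obtain ⟨h3, h4⟩ := sigmoid_saturating.fn_low (this.mono (by push_cast; linarith))
    exact ⟨0, 0, rfl, h3, h4⟩

theorem viol_step [ok : Ok p q] (l : ℕ) (hl : l + 1 < 4) {v : ℝ}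
    (hv : viol l v) : Out (Act.sigmoid.sigma p q) (Act.sigmoid.sigma' p q)
      ((XFlt.mul (F (tw q l)) (F v)).add (F (tb q l))) (viol (l + 1)) := by
  have hT := T_ge (q := q) p
  have h4m : 4 * T q ∈ floatSet p q := Kit.mT 4 (by norm_num) (by norm_num)
  have h2m : 2 * T q ∈ floatSet p q := Kit.mT 2 (by norm_num) (by norm_num)
  have h2m' : -2 * T q ∈ floatSet p q := Kit.mT (-2) (by norm_num) (by norm_num)
  have h3m : -3 * T q ∈ floatSet p q := Kit.mT (-3) (by norm_num) (by norm_num)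
  match l, hl with
  | 0, _ =>
    obtain ⟨v, d, ⟨hv, hv1⟩, h2⟩ := sigmoid_saturating.out_le
      ((mul_leX (B := 2 * T q) h4m (by linarith) half_mem h2m (by linarith) hv.2).add h2m'
        zero_mem (by linarith))
    rw [sigmoid_zero, rd_of_mem half_mem] at hv1
    exact ⟨v, d, ⟨hv, hv1⟩, h2⟩
  | 1, _ =>
    obtain ⟨h3, h4⟩ := sigmoid_saturating.fn_low (((mul_leX (B := 2 * T q) h4m (by linarith)
      half_mem h2m (by linarith) hv.2).add h3m (Kit.mT (-1) (by norm_num) rfl)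
      (by push_cast; linarith)).mono (by push_cast; linarith))
    exact ⟨0, 0, rfl, h3, h4⟩
  | 2, _ =>
    have hv : v = 0 := hv
    subst hv
    obtain ⟨h3, h4⟩ := (sigmoid_saturating.fn_on (p := p) (q := q)).1
    refine ⟨1, 0, rfl, ?_, ?_⟩ <;> simp only [tw, tb] <;> rw [mul_zero_F, zero_add_F]
    exacts [h3, h4]

/-- A bit that is on, read with weight `T`. -/
theorem row [ok : Ok p q] :
    lsum (F 0) cellList (fun c => XFlt.mul (F (sgn c.2 * T q))
      (F (if c.2 then 0 else 1))) = (F (4 * T q) : XFlt p q) := by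
  have hl : cellList = [(0, false), (0, true), (1, false), (1, true), (2, false), (2, true),
    (3, false), (3, true)] := by decide
  have hm : ∀ m : ℤ, |m| ≤ 7 → (m : ℝ) * T q ∈ floatSet p q := fun m h => Kit.mT m h rfl
  have hadd : ∀ a : ℤ, |a| ≤ 6 → (F (a * T q) : XFlt p q).add (F (T q)) = F ((a + 1 : ℤ) * T q) :=
    fun a ha => add_F_mem (hm a (by linarith)) (by simpa using hm 1 (by norm_num))
      (by push_cast; ring) (hm _ (by rw [abs_le] at *; omega))
  rw [hl]
  simp only [lsum_cons, lsum_nil, sgn_false, sgn_true, one_mul, neg_one_mul, if_true,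
    Bool.false_eq_true, if_false, mul_zero_F, mul_one_F]
  have h0 := hadd 0 (by norm_num)
  have h1 := hadd 1 (by norm_num)
  have h2 := hadd 2 (by norm_num)
  have h3 := hadd 3 (by norm_num)
  norm_num at h0 h1 h2 h3
  rw [h0, add_zero_F, h1, add_zero_F, h2, add_zero_F, h3, add_zero_F]

/-- The neurons of a network with the sigmoid activation function. -/
noncomputable def kit [ok : Ok p q] :
    Kit p q (Act.sigmoid.sigma p q) (Act.sigmoid.sigma' p q) (2 * T q) (2 ^ ((p : ℤ) - 1)) where
  kap := 0
  abs_kap := by norm_num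
  low _ hz := sigmoid_saturating.fn_low hz
  onH := 0
  vH := 1 / 2
  cH := 1 / 4
  onH_eq := Or.inl rfl
  sig_onH := by rw [Act.sigma, sigmoid_saturating.fn_F zero_mem, sigmoid_zero]
  dsig_onH := by rw [Act.sigma', sigmoid_saturating.deriv_F zero_mem, sigmoid_dfn_zero]
  vH_nonneg := by norm_num
  vH_le := by linarith [T_ge (q := q) p]
  cH_eq := Or.inr ⟨rfl, by
    rw [T, le_div_iff₀ (by norm_num), show (4 : ℝ) = 2 ^ (2 : ℤ) by norm_num,
      ← zpow_add₀ (by norm_num)]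
    exact Kit.two_pow_le (by have := ok.add_le; omega)⟩
  onL := 0
  vL := 1 / 2
  lc := 2
  lc_le := le_rfl
  sig_onL := by rw [Act.sigma, sigmoid_saturating.fn_F zero_mem, sigmoid_zero]
  dsig_onL := by rw [Act.sigma', sigmoid_saturating.deriv_F zero_mem, sigmoid_dfn_zero]; norm_num
  vL_nonneg := by norm_num
  vL_le := by norm_num
  vL_le' := by norm_num
  soft := True
  soft_spec _ := ⟨rfl, rfl, le_rfl, fun r => sigmoid_saturating.out_fin r⟩
  w := T q
  b' := -6 * T q
  vOn := 1
  vOn' := 0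
  dOn := 0
  w_bd := ⟨T_pos.le, le_rfl⟩
  b'_eq := Or.inr rfl
  on1 := sigmoid_saturating.fn_on.1
  on2 := by
    rw [show 4 * T q + -6 * T q = -2 * T q by ring]; exact sigmoid_saturating.fn_on.2
  dOn_eq := Or.inl rfl
  row_on := row
  nt := 4
  nt_ge := by norm_num
  tw := tw q
  tb := tb q
  good := good p
  viol := viol
  ta := ta q
  good_start _ hx _ ht _ htM _ hlt hs := good_start hx ht htM hlt hs
  viol_start _ hx _ ht _ htM _ hle hs := viol_start hx ht htM hle hs
  good_step l hl _ hv := good_step l hl hv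
  viol_step l hl _ hv := viol_step l hl hv
  good_end _ hv := hv
  wA := 4 * T q
  wA_bd := ⟨by linarith [T_pos (q := q)], le_rfl⟩
  and_good z hz := by
    rwa [mul_zero_F, mul_zero_F, add_zero_X, add_zero_X]
  and_viol z v hz hv := by
    have hv : v = 1 := hv
    rw [hv, mul_zero_F, add_zero_X, mul_one_F, ← neg_mul]
    have h4m : -4 * T q ∈ floatSet p q := Kit.mT (-4) (by norm_num) (by norm_num)
    exact hz.add h4m h4m (by linarith)
  m2 := 0
  m2_le := by have := ok.two_le; omega
  m2_lt := by have := ok.two_le; omega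
  reach := by
    have := ok.seven_le
    push_cast
    omega
  b1 x := -x
  zc := 0
  vc := Act.sigmoid.fn 0
  dc := 1 / 4
  d1 := 1 / 4
  A2 := 4
  A2' := -4
  C2 := 0
  sig_zc := by
    rw [Act.sigma, Act.sigma', sigmoid_saturating.fn_F zero_mem,
      sigmoid_saturating.deriv_F zero_mem, sigmoid_dfn_zero]
    exact ⟨rfl, rfl⟩
  dc_bd := by norm_num
  d1_bd := ⟨2, le_rfl, by norm_num⟩
  A2_eq := by norm_num
  A2'_bd := by norm_num
  C2_bd := by norm_num
  first x hx x0 hx0 hxM hxM0 :=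
    sigmoid_saturating.first hx hx0 hxM hxM0 (by norm_num) le_rfl sigmoid_dfn_zero
  value k hk hk' := by
    have hT := T_pos (q := q)
    have h7 := seven_T_le (p := p) (q := q)
    have h4m : 4 * T q ∈ floatSet p q := Kit.mT 4 (by norm_num) (by norm_num)
    have h2m : -2 * T q ∈ floatSet p q := Kit.mT (-2) (by norm_num) (by norm_num)
    have h2m' : 2 * T q ∈ floatSet p q := Kit.mT 2 (by norm_num) (by norm_num)
    obtain ⟨h1, h2⟩ := (sigmoid_saturating.fn_on (p := p) (q := q)).1
    obtain ⟨h3, h4⟩ := (sigmoid_saturating.fn_on (p := p) (q := q)).2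
    refine ⟨T q, -2 * T q, 2 ^ k, 4 * T q, 0, 1, 0, 0, 2 * T q, hT.le, le_rfl, row,
      add_F_mem h4m h2m (by ring) h2m', h1, h2, h3, h4, mul_one_F _, mul_zero_F _, ?_⟩
    intro y hy hyH
    have hkm : (2 : ℝ) ^ k ∈ floatSet p q := mem_zpow k hk (by omega)
    refine ⟨y * 2 ^ k, mul_F hy hkm ?_, fun d hd => ⟨0, 0, ?_, zero_mul_F _⟩⟩
    · rw [abs_mul, abs_of_pos (by positivity : (0 : ℝ) < 2 ^ k)]
      calc _ ≤ (2 : ℝ) ^ ((p : ℤ) - 1) * 2 ^ (emax q - p) :=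
            mul_le_mul hyH (Kit.two_pow_le hk') (by positivity) (by positivity)
        _ ≤ 4 * T q := by
            rw [four_T, ← zpow_add₀ (by norm_num)]; exact Kit.two_pow_le (by omega)
        _ ≤ _ := by linarith
    · rcases hd with rfl | rfl <;> exact mul_zero_F _

end SigmoidKit

/-! ### The hyperbolic tangent -/

theorem tanh_eq (z : ℝ) : Act.tanh.fn z = 2 * Act.sigmoid.fn (2 * z) - 1 := by
  simp only [Act.fn]
  rw [Real.tanh_eq_sinh_div_cosh, Real.sinh_eq, Real.cosh_eq]
  have h1 := Real.exp_pos z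
  have h2 : Real.exp (-(2 * z)) = Real.exp (-z) * Real.exp (-z) := by
    rw [← Real.exp_add]; ring_nf
  have h3 : Real.exp z * Real.exp (-z) = 1 := by rw [← Real.exp_add]; simp
  have h4 := Real.exp_pos (-z)
  rw [h2, Real.exp_neg]
  field_simp
  ring

theorem tanh_zero : Act.tanh.fn 0 = 0 := Real.tanh_zero

theorem tanh_neg (z : ℝ) : Act.tanh.fn (-z) = -Act.tanh.fn z := Real.tanh_neg z

theorem hasDerivAt_tanh (z : ℝ) : HasDerivAt Act.tanh.fn
    (4 * (Act.sigmoid.fn (2 * z) * (1 - Act.sigmoid.fn (2 * z)))) z := by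
  have h := (hasDerivAt_sigmoid (2 * z)).comp z ((hasDerivAt_id z).const_mul 2)
  have e : Act.tanh.fn = fun z => 2 * (Act.sigmoid.fn ∘ fun z => 2 * id z) z - 1 :=
    funext tanh_eq
  rw [e]
  exact ((h.const_mul 2).sub_const 1).congr_deriv (by simp; ring)

theorem one_sub_tanh (z : ℝ) : 1 - Act.tanh.fn z = 2 * Act.sigmoid.fn (2 * -z) := by
  rw [tanh_eq, mul_neg, sigmoid_neg]; ring

theorem tanh_saturating : Saturating Act.tanh.fn Act.tanh.dfn (-1) := by
  have hlow : ∀ z ≤ -32, 4 * Act.sigmoid.fn (2 * z) ≤ 1 / (2 * z ^ 2) := fun z hz => by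
    have h := two_mul_exp_neg_le (y := -z) (by linarith)
    rw [neg_neg, neg_sq] at h
    refine le_trans ?_ h
    have h1 := sigmoid_le_exp (2 * z)
    have h2 : Real.exp (2 * z) ≤ Real.exp z := Real.exp_le_exp.2 (by linarith)
    have h3 := Real.exp_pos z
    nlinarith
  have hhigh : ∀ z, 32 ≤ z → 4 * (1 - Act.sigmoid.fn (2 * z)) ≤ 1 / (2 * z ^ 2) := fun z hz => by
    rw [← sigmoid_neg, ← neg_sq, ← mul_neg]; exact hlow (-z) (by linarith)
  have hd : ∀ z, Act.tanh.dfn z = 4 * (Act.sigmoid.fn (2 * z) * (1 - Act.sigmoid.fn (2 * z))) :=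
    fun z => (hasDerivAt_tanh z).deriv
  refine ⟨Or.inr rfl, fun x y hxy => ?_, fun z => ?_,
    fun z hz => ?_, fun z hz => ?_, fun z hz => ?_, fun z hz => ?_, fun z => ?_⟩
  · rw [tanh_eq, tanh_eq]
    have := sigmoid_monotone (by linarith : 2 * x ≤ 2 * y)
    linarith
  all_goals
    have h1 := sigmoid_pos (2 * z)
    have h2 := sigmoid_lt_one (2 * z)
  · rw [tanh_eq]; constructor <;> linarith
  · rw [tanh_eq, sub_neg_eq_add, sub_add_cancel, abs_of_pos (by linarith)]; linarith [hlow z hz]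
  · rw [tanh_eq, abs_sub_comm, abs_of_pos (by linarith)]; linarith [hhigh z hz]
  · rw [hd, sub_zero, abs_of_nonneg (by nlinarith)]; nlinarith [hlow z hz]
  · rw [hd, sub_zero, abs_of_nonneg (by nlinarith)]; nlinarith [hhigh z hz]
  · rw [hd, abs_of_nonneg (by nlinarith)]; nlinarith [sq_nonneg (2 * Act.sigmoid.fn (2 * z) - 1)]

theorem tanh_dfn_zero : Act.tanh.dfn 0 = 1 := by
  have : Act.tanh.dfn 0 = 4 * (Act.sigmoid.fn (2 * 0) * (1 - Act.sigmoid.fn (2 * 0))) :=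
    (hasDerivAt_tanh 0).deriv
  rw [this, mul_zero, sigmoid_zero]; norm_num

theorem exp_neg_le_two_pow {z : ℝ} (n : ℕ) (hz : n ≤ z) : Real.exp (-z) ≤ (2 ^ n)⁻¹ := by
  have h1 := Real.add_one_le_exp 1
  have h2 : (2 : ℝ) ^ n ≤ Real.exp z := by
    calc (2 : ℝ) ^ n ≤ Real.exp 1 ^ n := by gcongr; linarith
      _ = Real.exp n := by rw [← Real.exp_nat_mul, mul_one]
      _ ≤ _ := Real.exp_le_exp.2 hz
  rw [Real.exp_neg]
  gcongr

theorem le_tanh (z : ℝ) : z ≤ Act.tanh.fn z * (1 + z) := by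
  have h1 := Real.add_one_le_exp (2 * z)
  rw [tanh_eq]
  simp only [Act.fn]
  rw [Real.exp_neg]
  have h2 := Real.exp_pos (2 * z)
  generalize Real.exp (2 * z) = E at *
  field_simp
  nlinarith

theorem tanh_le (z : ℝ) : Act.tanh.fn z * (1 - z) ≤ z := by
  have h1 := Real.add_one_le_exp (-(2 * z))
  rw [tanh_eq]
  simp only [Act.fn]
  have h2 := Real.exp_pos (-(2 * z))
  generalize Real.exp (-(2 * z)) = w at *
  have e : (2 * (1 / (1 + w)) - 1) * (1 - z) = (1 - w) * (1 - z) / (1 + w) := by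
    field_simp; ring
  rw [e, div_le_iff₀ (by positivity)]
  linarith

/-- The least positive float is a fixed point of the rounded hyperbolic tangent. -/
theorem rd_tanh_eta [ok : Ok p q] : rd p q (Act.tanh.fn (eta p q)) = eta p q := by
  have he := eta_pos (p := p) (q := q)
  have h1 := le_tanh (eta p q)
  have h3 : eta p q ≤ 1 / 4 := by
    have : eta p q ≤ 2 ^ (-2 : ℤ) :=
      Kit.two_pow_le (by have := ok.emin_eq; have := ok.seven_le; omega)
    norm_num at this ⊢; exact this
  refine rd_eq_of_close eta_mem ?_
  have h2 := tanh_le (eta p q)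
  rw [abs_lt]
  constructor <;> nlinarith

/-- Far out, the hyperbolic tangent is rounded to its limit. -/
theorem tanh_out [ok : Ok p q] {z : XFlt p q} (hz : GeX z 6) :
    Out (Act.tanh.sigma p q) (Act.tanh.sigma' p q) z fun v => v = 1 := by
  rcases hz with rfl | ⟨x, hx, rfl, hx6⟩
  · obtain ⟨h1, h2⟩ := tanh_saturating.fn_high (p := p) (q := q) (z := .posInf) (Or.inl rfl)
    exact ⟨1, 0, rfl, h1, h2⟩
  · refine ⟨1, Act.tanh.dfn x, rfl, ?_, tanh_saturating.deriv_F hx⟩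
    rw [Act.sigma, tanh_saturating.fn_F hx, F_eq_iff, rd_of_mem one_mem]
    have hE := ok.seven_le
    have hm := ok.emin_eq
    have hp := ok.p_le
    have h := rd_absorb (p := p) (q := q) (e := 0) (t := Act.tanh.fn x - 1) (by omega) (by omega)
      (by
      have h1 := sigmoid_le_exp (2 * -x)
      have h2 : Real.exp (2 * -x) ≤ 1 / 4096 := by
        rw [mul_neg]
        exact (exp_neg_le_two_pow 12 (by push_cast; linarith)).trans (by norm_num)
      have h3 := one_sub_tanh x
      have h4 := sigmoid_pos (2 * -x)
      have h5 : (2 : ℝ) ^ (-10 : ℤ) ≤ 2 ^ (0 - (p : ℤ) - 2) := Kit.two_pow_le (by omega)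
      rw [abs_sub_comm, h3, abs_of_pos (by linarith)]
      refine le_trans ?_ h5
      norm_num at h1 h2 ⊢
      linarith)
    rwa [zpow_zero, add_sub_cancel] at h

theorem tanh_out_neg [ok : Ok p q] {z : XFlt p q} (hz : LeX z (-6)) :
    Out (Act.tanh.sigma p q) (Act.tanh.sigma' p q) z fun v => v = -1 := by
  rcases hz with rfl | ⟨x, hx, rfl, hx6⟩
  · obtain ⟨h1, h2⟩ := tanh_saturating.fn_low (p := p) (q := q) (z := .negInf) (Or.inl rfl)
    exact ⟨-1, 0, rfl, h1, h2⟩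
  · obtain ⟨v, d, rfl, h1, -⟩ := tanh_out (geX_F (neg_mem_floatSet hx) (by linarith : 6 ≤ -x))
    refine ⟨-1, Act.tanh.dfn x, rfl, ?_, tanh_saturating.deriv_F hx⟩
    rw [Act.sigma, tanh_saturating.fn_F (neg_mem_floatSet hx), tanh_neg, ← nx_F] at h1
    rw [Act.sigma, tanh_saturating.fn_F hx]
    have := congrArg nx h1
    rwa [nx_F, nx_F, nx_F, neg_neg] at this

namespace TanhKit

/-- Values on the way to the outcome that a comparison is satisfied. The least positive float survives
the activation, and two multiplications by `4 T` amplify it to the limit `-1`. -/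
def good (p q : ℕ) : ℕ → ℝ → Prop
  | 0, v => eta p q ≤ v
  | 1, v => -1 ≤ v ∧ v ≤ -(3 / 4 * 2 ^ (-(p : ℤ)))
  | _, v => v = -1

/-- Values on the way to the outcome that a comparison is violated; the first bias makes them positive
in the second layer. -/
def viol (p : ℕ) : ℕ → ℝ → Prop
  | 0, v => -1 ≤ v ∧ v ≤ 0
  | 1, v => 3 / 4 * 2 ^ (-(p : ℤ)) ≤ v
  | _, v => v = 1

/-- The weights of a comparison. -/
noncomputable def tw (q : ℕ) : ℕ → ℝ
  | 0 => -(4 * T q)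
  | _ => 4 * T q

/-- The biases of a comparison. -/
noncomputable def tb (p : ℕ) : ℕ → ℝ
  | 0 => 2 ^ (-(p : ℤ))
  | _ => 0

theorem good_start [ok : Ok p q] {x t : ℝ} (hx : x ∈ floatSet p q)
    (ht : t ∈ floatSet p q) (htM : |t| ≤ 2 * T q) {s : ℝ} (hlt : s * x < s * t)
    (hs : s = 1 ∨ s = -1) :
    Out (Act.tanh.sigma p q) (Act.tanh.sigma' p q)
      ((XFlt.mul (F (-s * 1)) (F x)).add (F (s * 1 * t))) (good p q 0) := by
  have hm := ok.emin_eq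
  have hE := ok.seven_le
  have hT := T_ge (q := q) p
  have he1 : eta p q ≤ 1 := zpow_le_one_of_nonpos₀ (by norm_num) (by omega)
  have hgap : eta p q ≤ s * t - s * x := by
    have hx' := neg_mem_floatSet hx
    have ht' := neg_mem_floatSet ht
    rcases hs with rfl | rfl <;> exact eta_le_sub (by simpa) (by simpa) hlt
  have h := compare_pos (p := p) (q := q) (j := 0) (by simpa using one_mem) hx ht
    (by rw [pow_zero, mul_one]; linarith) eta_mem (by linarith)
    (by rwa [pow_zero, one_mul]) hlt hs
  rw [pow_zero] at h
  obtain ⟨v, d, ⟨hv, hv1⟩, h2⟩ := tanh_saturating.out_ge h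
  rw [rd_tanh_eta] at hv
  exact ⟨v, d, hv, h2⟩

theorem viol_start [ok : Ok p q] {x t : ℝ} (hx : x ∈ floatSet p q)
    (ht : t ∈ floatSet p q) (htM : |t| ≤ 2 * T q) {s : ℝ} (hle : s * t ≤ s * x)
    (hs : s = 1 ∨ s = -1) :
    Out (Act.tanh.sigma p q) (Act.tanh.sigma' p q)
      ((XFlt.mul (F (-s * 1)) (F x)).add (F (s * 1 * t))) (viol p 0) := by
  have hT := T_pos (q := q)
  have h := compare_nonpos (p := p) (q := q) (j := 0) (by simpa using one_mem) hx ht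
    (by rw [pow_zero, mul_one]; linarith) hle hs
  rw [pow_zero] at h
  obtain ⟨v, d, ⟨hv, hv1⟩, h2⟩ := tanh_saturating.out_le h
  rw [tanh_zero, rd_of_mem zero_mem] at hv1
  exact ⟨v, d, ⟨hv, hv1⟩, h2⟩

theorem three_quarters_mem [ok : Ok p q] : 3 / 4 * (2 : ℝ) ^ (-(p : ℤ)) ∈ floatSet p q := by
  have := ok.emin_eq
  have := ok.seven_le
  have := ok.two_le
  have h := mem_small (p := p) (q := q) 3 (-(p : ℤ) - 2) (by norm_num) (by omega) (by omega)
  rw [zpow_sub₀ (by norm_num)] at h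
  convert h using 1
  push_cast; ring

/-- The value `2 ^ (-p)` loses little by the activation. -/
theorem le_rd_tanh [ok : Ok p q] :
    3 / 4 * 2 ^ (-(p : ℤ)) ≤ rd p q (Act.tanh.fn (2 ^ (-(p : ℤ)))) := by
  refine le_rd ?_ three_quarters_mem
  have h0 : (0 : ℝ) < 2 ^ (-(p : ℤ)) := by positivity
  have h1 := le_tanh (2 ^ (-(p : ℤ)))
  have h2 : (2 : ℝ) ^ (-(p : ℤ)) ≤ 2 ^ (-2 : ℤ) :=
    Kit.two_pow_le (by have := ok.two_le; omega)
  have h3 : (2 : ℝ) ^ (-(p : ℤ)) ≤ 1 / 4 := h2.trans (by norm_num)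
  nlinarith

/-- Amplification of `3 / 4 * 2 ^ (-p)` by `4 T` leads beyond `6`, where the rounded hyperbolic
tangent is constant. -/
theorem scaled_ge [ok : Ok p q] : 3 * (2 : ℝ) ^ (emax q - p - 2) ∈ floatSet p q ∧
    6 ≤ 3 * (2 : ℝ) ^ (emax q - p - 2) ∧
    4 * T q * (3 / 4 * 2 ^ (-(p : ℤ))) = 3 * 2 ^ (emax q - p - 2) := by
  have := ok.emin_eq
  have := ok.seven_le
  have hpE := ok.add_le
  refine ⟨?_, ?_, ?_⟩
  · exact_mod_cast mem_small (p := p) (q := q) 3 (emax q - p - 2) (by norm_num) (by omega)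
      (by omega)
  · have : (2 : ℝ) ^ (1 : ℤ) ≤ 2 ^ (emax q - p - 2) := Kit.two_pow_le (by omega)
    rw [zpow_one] at this
    linarith
  · rw [four_T, sub_eq_add_neg (emax q), zpow_sub₀ (by norm_num), zpow_add₀ (by norm_num)]
    norm_num; ring

theorem good_step [ok : Ok p q] (l : ℕ) (hl : l + 1 < 3) {v : ℝ}
    (hv : good p q l v) : Out (Act.tanh.sigma p q) (Act.tanh.sigma' p q)
      ((XFlt.mul (F (tw q l)) (F v)).add (F (tb p l))) (good p q (l + 1)) := by
  have hE := ok.seven_le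
  have hm := ok.emin_eq
  have hT := T_ge (q := q) p
  have h4m : 4 * T q ∈ floatSet p q := Kit.mT 4 (by norm_num) (by norm_num)
  obtain ⟨h1, h2, h3⟩ := scaled_ge (p := p) (q := q)
  match l, hl with
  | 0, _ =>
    have hb := mem_zpow (p := p) (q := q) (-(p : ℤ)) (by omega) (by omega)
    have e : 4 * T q * eta p q = 2 * 2 ^ (-(p : ℤ)) := by
      rw [four_T, eta, ← zpow_add₀ (by norm_num), ← zpow_one_add₀ (by norm_num)]; congr 1; omega
    have hb2 : 2 * (2 : ℝ) ^ (-(p : ℤ)) ∈ floatSet p q := by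
      rw [← zpow_one_add₀ (by norm_num)]
      exact mem_zpow _ (by omega) (by have := ok.two_le; omega)
    obtain ⟨v, d, ⟨hv, hv1⟩, h2⟩ := tanh_saturating.out_le
      ((mul_neg_leX h4m (by linarith) eta_mem hb2 e hv).add hb (neg_mem_floatSet hb)
        (by linarith))
    rw [tanh_neg, rd_neg] at hv1
    exact ⟨v, d, ⟨hv, hv1.trans (neg_le_neg le_rd_tanh)⟩, h2⟩
  | 1, _ =>
    exact tanh_out_neg (((mul_leX (B := -(3 * 2 ^ (emax q - p - 2))) h4m (by linarith)
      (neg_mem_floatSet three_quarters_mem) (neg_mem_floatSet h1) (by rw [mul_neg, h3]) hv.2).add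
      zero_mem (neg_mem_floatSet h1) (add_zero _).le).mono (by linarith))

theorem viol_step [ok : Ok p q] (l : ℕ) (hl : l + 1 < 3) {v : ℝ}
    (hv : viol p l v) : Out (Act.tanh.sigma p q) (Act.tanh.sigma' p q)
      ((XFlt.mul (F (tw q l)) (F v)).add (F (tb p l))) (viol p (l + 1)) := by
  have hE := ok.seven_le
  have hm := ok.emin_eq
  have hT := T_ge (q := q) p
  have h4m : 4 * T q ∈ floatSet p q := Kit.mT 4 (by norm_num) (by norm_num)
  have h5m : 5 * T q ∈ floatSet p q := Kit.mT 5 (by norm_num) (by norm_num)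
  obtain ⟨h1, h2, h3⟩ := scaled_ge (p := p) (q := q)
  match l, hl with
  | 0, _ =>
    have hb := mem_zpow (p := p) (q := q) (-(p : ℤ)) (by omega) (by omega)
    have hb1 : (2 : ℝ) ^ (-(p : ℤ)) ≤ 1 := zpow_le_one_of_nonpos₀ (by norm_num) (by omega)
    obtain ⟨t, ht, ht'⟩ := exists_mul_neg h4m (by linarith) hv
    obtain ⟨x, hx, hx1, hx2, hx3⟩ := exists_add_pos ht' h4m hb (by positivity) h5m (by linarith)
    obtain ⟨v, d, ⟨hv, hv1⟩, h2⟩ := tanh_saturating.out_ge (geX_F (p := p) (q := q) hx hx2)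
    refine ⟨v, d, le_rd_tanh.trans hv, ?_⟩
    simp only [tw, tb]
    rwa [ht, hx1]
  | 1, _ =>
    have hz : GeX ((XFlt.mul (F (tw q 1)) (F v)).add (F (tb p 1)) : XFlt p q)
        (3 * 2 ^ (emax q - p - 2)) :=
      (mul_geX h4m (by linarith) three_quarters_mem h1 h3.ge hv).add zero_mem h1 (add_zero _).ge
    refine tanh_out ?_
    rcases hz with h | ⟨x, hx, h, h'⟩
    · exact Or.inl h
    · exact Or.inr ⟨x, hx, h, h2.trans h'⟩

/-- A bit that is on, read with weight `2 ^ e`. -/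
theorem row [ok : Ok p q] {e : ℤ} (he : 0 ≤ e) (he' : e + 3 ≤ emax q) :
    lsum (F 0) cellList (fun c => XFlt.mul (F (sgn c.2 * 2 ^ e))
      (F (if c.2 then -1 else 1))) = (F (2 ^ (e + 3)) : XFlt p q) := by
  have hE := ok.seven_le
  have hmin := ok.emin_eq
  have hl : cellList = [(0, false), (0, true), (1, false), (1, true), (2, false), (2, true),
    (3, false), (3, true)] := by decide
  have hm : ∀ m : ℤ, |m| ≤ 7 → (m : ℝ) * 2 ^ e ∈ floatSet p q := fun m h =>
    mem_small m e h (by omega) (by omega)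
  have h1m : (2 : ℝ) ^ e ∈ floatSet p q := by simpa using hm 1 (by norm_num)
  have hadd : ∀ a : ℤ, |a| ≤ 6 → (F (a * 2 ^ e) : XFlt p q).add (F (2 ^ e)) =
      F ((a + 1 : ℤ) * 2 ^ e) :=
    fun a ha => add_F_mem (hm a (by linarith)) h1m
      (by push_cast; ring) (hm _ (by rw [abs_le] at *; omega))
  rw [hl]
  have hneg : XFlt.mul (F (-2 ^ e) : XFlt p q) (F (-1)) = F (2 ^ e) := by
    rw [mul_nx_F, mul_one_F, nx_F, neg_neg]
  simp only [lsum_cons, lsum_nil, sgn_false, sgn_true, one_mul, neg_one_mul, if_true,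
    Bool.false_eq_true, if_false, mul_one_F, hneg]
  have h0 := hadd 0 (by norm_num)
  have h1 := hadd 1 (by norm_num)
  have h2 := hadd 2 (by norm_num)
  have h3 := hadd 3 (by norm_num)
  have h4 := hadd 4 (by norm_num)
  have h5 := hadd 5 (by norm_num)
  have h6 := hadd 6 (by norm_num)
  norm_num at h0 h1 h2 h3 h4 h5 h6
  rw [h0, h1, h2, h3, h4, h5, h6]
  refine add_F_mem (by exact_mod_cast hm 7 (by norm_num)) h1m ?_ (mem_zpow _ (by omega) he')
  rw [zpow_add₀ (by norm_num)]; norm_num; ring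

/-- The neurons of a network with the activation function `tanh`. -/
noncomputable def kit [ok : Ok p q] :
    Kit p q (Act.tanh.sigma p q) (Act.tanh.sigma' p q) (2 * T q) (2 ^ ((p : ℤ) - 2)) where
  kap := -1
  abs_kap := by norm_num
  low _ hz := tanh_saturating.fn_low hz
  onH := 0
  vH := 0
  cH := 1
  onH_eq := Or.inl rfl
  sig_onH := by rw [Act.sigma, tanh_saturating.fn_F zero_mem, tanh_zero]
  dsig_onH := by rw [Act.sigma', tanh_saturating.deriv_F zero_mem, tanh_dfn_zero]
  vH_nonneg := le_rfl
  vH_le := by linarith [T_ge (q := q) p]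
  cH_eq := Or.inl ⟨rfl, by
    have h1 : (2 : ℝ) ^ ((p : ℤ) - 2) ≤ T q :=
      Kit.two_pow_le (by have := ok.add_le; omega)
    linarith [T_ge (q := q) p, seven_T_le (p := p) (q := q)]⟩
  onL := 0
  vL := 0
  lc := 0
  lc_le := by norm_num
  sig_onL := by rw [Act.sigma, tanh_saturating.fn_F zero_mem, tanh_zero]
  dsig_onL := by rw [Act.sigma', tanh_saturating.deriv_F zero_mem, tanh_dfn_zero]; norm_num
  vL_nonneg := by norm_num
  vL_le := by norm_num
  vL_le' := by norm_num
  soft := True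
  soft_spec _ := ⟨rfl, rfl, by norm_num, fun r => tanh_saturating.out_fin r⟩
  w := 2 ^ (emax q - 3)
  b' := -6 * T q
  vOn := 1
  vOn' := -1
  dOn := 0
  w_bd := ⟨by positivity, Kit.two_pow_le (by omega)⟩
  b'_eq := Or.inr rfl
  on1 := tanh_saturating.fn_on.1
  on2 := by
    rw [show 4 * T q + -6 * T q = -2 * T q by ring]; exact tanh_saturating.fn_on.2
  dOn_eq := Or.inl rfl
  row_on := by
    rw [row (by have := ok.seven_le; omega) (by omega), sub_add_cancel, four_T]
  nt := 3
  nt_ge := by norm_num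
  tw := tw q
  tb := tb p
  good := good p q
  viol := viol p
  ta _ := 1
  good_start _ hx _ ht _ htM _ hlt hs := good_start hx ht htM hlt hs
  viol_start _ hx _ ht _ htM _ hle hs := viol_start hx ht htM hle hs
  good_step l hl _ hv := good_step l hl hv
  viol_step l hl _ hv := viol_step l hl hv
  good_end _ hv := hv
  wA := 2 * T q
  wA_bd := by have := T_pos (q := q); constructor <;> linarith
  and_good z hz := by
    have h2m : 2 * T q ∈ floatSet p q := Kit.mT 2 (by norm_num) (by norm_num)
    have h2m' : -2 * T q ∈ floatSet p q := Kit.mT (-2) (by norm_num) (by norm_num)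
    have h4m : -4 * T q ∈ floatSet p q := Kit.mT (-4) (by norm_num) (by norm_num)
    rw [mul_nx_F, mul_one_F, nx_F, neg_neg, mul_nx_F, mul_one_F, nx_F]
    exact (hz.add h2m h2m' (by linarith)).add (neg_mem_floatSet h2m) h4m (by linarith)
  and_viol z v hz hv := by
    have hv : v = 1 := hv
    have h2m : -(2 * T q) ∈ floatSet p q := neg_mem_floatSet (Kit.mT 2 (by norm_num) (by norm_num))
    have h4m : -4 * T q ∈ floatSet p q := Kit.mT (-4) (by norm_num) (by norm_num)
    rw [hv, mul_one_F, mul_nx_F, mul_one_F, nx_F]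
    exact (hz.add h2m h2m (by linarith)).add h2m h4m (by linarith)
  m2 := 0
  m2_le := by have := ok.two_le; omega
  m2_lt := by have := ok.two_le; omega
  reach := by
    push_cast
    omega
  b1 x := -x
  zc := 0
  vc := Act.tanh.fn 0
  dc := 1
  d1 := 1
  A2 := 1
  A2' := -1
  C2 := 0
  sig_zc := by
    rw [Act.sigma, Act.sigma', tanh_saturating.fn_F zero_mem,
      tanh_saturating.deriv_F zero_mem, tanh_dfn_zero]
    exact ⟨rfl, rfl⟩
  dc_bd := by norm_num
  d1_bd := ⟨0, by norm_num, by norm_num⟩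
  A2_eq := by norm_num
  A2'_bd := by norm_num
  C2_bd := by norm_num
  first x hx x0 hx0 hxM hxM0 :=
    tanh_saturating.first hx hx0 hxM hxM0 (by norm_num) (by norm_num) tanh_dfn_zero
  value k hk hk' := by
    have hT := T_ge (q := q) p
    have hE := ok.seven_le
    have hm := ok.emin_eq
    have hp8 := ok.p_le
    have hE15 := ok.le_fifteen
    have h7 := seven_T_le (p := p) (q := q)
    have h32 : (32 : ℝ) ∈ floatSet p q := by
      have := Kit.two_pow_mem (p := p) (q := q) 5 (by norm_num); norm_num at this; exact this
    have h4m : (4 : ℝ) ∈ floatSet p q := by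
      have := Kit.two_pow_mem (p := p) (q := q) 2 (by norm_num); norm_num at this; exact this
    have hrow := row (p := p) (q := q) (e := 2) (by norm_num) (by omega)
    norm_num at hrow
    obtain ⟨v, d, rfl, h1, -⟩ := tanh_out (geX_F h32 (by norm_num : (6 : ℝ) ≤ 32))
    -- the derivative at `32` is so small that it is rounded to `0`
    have h2 : Act.tanh.sigma' p q (F 32) = F 0 := by
      refine roundFun_F_near (Or.inl rfl) h32 ?_
      have hd : Act.tanh.dfn 32 = 4 * (Act.sigmoid.fn (2 * 32) * (1 - Act.sigmoid.fn (2 * 32))) :=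
        (hasDerivAt_tanh 32).deriv
      have hs := sigmoid_le_exp (-(2 * 32))
      have hs0 := sigmoid_pos (-(2 * 32))
      have hs1 := sigmoid_lt_one (-(2 * 32))
      have he := exp_neg_le_two_pow (z := 2 * 32) 64 (by norm_num)
      have heta : (2 : ℝ) ^ (-22 : ℤ) ≤ eta p q := Kit.two_pow_le (by omega)
      have e1 := sigmoid_neg (2 * 32)
      rw [hd, sub_zero, ← e1, show Act.sigmoid.fn (2 * 32) = 1 - Act.sigmoid.fn (-(2 * 32)) by
        rw [e1]; ring]
      set s := Act.sigmoid.fn (-(2 * 32))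
      norm_num at he heta
      rw [abs_of_nonneg (mul_nonneg (by norm_num) (mul_nonneg (by linarith) hs0.le))]
      have h3 : (1 - s) * s ≤ s := by nlinarith
      norm_num at hs
      linarith
    refine ⟨4, 0, 2 ^ k, 32, 0, 1, 1, 0, 32, by norm_num, by linarith, hrow, add_zero_F _, h1, h2,
      by rw [Act.sigma, tanh_saturating.fn_F zero_mem, tanh_zero],
      by rw [Act.sigma', tanh_saturating.deriv_F zero_mem, tanh_dfn_zero],
      mul_one_F _, mul_zero_F _, ?_⟩
    intro y hy hyH
    have hkm : (2 : ℝ) ^ k ∈ floatSet p q := mem_zpow k hk (by omega)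
    have hγ : |y * 2 ^ k| ≤ T q := by
      rw [abs_mul, abs_of_pos (by positivity : (0 : ℝ) < 2 ^ k)]
      calc _ ≤ (2 : ℝ) ^ ((p : ℤ) - 2) * 2 ^ (emax q - p) :=
            mul_le_mul hyH (Kit.two_pow_le hk') (by positivity) (by positivity)
        _ = T q := by rw [T, ← zpow_add₀ (by norm_num)]; congr 1; ring
    refine ⟨y * 2 ^ k, mul_F hy hkm (by linarith), fun d hd => ?_⟩
    rcases hd with rfl | rfl
    · obtain ⟨g, hg, -⟩ := exists_mul_F (p := p) (q := q) (s := 4) (b := 4) hγ (by norm_num)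
        (Kit.mT 1 (by norm_num) (by norm_num)) h4m (by linarith)
      exact ⟨y * 2 ^ k, g, mul_one_F _, hg⟩
    · exact ⟨0, 0, mul_zero_F _, zero_mul_F _⟩

end TanhKit

/-! ### The six activation functions -/

/-- An activation function for which the construction is available satisfies both assertions. -/
theorem Kit.main [ok : Ok p q] {d : ℕ} {a : Act} {M H : ℝ}
    (K : Kit p q (a.sigma p q) (a.sigma' p q) M H) (hM : a.M q = M) (hH : a.H p q = H)
    (hq : 2 ^ (q + 1) = 4 * (emax q + 1)) (hτ : K.nt + 6 ≤ a.tau q) :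
    (∀ (fs : a.domain p q d → Flt p q) (hs : a.domain p q d → Flt p q)
        (gs : (Fin d → Flt p q) → (Fin d → Flt p q)),
      (∀ x, (hs x : ℝ) ∈ Set.Icc (-a.H p q) (a.H p q)) →
      (∀ x : a.domain p q d, hs x = 0 → gs x = 0) →
      ∀ L : ℕ, a.tau q ≤ L →
        ∃ f : Net p q L d 1, ∀ x : a.domain p q d,
          f.eval (a.sigma p q) (toX x) = toX (fun _ => fs x) ∧
          f.grad (a.sigma p q) (a.sigma' p q) (toX x) (toX (fun _ => hs x)) =
            toX (gs x)) ∧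
    (∀ (fs : a.domain p q d → Flt p q)
        (gs : (Fin d → Flt p q) → Flt p q → (Fin d → Flt p q)),
      (∀ x y, gs x (-y) = -gs x y) →
      ∀ L : ℕ, 2 ^ (q + 1) + 2 * p + 2 + a.tau q ≤ L →
        ∃ f : Net p q L d 1, ∀ x : a.domain p q d, ∀ y : Flt p q,
          (y : ℝ) ∈ Set.Icc (-a.H p q) (a.H p q) →
          f.eval (a.sigma p q) (toX x) = toX (fun _ => fs x) ∧
          f.grad (a.sigma p q) (a.sigma' p q) (toX x) (toX (fun _ => y)) =
            toX (gs x y)) := by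
  subst hM hH
  have hD : ∀ x ∈ a.domain p q d, ∀ j, |(x j : ℝ)| ≤ a.M q := fun x hx j => abs_le.2 (hx j)
  refine ⟨fun fs hs gs hH h0 L hL => ?_, fun fs gs hgs L hL => ?_⟩
  · exact K.exists_net_of_gradient hD fs hs gs (fun x => abs_le.2 (hH x)) h0 (hτ.trans hL)
  · obtain ⟨f, hf⟩ := K.exists_net_of_odd_gradient hD fs gs hgs (L := L) (by
      have hE := ok.seven_le
      have : (2 ^ (q + 1) : ℤ) + 2 * p + 2 + a.tau q ≤ L := by exact_mod_cast hL
      rw [hq] at this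
      omega)
    exact ⟨f, fun x y hy => hf x y (abs_le.2 hy)⟩

end FPNet

theorem mainTheorem5 (p q d : ℕ) (hp : 2 ≤ p) (hpq : p ≤ 2 ^ (q - 2)) (hq4 : 4 ≤ q)
    (hq5 : q ≤ 5) (hd : 0 < d) (a : FPNet.Act) :
    (∀ (fs : a.domain p q d → FPNet.Flt p q) (hs : a.domain p q d → FPNet.Flt p q)
        (gs : (Fin d → FPNet.Flt p q) → (Fin d → FPNet.Flt p q)),
      (∀ x, (hs x : ℝ) ∈ Set.Icc (-a.H p q) (a.H p q)) →
      (∀ x : a.domain p q d, hs x = 0 → gs x = 0) →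
      ∀ L : ℕ, a.tau q ≤ L →
        ∃ f : FPNet.Net p q L d 1, ∀ x : a.domain p q d,
          f.eval (a.sigma p q) (FPNet.toX x) = FPNet.toX (fun _ => fs x) ∧
          f.grad (a.sigma p q) (a.sigma' p q) (FPNet.toX x) (FPNet.toX (fun _ => hs x)) =
            FPNet.toX (gs x)) ∧
    (∀ (fs : a.domain p q d → FPNet.Flt p q)
        (gs : (Fin d → FPNet.Flt p q) → FPNet.Flt p q → (Fin d → FPNet.Flt p q)),
      (∀ x y, gs x (-y) = -gs x y) →
      ∀ L : ℕ, 2 ^ (q + 1) + 2 * p + 2 + a.tau q ≤ L →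
        ∃ f : FPNet.Net p q L d 1, ∀ x : a.domain p q d, ∀ y : FPNet.Flt p q,
          (y : ℝ) ∈ Set.Icc (-a.H p q) (a.H p q) →
          f.eval (a.sigma p q) (FPNet.toX x) = FPNet.toX (fun _ => fs x) ∧
          f.grad (a.sigma p q) (a.sigma' p q) (FPNet.toX x) (FPNet.toX (fun _ => y)) =
            FPNet.toX (gs x y)) := by
  have ok := FPNet.Ok.of_bounds hp hpq hq4 hq5
  have hq : (2 ^ (q + 1) : ℤ) = 4 * (FPNet.emax q + 1) := by
    unfold FPNet.emax
    interval_cases q <;> norm_num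
  have hM : (2 : ℝ) ^ (FPNet.emax q - 1) = 2 * FPNet.T q := by
    rw [zpow_sub_one₀ (by norm_num), ← FPNet.four_T]; ring
  cases a with
  | relu => exact FPNet.relu_rectifier.kit.main rfl rfl hq le_rfl
  | elu => exact FPNet.elu_rectifier.kit.main rfl rfl hq le_rfl
  | gelu => exact FPNet.gelu_rectifier.kit.main rfl rfl hq le_rfl
  | swish => exact FPNet.swish_rectifier.kit.main rfl rfl hq le_rfl
  | sigmoid =>
    exact FPNet.SigmoidKit.kit.main hM rfl hq
      (show 4 + 6 ≤ if q = 4 then 13 else 10 by split_ifs <;> omega)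
  | tanh =>
    exact FPNet.TanhKit.kit.main hM rfl hq
      (show 3 + 6 ≤ if q = 4 then 10 else 9 by split_ifs <;> omega)
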